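/- **Setting.** Let $n,m\ge 0$, $N\ge 1$, $0\le M\le N$ be integers, $h>0$, $T=Nh$, $\mathcal K\subseteq\mathbb R^m$ a nonempty closed (not necessarily convex) cone, $\check x_0\in\mathbb R^n$, $\xi_0\in C([-Mh,0],\mathbb R^n)$, and let $f,g_1,\dots,g_m:\mathbb R\times(\mathbb R^n)^{M+1}\to\mathbb R^n$ be bounded and of class $C^1$. Put $\|w\|=\sum_j|w^j|$ for $w\in\mathbb R^m$, and, for an $\mathbb R^m$-valued Borel measure $\mu$ on $[0,T]$, $|\mu|=\sum_j(\mu^j_++\mu^j_-)$; $\mu^c$ is the non-atomic part of $\mu$. Call $\mu$ $\mathcal K$-valued if $d\mu/d|\mu|\in\mathcal K$ $|\mu|$-a.e. (for convex $\mathcal K$: iff $\mu(A)\in\mathcal K$ for all Borel $A$). Write $z^\pm$ for one-sided limits; for functions on $[a,b]$, $z^-(a):=z(a)$, $z^+(b):=z(b)$. The right inverse of an increasing $A:[T_1,T_2]\to[S_1,S_2]$ is $B(S_1)=T_1$, $B(S_2)=T_2$, $B(s)=\inf\{t: A(t)>s\}$ for $S_1<s<S_2$. **Impulse processes.** An impulse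 control $(\mu,\nu,\{\omega^r\}_{r\in[0,h]})$ consists of a finite $\mathbb R^m$-valued Borel measure $\mu$ on $[0,T]$ with values in the closed convex hull of $\mathcal K$ and with $\mu^c$ $\mathcal K$-valued (for convex $\mathcal K$ this says exactly that $\mu(A)\in\mathcal K$ for all $A$); a finite positive Borel measure $\nu$ on $[0,T]$ with $\nu^c=|\mu^c|$ such that $(\mu_i,|\mu_i|)\rightharpoonup^*(\mu,\nu)$ for some $\mathcal K$-valued measures $\mu_i$ on $[0,T]$; and essentially bounded measurable $\omega^r=(\omega^r_1,\dots,\omega^r_N):[0,1]\to\mathcal K^N$ (up to a.e. equality) such that $\sum_l\|\omega^r_l(s)\|=\sum_l\int_0^1\|\omega^r_l\|$ for a.e. $s$; $\int_0^1\omega^r_l=\mu(\{r+(l-1)h\})$ and $\int_0^1\|\omega^r_l\|=\nu(\{r+(l-1)h\})$ for $0<r<h$, $1\le l\le N$; $\int_0^1(\omega^h_l+\omega^0_{l+1})=\mu(\{lh\})$ and $\int_0^1(\|\omega^h_l\|+\|\omega^0_{l+1}\|)=\nu(\{lh\})$ for $0\le l\le N$, with $\omega^h_0=\omega^0_{N+1}=0$.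 It forms an impulse process together with $(x,v)$ if $x:[-Mh,T]\to\mathbb R^n$ and $v:[0,T]\to\mathbb R$ have bounded variation on $[0,T]$, $x=\xi_0$ on $[-Mh,0[$, $(x,v)(0)=(\check x_0,0)$, $(x,v)((l-1)h)=(\zeta^0_l,\theta^0_l)(1)$ for $2\le l\le N$, $(x,v)(T)=(\zeta^h_N,\theta^h_N)(1)$, and for $1\le l\le N$, $t\in](l-1)h,lh[$, $$x(t)=\zeta^0_l(1)+\int_{(l-1)h}^t f(t',\{x(t'-kh)\}_k)dt'+\sum_j\int_{[(l-1)h,t]}g_j(t',\{x(t'-kh)\}_k)\,d(\mu^c)^j+\sum_{r\in]0,t-(l-1)h]}\big(\zeta^r_l(1)-x^-(r+(l-1)h)\big),$$ $$v(t)=\theta^0_l(1)+\nu^c([(l-1)h,t])+\sum_{r\in]0,t-(l-1)h]}\big(\theta^r_l(1)-v^-(r+(l-1)h)\big),$$ both sums being summable. Here, for $r\in[0,h]$, $1\le l\le N$, $\zeta^r_l\in W^{1,1}([0,1],\mathbb R^n)$ satisfies $\dot\zeta^r_l(s)=\sum_j g_j(r+(l-1)h,\{\zeta^r_{l-k}(s)\}_{k=0}^M)(\omega^r_l)^j(s)$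 a.e., and $\theta^r_l(s)=\theta^r_l(0)+\int_0^s\|\omega^r_l\|$, with $(\zeta^r_l,\theta^r_l)(0)=(x^-,v^-)(r+(l-1)h)$ if $r>0$ and $(\zeta^0_l,\theta^0_l)(0)=(\zeta^h_{l-1},\theta^h_{l-1})(1)$; by convention $\theta^r_0=0$ and $\zeta^r_{-a}\equiv\xi_0(r-(a+1)h)$ for $a\ge 0$, except that $\zeta^h_0(1)=\check x_0$. **Canonical extended processes.** These are the tuples $(S,\varphi_0,\varphi,\tau,y,\beta)$, $S>0$, of functions on $[0,S]$ such that $\varphi_0:[0,S]\to[0,h]$ and $\varphi=(\varphi_1,\dots,\varphi_N):[0,S]\to(\mathbb R^m)^N$ are Lipschitz, $\varphi_0$ is nondecreasing, $\varphi_0(0)=0$, $\varphi_0(S)=h$, $\varphi_1(0)=0$, $\varphi_l(0)=\varphi_{l-1}(S)$ for $l\ge 2$, $\dot\varphi_l\in\mathcal K$ a.e., $\dot\varphi_0+\sum_l\|\dot\varphi_l\|=1$ a.e., and $\tau_l,y_l,\beta_l$ ($1\le l\le N$) are $W^{1,1}$ with, a.e., $$\dot\tau_l=\dot\varphi_0,\quad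 \dot y_l=f(\tau_l,\{y_{l-k}\}_{k=0}^M)\dot\varphi_0+\sum_jg_j(\tau_l,\{y_{l-k}\}_{k=0}^M)\dot\varphi_l^j,\quad\dot\beta_l=\|\dot\varphi_l\|,$$ $y_{-a}(s)=\xi_0(\tau_1(s)-(a+1)h)$ for $0\le a\le M-1$, $(\tau_1,y_1,\beta_1)(0)=(0,\check x_0,0)$, $(\tau_l,y_l,\beta_l)(0)=(\tau_{l-1},y_{l-1},\beta_{l-1})(S)$ for $l\ge2$. **Construction (i), the map $\mathcal I$.** Given an impulse process, let $\mu_l$ (resp. $\nu_l$) be the measure on $[0,h]$ that is the translate by $-(l-1)h$ of $\mu$ (resp. $\nu$) restricted to $](l-1)h,lh[$, plus atoms $\int_0^1\omega^r_l$ (resp. $\int_0^1\|\omega^r_l\|$) at $r=0$ and $r=h$. Let $\phi(0)=0$, $\phi(r)=r+\sum_l\nu_l([0,r])$ for $r\in]0,h]$, $S=\phi(h)$, $\mathcal J$ the set of discontinuities of $\phi$, $\Sigma^r=[\phi^-(r),\phi^+(r)]$, $\gamma^r(s)=(s-\phi^-(r))/(\phi^+(r)-\phi^-(r))$, $m_l=d\mu_l^c/d\phi$.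 Then $\varphi_0$ is the right inverse of $\phi$; $\varphi_l$ is absolutely continuous with $\dot\varphi_l(s)=m_l(\varphi_0(s))$ for a.e. $s\notin\bigcup_{\mathcal J}\Sigma^r$, $\dot\varphi_l(s)=\omega^r_l(\gamma^r(s))/(\phi^+(r)-\phi^-(r))$ for a.e. $s\in\Sigma^r$, $r\in\mathcal J$, and $\varphi_1(0)=0$, $\varphi_l(0)=\varphi_{l-1}(S)$; $\tau_l=(l-1)h+\varphi_0$; $(y_1,\beta_1)(0)=(\check x_0,0)$, $(y_l,\beta_l)(0)=(\zeta^h_{l-1},\theta^h_{l-1})(1)$ for $l\ge2$, $(y_l,\beta_l)(S)=(\zeta^h_l,\theta^h_l)(1)$, and on $]0,S[$: $(y_l,\beta_l)(s)=(x,v)(\tau_l(s))$ for $s\notin\bigcup_{\mathcal J}\Sigma^r$, $(y_l,\beta_l)(s)=(\zeta^r_l,\theta^r_l)(\gamma^r(s))$ for $s\in\Sigma^r$, $r\in\mathcal J$. **Construction (ii).** Given a canonical extended process, for $z\in\{\varphi,\tau,y,\beta\}$ let $\tilde z$ on $[0,NS]$ be $\tilde z(s)=z_l(s-(l-1)S)$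 for $(l-1)S\le s<lS$, $\tilde z(NS)=z_N(S)$; let $\sigma,\tilde\sigma$ be the right inverses of $\varphi_0:[0,S]\to[0,h]$ and $\tilde\tau:[0,NS]\to[0,T]$. Define $\mu,\nu$ on $[0,T]$ by $\mu([0,t])=\int_0^{\tilde\sigma^+(t)}\dot{\tilde\varphi}\,ds$, $\nu([0,t])=\int_0^{\tilde\sigma^+(t)}\|\dot{\tilde\varphi}\|\,ds$ for $t\in[0,T]$, $\omega^r_l(s)=(\sigma^+(r)-\sigma^-(r))\,\dot\varphi_l\big((\sigma^+(r)-\sigma^-(r))s+\sigma^-(r)\big)$ for a.e. $s\in[0,1]$, $(x,v)=(\tilde y,\tilde\beta)\circ\tilde\sigma$ on $[0,T]$, $x=\xi_0$ on $[-Mh,0[$. **Claim.** Construction (i) sends every impulse process to a uniquely determined canonical extended process, construction (ii) sends every canonical extended process to a uniquely determined impulse process, and the map $\mathcal I$ given by (i), from the set of impulse processes to the set of canonical extended processes, is a bijection whose inverse is the map given by (ii). -/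

import Mathlib

open MeasureTheory Set Filter Topology

noncomputable section

namespace ImpulseDelay

/-! ### Vector-valued measures, one-sided limits, right inverses -/

/-- The `ℓ¹` norm `‖w‖ = ∑ⱼ |wʲ|` of a control vector. -/
def l1 {m : ℕ} (w : Fin m → ℝ) : ℝ := ∑ j, |w j|

/-- The integral `∫_A F dμ` against a signed measure, through its Jordan decomposition. -/
def sInt {E : Type*} [NormedAddCommGroup E] [NormedSpace ℝ E] (μ : SignedMeasure ℝ) (A : Set ℝ)
    (F : ℝ → E) : E :=
  (∫ t in A, F t ∂μ.toJordanDecomposition.posPart) -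
    ∫ t in A, F t ∂μ.toJordanDecomposition.negPart

/-- The total variation `|μ| = ∑ⱼ (μʲ₊ + μʲ₋)` of a vector measure `μ = (μ¹, …, μᵐ)`. -/
def totalVar {m : ℕ} (μ : Fin m → SignedMeasure ℝ) : Measure ℝ := ∑ j, (μ j).totalVariation

/-- The density `dμ / d|μ|`. -/
def polarDensity {m : ℕ} (μ : Fin m → SignedMeasure ℝ) (t : ℝ) : Fin m → ℝ :=
  fun j => (μ j).rnDeriv (totalVar μ) t

/-- The continuous (non-atomic) component `μᶜ` of a vector measure: the restriction of `μ` to the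
complement of its (countable) set of atoms. -/
def contVec {m : ℕ} (μ : Fin m → SignedMeasure ℝ) : Fin m → SignedMeasure ℝ :=
  fun j => (μ j).restrict {t | ∀ i, μ i {t} = 0}

/-- The continuous (non-atomic) component `νᶜ` of a positive measure. -/
def contMeas (ν : Measure ℝ) : Measure ℝ := ν.restrict {t | ν {t} = 0}

/-- `μ` is carried by `[0, T]` and its density with respect to `|μ|` takes values in `K`.
For a closed convex cone this is the same as `μ(A) ∈ K` for all Borel sets `A`, see
`isKMeasure_iff_range_subset`. -/
def IsKMeasure {m : ℕ} (K : Set (Fin m → ℝ)) (T : ℝ) (μ : Fin m → SignedMeasure ℝ) : Prop :=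
  totalVar μ (Icc 0 T)ᶜ = 0 ∧ ∀ᵐ t ∂(totalVar μ), polarDensity μ t ∈ K

/-- `μ(A) = ∫_A (dμ/d|μ|) d|μ|`. -/
theorem apply_eq_integral_polarDensity {m : ℕ} (μ : Fin m → SignedMeasure ℝ) {A : Set ℝ}
    (hA : MeasurableSet A) :
    IntegrableOn (polarDensity μ) A (totalVar μ) ∧
      (fun j => μ j A) = ∫ t in A, polarDensity μ t ∂(totalVar μ) := by
  have hfin : IsFiniteMeasure (totalVar μ) := by
    refine ⟨?_⟩
    simp only [totalVar, Measure.finsetSum_apply, SignedMeasure.totalVariation, Measure.add_apply]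
    exact ENNReal.sum_lt_top.2 fun j _ =>
      ENNReal.add_lt_top.2 ⟨measure_lt_top _ _, measure_lt_top _ _⟩
  have hint : Integrable (polarDensity μ) (totalVar μ) :=
    Integrable.of_eval fun j => SignedMeasure.integrable_rnDeriv (μ j) (totalVar μ)
  refine ⟨hint.integrableOn, ?_⟩
  funext j
  rw [eval_integral fun j => (hint.eval j).integrableOn]
  have hac : μ j ≪ᵥ (totalVar μ).toENNRealVectorMeasure := by
    refine VectorMeasure.AbsolutelyContinuous.mk fun B hB h0 => ?_
    rw [Measure.toENNRealVectorMeasure_apply_measurable hB] at h0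
    refine SignedMeasure.null_of_totalVariation_zero _ ?_
    simp only [totalVar, Measure.finsetSum_apply, Finset.sum_eq_zero_iff] at h0
    exact h0 j (Finset.mem_univ j)
  conv_lhs => rw [← SignedMeasure.withDensityᵥ_rnDeriv_eq (μ j) (totalVar μ) hac]
  rw [withDensityᵥ_apply (SignedMeasure.integrable_rnDeriv _ _) hA]
  rfl

/-- For a closed convex cone `K`, a measure is `K`-valued if and only if its range is contained
in `K`. -/
theorem isKMeasure_iff_range_subset {m : ℕ} {K : Set (Fin m → ℝ)} {T : ℝ}
    (hne : K.Nonempty) (hK : IsClosed K) (hcone : ∀ w ∈ K, ∀ c : ℝ, 0 ≤ c → c • w ∈ K)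
    (hconv : Convex ℝ K) (μ : Fin m → SignedMeasure ℝ) :
    IsKMeasure K T μ ↔ totalVar μ (Icc 0 T)ᶜ = 0 ∧
      ∀ A : Set ℝ, MeasurableSet A → (fun j => μ j A) ∈ K := by
  have hfin : IsFiniteMeasure (totalVar μ) := by
    refine ⟨?_⟩
    simp only [totalVar, Measure.finsetSum_apply, SignedMeasure.totalVariation, Measure.add_apply]
    exact ENNReal.sum_lt_top.2 fun j _ =>
      ENNReal.add_lt_top.2 ⟨measure_lt_top _ _, measure_lt_top _ _⟩
  have h0 : (0 : Fin m → ℝ) ∈ K := by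
    obtain ⟨w, hw⟩ := hne
    simpa using hcone w hw 0 le_rfl
  have hmeas : Measurable (polarDensity μ) :=
    measurable_pi_lambda _ fun j => SignedMeasure.measurable_rnDeriv _ _
  refine and_congr_right fun _ => ⟨fun h A hA => ?_, fun h => ?_⟩
  · obtain ⟨hint, heq⟩ := apply_eq_integral_polarDensity μ hA
    rw [heq]
    by_cases hz : totalVar μ A = 0
    · rw [Measure.restrict_eq_zero.2 hz, integral_zero_measure]
      exact h0
    · have hav := hconv.set_average_mem hK hz (measure_ne_top _ _) (ae_restrict_of_ae h) hint
      rw [← measure_smul_setAverage _ (measure_ne_top _ _)]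
      exact hcone _ hav _ measureReal_nonneg
  · have hcov : ∀ w : (Kᶜ : Set (Fin m → ℝ)), ∃ r > 0,
        Metric.closedBall (w : Fin m → ℝ) r ⊆ Kᶜ := fun w =>
      Metric.nhds_basis_closedBall.mem_iff.1 (hK.isOpen_compl.mem_nhds w.2)
    choose r hr hsub using hcov
    obtain ⟨C, hC, hU⟩ := TopologicalSpace.isOpen_iUnion_countable
      (fun w : (Kᶜ : Set (Fin m → ℝ)) => Metric.ball (w : Fin m → ℝ) (r w))
      (fun _ => Metric.isOpen_ball)
    have hball : ∀ w ∈ C, ∀ᵐ t ∂(totalVar μ),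
        polarDensity μ t ∉ Metric.closedBall (w : Fin m → ℝ) (r w) := by
      intro w _
      have hA : MeasurableSet (polarDensity μ ⁻¹' Metric.closedBall (w : Fin m → ℝ) (r w)) :=
        hmeas measurableSet_closedBall
      by_contra hz
      have hz' : totalVar μ (polarDensity μ ⁻¹' Metric.closedBall (w : Fin m → ℝ) (r w)) ≠ 0 := by
        intro h'
        apply hz
        rw [ae_iff]
        simp only [not_not]
        exact h'
      obtain ⟨hint, heq⟩ := apply_eq_integral_polarDensity μ hA
      have hav := (convex_closedBall (w : Fin m → ℝ) (r w)).set_average_mem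
        Metric.isClosed_closedBall hz' (measure_ne_top _ _)
        (ae_restrict_of_forall_mem hA fun t ht => ht) hint
      refine hsub w hav ?_
      rw [setAverage_eq, ← heq]
      exact hcone _ (h _ hA) _ (inv_nonneg.2 measureReal_nonneg)
    filter_upwards [(ae_ball_iff hC).2 hball] with t ht
    by_contra hn
    have hmem : polarDensity μ t ∈ ⋃ w : (Kᶜ : Set (Fin m → ℝ)),
        Metric.ball (w : Fin m → ℝ) (r w) :=
      mem_iUnion.2 ⟨⟨_, hn⟩, Metric.mem_ball_self (hr _)⟩
    rw [← hU] at hmem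
    obtain ⟨w, hwC, hw⟩ := mem_iUnion₂.1 hmem
    exact ht w hwC (Metric.ball_subset_closedBall hw)

/-- For a closed convex cone `K`, the condition imposed on `μ` in an impulse control is that `μ` is
carried by `[0, T]` and that its range is contained in `K`. -/
theorem range_convexHull_and_cont_iff {m : ℕ} {K : Set (Fin m → ℝ)} {T : ℝ}
    (hne : K.Nonempty) (hK : IsClosed K) (hcone : ∀ w ∈ K, ∀ c : ℝ, 0 ≤ c → c • w ∈ K)
    (hconv : Convex ℝ K) (μ : Fin m → SignedMeasure ℝ) :
    (totalVar μ (Icc 0 T)ᶜ = 0 ∧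
      (∀ A : Set ℝ, MeasurableSet A → (fun j => μ j A) ∈ closure (convexHull ℝ K)) ∧
      IsKMeasure K T (contVec μ)) ↔
    (totalVar μ (Icc 0 T)ᶜ = 0 ∧ ∀ A : Set ℝ, MeasurableSet A → (fun j => μ j A) ∈ K) := by
  rw [hconv.convexHull_eq, hK.closure_eq]
  refine ⟨fun h => ⟨h.1, h.2.1⟩, fun h => ⟨h.1, h.2, ?_⟩⟩
  have hN : MeasurableSet {t : ℝ | ∀ i, μ i {t} = 0} := by
    have hc : {t : ℝ | ∀ i, μ i {t} = 0}ᶜ.Countable := by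
      have hsub : {t : ℝ | ∀ i, μ i {t} = 0}ᶜ ⊆
          ⋃ i, {t : ℝ | 0 < (μ i).totalVariation {t}} := by
        intro t ht
        simp only [mem_compl_iff, mem_ofPred_eq, not_forall] at ht
        obtain ⟨i, hi⟩ := ht
        refine mem_iUnion.2 ⟨i, ?_⟩
        rw [mem_ofPred_eq, pos_iff_ne_zero]
        exact fun h' => hi (SignedMeasure.null_of_totalVariation_zero _ h')
      refine Set.Countable.mono hsub (countable_iUnion fun i => ?_)
      have : IsFiniteMeasure (μ i).totalVariation := by
        unfold SignedMeasure.totalVariation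
        infer_instance
      exact Measure.countable_meas_pos_of_disjoint_iUnion (fun t => measurableSet_singleton t)
        fun a b hab => disjoint_singleton.2 hab
    simpa using hc.measurableSet.compl
  have happ : ∀ j, ∀ A : Set ℝ, MeasurableSet A →
      contVec μ j A = μ j (A ∩ {t | ∀ i, μ i {t} = 0}) := fun j A hA =>
    VectorMeasure.restrict_apply _ hN hA
  rw [isKMeasure_iff_range_subset hne hK hcone hconv]
  constructor
  · have hac : ∀ j, (contVec μ j).totalVariation ≪ totalVar μ := by
      intro j
      have := (SignedMeasure.absolutelyContinuous_ennreal_iff (contVec μ j)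
        (totalVar μ).toENNRealVectorMeasure).1
        (VectorMeasure.AbsolutelyContinuous.mk fun B hB hB0 => by
          rw [Measure.toENNRealVectorMeasure_apply_measurable hB] at hB0
          rw [happ j B hB]
          refine SignedMeasure.null_of_totalVariation_zero _ ?_
          have hB1 := measure_mono_null (inter_subset_left (t := {t | ∀ i, μ i {t} = 0})) hB0
          simp only [totalVar, Measure.finsetSum_apply, Finset.sum_eq_zero_iff] at hB1
          exact hB1 j (Finset.mem_univ j))
      rwa [VectorMeasure.ennrealToMeasure_toENNRealVectorMeasure] at this
    rw [totalVar, Measure.finsetSum_apply]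
    exact Finset.sum_eq_zero fun j _ => hac j h.1
  · intro A hA
    have := h.2 _ (hA.inter hN)
    simpa only [happ _ A hA] using this

/-- Weak* convergence of positive measures on `[0, T]`. -/
def WeakStar (T : ℝ) (νs : ℕ → Measure ℝ) (ν : Measure ℝ) : Prop :=
  ∀ ψ : ℝ → ℝ, ContinuousOn ψ (Icc 0 T) →
    Tendsto (fun i => ∫ t in Icc 0 T, ψ t ∂(νs i)) atTop (𝓝 (∫ t in Icc 0 T, ψ t ∂ν))

/-- Weak* convergence of vector measures on `[0, T]`. -/
def WeakStarVec {m : ℕ} (T : ℝ) (μs : ℕ → Fin m → SignedMeasure ℝ)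
    (μ : Fin m → SignedMeasure ℝ) : Prop :=
  ∀ ψ : ℝ → ℝ, ContinuousOn ψ (Icc 0 T) → ∀ j,
    Tendsto (fun i => sInt (μs i j) (Icc 0 T) ψ) atTop (𝓝 (sInt (μ j) (Icc 0 T) ψ))

/-- The set `𝒱_c(μ)`: `νᶜ = |μᶜ|`, and `(μ, ν)` is a weak* limit of pairs `(μᵢ, |μᵢ|)` with
`K`-valued `μᵢ`. -/
def InVc {m : ℕ} (K : Set (Fin m → ℝ)) (T : ℝ) (μ : Fin m → SignedMeasure ℝ)
    (ν : Measure ℝ) : Prop :=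
  contMeas ν = totalVar (contVec μ) ∧
    ∃ μs : ℕ → Fin m → SignedMeasure ℝ, (∀ i, IsKMeasure K T (μs i)) ∧
      WeakStarVec T μs μ ∧ WeakStar T (fun i => totalVar (μs i)) ν

/-- Left limit at `t` of a function on an interval with left end-point `a`, with the convention
that it is the value of the function at `t = a`. -/
def limL (a : ℝ) (A : ℝ → ℝ) (t : ℝ) : ℝ := if t ≤ a then A a else Function.leftLim A t

/-- Right limit at `t` of a function on an interval with right end-point `b`, with the convention
that it is the value of the function at `t = b`. -/
def limR (b : ℝ) (A : ℝ → ℝ) (t : ℝ) : ℝ := if b ≤ t then A b else Function.rightLim A t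

/-- The right inverse `[S₁, S₂] → [T₁, T₂]` of an increasing function
`A : [T₁, T₂] → [S₁, S₂]`. -/
def rightInv (A : ℝ → ℝ) (T₁ T₂ S₁ S₂ : ℝ) (s : ℝ) : ℝ :=
  if s = S₁ then T₁ else if s = S₂ then T₂ else sInf {t | t ∈ Icc T₁ T₂ ∧ s < A t}

/-- The concatenation `z̃ : [0, N S] → E` of functions `z₁, …, z_N : [0, S] → E`. -/
def concat {E : Type*} [AddCommMonoid E] (N : ℕ) (S : ℝ) (z : ℕ → ℝ → E) (s : ℝ) : E :=
  if s = N * S then z N S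
  else ∑ l ∈ Finset.Icc 1 N,
    (Ico (((l : ℝ) - 1) * S) (l * S)).indicator (fun s' => z l (s' - ((l : ℝ) - 1) * S)) s

/-- `z ∈ W^{1,1}([a, b])` and `dz/ds = F` a.e. on `[a, b]`. -/
def SolvesOn {E : Type*} [NormedAddCommGroup E] [NormedSpace ℝ E] (z F : ℝ → E) (a b : ℝ) :
    Prop :=
  AbsolutelyContinuousOnInterval z a b ∧ ∀ᵐ s ∂(volume.restrict (Icc a b)), HasDerivAt z (F s) s

/-! ### The data -/

/-- The data of the delay system, with the standing hypotheses: the control set `K` is a closed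
cone, `f` and the `g_j` are bounded and of class `C¹`, the history `ξ₀` is continuous on
`[-Mh, 0]`. The horizon is `T = N h`. -/
structure DelaySystem (n m N M : ℕ) where
  one_le_N : 1 ≤ N
  M_le_N : M ≤ N
  h : ℝ
  h_pos : 0 < h
  K : Set (Fin m → ℝ)
  K_nonempty : K.Nonempty
  K_closed : IsClosed K
  K_cone : ∀ w ∈ K, ∀ c : ℝ, 0 ≤ c → c • w ∈ K
  x₀ : Fin n → ℝ
  ξ₀ : ℝ → Fin n → ℝ
  ξ₀_cont : ContinuousOn ξ₀ (Icc (-(M * h)) 0)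
  f : ℝ → (Fin (M + 1) → Fin n → ℝ) → Fin n → ℝ
  f_C1 : ContDiff ℝ 1 (fun q : ℝ × (Fin (M + 1) → Fin n → ℝ) => f q.1 q.2)
  f_bdd : ∃ C : ℝ, ∀ t X, ‖f t X‖ ≤ C
  g : Fin m → ℝ → (Fin (M + 1) → Fin n → ℝ) → Fin n → ℝ
  g_C1 : ∀ j, ContDiff ℝ 1 (fun q : ℝ × (Fin (M + 1) → Fin n → ℝ) => g j q.1 q.2)
  g_bdd : ∀ j, ∃ C : ℝ, ∀ t X, ‖g j t X‖ ≤ C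

/-- The tuple `(μ, ν, {ω^r}, x, v)`; `ω r l` stands for `ω^r_l`. Only `r ∈ [0, h]`, `1 ≤ l ≤ N`,
the values of `x` on `[-Mh, T]` and of `v` on `[0, T]` are relevant, and `ω r l` matters up to
a.e. equality on `[0, 1]`, see `DelaySystem.SameImpulse`. -/
structure ImpulseData (n m : ℕ) where
  μ : Fin m → SignedMeasure ℝ
  ν : Measure ℝ
  ω : ℝ → ℕ → ℝ → Fin m → ℝ
  x : ℝ → Fin n → ℝ
  v : ℝ → ℝ

/-- The tuple `(S, φ₀, φ, τ, y, β)`; all functions are functions on `[0, S]` and only the indices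
`1 ≤ l ≤ N` are relevant, see `DelaySystem.SameExtended`. -/
structure ExtendedData (n m : ℕ) where
  S : ℝ
  φ₀ : ℝ → ℝ
  φ : ℕ → ℝ → Fin m → ℝ
  τ : ℕ → ℝ → ℝ
  y : ℕ → ℝ → Fin n → ℝ
  β : ℕ → ℝ → ℝ

namespace DelaySystem

variable {n m N M : ℕ} (P : DelaySystem n m N M)

/-- The horizon `T = N h`. -/
def T : ℝ := N * P.h

/-! ### Impulse controls and impulse processes -/

/-- `ω^r_l`, with the convention that it vanishes for `l = 0` and `l = N + 1`. -/
def omegaExt (_ : DelaySystem n m N M) (p : ImpulseData n m) (r : ℝ) (l : ℕ) (s : ℝ) :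
    Fin m → ℝ :=
  if 1 ≤ l ∧ l ≤ N then p.ω r l s else 0

/-- `(μ, ν, {ω^r})` is an impulse control. The measure `μ` takes its values in the closed convex
hull of `K`, and its continuous component is `K`-valued. -/
structure IsImpulseControl (p : ImpulseData n m) : Prop where
  μ_supp : totalVar p.μ (Icc 0 P.T)ᶜ = 0
  μ_range : ∀ A : Set ℝ, MeasurableSet A → (fun j => p.μ j A) ∈ closure (convexHull ℝ P.K)
  μ_cont : IsKMeasure P.K P.T (contVec p.μ)
  ν_finite : IsFiniteMeasure p.ν
  ν_supp : p.ν (Icc 0 P.T)ᶜ = 0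
  ν_mem : InVc P.K P.T p.μ p.ν
  ω_bdd : ∀ r ∈ Icc 0 P.h, ∀ l ∈ Finset.Icc 1 N,
    MemLp (p.ω r l) ⊤ (volume.restrict (Icc 0 1))
  ω_mem : ∀ r ∈ Icc 0 P.h, ∀ l ∈ Finset.Icc 1 N,
    ∀ᵐ s ∂(volume.restrict (Icc (0 : ℝ) 1)), p.ω r l s ∈ P.K
  ω_const : ∀ r ∈ Icc 0 P.h, ∀ᵐ s ∂(volume.restrict (Icc (0 : ℝ) 1)),
    ∑ l ∈ Finset.Icc 1 N, l1 (p.ω r l s) = ∑ l ∈ Finset.Icc 1 N, ∫ s' in (0)..1, l1 (p.ω r l s')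
  ν_atom : ∀ r ∈ Ioo 0 P.h, ∀ l ∈ Finset.Icc 1 N,
    ∫ s in (0)..1, l1 (p.ω r l s) = p.ν.real {r + ((l : ℝ) - 1) * P.h}
  ν_atom_end : ∀ l ∈ Finset.Icc 0 N,
    ∫ s in (0)..1, (l1 (P.omegaExt p P.h l s) + l1 (P.omegaExt p 0 (l + 1) s))
      = p.ν.real {(l : ℝ) * P.h}
  μ_atom : ∀ r ∈ Ioo 0 P.h, ∀ l ∈ Finset.Icc 1 N, ∀ j,
    ∫ s in (0)..1, p.ω r l s j = p.μ j {r + ((l : ℝ) - 1) * P.h}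
  μ_atom_end : ∀ l ∈ Finset.Icc 0 N, ∀ j,
    ∫ s in (0)..1, (P.omegaExt p P.h l s j + P.omegaExt p 0 (l + 1) s j)
      = p.μ j {(l : ℝ) * P.h}

/-- The delayed states `{x(t - k h)}_{k = 0, …, M}`. -/
def delayed (x : ℝ → Fin n → ℝ) (t : ℝ) : Fin (M + 1) → Fin n → ℝ :=
  fun k => x (t - (k : ℕ) * P.h)

/-- The functions `ζ^r_i` for all integers `i > -M`, given `ζ^r_l` for `l ≥ 1`: one has
`ζ^r_{-a} = ξ₀(r - (a + 1) h)`, except that `ζ^h_0(1) = x₀`. -/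
def zetaExt (ζ : ℝ → ℕ → ℝ → Fin n → ℝ) (r : ℝ) (i : ℤ) (s : ℝ) : Fin n → ℝ :=
  if 1 ≤ i then ζ r i.toNat s
  else if i = 0 ∧ r = P.h ∧ s = 1 then P.x₀
  else P.ξ₀ (r - (1 - (i : ℝ)) * P.h)

/-- `ζ^r_l` and `θ^r_l`, for `r ∈ [0, h]` and `1 ≤ l ≤ N`, solve the jump equations associated
with the impulse control and with `(x, v)`. -/
structure IsJumpSolution (p : ImpulseData n m) (ζ : ℝ → ℕ → ℝ → Fin n → ℝ)
    (θ : ℝ → ℕ → ℝ → ℝ) : Prop where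
  ζ_eq : ∀ r ∈ Icc 0 P.h, ∀ l ∈ Finset.Icc 1 N,
    SolvesOn (ζ r l)
      (fun s => ∑ j, p.ω r l s j • P.g j (r + ((l : ℝ) - 1) * P.h)
        (fun k => P.zetaExt ζ r ((l : ℤ) - (k : ℕ)) s)) 0 1
  ζ_init : ∀ r ∈ Icc 0 P.h, ∀ l ∈ Finset.Icc 1 N,
    ζ r l 0 = if r = 0 then P.zetaExt ζ P.h ((l : ℤ) - 1) 1
      else Function.leftLim p.x (r + ((l : ℝ) - 1) * P.h)
  θ_eq : ∀ r ∈ Icc 0 P.h, ∀ l ∈ Finset.Icc 1 N, ∀ s ∈ Icc (0 : ℝ) 1,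
    θ r l s = θ r l 0 + ∫ s' in (0)..s, l1 (p.ω r l s')
  θ_init : ∀ r ∈ Icc 0 P.h, ∀ l ∈ Finset.Icc 1 N,
    θ r l 0 = if r = 0 then (if l = 1 then 0 else θ P.h (l - 1) 1)
      else Function.leftLim p.v (r + ((l : ℝ) - 1) * P.h)

/-- `(x, v)` is an impulse solution associated with `(μ, ν, {ω^r})`. At `t = T = N h` the value
`(x, v)(T)` is `(ζ^h_N, θ^h_N)(1)`, since `ω^0_{N+1} ≡ 0`. -/
structure IsImpulseSolution (p : ImpulseData n m) : Prop where
  x_hist : ∀ t ∈ Ico (-(M * P.h)) 0, p.x t = P.ξ₀ t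
  x_zero : p.x 0 = P.x₀
  v_zero : p.v 0 = 0
  x_bv : BoundedVariationOn p.x (Icc 0 P.T)
  v_bv : BoundedVariationOn p.v (Icc 0 P.T)
  jump : ∃ ζ θ, P.IsJumpSolution p ζ θ ∧
    (∀ l ∈ Finset.Icc 2 N, p.x (((l : ℝ) - 1) * P.h) = ζ 0 l 1 ∧
      p.v (((l : ℝ) - 1) * P.h) = θ 0 l 1) ∧
    (p.x P.T = ζ P.h N 1 ∧ p.v P.T = θ P.h N 1) ∧
    ∀ l ∈ Finset.Icc 1 N, ∀ t ∈ Ioo (((l : ℝ) - 1) * P.h) (l * P.h),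
      (Summable (fun r : Ioc 0 (t - ((l : ℝ) - 1) * P.h) =>
          ζ r l 1 - Function.leftLim p.x (r + ((l : ℝ) - 1) * P.h)) ∧
        p.x t = ζ 0 l 1 + (∫ t' in (((l : ℝ) - 1) * P.h)..t, P.f t' (P.delayed p.x t'))
          + (∑ j, sInt (contVec p.μ j) (Icc (((l : ℝ) - 1) * P.h) t)
              (fun t' => P.g j t' (P.delayed p.x t')))
          + ∑' r : Ioc 0 (t - ((l : ℝ) - 1) * P.h),
              (ζ r l 1 - Function.leftLim p.x (r + ((l : ℝ) - 1) * P.h))) ∧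
      (Summable (fun r : Ioc 0 (t - ((l : ℝ) - 1) * P.h) =>
          θ r l 1 - Function.leftLim p.v (r + ((l : ℝ) - 1) * P.h)) ∧
        p.v t = θ 0 l 1 + (contMeas p.ν).real (Icc (((l : ℝ) - 1) * P.h) t)
          + ∑' r : Ioc 0 (t - ((l : ℝ) - 1) * P.h),
              (θ r l 1 - Function.leftLim p.v (r + ((l : ℝ) - 1) * P.h)))

/-- Impulse processes. -/
def IsImpulseProc (p : ImpulseData n m) : Prop :=
  P.IsImpulseControl p ∧ P.IsImpulseSolution p

/-! ### Canonical extended processes -/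

/-- `(S, φ₀, φ)` is an extended control. -/
structure IsExtendedControl (e : ExtendedData n m) : Prop where
  S_pos : 0 < e.S
  lipschitz : ∃ L : NNReal, LipschitzOnWith L e.φ₀ (Icc 0 e.S) ∧
    ∀ l ∈ Finset.Icc 1 N, LipschitzOnWith L (e.φ l) (Icc 0 e.S)
  mono : MonotoneOn e.φ₀ (Icc 0 e.S)
  φ₀_zero : e.φ₀ 0 = 0
  φ₀_S : e.φ₀ e.S = P.h
  φ_init : ∀ l ∈ Finset.Icc 1 N, e.φ l 0 = if l = 1 then 0 else e.φ (l - 1) e.S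
  φ_mem : ∀ l ∈ Finset.Icc 1 N,
    ∀ᵐ s ∂(volume.restrict (Icc 0 e.S)), deriv (e.φ l) s ∈ P.K

/-- The functions `y_i` for all integers `i > -M`, given `y_l` for `l ≥ 1`: one has
`y_{-a}(s) = ξ₀(τ₁(s) - (a + 1) h)`. -/
def yExt (e : ExtendedData n m) (i : ℤ) (s : ℝ) : Fin n → ℝ :=
  if 1 ≤ i then e.y i.toNat s else P.ξ₀ (e.τ 1 s - (1 - (i : ℝ)) * P.h)

/-- `(τ, y, β)` solves the auxiliary control system driven by `(φ₀, φ)`. -/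
structure IsExtendedSolution (e : ExtendedData n m) : Prop where
  τ_eq : ∀ l ∈ Finset.Icc 1 N, SolvesOn (e.τ l) (deriv e.φ₀) 0 e.S
  y_eq : ∀ l ∈ Finset.Icc 1 N, SolvesOn (e.y l)
    (fun s => deriv e.φ₀ s • P.f (e.τ l s) (fun k => P.yExt e ((l : ℤ) - (k : ℕ)) s)
      + ∑ j, deriv (e.φ l) s j •
          P.g j (e.τ l s) (fun k => P.yExt e ((l : ℤ) - (k : ℕ)) s)) 0 e.S
  β_eq : ∀ l ∈ Finset.Icc 1 N, SolvesOn (e.β l) (fun s => l1 (deriv (e.φ l) s)) 0 e.S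
  init_one : e.τ 1 0 = 0 ∧ e.y 1 0 = P.x₀ ∧ e.β 1 0 = 0
  init_succ : ∀ l ∈ Finset.Icc 2 N, e.τ l 0 = e.τ (l - 1) e.S ∧ e.y l 0 = e.y (l - 1) e.S ∧
    e.β l 0 = e.β (l - 1) e.S

/-- Canonical extended processes. -/
structure IsCanonicalProc (e : ExtendedData n m) : Prop where
  control : P.IsExtendedControl e
  solution : P.IsExtendedSolution e
  canonical : ∀ᵐ s ∂(volume.restrict (Icc 0 e.S)),
    deriv e.φ₀ s + ∑ l ∈ Finset.Icc 1 N, l1 (deriv (e.φ l) s) = 1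

/-! ### From impulse processes to canonical extended processes -/

/-- The measure `μ_l` on `[0, h]`: the translate of `μ` on `](l-1)h, lh[`, with atoms
`∫ ω^0_l` at `0` and `∫ ω^h_l` at `h`. -/
def muL (p : ImpulseData n m) (l : ℕ) : Fin m → SignedMeasure ℝ := fun j =>
  ((p.μ j).restrict (Ioo (((l : ℝ) - 1) * P.h) (l * P.h))).map
      (fun t => t - ((l : ℝ) - 1) * P.h)
    + (∫ s in (0)..1, p.ω 0 l s j) • (Measure.dirac (0 : ℝ)).toSignedMeasure
    + (∫ s in (0)..1, p.ω P.h l s j) • (Measure.dirac P.h).toSignedMeasure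

/-- The measure `ν_l` on `[0, h]`: the translate of `ν` on `](l-1)h, lh[`, with atoms
`∫ ‖ω^0_l‖` at `0` and `∫ ‖ω^h_l‖` at `h`. -/
def nuL (p : ImpulseData n m) (l : ℕ) : Measure ℝ :=
  (p.ν.restrict (Ioo (((l : ℝ) - 1) * P.h) (l * P.h))).map (fun t => t - ((l : ℝ) - 1) * P.h)
    + ENNReal.ofReal (∫ s in (0)..1, l1 (p.ω 0 l s)) • Measure.dirac 0
    + ENNReal.ofReal (∫ s in (0)..1, l1 (p.ω P.h l s)) • Measure.dirac P.h

/-- The function `ϕ(r) = r + ∑_l ν_l([0, r])`, `ϕ(0) = 0`. -/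
def phi (p : ImpulseData n m) (r : ℝ) : ℝ :=
  if r = 0 then 0 else r + ∑ l ∈ Finset.Icc 1 N, (P.nuL p l).real (Icc 0 r)

/-- The measure `dϕ` on `[0, h]`. -/
def dphi (p : ImpulseData n m) : Measure ℝ :=
  volume.restrict (Icc 0 P.h) + ∑ l ∈ Finset.Icc 1 N, P.nuL p l

/-- The set `𝒥` of discontinuity points of `ϕ`. -/
def jumpSet (p : ImpulseData n m) : Set ℝ :=
  {r | r ∈ Icc 0 P.h ∧ ¬ ContinuousWithinAt (P.phi p) (Icc 0 P.h) r}

/-- `ϕ⁻(r)`. -/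
def phiL (p : ImpulseData n m) (r : ℝ) : ℝ := limL 0 (P.phi p) r

/-- `ϕ⁺(r)`. -/
def phiR (p : ImpulseData n m) (r : ℝ) : ℝ := limR P.h (P.phi p) r

/-- The interval `Σ^r = [ϕ⁻(r), ϕ⁺(r)]`. -/
def sigmaSet (p : ImpulseData n m) (r : ℝ) : Set ℝ := Icc (P.phiL p r) (P.phiR p r)

/-- The set `⋃_{r ∈ 𝒥} Σ^r`. -/
def sigmaUnion (p : ImpulseData n m) : Set ℝ := ⋃ r ∈ P.jumpSet p, P.sigmaSet p r

/-- `γ^r : Σ^r → [0, 1]`. -/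
def gam (p : ImpulseData n m) (r s : ℝ) : ℝ :=
  (s - P.phiL p r) / (P.phiR p r - P.phiL p r)

/-- The Radon-Nikodym derivative `m_l` of `μ_lᶜ` with respect to `dϕ`. -/
def mL (p : ImpulseData n m) (l : ℕ) (r : ℝ) : Fin m → ℝ :=
  fun j => (contVec (P.muL p l) j).rnDeriv (P.dphi p) r

/-- `e = (S, φ₀, φ, τ, y, β)` is the tuple constructed from the impulse process
`p = (μ, ν, {ω^r}, x, v)`: the graph of the map `ℐ`. -/
structure AssociatedExtended (p : ImpulseData n m) (e : ExtendedData n m) : Prop where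
  S_eq : e.S = P.phi p P.h
  φ₀_eq : ∀ s ∈ Icc 0 e.S, e.φ₀ s = rightInv (P.phi p) 0 P.h 0 e.S s
  φ_ac : ∀ l ∈ Finset.Icc 1 N, AbsolutelyContinuousOnInterval (e.φ l) 0 e.S
  φ_init : ∀ l ∈ Finset.Icc 1 N, e.φ l 0 = if l = 1 then 0 else e.φ (l - 1) e.S
  φ_cont : ∀ l ∈ Finset.Icc 1 N, ∀ᵐ s ∂(volume.restrict (Icc 0 e.S \ P.sigmaUnion p)),
    HasDerivAt (e.φ l) (P.mL p l (e.φ₀ s)) s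
  φ_jump : ∀ l ∈ Finset.Icc 1 N, ∀ r ∈ P.jumpSet p,
    ∀ᵐ s ∂(volume.restrict (P.sigmaSet p r)),
      HasDerivAt (e.φ l) ((1 / (P.phiR p r - P.phiL p r)) • p.ω r l (P.gam p r s)) s
  τ_eq : ∀ l ∈ Finset.Icc 1 N, ∀ s ∈ Icc 0 e.S, e.τ l s = ((l : ℝ) - 1) * P.h + e.φ₀ s
  yβ : ∃ ζ θ, P.IsJumpSolution p ζ θ ∧ ∀ l ∈ Finset.Icc 1 N,
    (e.y l 0 = if l = 1 then P.x₀ else ζ P.h (l - 1) 1) ∧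
    (e.β l 0 = if l = 1 then 0 else θ P.h (l - 1) 1) ∧
    (e.y l e.S = ζ P.h l 1 ∧ e.β l e.S = θ P.h l 1) ∧
    (∀ s ∈ Ioo 0 e.S \ P.sigmaUnion p,
      e.y l s = p.x (e.τ l s) ∧ e.β l s = p.v (e.τ l s)) ∧
    (∀ r ∈ P.jumpSet p, ∀ s ∈ Ioo 0 e.S ∩ P.sigmaSet p r,
      e.y l s = ζ r l (P.gam p r s) ∧ e.β l s = θ r l (P.gam p r s))

/-! ### From canonical extended processes to impulse processes -/

/-- `σ`, the right inverse of `φ₀`. -/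
def sigma (e : ExtendedData n m) : ℝ → ℝ := rightInv e.φ₀ 0 e.S 0 P.h

/-- `σ̃`, the right inverse of `τ̃`. -/
def sigmaT (e : ExtendedData n m) : ℝ → ℝ :=
  rightInv (concat N e.S e.τ) 0 (N * e.S) 0 P.T

/-- `p = (μ, ν, {ω^r}, x, v)` is the tuple constructed from the canonical extended process
`e = (S, φ₀, φ, τ, y, β)`. -/
structure AssociatedImpulse (e : ExtendedData n m) (p : ImpulseData n m) : Prop where
  μ_supp : totalVar p.μ (Icc 0 P.T)ᶜ = 0
  μ_eq : ∀ t ∈ Icc 0 P.T, ∀ j, p.μ j (Icc 0 t)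
    = ∫ s in (0)..(limR P.T (P.sigmaT e) t), deriv (concat N e.S e.φ) s j
  ν_supp : p.ν (Icc 0 P.T)ᶜ = 0
  ν_eq : ∀ t ∈ Icc 0 P.T, p.ν (Icc 0 t)
    = ENNReal.ofReal (∫ s in (0)..(limR P.T (P.sigmaT e) t), l1 (deriv (concat N e.S e.φ) s))
  ω_eq : ∀ r ∈ Icc 0 P.h, ∀ l ∈ Finset.Icc 1 N, ∀ᵐ s ∂(volume.restrict (Icc (0 : ℝ) 1)),
    p.ω r l s = (limR P.h (P.sigma e) r - limL 0 (P.sigma e) r) •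
      deriv (e.φ l) ((limR P.h (P.sigma e) r - limL 0 (P.sigma e) r) * s
        + limL 0 (P.sigma e) r)
  x_hist : ∀ t ∈ Ico (-(M * P.h)) 0, p.x t = P.ξ₀ t
  x_eq : ∀ t ∈ Icc 0 P.T, p.x t = concat N e.S e.y (P.sigmaT e t)
  v_eq : ∀ t ∈ Icc 0 P.T, p.v t = concat N e.S e.β (P.sigmaT e t)

/-! ### The two classes -/

/-- Equality of impulse processes: the functions `x`, `v` are functions on `[-Mh, T]` and
`[0, T]`, and the `ω^r_l` are functions on `[0, 1]` up to a.e. equality. -/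
structure SameImpulse (p q : ImpulseData n m) : Prop where
  μ_eq : p.μ = q.μ
  ν_eq : p.ν = q.ν
  ω_eq : ∀ r ∈ Icc 0 P.h, ∀ l ∈ Finset.Icc 1 N,
    p.ω r l =ᵐ[volume.restrict (Icc 0 1)] q.ω r l
  x_eq : EqOn p.x q.x (Icc (-(M * P.h)) P.T)
  v_eq : EqOn p.v q.v (Icc 0 P.T)

/-- Equality of extended processes: all functions are functions on `[0, S]`. -/
structure SameExtended (_ : DelaySystem n m N M) (e d : ExtendedData n m) : Prop where
  S_eq : e.S = d.S
  φ₀_eq : EqOn e.φ₀ d.φ₀ (Icc 0 e.S)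
  φ_eq : ∀ l ∈ Finset.Icc 1 N, EqOn (e.φ l) (d.φ l) (Icc 0 e.S)
  τ_eq : ∀ l ∈ Finset.Icc 1 N, EqOn (e.τ l) (d.τ l) (Icc 0 e.S)
  y_eq : ∀ l ∈ Finset.Icc 1 N, EqOn (e.y l) (d.y l) (Icc 0 e.S)
  β_eq : ∀ l ∈ Finset.Icc 1 N, EqOn (e.β l) (d.β l) (Icc 0 e.S)

/-- `SameImpulse` as an equivalence relation on impulse processes. -/
def impulseSetoid : Setoid {p : ImpulseData n m // P.IsImpulseProc p} where
  r p q := P.SameImpulse p.1 q.1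
  iseqv :=
    { refl := fun _ => ⟨rfl, rfl, fun _ _ _ _ => Filter.EventuallyEq.rfl, fun _ _ => rfl,
        fun _ _ => rfl⟩
      symm := fun h => ⟨h.μ_eq.symm, h.ν_eq.symm, fun r hr l hl => (h.ω_eq r hr l hl).symm,
        h.x_eq.symm, h.v_eq.symm⟩
      trans := fun h k => ⟨h.μ_eq.trans k.μ_eq, h.ν_eq.trans k.ν_eq,
        fun r hr l hl => (h.ω_eq r hr l hl).trans (k.ω_eq r hr l hl),
        h.x_eq.trans k.x_eq, h.v_eq.trans k.v_eq⟩ }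

/-- `SameExtended` as an equivalence relation on canonical extended processes. -/
def extendedSetoid : Setoid {e : ExtendedData n m // P.IsCanonicalProc e} where
  r e d := P.SameExtended e.1 d.1
  iseqv :=
    { refl := fun _ => ⟨rfl, fun _ _ => rfl, fun _ _ _ _ => rfl, fun _ _ _ _ => rfl,
        fun _ _ _ _ => rfl, fun _ _ _ _ => rfl⟩
      symm := fun h => ⟨h.S_eq.symm, h.S_eq ▸ h.φ₀_eq.symm,
        fun l hl => h.S_eq ▸ (h.φ_eq l hl).symm, fun l hl => h.S_eq ▸ (h.τ_eq l hl).symm,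
        fun l hl => h.S_eq ▸ (h.y_eq l hl).symm, fun l hl => h.S_eq ▸ (h.β_eq l hl).symm⟩
      trans := fun h k => ⟨h.S_eq.trans k.S_eq, h.φ₀_eq.trans (h.S_eq ▸ k.φ₀_eq),
        fun l hl => (h.φ_eq l hl).trans (h.S_eq ▸ k.φ_eq l hl),
        fun l hl => (h.τ_eq l hl).trans (h.S_eq ▸ k.τ_eq l hl),
        fun l hl => (h.y_eq l hl).trans (h.S_eq ▸ k.y_eq l hl),
        fun l hl => (h.β_eq l hl).trans (h.S_eq ▸ k.β_eq l hl)⟩ }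

/-- The set of impulse processes. -/
def ImpulseProcs : Type := Quotient P.impulseSetoid

/-- The set of canonical extended processes. -/
def CanonicalProcs : Type := Quotient P.extendedSetoid

/-- The impulse process with given data. -/
def ImpulseProcs.mk (p : {p : ImpulseData n m // P.IsImpulseProc p}) : P.ImpulseProcs :=
  Quotient.mk P.impulseSetoid p

/-- The canonical extended process with given data. -/
def CanonicalProcs.mk (e : {e : ExtendedData n m // P.IsCanonicalProc e}) :
    P.CanonicalProcs :=
  Quotient.mk P.extendedSetoid e

end DelaySystem

end ImpulseDelay

end

noncomputable section

namespace ImpulseDelay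

/-! ### Integral representation of Carathéodory solutions -/

section Solves

variable {E : Type*} [NormedAddCommGroup E] [NormedSpace ℝ E]

/-! Everything is read through one clock. In a canonical extended process all blocks advance
together, because `τ_l = (l-1)h + φ₀` (`tau_eq_of_solution`), so only `φ₀ : [0,S] → [0,h]` matters.
For a continuous nondecreasing surjection (`IsClock`) the fibre over `r` is an interval `[lo r, hi
r]`. It is nondegenerate for at most countably many stopping values (`jset`). Off the union `uset`
of these fibres the clock is injective, with inverse `hi`. Impulses are what the extended process
does while the clock stands still.

Controls. Both constructions are shown to yield the same relation `Linked`: `μ` and `ν` are the sums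
over `l` of the images under `(l-1)h + φ₀` of `φ̇_l ds` and `‖φ̇_l‖ ds`, and `ω^r_l` is `φ̇_l` on
the fibre over `r`, rescaled to `[0,1]`. Given this relation, integrating the normalization `φ̇₀ +
∑‖φ̇_l‖ = 1` gives `ϕ(r) = hi r` for `r > 0` (`Linked.phi_eq`). Hence `φ₀` is the right inverse of
`ϕ`, the sets `𝒥` and `Σ^r` are the stopping values and their fibres, and `m_l ∘ φ₀ = φ̇_l` off the
stops (`Linked.ae_mL`). The weak* requirement on `(μ,ν)` is met by pushing the same velocities
forward along strictly increasing perturbations of the clock, for which no cancellation takes place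
(`IsClock.inVc`). Conversely, for an impulse control `ϕ` grows at speed at least one, so its right
inverse is a 1-Lipschitz clock (`isClock_rightInv_phi`) under which `dϕ` is the image of Lebesgue
measure (`dphi_eq`). The identity `νᶜ = |μᶜ|` makes `m_l` `K`-valued, with `‖m_l‖` the density of
the continuous part of `ν_l` (`mL_spec`). The decomposition `dϕ = dr + ∑ν_l` becomes the canonical
normalization off the stops (`rho_add_sum`), and the constancy of `∑‖ω^r_l‖` gives it on the stops
(`IsAssocControl.ae_bound`); `IsAssocControl.linked` collects the result.

States. Off the stops the velocity of `y_l` depends on the clock value only, and its integral is the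
drift term plus the integral against `μᶜ` (`Linked.integral_velocity_off`). On a stop `φ̇₀ = 0`, the
drift disappears and the equation of `y_l` is the rescaled jump equation (`Linked.ae_jumpVelocity`).
Countable additivity over the fibres turns a primitive on `[0,S]` into an integral equation with a
sum of jumps, and back (`IsClock.jumps_of_eq_primitive`, `IsClock.eq_primitive_of_jumps`). The arcs
`(ζ,θ)` are unique (`IsJumpSolution.unique`), so it does not matter which pair construction (i)
uses.

Bijection. On processes the two constructions, as relations, imply each other
(`AssociatedExtended.associatedImpulse`, `AssociatedImpulse.associatedExtended`), and each has an
outcome that is unique up to equality of processes. Uniqueness of the trajectories `x` and `y`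
themselves is never needed, since they are part of the data. -/

theorem lipschitzOnWith_integral {F : ℝ → E} {a b : ℝ} {C : NNReal}
    (hF : IntervalIntegrable F volume a b)
    (hC : ∀ᵐ s ∂(volume.restrict (Icc a b)), ‖F s‖ ≤ C) (hab : a ≤ b) :
    LipschitzOnWith C (fun s => ∫ t in a..s, F t) (Icc a b) := by
  have key : ∀ x ∈ Icc a b, ∀ y ∈ Icc a b,
      ‖(∫ t in a..x, F t) - ∫ t in a..y, F t‖ ≤ C * |x - y| := by
    intro x hx y hy
    have h1 : IntervalIntegrable F volume a x := hF.mono_set (by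
      rw [uIcc_of_le hx.1, uIcc_of_le hab]; exact Icc_subset_Icc le_rfl hx.2)
    have h2 : IntervalIntegrable F volume a y := hF.mono_set (by
      rw [uIcc_of_le hy.1, uIcc_of_le hab]; exact Icc_subset_Icc le_rfl hy.2)
    rw [intervalIntegral.integral_interval_sub_left h1 h2]
    apply intervalIntegral.norm_integral_le_of_norm_le_const_ae
    filter_upwards [(ae_restrict_iff' measurableSet_Icc).1 hC] with t ht htm
    refine ht ?_
    have := uIoc_subset_uIcc htm
    exact (uIcc_subset_Icc hy hx) this
  refine LipschitzOnWith.of_dist_le_mul fun x hx y hy => ?_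
  rw [dist_eq_norm, Real.dist_eq]
  exact key x hx y hy

variable [CompleteSpace E]

theorem solvesOn_of_eq_integral {z F : ℝ → E} {a b : ℝ} {C : NNReal} (hab : a ≤ b)
    (hF : IntervalIntegrable F volume a b)
    (hC : ∀ᵐ s ∂(volume.restrict (Icc a b)), ‖F s‖ ≤ C)
    (hz : ∀ s ∈ Icc a b, z s = z a + ∫ t in a..s, F t) :
    SolvesOn z F a b ∧ LipschitzOnWith C z (Icc a b) := by
  have hL : LipschitzOnWith C z (Icc a b) := by
    refine LipschitzOnWith.of_dist_le_mul fun x hx y hy => ?_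
    rw [hz x hx, hz y hy, dist_add_left]
    exact (lipschitzOnWith_integral hF hC hab).dist_le_mul x hx y hy
  refine ⟨⟨?_, ?_⟩, hL⟩
  · apply LipschitzOnWith.absolutelyContinuousOnInterval (K := C)
    rwa [uIcc_of_le hab]
  · rw [ae_restrict_iff' measurableSet_Icc]
    filter_upwards [hF.ae_hasDerivAt_integral, Measure.ae_ne volume a, Measure.ae_ne volume b]
      with s hs hsa hsb hmem
    have h1 := hs (by rwa [uIcc_of_le hab]) a left_mem_uIcc
    have h2 : HasDerivAt (fun s => z a + ∫ t in a..s, F t) (F s) s := by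
      simpa using h1.const_add (z a)
    refine h2.congr_of_eventuallyEq ?_
    have : Icc a b ∈ 𝓝 s := Icc_mem_nhds (lt_of_le_of_ne hmem.1 (Ne.symm hsa))
      (lt_of_le_of_ne hmem.2 hsb)
    filter_upwards [this] with t ht using hz t ht

/-- Measurability of `F` comes for free: `F` agrees almost everywhere with `deriv z`, which is
measurable. Only a bound has to be supplied. -/
theorem SolvesOn.intervalIntegrable {z F : ℝ → E} {a b C : ℝ} (hab : a ≤ b)
    (h : SolvesOn z F a b) (hC : ∀ᵐ s ∂(volume.restrict (Icc a b)), ‖F s‖ ≤ C) :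
    IntervalIntegrable F volume a b := by
  rw [intervalIntegrable_iff_integrableOn_Icc_of_le hab]
  have hm : AEStronglyMeasurable F (volume.restrict (Icc a b)) := by
    refine (aestronglyMeasurable_deriv z _).congr ?_
    filter_upwards [h.2] with s hs using hs.deriv
  exact Integrable.of_bound hm C hC

/-- The difference of `z` and the primitive of `F` is absolutely continuous with derivative zero
almost everywhere, hence constant. -/
theorem SolvesOn.eq_add_integral {z F : ℝ → E} {a b : ℝ} {C : NNReal} (hab : a ≤ b)
    (h : SolvesOn z F a b) (hC : ∀ᵐ s ∂(volume.restrict (Icc a b)), ‖F s‖ ≤ C) :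
    ∀ s ∈ Icc a b, z s = z a + ∫ t in a..s, F t := by
  have hF := h.intervalIntegrable hab hC
  have hI := (solvesOn_of_eq_integral (z := fun s => ∫ t in a..s, F t) hab hF hC
    (fun s _ => by simp)).1
  have hd : AbsolutelyContinuousOnInterval (z - fun s => ∫ t in a..s, F t) a b := h.1.sub hI.1
  obtain ⟨c, hc⟩ := hd.const_of_ae_hasDerivAt_zero (by
    have h1 := (ae_restrict_iff' measurableSet_Icc).1 h.2
    have h2 := (ae_restrict_iff' measurableSet_Icc).1 hI.2
    filter_upwards [h1, h2] with s h1 h2 hs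
    rw [uIcc_of_le hab] at hs
    simpa using (h1 hs).sub (h2 hs))
  rw [uIcc_of_le hab] at hc
  intro s hs
  have e1 := hc s hs
  have e2 := hc a (left_mem_Icc.2 hab)
  simp only [Pi.sub_apply, intervalIntegral.integral_same, sub_zero] at e1 e2
  rw [e2, ← e1]; abel

end Solves

/-- A nonnegative continuous function dominated by a multiple of its primitive vanishes. -/
theorem eq_zero_of_le_mul_integral {u : ℝ → ℝ} {b C : ℝ} (hu : ContinuousOn u (Icc 0 b))
    (h0 : ∀ s ∈ Icc 0 b, 0 ≤ u s) (h : ∀ s ∈ Icc 0 b, u s ≤ C * ∫ t in (0)..s, u t) :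
    ∀ s ∈ Icc 0 b, u s = 0 := by
  intro s₀ hs₀
  have hb : 0 ≤ b := hs₀.1.trans hs₀.2
  -- The constant extension of `u` beyond `[0, b]` is continuous on the line, so its primitive is
  -- differentiable everywhere. Grönwall's inequality with zero initial value and zero forcing is
  -- applied to that primitive.
  set v : ℝ → ℝ := IccExtend hb (fun x : Icc 0 b => u x) with hv
  have hvc : Continuous v := continuousOn_iff_continuous_domRestrict.1 hu |>.Icc_extend'
  have hvu : ∀ s ∈ Icc 0 b, v s = u s := fun s hs => IccExtend_of_mem hb _ hs
  have hint : ∀ s ∈ Icc 0 b, ∫ t in (0)..s, u t = ∫ t in (0)..s, v t := by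
    intro s hs
    refine intervalIntegral.integral_congr fun t ht => ?_
    rw [uIcc_of_le hs.1] at ht
    exact (hvu t ⟨ht.1, ht.2.trans hs.2⟩).symm
  have hnn : ∀ s ∈ Icc 0 b, 0 ≤ ∫ t in (0)..s, v t := by
    intro s hs
    refine intervalIntegral.integral_nonneg hs.1 fun t ht => ?_
    rw [hvu t ⟨ht.1, ht.2.trans hs.2⟩]; exact h0 t ⟨ht.1, ht.2.trans hs.2⟩
  have hI : ∀ s, HasDerivAt (fun s => ∫ t in (0)..s, v t) (v s) s := fun s =>
    intervalIntegral.integral_hasDerivAt_right (hvc.intervalIntegrable _ _)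
      (hvc.stronglyMeasurableAtFilter _ _) hvc.continuousAt
  have hg := norm_le_gronwallBound_of_norm_deriv_right_le
    (f := fun s => ∫ t in (0)..s, v t) (f' := v) (δ := 0) (K := C) (ε := 0) (a := 0) (b := b)
    (fun s _ => (hI s).continuousAt.continuousWithinAt)
    (fun s _ => (hI s).hasDerivWithinAt) (by simp) (fun s hs => by
      have hs' : s ∈ Icc 0 b := ⟨hs.1, hs.2.le⟩
      rw [add_zero, Real.norm_of_nonneg (hnn s hs'), hvu s hs', Real.norm_of_nonneg (h0 s hs'),
        ← hint s hs']
      exact h s hs')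
  have hz := hg s₀ hs₀
  rw [gronwallBound_ε0_δ0, Real.norm_of_nonneg (hnn s₀ hs₀)] at hz
  have h1 := h s₀ hs₀
  rw [hint s₀ hs₀] at h1
  have h2 : ∫ t in (0)..s₀, v t = 0 := le_antisymm hz (hnn s₀ hs₀)
  rw [h2, mul_zero] at h1
  exact le_antisymm h1 (h0 s₀ hs₀)

/-! ### Signed and vector measures -/

/-- Half-lines `Iic t` form a generating π-system, and each of them meets `[0, T]` in the empty set
or in some `[0, t']`. It identifies `μ` with an image of `φ̇ ds` from the values that construction
(ii) prescribes. -/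
theorem signedMeasure_ext_of_Icc {T : ℝ} (hT : 0 ≤ T) {μ₁ μ₂ : SignedMeasure ℝ}
    (h₁ : μ₁.totalVariation (Icc 0 T)ᶜ = 0) (h₂ : μ₂.totalVariation (Icc 0 T)ᶜ = 0)
    (h : ∀ t ∈ Icc 0 T, μ₁ (Icc 0 t) = μ₂ (Icc 0 t)) : μ₁ = μ₂ := by
  have hs : ∀ μ : SignedMeasure ℝ, μ.totalVariation (Icc 0 T)ᶜ = 0 → ∀ A, MeasurableSet A →
      μ A = μ (A ∩ Icc 0 T) := by
    intro μ hμ A hA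
    have := VectorMeasure.of_add_of_sdiff (v := μ) (hA.inter measurableSet_Icc) hA
      (inter_subset_left (t := Icc 0 T))
    rw [← this, SignedMeasure.null_of_totalVariation_zero μ (i := A \ (A ∩ Icc 0 T)), add_zero]
    refine measure_mono_null (fun t ht => ?_) hμ
    exact fun h' => ht.2 ⟨ht.1, h'⟩
  refine VectorMeasure.ext_of_generateFrom _ ?_
    ((BorelSpace.measurable_eq).trans (borel_eq_generateFrom_Iic ℝ)) isPiSystem_Iic ?_
  · rintro _ ⟨t, rfl⟩
    rw [hs μ₁ h₁ _ measurableSet_Iic, hs μ₂ h₂ _ measurableSet_Iic]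
    rcases lt_or_ge t 0 with ht | ht
    · have : Iic t ∩ Icc 0 T = ∅ := by
        ext s; simp only [mem_inter_iff, mem_Iic, mem_Icc, mem_empty_iff_false, iff_false]
        intro h; linarith [h.1, h.2.1]
      simp [this]
    · have : Iic t ∩ Icc 0 T = Icc 0 (min t T) := by
        ext s; simp only [mem_inter_iff, mem_Iic, mem_Icc, le_min_iff]; tauto
      rw [this]
      exact h _ ⟨le_min ht hT, min_le_right _ _⟩
  · rw [hs μ₁ h₁ _ MeasurableSet.univ, hs μ₂ h₂ _ MeasurableSet.univ, univ_inter]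
    exact h T ⟨hT, le_rfl⟩

instance isFiniteMeasure_totalVariation (μ : SignedMeasure ℝ) :
    IsFiniteMeasure μ.totalVariation := by
  unfold SignedMeasure.totalVariation
  infer_instance

instance isFiniteMeasure_totalVar {m : ℕ} (μ : Fin m → SignedMeasure ℝ) :
    IsFiniteMeasure (totalVar μ) := by
  refine ⟨?_⟩
  simp only [totalVar, Measure.finsetSum_apply]
  exact ENNReal.sum_lt_top.2 fun j _ => measure_lt_top _ _

theorem measurable_l1 {m : ℕ} : Measurable (l1 (m := m)) := by
  unfold l1
  fun_prop

theorem l1_nonneg {m : ℕ} (w : Fin m → ℝ) : 0 ≤ l1 w := Finset.sum_nonneg fun _ _ => abs_nonneg _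

theorem abs_le_l1 {m : ℕ} (w : Fin m → ℝ) (j : Fin m) : |w j| ≤ l1 w :=
  Finset.single_le_sum (f := fun j => |w j|) (fun _ _ => abs_nonneg _) (Finset.mem_univ j)

theorem norm_le_l1 {m : ℕ} (w : Fin m → ℝ) : ‖w‖ ≤ l1 w :=
  (pi_norm_le_iff_of_nonneg (l1_nonneg w)).2 fun j => abs_le_l1 w j

theorem l1_smul {m : ℕ} (c : ℝ) (w : Fin m → ℝ) : l1 (c • w) = |c| * l1 w := by
  simp [l1, abs_mul, Finset.mul_sum]

theorem l1_zero {m : ℕ} : l1 (0 : Fin m → ℝ) = 0 := by simp [l1]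

theorem l1_eq_zero {m : ℕ} {w : Fin m → ℝ} (h : l1 w = 0) : w = 0 := by
  funext j
  have := abs_le_l1 w j
  rw [h] at this
  simpa using this

theorem integrable_l1 {m : ℕ} {α : Type*} {m0 : MeasurableSpace α} {lam : Measure α}
    {k : α → Fin m → ℝ} (hk : Integrable k lam) : Integrable (fun t => l1 (k t)) lam := by
  unfold l1
  exact integrable_finsetSum _ fun j _ => (hk.eval j).abs

/-- The variation of a scalar density `k_j` is `|k_j|`; since the total variation of a vector
measure is here the sum over the components, the densities add up to the `ℓ¹` norm. -/
theorem totalVar_withDensity {m : ℕ} {lam : Measure ℝ} {k : ℝ → Fin m → ℝ}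
    (hk : Integrable k lam) {μ : Fin m → SignedMeasure ℝ}
    (hμ : ∀ j, ∀ A, MeasurableSet A → μ j A = ∫ t in A, k t j ∂lam) :
    totalVar μ = lam.withDensity fun t => ENNReal.ofReal (l1 (k t)) := by
  have h1 : ∀ j, (μ j).totalVariation = lam.withDensity fun t => ‖k t j‖ₑ := by
    intro j
    have : μ j = lam.withDensityᵥ (fun t => k t j) := by
      ext A hA
      rw [hμ j A hA, withDensityᵥ_apply (hk.eval j) hA]
    rw [SignedMeasure.totalVariation_eq_variation, this,
      Measure.variation_withDensityᵥ (hk.eval j)]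
  ext A hA
  simp only [totalVar, Measure.finsetSum_apply, h1]
  simp_rw [withDensity_apply _ hA]
  rw [← lintegral_finsetSum' _ fun j _ => (hk.eval j).aestronglyMeasurable.restrict.enorm]
  refine lintegral_congr fun t => ?_
  rw [l1, ENNReal.ofReal_sum_of_nonneg fun _ _ => abs_nonneg _]
  simp [Real.enorm_eq_ofReal_abs]

/-- Since `|μ| = ‖k‖ λ`, the quotient `k/‖k‖` is a density of `μ` with respect to `|μ|`, and
densities are unique. Where `‖k‖ = 0` the convention `0⁻¹ = 0` makes both sides vanish. -/
theorem polarDensity_of_withDensity {m : ℕ} {lam : Measure ℝ} {k : ℝ → Fin m → ℝ}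
    (hk : Integrable k lam) {μ : Fin m → SignedMeasure ℝ}
    (hμ : ∀ j, ∀ A, MeasurableSet A → μ j A = ∫ t in A, k t j ∂lam) :
    ∀ᵐ t ∂(totalVar μ), polarDensity μ t = (l1 (k t))⁻¹ • k t := by
  have htv := totalVar_withDensity hk hμ
  have hae : AEMeasurable (fun t => ENNReal.ofReal (l1 (k t))) lam :=
    (measurable_l1.comp_aemeasurable hk.aestronglyMeasurable.aemeasurable).ennreal_ofReal
  have hm : AEStronglyMeasurable (fun t => (l1 (k t))⁻¹ • k t) lam := by
    have h1 : AEMeasurable k lam := hk.aestronglyMeasurable.aemeasurable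
    exact ((measurable_l1.comp_aemeasurable h1).inv.smul h1).aestronglyMeasurable
  have hac : totalVar μ ≪ lam := by rw [htv]; exact withDensity_absolutelyContinuous _ _
  have hint : Integrable (fun t => (l1 (k t))⁻¹ • k t) (totalVar μ) := by
    refine Integrable.of_bound (hm.mono_ac hac) 1 (Eventually.of_forall fun t => ?_)
    rw [norm_smul, norm_inv, Real.norm_of_nonneg (l1_nonneg _)]
    exact inv_mul_le_one_of_le₀ (norm_le_l1 _) (l1_nonneg _)
  have hj : ∀ j, (fun t => ((l1 (k t))⁻¹ • k t) j) =ᵐ[totalVar μ]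
      (μ j).rnDeriv (totalVar μ) := by
    intro j
    refine SignedMeasure.eq_rnDeriv 0 _ (hint.eval j) VectorMeasure.MutuallySingular.zero_left ?_
    rw [zero_add]
    ext A hA
    rw [hμ j A hA, withDensityᵥ_apply (hint.eval j) hA, htv,
      setIntegral_withDensity_eq_setIntegral_toReal_smul₀ hae.restrict
        (Eventually.of_forall fun _ => ENNReal.ofReal_lt_top) _ hA]
    refine integral_congr_ae (Eventually.of_forall fun t => ?_)
    simp only [Pi.smul_apply, smul_eq_mul, ENNReal.toReal_ofReal (l1_nonneg _)]
    by_cases h0 : l1 (k t) = 0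
    · simp [l1_eq_zero h0]
    · field_simp
  filter_upwards [eventually_countable_forall.2 hj] with t ht
  funext j
  exact (ht j).symm

/-- Only the cone property is used, not convexity: a `K`-valued density with respect to any
reference measure certifies that the polar density is `K`-valued. -/
theorem ae_polarDensity_mem {m : ℕ} {K : Set (Fin m → ℝ)}
    (hcone : ∀ w ∈ K, ∀ c : ℝ, 0 ≤ c → c • w ∈ K) {lam : Measure ℝ} {k : ℝ → Fin m → ℝ}
    (hk : Integrable k lam) {μ : Fin m → SignedMeasure ℝ}
    (hμ : ∀ j, ∀ A, MeasurableSet A → μ j A = ∫ t in A, k t j ∂lam)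
    (hK : ∀ᵐ t ∂lam, k t ∈ K) : ∀ᵐ t ∂(totalVar μ), polarDensity μ t ∈ K := by
  have hac : totalVar μ ≪ lam := by
    rw [totalVar_withDensity hk hμ]; exact withDensity_absolutelyContinuous _ _
  filter_upwards [polarDensity_of_withDensity hk hμ, hac hK] with t ht hKt
  rw [ht]
  exact hcone _ hKt _ (inv_nonneg.2 (l1_nonneg _))

theorem measurable_polarDensity {m : ℕ} (μ : Fin m → SignedMeasure ℝ) :
    Measurable (polarDensity μ) :=
  measurable_pi_lambda _ fun _ => SignedMeasure.measurable_rnDeriv _ _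

theorem apply_eq_integral_polarDensity_eval {m : ℕ} (μ : Fin m → SignedMeasure ℝ) {A : Set ℝ}
    (hA : MeasurableSet A) (j : Fin m) : μ j A = ∫ t in A, polarDensity μ t j ∂(totalVar μ) := by
  obtain ⟨h1, h2⟩ := apply_eq_integral_polarDensity μ hA
  have := congrFun h2 j
  rw [eval_integral fun j => (h1.eval j)] at this
  exact this

theorem integrable_polarDensity {m : ℕ} (μ : Fin m → SignedMeasure ℝ) :
    Integrable (polarDensity μ) (totalVar μ) := by
  simpa using (apply_eq_integral_polarDensity μ MeasurableSet.univ).1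

/-- The formula for the total variation of a density is applied with reference measure `|μ|` itself;
comparing `‖k‖ |μ|` with `|μ|` forces `‖k‖ = 1`. -/
theorem ae_l1_polarDensity {m : ℕ} (μ : Fin m → SignedMeasure ℝ) :
    ∀ᵐ t ∂(totalVar μ), l1 (polarDensity μ t) = 1 := by
  have h := totalVar_withDensity (integrable_polarDensity μ) (μ := μ)
    fun j A hA => apply_eq_integral_polarDensity_eval μ hA j
  have h1 : (totalVar μ).withDensity (fun t => ENNReal.ofReal (l1 (polarDensity μ t)))
      = (totalVar μ).withDensity 1 := by rw [← h, withDensity_one]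
  have h2 := (withDensity_eq_iff_of_sigmaFinite
    (measurable_l1.comp (measurable_polarDensity μ)).ennreal_ofReal.aemeasurable
    aemeasurable_const).1 h1
  filter_upwards [h2] with t ht
  have : ENNReal.ofReal (l1 (polarDensity μ t)) = 1 := ht
  rwa [ENNReal.ofReal_eq_one] at this

/-- The integral against a signed measure which is the image of a measure with density. -/
theorem sInt_eq_integral_of_map {E : Type*} [NormedAddCommGroup E] [NormedSpace ℝ E]
    [CompleteSpace E] [SecondCountableTopology E] [MeasurableSpace E] [BorelSpace E]
    {μ : SignedMeasure ℝ} {A : Set ℝ} (hA : MeasurableSet A)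
    {lam : Measure ℝ} [SFinite lam] {ψ k : ℝ → ℝ} (hψ : AEMeasurable ψ lam) (hk : Integrable k lam)
    (h : ∀ B, MeasurableSet B → B ⊆ A → μ B = ∫ s, (ψ ⁻¹' B).indicator k s ∂lam)
    {G : ℝ → E} (hG : Measurable G) {C : ℝ} (hC : ∀ t, ‖G t‖ ≤ C) :
    sInt μ A G = ∫ s, (ψ ⁻¹' A).indicator (fun s => k s • G (ψ s)) s ∂lam := by
  set ρ₁ : ℝ → ENNReal := fun s => ENNReal.ofReal (k s) with hρ₁
  set ρ₂ : ℝ → ENNReal := fun s => ENNReal.ofReal (-k s) with hρ₂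
  have hm1 : AEMeasurable ρ₁ lam := hk.aestronglyMeasurable.aemeasurable.ennreal_ofReal
  have hm2 : AEMeasurable ρ₂ lam := hk.aestronglyMeasurable.aemeasurable.neg.ennreal_ofReal
  have hf1 := isFiniteMeasure_withDensity_ofReal hk.2
  have hf2 := isFiniteMeasure_withDensity_ofReal hk.neg.2
  have hψ1 : AEMeasurable ψ (lam.withDensity ρ₁) :=
    hψ.mono_ac (withDensity_absolutelyContinuous _ _)
  have hψ2 : AEMeasurable ψ (lam.withDensity ρ₂) :=
    hψ.mono_ac (withDensity_absolutelyContinuous _ _)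
  set α : Measure ℝ := (lam.withDensity ρ₁).map ψ with hα
  set β : Measure ℝ := (lam.withDensity ρ₂).map ψ with hβ
  have : IsFiniteMeasure α := by rw [hα]; infer_instance
  have : IsFiniteMeasure β := by rw [hβ]; infer_instance
  have hGi : ∀ κ : Measure ℝ, IsFiniteMeasure κ → Integrable G κ := fun κ _ =>
    Integrable.of_bound hG.aestronglyMeasurable C (Eventually.of_forall hC)
  have hnull : ∀ B, MeasurableSet B → NullMeasurableSet (ψ ⁻¹' B) lam := fun B hB =>
    hψ.nullMeasurable hB
  have hαβ : ∀ B, MeasurableSet B → α.real B - β.real B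
      = ∫ s, (ψ ⁻¹' B).indicator k s ∂lam := by
    intro B hB
    have n1 : NullMeasurableSet (ψ ⁻¹' B) (lam.withDensity ρ₁) := hψ1.nullMeasurable hB
    rw [hα, hβ, measureReal_def, measureReal_def, Measure.map_apply_of_aemeasurable hψ1 hB,
      Measure.map_apply_of_aemeasurable hψ2 hB, withDensity_apply₀ _ (hnull B hB),
      withDensity_apply₀ _ (hnull B hB),
      integral_indicator₀ (hnull B hB),
      integral_eq_lintegral_pos_part_sub_lintegral_neg_part hk.integrableOn]
  set j := μ.toJordanDecomposition
  -- The images `α` and `β` of the positive and negative parts of `k` need not be mutually singular,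
  -- so they are not the Jordan parts of `μ`. Only the differences agree on `A`, and they are
  -- compared as an equality of sums of positive measures.
  have hsum : j.posPart.restrict A + β.restrict A = α.restrict A + j.negPart.restrict A := by
    ext B hB
    have hBA : MeasurableSet (B ∩ A) := hB.inter hA
    have e1 := h (B ∩ A) hBA inter_subset_right
    rw [← hαβ _ hBA, SignedMeasure.apply_eq_posPart_real_sub_negPart_real μ hBA] at e1
    simp only [Measure.add_apply, Measure.restrict_apply hB]
    have e2 : (j.posPart (B ∩ A) + β (B ∩ A)).toReal = (α (B ∩ A) + j.negPart (B ∩ A)).toReal := by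
      rw [ENNReal.toReal_add (measure_ne_top _ _) (measure_ne_top _ _),
        ENNReal.toReal_add (measure_ne_top _ _) (measure_ne_top _ _)]
      simp only [measureReal_def] at e1
      linarith
    exact (ENNReal.toReal_eq_toReal_iff' (by finiteness) (by finiteness)).1 e2
  have e3 : (∫ t in A, G t ∂j.posPart) + ∫ t in A, G t ∂β
      = (∫ t in A, G t ∂α) + ∫ t in A, G t ∂j.negPart := by
    rw [← integral_add_measure (hGi _ inferInstance) (hGi _ inferInstance), hsum,
      integral_add_measure (hGi _ inferInstance) (hGi _ inferInstance)]
  have e4 : sInt μ A G = (∫ t in A, G t ∂α) - ∫ t in A, G t ∂β := by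
    rw [sInt, sub_eq_sub_iff_add_eq_add, e3]
  have hGψ1 : AEStronglyMeasurable (fun s => G (ψ s)) lam :=
    (hG.comp_aemeasurable hψ).aestronglyMeasurable
  have e5 : ∀ ρ : ℝ → ENNReal, AEMeasurable ρ lam → (∀ s, ρ s < ⊤) →
      AEMeasurable ψ (lam.withDensity ρ) →
      ∫ t in A, G t ∂((lam.withDensity ρ).map ψ)
        = ∫ s in ψ ⁻¹' A, (ρ s).toReal • G (ψ s) ∂lam := by
    intro ρ hρ hρt hψρ
    rw [setIntegral_map hA hG.aestronglyMeasurable hψρ]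
    rw [restrict_withDensity' (ψ ⁻¹' A),
      integral_withDensity_eq_integral_toReal_smul₀ hρ.restrict (Eventually.of_forall hρt)]
  rw [e4, hα, hβ, e5 ρ₁ hm1 (fun _ => ENNReal.ofReal_lt_top) hψ1,
    e5 ρ₂ hm2 (fun _ => ENNReal.ofReal_lt_top) hψ2, integral_indicator₀ (hnull A hA)]
  have i1 : Integrable (fun s => (ρ₁ s).toReal • G (ψ s)) lam := by
    refine Integrable.smul_bdd ?_ C hGψ1 (Eventually.of_forall fun s => hC _)
    simpa [hρ₁, ENNReal.toReal_ofReal'] using hk.pos_part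
  have i2 : Integrable (fun s => (ρ₂ s).toReal • G (ψ s)) lam := by
    refine Integrable.smul_bdd ?_ C hGψ1 (Eventually.of_forall fun s => hC _)
    simpa [hρ₂, ENNReal.toReal_ofReal'] using hk.neg_part
  rw [← integral_sub i1.integrableOn i2.integrableOn]
  refine integral_congr_ae (Eventually.of_forall fun s => ?_)
  simp only [hρ₁, hρ₂, ENNReal.toReal_ofReal', ← sub_smul]
  congr 1
  rcases le_total 0 (k s) with h0 | h0
  · rw [max_eq_left h0, max_eq_right (by linarith)]; ring
  · rw [max_eq_right h0, max_eq_left (by linarith)]; ring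

/-! ### Monotone continuous time changes -/

/-- A continuous nondecreasing surjection `[0, S] → [0, h]`. -/
structure IsClock (φ : ℝ → ℝ) (S h : ℝ) : Prop where
  S_pos : 0 < S
  h_pos : 0 < h
  mono : MonotoneOn φ (Icc 0 S)
  cont : ContinuousOn φ (Icc 0 S)
  zero : φ 0 = 0
  last : φ S = h

/-- The first time at which the clock `φ` reaches `r`. -/
def lo (φ : ℝ → ℝ) (S r : ℝ) : ℝ := sInf {s | s ∈ Icc 0 S ∧ r ≤ φ s}

/-- The last time at which the clock `φ` is at most `r`. -/
def hi (φ : ℝ → ℝ) (S r : ℝ) : ℝ := sSup {s | s ∈ Icc 0 S ∧ φ s ≤ r}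

/-- The values at which the clock `φ` stops. -/
def jset (φ : ℝ → ℝ) (S h : ℝ) : Set ℝ := {r | r ∈ Icc 0 h ∧ lo φ S r < hi φ S r}

/-- The times at which the clock `φ` is stopped. -/
def uset (φ : ℝ → ℝ) (S h : ℝ) : Set ℝ := ⋃ r ∈ jset φ S h, Icc (lo φ S r) (hi φ S r)

namespace IsClock

variable {φ : ℝ → ℝ} {S h : ℝ} (hc : IsClock φ S h)
include hc

theorem mem_Icc {s : ℝ} (hs : s ∈ Icc 0 S) : φ s ∈ Icc 0 h := by
  have h0 : (0 : ℝ) ∈ Icc 0 S := ⟨le_rfl, hc.S_pos.le⟩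
  have h1 : S ∈ Icc 0 S := ⟨hc.S_pos.le, le_rfl⟩
  constructor
  · rw [← hc.zero]; exact hc.mono h0 hs hs.1
  · rw [← hc.last]; exact hc.mono hs h1 hs.2

theorem hi_spec {r : ℝ} (hr : r ∈ Icc 0 h) : hi φ S r ∈ Icc 0 S ∧ φ (hi φ S r) = r := by
  set A := {s | s ∈ Icc 0 S ∧ φ s ≤ r}
  have hA : IsCompact A := by
    have : IsClosed (Icc 0 S ∩ φ ⁻¹' Iic r) := hc.cont.preimage_isClosed_of_isClosed isClosed_Icc
      isClosed_Iic
    exact isCompact_Icc.of_isClosed_subset this inter_subset_left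
  have hne : A.Nonempty := ⟨0, ⟨le_rfl, hc.S_pos.le⟩, by rw [hc.zero]; exact hr.1⟩
  have hmem := hA.sSup_mem hne
  refine ⟨hmem.1, le_antisymm hmem.2 ?_⟩
  obtain ⟨s, hs, hsr⟩ := intermediate_value_Icc hc.S_pos.le hc.cont
    (by rw [hc.zero, hc.last]; exact hr)
  have : s ≤ sSup A := le_csSup hA.bddAbove ⟨hs, hsr.le⟩
  exact hsr.ge.trans (hc.mono hs hmem.1 this)

theorem lo_spec {r : ℝ} (hr : r ∈ Icc 0 h) : lo φ S r ∈ Icc 0 S ∧ φ (lo φ S r) = r := by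
  set A := {s | s ∈ Icc 0 S ∧ r ≤ φ s}
  have hA : IsCompact A := by
    have : IsClosed (Icc 0 S ∩ φ ⁻¹' Ici r) := hc.cont.preimage_isClosed_of_isClosed isClosed_Icc
      isClosed_Ici
    exact isCompact_Icc.of_isClosed_subset this inter_subset_left
  have hne : A.Nonempty := ⟨S, ⟨hc.S_pos.le, le_rfl⟩, by rw [hc.last]; exact hr.2⟩
  have hmem := hA.sInf_mem hne
  refine ⟨hmem.1, le_antisymm ?_ hmem.2⟩
  obtain ⟨s, hs, hsr⟩ := intermediate_value_Icc hc.S_pos.le hc.cont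
    (by rw [hc.zero, hc.last]; exact hr)
  have : sInf A ≤ s := csInf_le hA.bddBelow ⟨hs, hsr.ge⟩
  exact (hc.mono hmem.1 hs this).trans hsr.le

/-- This adjunction between `φ` and `hi`, and the dual one for `lo`, are the form in which
monotonicity and continuity of the clock are used below. -/
theorem le_hi_iff {r s : ℝ} (hr : r ∈ Icc 0 h) (hs : s ∈ Icc 0 S) : s ≤ hi φ S r ↔ φ s ≤ r := by
  obtain ⟨h1, h2⟩ := hc.hi_spec hr
  refine ⟨fun h' => by rw [← h2]; exact hc.mono hs h1 h', fun h' => ?_⟩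
  exact le_csSup ⟨S, fun x hx => hx.1.2⟩ ⟨hs, h'⟩

theorem lo_le_iff {r s : ℝ} (hr : r ∈ Icc 0 h) (hs : s ∈ Icc 0 S) : lo φ S r ≤ s ↔ r ≤ φ s := by
  obtain ⟨h1, h2⟩ := hc.lo_spec hr
  refine ⟨fun h' => by rw [← h2]; exact hc.mono h1 hs h', fun h' => ?_⟩
  exact csInf_le ⟨0, fun x hx => hx.1.1⟩ ⟨hs, h'⟩

theorem lo_le_hi {r : ℝ} (hr : r ∈ Icc 0 h) : lo φ S r ≤ hi φ S r :=
  (hc.lo_le_iff hr (hc.hi_spec hr).1).2 (hc.hi_spec hr).2.ge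

theorem Icc_subset {r : ℝ} (hr : r ∈ Icc 0 h) : Icc (lo φ S r) (hi φ S r) ⊆ Icc 0 S :=
  Icc_subset_Icc (hc.lo_spec hr).1.1 (hc.hi_spec hr).1.2

theorem mem_Icc_iff {r s : ℝ} (hr : r ∈ Icc 0 h) (hs : s ∈ Icc 0 S) :
    s ∈ Icc (lo φ S r) (hi φ S r) ↔ φ s = r := by
  rw [Set.mem_Icc, hc.lo_le_iff hr hs, hc.le_hi_iff hr hs]
  exact ⟨fun h => le_antisymm h.2 h.1, fun h => ⟨h.ge, h.le⟩⟩

theorem apply_eq {r s : ℝ} (hr : r ∈ Icc 0 h) (hs : s ∈ Icc (lo φ S r) (hi φ S r)) : φ s = r :=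
  (hc.mem_Icc_iff hr (hc.Icc_subset hr hs)).1 hs

theorem hi_lt_lo {r r' : ℝ} (hr : r ∈ Icc 0 h) (hr' : r' ∈ Icc 0 h) (hlt : r < r') :
    hi φ S r < lo φ S r' := by
  by_contra hcon
  rw [not_lt, hc.lo_le_iff hr' (hc.hi_spec hr).1, (hc.hi_spec hr).2] at hcon
  linarith

theorem lo_zero : lo φ S 0 = 0 := by
  have h0 : (0 : ℝ) ∈ Icc 0 h := ⟨le_rfl, hc.h_pos.le⟩
  refine le_antisymm ((hc.lo_le_iff h0 ⟨le_rfl, hc.S_pos.le⟩).2 hc.zero.ge) (hc.lo_spec h0).1.1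

theorem hi_last : hi φ S h = S := by
  have h0 : h ∈ Icc 0 h := ⟨hc.h_pos.le, le_rfl⟩
  refine le_antisymm (hc.hi_spec h0).1.2 ((hc.le_hi_iff h0 ⟨hc.S_pos.le, le_rfl⟩).2 hc.last.le)

theorem hi_lt {r : ℝ} (hr : r ∈ Ico 0 h) : hi φ S r < S := by
  have h1 := hc.hi_spec ⟨hr.1, hr.2.le⟩
  refine lt_of_le_of_ne h1.1.2 fun h' => ?_
  have := h1.2
  rw [h', hc.last] at this
  linarith [hr.2]

theorem lo_pos {r : ℝ} (hr : r ∈ Ioc 0 h) : 0 < lo φ S r :=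
  lt_of_le_of_lt (hc.hi_spec ⟨le_rfl, hc.h_pos.le⟩).1.1
    (hc.hi_lt_lo ⟨le_rfl, hc.h_pos.le⟩ ⟨hr.1.le, hr.2⟩ hr.1)

omit hc in
theorem hi_nonneg (φ : ℝ → ℝ) (S r : ℝ) : 0 ≤ hi φ S r := Real.sSup_nonneg fun _ hs => hs.1.1

omit hc in
-- Monotone on the whole line and for any function, because the supremum of the empty set is `0`.
-- Hence `hi` is Borel, and so is every measurable velocity composed with it.
theorem monotone_hi (φ : ℝ → ℝ) (S : ℝ) : Monotone (hi φ S) := by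
  intro r r' hrr
  rcases Set.eq_empty_or_nonempty {s | s ∈ Icc 0 S ∧ φ s ≤ r} with he | hne
  · rw [hi, he, Real.sSup_empty]; exact hi_nonneg φ S r'
  · exact csSup_le_csSup ⟨S, fun x hx => hx.1.2⟩ hne fun s hs => ⟨hs.1, hs.2.trans hrr⟩

omit hc in
theorem measurable_hi (φ : ℝ → ℝ) (S : ℝ) : Measurable (hi φ S) := (monotone_hi φ S).measurable

theorem tendsto_hi_right {r : ℝ} (hr : r ∈ Ico 0 h) :
    Tendsto (hi φ S) (𝓝[>] r) (𝓝 (hi φ S r)) := by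
  have hr' : r ∈ Icc 0 h := ⟨hr.1, hr.2.le⟩
  rw [tendsto_order]
  refine ⟨fun a ha => ?_, fun a ha => ?_⟩
  · filter_upwards [self_mem_nhdsWithin] with t ht
    exact ha.trans_le (monotone_hi φ S (le_of_lt ht))
  · set b := min a S
    have hbr : hi φ S r < b := lt_min ha (hc.hi_lt hr)
    have hb : b ∈ Icc 0 S := ⟨(hi_nonneg φ S r).trans hbr.le, min_le_right _ _⟩
    have hφ : r < φ b := by
      by_contra hcon
      exact absurd ((hc.le_hi_iff hr' hb).2 (not_lt.1 hcon)) (not_le.2 hbr)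
    filter_upwards [Ioo_mem_nhdsGT hφ] with t ht
    have ht' : t ∈ Icc 0 h := ⟨hr.1.trans ht.1.le, ht.2.le.trans (hc.mem_Icc hb).2⟩
    by_contra hcon
    have h1 : b ≤ hi φ S t := (min_le_left _ _).trans (not_lt.1 hcon)
    rw [hc.le_hi_iff ht' hb] at h1
    linarith [ht.2]

theorem tendsto_hi_left {r : ℝ} (hr : r ∈ Ioc 0 h) :
    Tendsto (hi φ S) (𝓝[<] r) (𝓝 (lo φ S r)) := by
  have hr' : r ∈ Icc 0 h := ⟨hr.1.le, hr.2⟩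
  rw [tendsto_order]
  refine ⟨fun a ha => ?_, fun a ha => ?_⟩
  · set b := max a 0
    have hbr : b < lo φ S r := max_lt ha (hc.lo_pos hr)
    have hb : b ∈ Icc 0 S := ⟨le_max_right _ _, hbr.le.trans (hc.lo_spec hr').1.2⟩
    have hφ : φ b < r := by
      by_contra hcon
      exact absurd ((hc.lo_le_iff hr' hb).2 (not_lt.1 hcon)) (not_le.2 hbr)
    have hφ' := hc.mem_Icc hb
    filter_upwards [Ioo_mem_nhdsLT hφ] with t ht
    have ht' : t ∈ Icc 0 h := ⟨hφ'.1.trans ht.1.le, ht.2.le.trans hr.2⟩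
    have h1 : hi φ S (φ b) < lo φ S t := hc.hi_lt_lo hφ' ht' ht.1
    have h2 : b ≤ hi φ S (φ b) := (hc.le_hi_iff hφ' hb).2 le_rfl
    exact (le_max_left a 0).trans_lt (h2.trans_lt (h1.trans_le (hc.lo_le_hi ht')))
  · filter_upwards [Ioo_mem_nhdsLT hr.1] with t ht
    exact (hc.hi_lt_lo ⟨ht.1.le, ht.2.le.trans hr.2⟩ hr' ht.2).trans ha

/-- The value `r = 0` is excluded: there the right inverse is `0` by convention, whereas `hi φ S 0`
is positive when the clock stops at the start. -/
theorem rightInv_eq {r : ℝ} (hr : r ∈ Ioc 0 h) : rightInv φ 0 S 0 h r = hi φ S r := by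
  have hr' : r ∈ Icc 0 h := ⟨hr.1.le, hr.2⟩
  unfold rightInv
  rw [if_neg hr.1.ne']
  split_ifs with h1
  · rw [h1, hc.hi_last]
  · have hlt : r < h := lt_of_le_of_ne hr.2 h1
    apply le_antisymm
    · refine le_of_forall_gt_imp_ge_of_dense fun b hb => ?_
      rcases le_total S b with hSb | hSb
      · have hmS : S ∈ {t | t ∈ Icc 0 S ∧ r < φ t} :=
          ⟨⟨hc.S_pos.le, le_rfl⟩, by rwa [hc.last]⟩
        exact (csInf_le ⟨0, fun x hx => hx.1.1⟩ hmS).trans hSb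
      · have hb' : b ∈ Icc 0 S := ⟨(hi_nonneg φ S r).trans hb.le, hSb⟩
        refine csInf_le ⟨0, fun x hx => hx.1.1⟩ ⟨hb', ?_⟩
        by_contra hcon
        exact absurd ((hc.le_hi_iff hr' hb').2 (not_lt.1 hcon)) (not_le.2 hb)
    · refine le_csInf ⟨S, ⟨hc.S_pos.le, le_rfl⟩, by rwa [hc.last]⟩ fun b hb => ?_
      by_contra hcon
      have := (hc.le_hi_iff hr' hb.1).1 (not_le.1 hcon).le
      linarith [hb.2]

/-- A function which coincides with the last-time function of a clock inside the interval has the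
same one-sided limits. -/
theorem limR_eq {A : ℝ → ℝ} (hA : ∀ r ∈ Ioc 0 h, A r = hi φ S r) {r : ℝ} (hr : r ∈ Icc 0 h) :
    limR h A r = hi φ S r := by
  unfold limR
  split_ifs with h1
  · have : r = h := le_antisymm hr.2 h1
    rw [hA h ⟨hc.h_pos, le_rfl⟩, this]
  · have hlt := not_le.1 h1
    refine rightLim_eq_of_tendsto ?_
    refine (hc.tendsto_hi_right ⟨hr.1, hlt⟩).congr' ?_
    filter_upwards [Ioo_mem_nhdsGT hlt] with t ht
    exact (hA t ⟨hr.1.trans_lt ht.1, ht.2.le⟩).symm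

/-- Approaching `r` from the left, the last times at level `t < r` are squeezed under the first time
at level `r`. At `r = 0` the convention for `limL` requires the value `A 0 = 0`, which is `lo φ S
0`. -/
theorem limL_eq {A : ℝ → ℝ} (hA0 : A 0 = 0) (hA : ∀ r ∈ Ioo 0 h, A r = hi φ S r) {r : ℝ}
    (hr : r ∈ Icc 0 h) : limL 0 A r = lo φ S r := by
  unfold limL
  split_ifs with h1
  · have : r = 0 := le_antisymm h1 hr.1
    rw [hA0, this, hc.lo_zero]
  · have hlt := not_le.1 h1
    refine leftLim_eq_of_tendsto ?_
    refine (hc.tendsto_hi_left ⟨hlt, hr.2⟩).congr' ?_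
    filter_upwards [Ioo_mem_nhdsLT hlt] with t ht
    exact (hA t ⟨ht.1, ht.2.trans_le hr.2⟩).symm

theorem countable_jset : (jset φ S h).Countable := by
  have : (jset φ S h).PairwiseDisjoint fun r => Ioo (lo φ S r) (hi φ S r) := by
    intro r hr r' hr' hne
    refine Set.disjoint_left.2 fun s hs hs' => hne ?_
    rw [← hc.apply_eq hr.1 (Ioo_subset_Icc_self hs), hc.apply_eq hr'.1 (Ioo_subset_Icc_self hs')]
  exact this.countable_of_isOpen (fun _ _ => isOpen_Ioo) fun r hr => nonempty_Ioo.2 hr.2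

theorem measurableSet_jset : MeasurableSet (jset φ S h) := hc.countable_jset.measurableSet

theorem measurableSet_uset : MeasurableSet (uset φ S h) :=
  MeasurableSet.biUnion hc.countable_jset fun _ _ => measurableSet_Icc

theorem mem_uset_iff {s : ℝ} (hs : s ∈ Icc 0 S) : s ∈ uset φ S h ↔ φ s ∈ jset φ S h := by
  simp only [uset, mem_iUnion, exists_prop]
  constructor
  · rintro ⟨r, hr, hsr⟩
    rwa [hc.apply_eq hr.1 hsr]
  · intro h'
    exact ⟨φ s, h', (hc.mem_Icc_iff h'.1 hs).2 rfl⟩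

theorem uset_subset : uset φ S h ⊆ Icc 0 S := iUnion₂_subset fun _ hr => hc.Icc_subset hr.1

theorem lo_hi_of_notMem {s : ℝ} (hs : s ∈ Icc 0 S) (hU : s ∉ uset φ S h) :
    lo φ S (φ s) = s ∧ hi φ S (φ s) = s := by
  have hφ := hc.mem_Icc hs
  rw [hc.mem_uset_iff hs] at hU
  have h1 : hi φ S (φ s) ≤ lo φ S (φ s) := not_lt.1 fun h' => hU ⟨hφ, h'⟩
  have h2 := (hc.mem_Icc_iff hφ hs).2 rfl
  exact ⟨le_antisymm h2.1 (h2.2.trans h1), le_antisymm (h1.trans h2.1) h2.2⟩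

/-- Off the stops a time is recovered from the clock value through `hi`. This makes functions of `s`
into functions of `φ s` there. -/
theorem injOn : InjOn φ (Icc 0 S \ uset φ S h) := by
  intro s hs s' hs' he
  rw [← (hc.lo_hi_of_notMem hs.1 hs.2).2, ← (hc.lo_hi_of_notMem hs'.1 hs'.2).2, he]

theorem notMem_uset_apply {s : ℝ} (hs : s ∈ Ioo 0 S) (hU : s ∉ uset φ S h) : φ s ∈ Ioo 0 h := by
  have hs' := Ioo_subset_Icc_self hs
  obtain ⟨h1, h2⟩ := hc.lo_hi_of_notMem hs' hU
  have hφ := hc.mem_Icc hs'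
  refine ⟨lt_of_le_of_ne hφ.1 fun h' => ?_, lt_of_le_of_ne hφ.2 fun h' => ?_⟩
  · rw [← h', hc.lo_zero] at h1; linarith [hs.1]
  · rw [h', hc.hi_last] at h2; linarith [hs.2]

theorem aemeasurable : AEMeasurable φ (volume.restrict (Icc 0 S)) :=
  hc.cont.aemeasurable measurableSet_Icc

theorem measurableSet_preimage {A : Set ℝ} (hA : MeasurableSet A) :
    MeasurableSet (Icc 0 S ∩ φ ⁻¹' A) := by
  have h1 : Measurable ((Icc 0 S).domRestrict φ) :=
    (continuousOn_iff_continuous_domRestrict.1 hc.cont).measurable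
  have h2 := (MeasurableEmbedding.subtype_coe (measurableSet_Icc (a := (0 : ℝ)) (b := S))).measurableSet_image.2
    (h1 hA)
  convert h2 using 1
  ext s
  simp only [mem_inter_iff, mem_preimage, mem_image, Subtype.exists, exists_and_right,
    exists_eq_right, domRestrict_apply]
  exact ⟨fun h => ⟨h.1, h.2⟩, fun ⟨h1, h2⟩ => ⟨h1, h2⟩⟩

theorem measurableSet_off {A : Set ℝ} (hA : MeasurableSet A) :
    MeasurableSet ((Icc 0 S \ uset φ S h) ∩ φ ⁻¹' A) := by
  have : (Icc 0 S \ uset φ S h) ∩ φ ⁻¹' A = (Icc 0 S ∩ φ ⁻¹' A) \ uset φ S h := by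
    ext s; simp only [mem_inter_iff, Set.mem_sdiff]; tauto
  rw [this]
  exact (hc.measurableSet_preimage hA).diff hc.measurableSet_uset

theorem preimage_singleton {r : ℝ} (hr : r ∈ Icc 0 h) :
    Icc 0 S ∩ φ ⁻¹' {r} = Icc (lo φ S r) (hi φ S r) := by
  ext s
  constructor
  · rintro ⟨h1, h2⟩; exact (hc.mem_Icc_iff hr h1).2 h2
  · intro h'; exact ⟨hc.Icc_subset hr h', hc.apply_eq hr h'⟩

theorem preimage_Ioc {r : ℝ} (hr : r ∈ Icc 0 h) :
    Icc 0 S ∩ φ ⁻¹' (Ioc 0 r) = Ioc (hi φ S 0) (hi φ S r) := by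
  have h0 : (0 : ℝ) ∈ Icc 0 h := ⟨le_rfl, hc.h_pos.le⟩
  ext s
  constructor
  · rintro ⟨h1, h2⟩
    refine ⟨?_, (hc.le_hi_iff hr h1).2 h2.2⟩
    by_contra hcon
    have := (hc.le_hi_iff h0 h1).1 (not_lt.1 hcon)
    linarith [h2.1]
  · rintro ⟨h1, h2⟩
    have hs : s ∈ Icc 0 S := ⟨(hi_nonneg _ _ _).trans h1.le, h2.trans (hc.hi_spec hr).1.2⟩
    refine ⟨hs, ?_, (hc.le_hi_iff hr hs).1 h2⟩
    by_contra hcon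
    have := (hc.le_hi_iff h0 hs).2 (not_lt.1 hcon)
    linarith

theorem preimage_Icc {r : ℝ} (hr : r ∈ Icc 0 h) :
    Icc 0 S ∩ φ ⁻¹' (Icc 0 r) = Icc 0 (hi φ S r) := by
  ext s
  constructor
  · rintro ⟨h1, h2⟩
    exact ⟨h1.1, (hc.le_hi_iff hr h1).2 h2.2⟩
  · rintro ⟨h1, h2⟩
    have hs : s ∈ Icc 0 S := ⟨h1, h2.trans (hc.hi_spec hr).1.2⟩
    exact ⟨hs, (hc.mem_Icc hs).1, (hc.le_hi_iff hr hs).1 h2⟩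

/-- By injectivity off the stops, the values in a countable set `D` are taken there at only
countably many times. Removing `D` from the values therefore amounts, up to a null set, to removing
the stopping times. -/
theorem preimage_diff_ae {A D : Set ℝ} (hD : D.Countable) (hJ : jset φ S h ⊆ D) :
    (Icc 0 S ∩ φ ⁻¹' (A \ D) : Set ℝ) =ᵐ[volume] ((Icc 0 S \ uset φ S h) ∩ φ ⁻¹' A : Set ℝ) := by
  have hcount : ((Icc 0 S \ uset φ S h) ∩ φ ⁻¹' D).Countable := by
    refine countable_of_injective_of_countable_image (hc.injOn.mono inter_subset_left)
      (hD.mono ?_)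
    rintro _ ⟨s, hs, rfl⟩; exact hs.2
  filter_upwards [hcount.ae_notMem volume] with s hs
  refine propext ⟨fun h' => ⟨⟨h'.1, fun hU => h'.2.2 (hJ ((hc.mem_uset_iff h'.1).1 hU))⟩, h'.2.1⟩,
    fun h' => ⟨h'.1.1, h'.2, fun hs' => hs ⟨h'.1, hs'⟩⟩⟩

/-- The sum over the stopping values of the clock of the increments of a primitive. -/
theorem hasSum_jumps {E : Type*} [NormedAddCommGroup E] [NormedSpace ℝ E]
    {F : ℝ → E} (hF : IntegrableOn F (Icc 0 S)) {A : Set ℝ} (hA : MeasurableSet A)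
    (hAh : A ⊆ Icc 0 h) :
    HasSum (fun r : A => ∫ s in (lo φ S r)..(hi φ S r), F s)
      ((∫ s in Icc 0 S ∩ φ ⁻¹' A, F s) - ∫ s in (Icc 0 S \ uset φ S h) ∩ φ ⁻¹' A, F s) := by
  set f : ℝ → E := fun r => ∫ s in (lo φ S r)..(hi φ S r), F s with hf
  set B : Set ℝ := A ∩ jset φ S h with hB
  have hBc : B.Countable := hc.countable_jset.mono inter_subset_right
  -- Values at which the clock does not stop contribute zero terms, so the sum over the uncountable
  -- `A` reduces to one over the countable set of stopping values.
  have hfz : ∀ r ∈ A, r ∉ jset φ S h → f r = 0 := by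
    intro r hr hrj
    have : lo φ S r = hi φ S r :=
      le_antisymm (hc.lo_le_hi (hAh hr)) (not_lt.1 fun h' => hrj ⟨hAh hr, h'⟩)
    simp [hf, this]
  have hset : (Icc 0 S ∩ φ ⁻¹' A) \ ((Icc 0 S \ uset φ S h) ∩ φ ⁻¹' A)
      = ⋃ r : B, Icc (lo φ S r) (hi φ S r) := by
    ext s
    simp only [Set.mem_sdiff, mem_inter_iff, mem_iUnion]
    constructor
    · rintro ⟨⟨h1, h2⟩, h3⟩
      have hU : s ∈ uset φ S h := by tauto
      have hj := (hc.mem_uset_iff h1).1 hU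
      exact ⟨⟨φ s, h2, hj⟩, (hc.mem_Icc_iff hj.1 h1).2 rfl⟩
    · rintro ⟨⟨r, hrA, hrj⟩, hs⟩
      have h1 := hc.Icc_subset hrj.1 hs
      have h2 : φ s = r := hc.apply_eq hrj.1 hs
      have hU : s ∈ uset φ S h := (hc.mem_uset_iff h1).2 (by rwa [h2])
      exact ⟨⟨h1, by rw [mem_preimage, h2]; exact hrA⟩, fun h' => h'.1.2 hU⟩
  have hsub : ((Icc 0 S \ uset φ S h) ∩ φ ⁻¹' A) ⊆ (Icc 0 S ∩ φ ⁻¹' A) :=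
    fun s hs => ⟨hs.1.1, hs.2⟩
  have hFA : IntegrableOn F (Icc 0 S ∩ φ ⁻¹' A) := hF.mono_set inter_subset_left
  rw [← setIntegral_sdiff (hc.measurableSet_off hA) hFA hsub, hset]
  have : Countable B := hBc.to_subtype
  have hs := hasSum_integral_iUnion (f := F) (μ := volume)
    (s := fun r : B => Icc (lo φ S r) (hi φ S r)) (fun _ => measurableSet_Icc)
    (fun r r' hne => Set.disjoint_left.2 fun s hs hs' => hne (Subtype.ext (by
      rw [← hc.apply_eq r.2.2.1 hs, hc.apply_eq r'.2.2.1 hs'])))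
    (hF.mono_set (iUnion_subset fun r => hc.Icc_subset r.2.2.1))
  have hs' : HasSum (fun r : B => f r) (∫ s in ⋃ r : B, Icc (lo φ S r) (hi φ S r), F s) := by
    convert hs using 2 with r
    simp only [hf]
    rw [intervalIntegral.integral_of_le r.2.2.2.le, integral_Icc_eq_integral_Ioc]
  change HasSum (f ∘ ((↑) : A → ℝ)) _
  rw [hasSum_subtype_iff_indicator]
  have hs'' : HasSum (f ∘ ((↑) : B → ℝ)) (∫ s in ⋃ r : B, Icc (lo φ S r) (hi φ S r), F s) := hs'
  rw [hasSum_subtype_iff_indicator] at hs''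
  convert hs'' using 1
  funext r
  by_cases hrA : r ∈ A
  · by_cases hrj : r ∈ jset φ S h
    · rw [indicator_of_mem hrA, indicator_of_mem (show r ∈ B from ⟨hrA, hrj⟩)]
    · rw [indicator_of_mem hrA, indicator_of_notMem (fun h' : r ∈ B => hrj h'.2), hfz r hrA hrj]
  · rw [indicator_of_notMem hrA, indicator_of_notMem (fun h' : r ∈ B => hrA h'.1)]

theorem integral_eq_add_preimage_Ioc {E : Type*} [NormedAddCommGroup E] [NormedSpace ℝ E]
    {F : ℝ → E} {r : ℝ} (hr : r ∈ Icc 0 h) :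
    (∫ s in (hi φ S 0)..(hi φ S r), F s) = ∫ s in Icc 0 S ∩ φ ⁻¹' (Ioc 0 r), F s := by
  rw [hc.preimage_Ioc hr, intervalIntegral.integral_of_le (monotone_hi φ S hr.1)]

end IsClock

/-! ### Images of vector densities under a time change -/

theorem signedMeasure_countable_eq_zero {μ : SignedMeasure ℝ} {B : Set ℝ} (hB : B.Countable)
    (h : ∀ t ∈ B, μ {t} = 0) : μ B = 0 := by
  have : Countable B := hB.to_subtype
  have hU : B = ⋃ t : B, {(t : ℝ)} := by
    ext s; simp
  rw [hU, VectorMeasure.of_disjoint_iUnion (fun t : B => measurableSet_singleton (t : ℝ))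
    (fun a b hab => Set.disjoint_singleton.2 fun h' => hab (Subtype.ext h'))]
  simp [h]

theorem countable_atoms_compl {m : ℕ} (μ : Fin m → SignedMeasure ℝ) :
    {t : ℝ | ∀ i, μ i {t} = 0}ᶜ.Countable := by
  have hsub : {t : ℝ | ∀ i, μ i {t} = 0}ᶜ ⊆ ⋃ i, {t : ℝ | 0 < (μ i).totalVariation {t}} := by
    intro t ht
    simp only [mem_compl_iff, mem_ofPred_eq, not_forall] at ht
    obtain ⟨i, hi⟩ := ht
    refine mem_iUnion.2 ⟨i, ?_⟩
    rw [mem_ofPred_eq, pos_iff_ne_zero]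
    exact fun h' => hi (SignedMeasure.null_of_totalVariation_zero _ h')
  refine Set.Countable.mono hsub (countable_iUnion fun i => ?_)
  exact Measure.countable_meas_pos_of_disjoint_iUnion (fun t => measurableSet_singleton t)
    fun a b hab => disjoint_singleton.2 hab

theorem measurableSet_atoms {m : ℕ} (μ : Fin m → SignedMeasure ℝ) :
    MeasurableSet {t : ℝ | ∀ i, μ i {t} = 0} := by
  simpa using (countable_atoms_compl μ).measurableSet.compl

theorem contVec_apply {m : ℕ} (μ : Fin m → SignedMeasure ℝ) (j : Fin m) {A : Set ℝ}
    (hA : MeasurableSet A) : contVec μ j A = μ j (A ∩ {t | ∀ i, μ i {t} = 0}) :=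
  VectorMeasure.restrict_apply _ (measurableSet_atoms μ) hA

theorem signedMeasure_apply_sub_countable {μ : SignedMeasure ℝ} {A D : Set ℝ}
    (hA : MeasurableSet A) (hD : D.Countable) (h : ∀ t ∈ A, t ∈ D → μ {t} = 0) :
    μ A = μ (A \ D) := by
  have hAD : (A ∩ D).Countable := hD.mono inter_subset_right
  have := VectorMeasure.of_add_of_sdiff (v := μ) hAD.measurableSet hA inter_subset_left
  rw [← this, signedMeasure_countable_eq_zero hAD fun t ht => h t ht.1 ht.2, zero_add,
    Set.sdiff_self_inter]

/-- The continuous component can be computed by removing any countable set containing the atoms. -/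
theorem contVec_apply_eq_diff {m : ℕ} {μ : Fin m → SignedMeasure ℝ} {D : Set ℝ} (hD : D.Countable)
    (h : ∀ t, t ∉ D → ∀ i, μ i {t} = 0) (j : Fin m) {A : Set ℝ} (hA : MeasurableSet A) :
    contVec μ j A = μ j (A \ D) := by
  rw [contVec_apply μ j hA,
    signedMeasure_apply_sub_countable (hA.inter (measurableSet_atoms μ)) hD
      fun t ht _ => ht.2 j]
  congr 1
  ext t
  simp only [Set.mem_sdiff, mem_inter_iff, mem_ofPred_eq]
  exact ⟨fun h' => ⟨h'.1.1, h'.2⟩, fun h' => ⟨⟨h'.1, h t h'.2⟩, h'.2⟩⟩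

theorem contMeas_apply (ν : Measure ℝ) {A : Set ℝ} (hA : MeasurableSet A) :
    contMeas ν A = ν (A ∩ {t | ν {t} = 0}) := Measure.restrict_apply hA

theorem measure_apply_sub_countable {ν : Measure ℝ} {A D : Set ℝ} (hD : D.Countable)
    (h : ∀ t ∈ A, t ∈ D → ν {t} = 0) : ν A = ν (A \ D) := by
  have hAD : (A ∩ D).Countable := hD.mono inter_subset_right
  have h0 : ν (A ∩ D) = 0 := by
    rw [← biUnion_of_singleton (A ∩ D)]
    exact (measure_biUnion_null_iff hAD).2 fun t ht => h t ht.1 ht.2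
  have := measure_inter_add_sdiff A hD.measurableSet (μ := ν)
  rw [h0, zero_add] at this
  exact this.symm

theorem contMeas_apply_eq_diff {ν : Measure ℝ} {D : Set ℝ} (hD : D.Countable)
    (h : ∀ t, t ∉ D → ν {t} = 0) {A : Set ℝ} (hA : MeasurableSet A) :
    contMeas ν A = ν (A \ D) := by
  rw [contMeas_apply ν hA, measure_apply_sub_countable hD fun t ht _ => ht.2]
  congr 1
  ext t
  simp only [Set.mem_sdiff, mem_inter_iff, mem_ofPred_eq]
  exact ⟨fun h' => ⟨h'.1.1, h'.2⟩, fun h' => ⟨⟨h'.1, h t h'.2⟩, h'.2⟩⟩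

/-- The image of a density under an almost everywhere measurable map. -/
theorem exists_signedMeasure_map {lam : Measure ℝ} {φ k : ℝ → ℝ} (hφ : AEMeasurable φ lam)
    (hk : Integrable k lam) : ∃ μ : SignedMeasure ℝ, ∀ A, MeasurableSet A →
      μ A = ∫ s in φ ⁻¹' A, k s ∂lam := by
  refine ⟨(lam.withDensityᵥ k).map (hφ.mk φ), fun A hA => ?_⟩
  rw [VectorMeasure.map_apply _ hφ.measurable_mk hA,
    withDensityᵥ_apply hk (hφ.measurable_mk hA)]
  refine setIntegral_congr_set ?_
  filter_upwards [hφ.ae_eq_mk] with s hs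
  exact propext (by rw [mem_preimage_iff_of_eq hs])
where
  mem_preimage_iff_of_eq {φ ψ : ℝ → ℝ} {A : Set ℝ} {s : ℝ} (h : φ s = ψ s) :
      (ψ ⁻¹' A) s = (φ ⁻¹' A) s := by
    change (ψ s ∈ A) = (φ s ∈ A)
    rw [h]

namespace IsClock

variable {φ : ℝ → ℝ} {S h : ℝ} (hc : IsClock φ S h)
include hc

variable {m : ℕ} {V : ℝ → Fin m → ℝ} {μ : Fin m → SignedMeasure ℝ} {ν : Measure ℝ}

/-- An image measure can charge `{t}` only if the fibre over `t` has positive length, so the atoms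
lie in `jset` and removing them restricts the integral to the times off the stops. -/
theorem contVec_apply_eq
    (hμ : ∀ j A, MeasurableSet A → μ j A = ∫ s in Icc 0 S ∩ φ ⁻¹' A, V s j) (j : Fin m)
    {A : Set ℝ} (hA : MeasurableSet A) :
    contVec μ j A = ∫ s in (Icc 0 S \ uset φ S h) ∩ φ ⁻¹' A, V s j := by
  rw [contVec_apply_eq_diff hc.countable_jset ?_ j hA, hμ j _ (hA.diff hc.measurableSet_jset)]
  · exact setIntegral_congr_set (hc.preimage_diff_ae hc.countable_jset subset_rfl)
  · intro t ht i
    rw [hμ i _ (measurableSet_singleton t)]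
    refine setIntegral_measure_zero _ ?_
    refine (Set.Subsingleton.measure_zero ?_ _)
    intro s hs s' hs'
    have hU : ∀ s ∈ Icc 0 S ∩ φ ⁻¹' {t}, s ∈ Icc 0 S \ uset φ S h := fun s hs =>
      ⟨hs.1, fun h' => ht (by rw [← show φ s = t from hs.2]; exact (hc.mem_uset_iff hs.1).1 h')⟩
    exact hc.injOn (hU s hs) (hU s' hs') ((show φ s = t from hs.2).trans hs'.2.symm)

theorem contMeas_apply_eq {w : ℝ → ENNReal}
    (hν : ∀ A, MeasurableSet A → ν A = ∫⁻ s in Icc 0 S ∩ φ ⁻¹' A, w s)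
    {A : Set ℝ} (hA : MeasurableSet A) :
    contMeas ν A = ∫⁻ s in (Icc 0 S \ uset φ S h) ∩ φ ⁻¹' A, w s := by
  rw [contMeas_apply_eq_diff hc.countable_jset ?_ hA, hν _ (hA.diff hc.measurableSet_jset)]
  · exact setLIntegral_congr (hc.preimage_diff_ae hc.countable_jset subset_rfl)
  · intro t ht
    rw [hν _ (measurableSet_singleton t)]
    refine setLIntegral_measure_zero _ _ ?_
    refine (Set.Subsingleton.measure_zero ?_ _)
    intro s hs s' hs'
    have hU : ∀ s ∈ Icc 0 S ∩ φ ⁻¹' {t}, s ∈ Icc 0 S \ uset φ S h := fun s hs =>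
      ⟨hs.1, fun h' => ht (by rw [← show φ s = t from hs.2]; exact (hc.mem_uset_iff hs.1).1 h')⟩
    exact hc.injOn (hU s hs) (hU s' hs') ((show φ s = t from hs.2).trans hs'.2.symm)

theorem measurableSet_compl_uset : MeasurableSet (Icc 0 S \ uset φ S h) :=
  measurableSet_Icc.diff hc.measurableSet_uset

theorem aemeasurable_off : AEMeasurable φ (volume.restrict (Icc 0 S \ uset φ S h)) :=
  hc.aemeasurable.mono_measure (Measure.restrict_mono Set.sdiff_subset le_rfl)

theorem ae_hi_apply : ∀ᵐ s ∂(volume.restrict (Icc 0 S \ uset φ S h)), hi φ S (φ s) = s := by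
  filter_upwards [ae_restrict_mem hc.measurableSet_compl_uset] with s hs
  exact (hc.lo_hi_of_notMem hs.1 hs.2).2

/-- Change of variables off the stopping times. -/
theorem integrable_comp_hi {E : Type*} [NormedAddCommGroup E] {V : ℝ → E}
    (hV : StronglyMeasurable V) (hVi : IntegrableOn V (Icc 0 S)) :
    Integrable (fun t => V (hi φ S t)) ((volume.restrict (Icc 0 S \ uset φ S h)).map φ) := by
  have hm : StronglyMeasurable fun t => V (hi φ S t) := hV.comp_measurable (measurable_hi φ S)
  rw [integrable_map_measure hm.aestronglyMeasurable hc.aemeasurable_off]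
  refine (hVi.mono_set Set.sdiff_subset).congr ?_
  filter_upwards [hc.ae_hi_apply] with s hs
  simp [hs]

theorem setIntegral_comp_hi {E : Type*} [NormedAddCommGroup E] [NormedSpace ℝ E] {V : ℝ → E}
    (hV : StronglyMeasurable V) {A : Set ℝ} (hA : MeasurableSet A) :
    ∫ t in A, V (hi φ S t) ∂((volume.restrict (Icc 0 S \ uset φ S h)).map φ)
      = ∫ s in (Icc 0 S \ uset φ S h) ∩ φ ⁻¹' A, V s := by
  have hm : StronglyMeasurable fun t => V (hi φ S t) := hV.comp_measurable (measurable_hi φ S)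
  rw [setIntegral_map hA hm.aestronglyMeasurable hc.aemeasurable_off,
    Measure.restrict_restrict' hc.measurableSet_compl_uset, inter_comm]
  refine integral_congr_ae ?_
  refine ae_mono (Measure.restrict_mono inter_subset_left le_rfl) ?_
  filter_upwards [hc.ae_hi_apply] with s hs
  simp [hs]

theorem setLIntegral_comp_hi {w : ℝ → ENNReal} (hw : Measurable w) {A : Set ℝ}
    (hA : MeasurableSet A) :
    ∫⁻ t in A, w (hi φ S t) ∂((volume.restrict (Icc 0 S \ uset φ S h)).map φ)
      = ∫⁻ s in (Icc 0 S \ uset φ S h) ∩ φ ⁻¹' A, w s := by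
  have hm : Measurable fun t => w (hi φ S t) := hw.comp (measurable_hi φ S)
  rw [Measure.restrict_map_of_aemeasurable hc.aemeasurable_off hA,
    lintegral_map' hm.aemeasurable
      (hc.aemeasurable_off.mono_measure Measure.restrict_le_self),
    Measure.restrict_restrict' hc.measurableSet_compl_uset, inter_comm]
  refine lintegral_congr_ae ?_
  refine ae_mono (Measure.restrict_mono inter_subset_left le_rfl) ?_
  filter_upwards [hc.ae_hi_apply] with s hs
  simp [hs]

/-- The property `p` is not assumed measurable, so its exceptional set is first enlarged to a
measurable null set. -/
theorem ae_map_comp_hi {p : ℝ → Prop} (hp : ∀ᵐ s ∂(volume.restrict (Icc 0 S)), p s) :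
    ∀ᵐ t ∂((volume.restrict (Icc 0 S \ uset φ S h)).map φ), p (hi φ S t) := by
  obtain ⟨N, hN, hNm, hN0⟩ := exists_measurable_superset_of_null (ae_iff.1 hp)
  have h2 : ∀ᵐ t ∂((volume.restrict (Icc 0 S \ uset φ S h)).map φ), hi φ S t ∉ N := by
    have hm : MeasurableSet {t | hi φ S t ∉ N} := (measurable_hi φ S) hNm.compl
    rw [ae_map_iff hc.aemeasurable_off hm]
    have h3 : ∀ᵐ s ∂(volume.restrict (Icc 0 S \ uset φ S h)), s ∉ N :=
      ae_mono (Measure.restrict_mono Set.sdiff_subset le_rfl) (measure_eq_zero_iff_ae_notMem.1 hN0)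
    filter_upwards [h3, hc.ae_hi_apply] with s hs hs'
    rwa [hs']
  filter_upwards [h2] with t ht
  by_contra hcon
  exact ht (hN hcon)

/-- Off the stops `V` is a function of the clock value, namely `V ∘ hi`, so nothing cancels under
the image and the variation is the image of `‖V‖`. On a stop the whole fibre is collapsed to one
atom and cancellation is possible, which is why `ν` carries information beyond `|μ|`. -/
theorem totalVar_off (hV : Measurable V) (hVi : IntegrableOn V (Icc 0 S))
    (hμ : ∀ j A, MeasurableSet A →
      μ j A = ∫ s in (Icc 0 S \ uset φ S h) ∩ φ ⁻¹' A, V s j) {A : Set ℝ} (hA : MeasurableSet A) :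
    totalVar μ A = ∫⁻ s in (Icc 0 S \ uset φ S h) ∩ φ ⁻¹' A, ENNReal.ofReal (l1 (V s)) := by
  rw [totalVar_withDensity (hc.integrable_comp_hi hV.stronglyMeasurable hVi) (μ := μ)
    (fun j A hA => by
      rw [hμ j A hA, ← hc.setIntegral_comp_hi (V := fun s => V s j)
        (measurable_pi_iff.1 hV j).stronglyMeasurable hA]), withDensity_apply _ hA]
  exact hc.setLIntegral_comp_hi (measurable_l1.comp hV).ennreal_ofReal hA

theorem polarDensity_mem_off {K : Set (Fin m → ℝ)}
    (hcone : ∀ w ∈ K, ∀ c : ℝ, 0 ≤ c → c • w ∈ K)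
    (hV : Measurable V) (hVi : IntegrableOn V (Icc 0 S))
    (hμ : ∀ j A, MeasurableSet A →
      μ j A = ∫ s in (Icc 0 S \ uset φ S h) ∩ φ ⁻¹' A, V s j)
    (hK : ∀ᵐ s ∂(volume.restrict (Icc 0 S)), V s ∈ K) :
    ∀ᵐ t ∂(totalVar μ), polarDensity μ t ∈ K :=
  ae_polarDensity_mem hcone (hc.integrable_comp_hi hV.stronglyMeasurable hVi)
    (fun j A hA => by
      rw [hμ j A hA, ← hc.setIntegral_comp_hi (V := fun s => V s j)
        (measurable_pi_iff.1 hV j).stronglyMeasurable hA])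
    (hc.ae_map_comp_hi hK)

theorem isKMeasure_off {K : Set (Fin m → ℝ)}
    (hcone : ∀ w ∈ K, ∀ c : ℝ, 0 ≤ c → c • w ∈ K)
    (hV : Measurable V) (hVi : IntegrableOn V (Icc 0 S))
    (hμ : ∀ j A, MeasurableSet A →
      μ j A = ∫ s in (Icc 0 S \ uset φ S h) ∩ φ ⁻¹' A, V s j)
    (hK : ∀ᵐ s ∂(volume.restrict (Icc 0 S)), V s ∈ K) : IsKMeasure K h μ := by
  refine ⟨?_, hc.polarDensity_mem_off hcone hV hVi hμ hK⟩
  rw [hc.totalVar_off hV hVi hμ measurableSet_Icc.compl]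
  have : (Icc 0 S \ uset φ S h) ∩ φ ⁻¹' (Icc 0 h)ᶜ = ∅ := by
    ext s
    simp only [mem_inter_iff, Set.mem_sdiff, mem_preimage, mem_compl_iff, mem_empty_iff_false,
      iff_false, not_and, not_not]
    exact fun hs => hc.mem_Icc hs.1
  rw [this]; simp

theorem contMeas_eq_totalVar (hV : Measurable V) (hVi : IntegrableOn V (Icc 0 S))
    (hμ : ∀ j A, MeasurableSet A → μ j A = ∫ s in Icc 0 S ∩ φ ⁻¹' A, V s j)
    (hν : ∀ A, MeasurableSet A → ν A = ∫⁻ s in Icc 0 S ∩ φ ⁻¹' A, ENNReal.ofReal (l1 (V s))) :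
    contMeas ν = totalVar (contVec μ) := by
  ext A hA
  rw [hc.contMeas_apply_eq hν hA,
    hc.totalVar_off hV hVi (fun j A hA => hc.contVec_apply_eq hμ j hA) hA]

omit hc in
-- The average of `V` over the preimage of `A` lies in the closed convex hull of `K`, and this hull
-- is again a cone, so it may be multiplied by the length of the preimage.
theorem range_mem {K : Set (Fin m → ℝ)} (hne : K.Nonempty)
    (hcone : ∀ w ∈ K, ∀ c : ℝ, 0 ≤ c → c • w ∈ K) (hVi : IntegrableOn V (Icc 0 S))
    (hμ : ∀ j A, MeasurableSet A → μ j A = ∫ s in Icc 0 S ∩ φ ⁻¹' A, V s j)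
    (hK : ∀ᵐ s ∂(volume.restrict (Icc 0 S)), V s ∈ K) {A : Set ℝ} (hA : MeasurableSet A) :
    (fun j => μ j A) ∈ closure (convexHull ℝ K) := by
  set B := Icc 0 S ∩ φ ⁻¹' A
  have hVB : IntegrableOn V B := hVi.mono_set inter_subset_left
  have hB : volume B ≠ ⊤ := ((measure_mono inter_subset_left).trans_lt
    (by simp : volume (Icc 0 S) < ⊤)).ne
  have heq : (fun j => μ j A) = ∫ s in B, V s := by
    funext j
    rw [eval_integral fun j => (hVB.eval j)]
    exact hμ j A hA
  have hcone' : ∀ c : ℝ, 0 ≤ c → ∀ w ∈ closure (convexHull ℝ K),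
      c • w ∈ closure (convexHull ℝ K) := by
    intro c hc0 w hw
    refine map_mem_closure (continuous_const_smul c) hw ?_
    have : convexHull ℝ K ⊆ (fun w => c • w) ⁻¹' convexHull ℝ K :=
      convexHull_min (fun k hk => subset_convexHull ℝ K (hcone k hk c hc0))
        ((convex_convexHull ℝ K).smul_preimage c)
    exact this
  rw [heq]
  by_cases hz : volume B = 0
  · rw [Measure.restrict_eq_zero.2 hz, integral_zero_measure]
    obtain ⟨w, hw⟩ := hne
    have := hcone' 0 le_rfl w (subset_closure (subset_convexHull ℝ K hw))
    simpa using this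
  · have hav := (convex_convexHull ℝ K).closure.set_average_mem isClosed_closure hz hB
      (by
        refine ae_mono (Measure.restrict_mono inter_subset_left le_rfl) ?_
        filter_upwards [hK] with s hs using subset_closure (subset_convexHull ℝ K hs)) hVB
    rw [← measure_smul_setAverage _ hB]
    exact hcone' _ measureReal_nonneg _ hav

omit hc in
theorem uset_eq_empty_of_strictMonoOn (hc : IsClock φ S h) (hmono : StrictMonoOn φ (Icc 0 S)) :
    uset φ S h = ∅ := by
  have : jset φ S h = ∅ := by
    ext r
    simp only [mem_empty_iff_false, iff_false]
    intro hr
    have h1 := hmono (hc.lo_spec hr.1).1 (hc.hi_spec hr.1).1 hr.2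
    rw [(hc.lo_spec hr.1).2, (hc.hi_spec hr.1).2] at h1
    exact lt_irrefl _ h1
  simp [uset, this]

/-- Mixing in a multiple of the uniform clock removes all the stops while keeping the endpoints. -/
theorem approx {ε : ℝ} (h0 : 0 < ε) (h1 : ε ≤ 1) :
    IsClock (fun s => (1 - ε) * φ s + ε * (h / S * s)) S h ∧
      StrictMonoOn (fun s => (1 - ε) * φ s + ε * (h / S * s)) (Icc 0 S) := by
  have hS := hc.S_pos
  have hh := hc.h_pos
  have hsm : StrictMonoOn (fun s => (1 - ε) * φ s + ε * (h / S * s)) (Icc 0 S) := by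
    intro s hs s' hs' hlt
    have e1 : (1 - ε) * φ s ≤ (1 - ε) * φ s' :=
      mul_le_mul_of_nonneg_left (hc.mono hs hs' hlt.le) (by linarith)
    have e2 : ε * (h / S * s) < ε * (h / S * s') := by
      have : 0 < h / S := by positivity
      gcongr
    exact add_lt_add_of_le_of_lt e1 e2
  refine ⟨⟨hS, hh, hsm.monotoneOn, ?_, ?_, ?_⟩, hsm⟩
  · exact (continuousOn_const.mul hc.cont).add (by fun_prop)
  · simp [hc.zero]
  · simp only [hc.last]; field_simp; ring

/-- The approximating measures are the images of the same velocities `V` under strictly increasing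
clocks converging pointwise to `φ`. Without stops `|μᵢ|` is exactly the image of `‖V‖ ds`, so both
weak* limits follow from dominated convergence for `∫ k(s) ψ(Φᵢ(s)) ds`. -/
theorem inVc {K : Set (Fin m → ℝ)} (hcone : ∀ w ∈ K, ∀ c : ℝ, 0 ≤ c → c • w ∈ K)
    (hV : Measurable V) (hVi : IntegrableOn V (Icc 0 S))
    (hK : ∀ᵐ s ∂(volume.restrict (Icc 0 S)), V s ∈ K)
    (hμ : ∀ j A, MeasurableSet A → μ j A = ∫ s in Icc 0 S ∩ φ ⁻¹' A, V s j)
    (hν : ∀ A, MeasurableSet A → ν A = ∫⁻ s in Icc 0 S ∩ φ ⁻¹' A, ENNReal.ofReal (l1 (V s))) :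
    InVc K h μ ν := by
  refine ⟨hc.contMeas_eq_totalVar hV hVi hμ hν, ?_⟩
  set ε : ℕ → ℝ := fun i => 1 / ((i : ℝ) + 1) with hε
  have hε0 : ∀ i, 0 < ε i := fun i => by simp only [hε]; positivity
  have hε1 : ∀ i, ε i ≤ 1 := fun i => by
    simp only [hε]
    rw [div_le_one (by positivity)]
    linarith [Nat.cast_nonneg (α := ℝ) i]
  have hεt : Tendsto ε atTop (𝓝 0) := tendsto_one_div_add_atTop_nhds_zero_nat
  set Φ : ℕ → ℝ → ℝ := fun i s => (1 - ε i) * φ s + ε i * (h / S * s) with hΦ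
  have hΦc : ∀ i, IsClock (Φ i) S h := fun i => (hc.approx (hε0 i) (hε1 i)).1
  have hΦU : ∀ i, uset (Φ i) S h = ∅ := fun i =>
    uset_eq_empty_of_strictMonoOn (hΦc i) (hc.approx (hε0 i) (hε1 i)).2
  have hΦt : ∀ s, Tendsto (fun i => Φ i s) atTop (𝓝 (φ s)) := by
    intro s
    have := ((tendsto_const_nhds (x := (1 : ℝ))).sub hεt).mul_const (φ s) |>.add
      (hεt.mul_const (h / S * s))
    simpa using this
  have hVj : ∀ j, Integrable (fun s => V s j) (volume.restrict (Icc 0 S)) := fun j =>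
    Integrable.eval hVi j
  choose μs hμs using fun i j => exists_signedMeasure_map (hΦc i).aemeasurable (hVj j)
  have hpush : ∀ i j A, MeasurableSet A → μs i j A = ∫ s in Icc 0 S ∩ Φ i ⁻¹' A, V s j := by
    intro i j A hA
    rw [hμs i j A hA, Measure.restrict_restrict' measurableSet_Icc, inter_comm]
  have hoff : ∀ i j A, MeasurableSet A →
      μs i j A = ∫ s in (Icc 0 S \ uset (Φ i) S h) ∩ Φ i ⁻¹' A, V s j := by
    intro i j A hA
    rw [hpush i j A hA, hΦU i, Set.sdiff_empty]
  have hint : ∀ k : ℝ → ℝ, Integrable k (volume.restrict (Icc 0 S)) → ∀ ψ : ℝ → ℝ,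
      Continuous ψ → (∃ C, ∀ t, ‖ψ t‖ ≤ C) →
      Tendsto (fun i => ∫ s in Icc 0 S, k s * ψ (Φ i s)) atTop
        (𝓝 (∫ s in Icc 0 S, k s * ψ (φ s))) := by
    rintro k hk ψ hψ ⟨C, hC⟩
    refine tendsto_integral_of_dominated_convergence (fun s => ‖k s‖ * C) ?_
      (hk.norm.mul_const C) ?_ ?_
    · intro i
      exact hk.aestronglyMeasurable.mul
        (hψ.measurable.comp_aemeasurable (hΦc i).aemeasurable).aestronglyMeasurable
    · intro i
      refine Eventually.of_forall fun s => ?_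
      rw [norm_mul]
      exact mul_le_mul_of_nonneg_left (hC _) (norm_nonneg _)
    · refine Eventually.of_forall fun s => ?_
      exact ((hψ.tendsto _).comp (hΦt s)).const_mul _
  -- Test functions are only continuous on `[0, h]`; their constant extension is bounded and
  -- continuous on the line, and the integrals over `[0, h]` do not see the difference.
  have hext : ∀ ψ : ℝ → ℝ, ContinuousOn ψ (Icc 0 h) → ∃ ψ' : ℝ → ℝ, Continuous ψ' ∧
      (∃ C, ∀ t, ‖ψ' t‖ ≤ C) ∧ EqOn ψ ψ' (Icc 0 h) := by
    intro ψ hψ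
    have hψc := continuousOn_iff_continuous_domRestrict.1 hψ
    obtain ⟨C, hC⟩ := isCompact_Icc.exists_bound_of_continuousOn hψ
    refine ⟨IccExtend hc.h_pos.le ((Icc 0 h).domRestrict ψ), hψc.Icc_extend', ⟨C, fun t => ?_⟩,
      fun t ht => (IccExtend_of_mem hc.h_pos.le ((Icc 0 h).domRestrict ψ) ht).symm⟩
    exact hC _ (projIcc 0 h hc.h_pos.le t).2
  have hfull : ∀ {χ : ℝ → ℝ}, IsClock χ S h → Icc 0 S ∩ χ ⁻¹' (Icc 0 h) = Icc 0 S := by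
    intro χ hχ
    exact inter_eq_left.2 fun s hs => hχ.mem_Icc hs
  have hsInt : ∀ {χ : ℝ → ℝ}, IsClock χ S h → ∀ {κ : SignedMeasure ℝ} {k : ℝ → ℝ},
      Integrable k (volume.restrict (Icc 0 S)) →
      (∀ A, MeasurableSet A → κ A = ∫ s in Icc 0 S ∩ χ ⁻¹' A, k s) →
      ∀ {ψ : ℝ → ℝ}, Continuous ψ → (∃ C, ∀ t, ‖ψ t‖ ≤ C) →
      sInt κ (Icc 0 h) ψ = ∫ s in Icc 0 S, k s * ψ (χ s) := by
    rintro χ hχ κ k hk hκ ψ hψ ⟨C, hC⟩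
    have hnull : ∀ B, MeasurableSet B → NullMeasurableSet (χ ⁻¹' B) (volume.restrict (Icc 0 S)) :=
      fun B hB => hχ.aemeasurable.nullMeasurable hB
    rw [sInt_eq_integral_of_map measurableSet_Icc hχ.aemeasurable hk (fun B hB _ => by
      rw [hκ B hB, integral_indicator₀ (hnull B hB),
        Measure.restrict_restrict' measurableSet_Icc, inter_comm]) hψ.measurable hC,
      integral_indicator₀ (hnull _ measurableSet_Icc),
      Measure.restrict_restrict' measurableSet_Icc, inter_comm, hfull hχ]
    rfl
  have hposInt : ∀ {χ : ℝ → ℝ}, IsClock χ S h → ∀ {κ : Measure ℝ},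
      (∀ A, MeasurableSet A → κ A = ∫⁻ s in Icc 0 S ∩ χ ⁻¹' A, ENNReal.ofReal (l1 (V s))) →
      ∀ {ψ : ℝ → ℝ}, Continuous ψ →
      ∫ t in Icc 0 h, ψ t ∂κ = ∫ s in Icc 0 S, l1 (V s) * ψ (χ s) := by
    intro χ hχ κ hκ ψ hψ
    set w : ℝ → ENNReal := fun s => ENNReal.ofReal (l1 (V s))
    have hw : Measurable w := (measurable_l1.comp hV).ennreal_ofReal
    have hχ' : AEMeasurable χ ((volume.restrict (Icc 0 S)).withDensity w) :=
      hχ.aemeasurable.mono_ac (withDensity_absolutelyContinuous _ _)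
    have hκe : κ = ((volume.restrict (Icc 0 S)).withDensity w).map χ := by
      ext A hA
      rw [Measure.map_apply_of_aemeasurable hχ' hA,
        withDensity_apply₀ _ (hχ.aemeasurable.nullMeasurable hA),
        Measure.restrict_restrict' measurableSet_Icc, inter_comm, hκ A hA]
    rw [hκe, setIntegral_map measurableSet_Icc hψ.aestronglyMeasurable hχ',
      restrict_withDensity' _ , integral_withDensity_eq_integral_toReal_smul₀
      hw.aemeasurable (Eventually.of_forall fun _ => ENNReal.ofReal_lt_top),
      Measure.restrict_restrict' measurableSet_Icc, inter_comm, hfull hχ]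
    refine integral_congr_ae (Eventually.of_forall fun s => ?_)
    simp only [w, ENNReal.toReal_ofReal (l1_nonneg _), smul_eq_mul]
  refine ⟨μs, fun i => (hΦc i).isKMeasure_off hcone hV hVi (hoff i) hK, ?_, ?_⟩
  · intro ψ hψ j
    obtain ⟨ψ', h1, h2, h3⟩ := hext ψ hψ
    have hcongr : ∀ κ : SignedMeasure ℝ, sInt κ (Icc 0 h) ψ = sInt κ (Icc 0 h) ψ' := by
      intro κ
      rw [sInt, sInt, setIntegral_congr_fun measurableSet_Icc h3,
        setIntegral_congr_fun measurableSet_Icc h3]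
    simp_rw [hcongr]
    rw [hsInt hc (hVj j) (hμ j) h1 h2]
    simp_rw [fun i => hsInt (hΦc i) (hVj j) (hpush i j) h1 h2]
    exact hint _ (hVj j) ψ' h1 h2
  · intro ψ hψ
    obtain ⟨ψ', h1, h2, h3⟩ := hext ψ hψ
    simp_rw [setIntegral_congr_fun measurableSet_Icc h3]
    rw [hposInt hc hν h1]
    simp_rw [fun i => hposInt (hΦc i) (κ := totalVar (μs i)) (fun A hA => by
      rw [(hΦc i).totalVar_off hV hVi (hoff i) hA, hΦU i, Set.sdiff_empty]) h1]
    exact hint _ (integrable_l1 hVi) ψ' h1 h2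

end IsClock

/-! ### Concatenation -/

section Concat

variable {E : Type*} [AddCommMonoid E] {N : ℕ} {S : ℝ}

theorem concat_congr {z z' : ℕ → ℝ → E} (hS : 0 < S) (hN : 1 ≤ N)
    (h : ∀ l ∈ Finset.Icc 1 N, EqOn (z l) (z' l) (Icc 0 S)) : concat N S z = concat N S z' := by
  funext s
  unfold concat
  split_ifs
  · exact h N (Finset.mem_Icc.2 ⟨hN, le_rfl⟩) ⟨hS.le, le_rfl⟩
  · refine Finset.sum_congr rfl fun l hl => ?_
    by_cases hs : s ∈ Ico (((l : ℝ) - 1) * S) (l * S)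
    · rw [indicator_of_mem hs, indicator_of_mem hs]
      exact h l hl ⟨by linarith [hs.1], by linarith [hs.2]⟩
    · rw [indicator_of_notMem hs, indicator_of_notMem hs]

theorem concat_apply (z : ℕ → ℝ → E) {l : ℕ} (hl : l ∈ Finset.Icc 1 N) {s : ℝ}
    (hs : s ∈ Ico 0 S) : concat N S z (((l : ℝ) - 1) * S + s) = z l s := by
  have hS : 0 < S := hs.1.trans_lt hs.2
  obtain ⟨hl1, hlN⟩ := Finset.mem_Icc.1 hl
  have hlN' : (l : ℝ) ≤ N := by exact_mod_cast hlN
  unfold concat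
  rw [if_neg]
  · rw [Finset.sum_eq_single l]
    · rw [indicator_of_mem]
      · congr 1; ring
      · exact ⟨by linarith [hs.1], by linarith [hs.2]⟩
    · intro k _ hkl
      refine indicator_of_notMem ?_ _
      rintro ⟨h1, h2⟩
      rcases lt_or_gt_of_ne hkl with hlt | hlt
      · have : (k : ℝ) + 1 ≤ l := by exact_mod_cast hlt
        nlinarith [hs.1]
      · have : (l : ℝ) + 1 ≤ k := by exact_mod_cast hlt
        nlinarith [hs.2]
    · exact fun h => absurd hl h
  · intro h
    nlinarith [hs.2]

theorem concat_last (z : ℕ → ℝ → E) : concat N S z (N * S) = z N S := by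
  unfold concat; rw [if_pos rfl]

/-- At a junction the concatenation takes the value of the next block; the matching condition is
what allows the right endpoint of a block to be included. -/
theorem concat_apply_Icc {z : ℕ → ℝ → E} (hS : 0 < S)
    (hz : ∀ l ∈ Finset.Icc 2 N, z l 0 = z (l - 1) S) {l : ℕ} (hl : l ∈ Finset.Icc 1 N) {s : ℝ}
    (hs : s ∈ Icc 0 S) : concat N S z (((l : ℝ) - 1) * S + s) = z l s := by
  rcases hs.2.eq_or_lt with rfl | hlt
  · obtain ⟨hl1, hlN⟩ := Finset.mem_Icc.1 hl
    rcases hlN.eq_or_lt with rfl | hlt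
    · rw [← concat_last (N := l) (S := s) z]; congr 1; ring
    · have h1 := hz (l + 1) (Finset.mem_Icc.2 ⟨by omega, hlt⟩)
      have h2 := concat_apply z (N := N) (S := s) (l := l + 1) (Finset.mem_Icc.2 ⟨by omega, hlt⟩)
        (s := 0) ⟨le_rfl, hS⟩
      rw [Nat.add_sub_cancel] at h1
      rw [← h1, ← h2]
      congr 1
      push_cast; ring
  · exact concat_apply z hl ⟨hs.1, hlt⟩

theorem exists_block (hS : 0 < S) {t : ℝ} (ht : t ∈ Ico 0 (N * S)) :
    ∃ l ∈ Finset.Icc 1 N, ∃ s ∈ Ico 0 S, t = ((l : ℝ) - 1) * S + s := by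
  have h0 : 0 ≤ t / S := div_nonneg ht.1 hS.le
  have h1 := Nat.floor_le h0
  have h2 := Nat.lt_floor_add_one (t / S)
  rw [le_div_iff₀ hS] at h1
  rw [div_lt_iff₀ hS] at h2
  refine ⟨⌊t / S⌋₊ + 1, Finset.mem_Icc.2 ⟨by omega, ?_⟩, t - ⌊t / S⌋₊ * S, ⟨by linarith, by linarith⟩,
    by push_cast; ring⟩
  have : (⌊t / S⌋₊ : ℝ) < N := by
    by_contra hcon
    have := mul_le_mul_of_nonneg_right (not_lt.1 hcon) hS.le
    linarith [ht.2]
  exact_mod_cast this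

theorem exists_block_Icc (hS : 0 < S) (hN : 1 ≤ N) {t : ℝ} (ht : t ∈ Icc 0 (N * S)) :
    ∃ l ∈ Finset.Icc 1 N, ∃ s ∈ Icc 0 S, t = ((l : ℝ) - 1) * S + s := by
  rcases ht.2.eq_or_lt with rfl | hlt
  · exact ⟨N, Finset.mem_Icc.2 ⟨hN, le_rfl⟩, S, ⟨hS.le, le_rfl⟩, by ring⟩
  · obtain ⟨l, hl, s, hs, h⟩ := exists_block hS ⟨ht.1, hlt⟩
    exact ⟨l, hl, s, Ico_subset_Icc_self hs, h⟩

theorem block_mem (hS : 0 ≤ S) {l : ℕ} (hl : l ∈ Finset.Icc 1 N) {s : ℝ} (hs : s ∈ Icc 0 S) :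
    ((l : ℝ) - 1) * S + s ∈ Icc 0 (N * S) := by
  obtain ⟨hl1, hlN⟩ := Finset.mem_Icc.1 hl
  have h1 : (1 : ℝ) ≤ l := by exact_mod_cast hl1
  have h2 : (l : ℝ) ≤ N := by exact_mod_cast hlN
  constructor <;> nlinarith [hs.1, hs.2]

theorem map_add_left_restrict_Ico (a S : ℝ) :
    (volume.restrict (Ico 0 S)).map (fun s => a + s) = volume.restrict (Ico a (a + S)) := by
  have h := (measurableEmbedding_addLeft a).restrict_map volume (Ico a (a + S))
  rw [(measurePreserving_add_left volume a).map_eq] at h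
  rw [h]
  congr 2
  ext s; simp

theorem volume_restrict_blocks (hS : 0 ≤ S) (N : ℕ) :
    volume.restrict (Ico 0 (N * S)) = ∑ l ∈ Finset.Icc 1 N,
      (volume.restrict (Ico 0 S)).map (fun s => ((l : ℝ) - 1) * S + s) := by
  induction N with
  | zero => simp
  | succ k ih =>
    rw [Finset.sum_Icc_succ_top (by omega), ← ih, map_add_left_restrict_Ico,
      ← Measure.restrict_union]
    · congr 1
      push_cast
      rw [show ((k : ℝ) + 1 - 1) * S = k * S by ring, show (k : ℝ) * S + S = (k + 1) * S by ring,
        Ico_union_Ico_eq_Ico (by positivity) (by nlinarith)]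
    · push_cast
      refine Set.disjoint_left.2 fun s h1 h2 => ?_
      rw [show ((k : ℝ) + 1 - 1) * S = k * S by ring] at h2
      linarith [h1.2, h2.1]
    · exact measurableSet_Ico

end Concat

theorem deriv_concat {E : Type*} [NormedAddCommGroup E] [NormedSpace ℝ E] {N : ℕ} {S : ℝ}
    (z : ℕ → ℝ → E) {l : ℕ} (hl : l ∈ Finset.Icc 1 N) {s : ℝ} (hs : s ∈ Ioo 0 S) :
    deriv (concat N S z) (((l : ℝ) - 1) * S + s) = deriv (z l) s := by
  have : concat N S z =ᶠ[𝓝 (((l : ℝ) - 1) * S + s)] fun t => z l (t - ((l : ℝ) - 1) * S) := by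
    have hn : Ioo (((l : ℝ) - 1) * S) (((l : ℝ) - 1) * S + S) ∈ 𝓝 (((l : ℝ) - 1) * S + s) :=
      Ioo_mem_nhds (by linarith [hs.1]) (by linarith [hs.2])
    filter_upwards [hn] with t ht
    have := concat_apply z hl (s := t - ((l : ℝ) - 1) * S) (S := S)
      ⟨by linarith [ht.1], by linarith [ht.2]⟩
    rw [← this]; congr 1; ring
  rw [this.deriv_eq, deriv_comp_sub_const]
  congr 1; ring

/-- Agreement is required only in the interior of the blocks. The junctions form a null set, and
nothing is known about derivatives of a concatenation there. -/
theorem setIntegral_concat {E : Type*} [NormedAddCommGroup E] [NormedSpace ℝ E] {N : ℕ} {S : ℝ}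
    (hS : 0 < S) {A : ℝ → Prop} {Al : ℕ → ℝ → Prop} {H : ℝ → E} {Hl : ℕ → ℝ → E}
    (hA : ∀ l ∈ Finset.Icc 1 N, ∀ s ∈ Ioo 0 S, A (((l : ℝ) - 1) * S + s) ↔ Al l s)
    (hH : ∀ l ∈ Finset.Icc 1 N, ∀ s ∈ Ioo 0 S, H (((l : ℝ) - 1) * S + s) = Hl l s)
    (hAm : MeasurableSet (Icc 0 (N * S) ∩ {s | A s}))
    (hAlm : ∀ l ∈ Finset.Icc 1 N, MeasurableSet (Icc 0 S ∩ {s | Al l s}))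
    (hHl : ∀ l ∈ Finset.Icc 1 N, IntegrableOn (Hl l) (Icc 0 S)) :
    ∫ s in Icc 0 (N * S) ∩ {s | A s}, H s
      = ∑ l ∈ Finset.Icc 1 N, ∫ s in Icc 0 S ∩ {s | Al l s}, Hl l s := by
  set B := Icc 0 (N * S) ∩ {s | A s}
  have e0 : ∀ l ∈ Finset.Icc 1 N, ∀ᵐ s ∂(volume.restrict (Ico 0 S)),
      (Icc 0 S ∩ {s | Al l s}).indicator (Hl l) s = B.indicator H (((l : ℝ) - 1) * S + s) := by
    intro l hl
    rw [ae_restrict_iff' measurableSet_Ico]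
    filter_upwards [Measure.ae_ne volume 0] with s hs0 hs
    have hs' : s ∈ Ioo 0 S := ⟨lt_of_le_of_ne hs.1 (Ne.symm hs0), hs.2⟩
    by_cases hm : Al l s
    · rw [indicator_of_mem (show s ∈ Icc 0 S ∩ {s | Al l s} from ⟨Ico_subset_Icc_self hs, hm⟩),
        indicator_of_mem (show _ ∈ B from
          ⟨block_mem hS.le hl (Ico_subset_Icc_self hs), (hA l hl s hs').2 hm⟩), hH l hl s hs']
    · rw [indicator_of_notMem (fun h => hm h.2),
        indicator_of_notMem (fun h => hm ((hA l hl s hs').1 h.2))]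
  have e1 : ∫ s in B, H s = ∫ s in Ico 0 (N * S), B.indicator H s := by
    rw [setIntegral_congr_set (Ico_ae_eq_Icc (a := 0) (b := N * S)), setIntegral_indicator hAm,
      ← inter_assoc, inter_self]
  rw [e1, volume_restrict_blocks hS.le, integral_finsetSum_measure]
  · refine Finset.sum_congr rfl fun l hl => ?_
    rw [(measurableEmbedding_addLeft (((l : ℝ) - 1) * S)).integral_map]
    rw [← integral_congr_ae (e0 l hl), setIntegral_congr_set (Ico_ae_eq_Icc (a := 0) (b := S)),
      setIntegral_indicator (hAlm l hl), ← inter_assoc, inter_self]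
  · intro l hl
    rw [(measurableEmbedding_addLeft (((l : ℝ) - 1) * S)).integrable_map_iff]
    refine Integrable.congr ?_ (e0 l hl)
    exact ((hHl l hl).mono_set Ico_subset_Icc_self).indicator₀
      (hAlm l hl).nullMeasurableSet

theorem setLIntegral_concat {N : ℕ} {S : ℝ}
    (hS : 0 < S) {A : ℝ → Prop} {Al : ℕ → ℝ → Prop} {H : ℝ → ENNReal} {Hl : ℕ → ℝ → ENNReal}
    (hA : ∀ l ∈ Finset.Icc 1 N, ∀ s ∈ Ioo 0 S, A (((l : ℝ) - 1) * S + s) ↔ Al l s)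
    (hH : ∀ l ∈ Finset.Icc 1 N, ∀ s ∈ Ioo 0 S, H (((l : ℝ) - 1) * S + s) = Hl l s)
    (hAm : MeasurableSet (Icc 0 (N * S) ∩ {s | A s}))
    (hAlm : ∀ l ∈ Finset.Icc 1 N, MeasurableSet (Icc 0 S ∩ {s | Al l s})) :
    ∫⁻ s in Icc 0 (N * S) ∩ {s | A s}, H s
      = ∑ l ∈ Finset.Icc 1 N, ∫⁻ s in Icc 0 S ∩ {s | Al l s}, Hl l s := by
  set B := Icc 0 (N * S) ∩ {s | A s}
  have e0 : ∀ l ∈ Finset.Icc 1 N, ∀ᵐ s ∂(volume.restrict (Ico 0 S)),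
      (Icc 0 S ∩ {s | Al l s}).indicator (Hl l) s = B.indicator H (((l : ℝ) - 1) * S + s) := by
    intro l hl
    rw [ae_restrict_iff' measurableSet_Ico]
    filter_upwards [Measure.ae_ne volume 0] with s hs0 hs
    have hs' : s ∈ Ioo 0 S := ⟨lt_of_le_of_ne hs.1 (Ne.symm hs0), hs.2⟩
    by_cases hm : Al l s
    · rw [indicator_of_mem (show s ∈ Icc 0 S ∩ {s | Al l s} from ⟨Ico_subset_Icc_self hs, hm⟩),
        indicator_of_mem (show _ ∈ B from
          ⟨block_mem hS.le hl (Ico_subset_Icc_self hs), (hA l hl s hs').2 hm⟩), hH l hl s hs']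
    · rw [indicator_of_notMem (fun h => hm h.2),
        indicator_of_notMem (fun h => hm ((hA l hl s hs').1 h.2))]
  have e1 : ∫⁻ s in B, H s = ∫⁻ s in Ico 0 (N * S), B.indicator H s := by
    rw [setLIntegral_congr (Ico_ae_eq_Icc (a := 0) (b := N * S)), setLIntegral_indicator hAm,
      inter_comm, ← inter_assoc, inter_self]
  rw [e1, volume_restrict_blocks hS.le, lintegral_finsetSum_measure]
  refine Finset.sum_congr rfl fun l hl => ?_
  rw [(measurableEmbedding_addLeft (((l : ℝ) - 1) * S)).lintegral_map]
  rw [← lintegral_congr_ae (e0 l hl), setLIntegral_congr (Ico_ae_eq_Icc (a := 0) (b := S)),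
    setLIntegral_indicator (hAlm l hl), inter_comm, ← inter_assoc, inter_self]

theorem lipschitzOnWith_Icc_union {E : Type*} [PseudoMetricSpace E] {f : ℝ → E} {a b c : ℝ}
    {C : NNReal} (hab : a ≤ b) (hbc : b ≤ c) (h1 : LipschitzOnWith C f (Icc a b))
    (h2 : LipschitzOnWith C f (Icc b c)) : LipschitzOnWith C f (Icc a c) := by
  have key : ∀ x ∈ Icc a c, ∀ y ∈ Icc a c, x ≤ y → dist (f x) (f y) ≤ C * dist x y := by
    intro x hx y hy hxy
    rcases le_total y b with hyb | hyb
    · exact h1.dist_le_mul x ⟨hx.1, hxy.trans hyb⟩ y ⟨hy.1, hyb⟩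
    · rcases le_total x b with hxb | hxb
      · have e1 := h1.dist_le_mul x ⟨hx.1, hxb⟩ b ⟨hab, le_rfl⟩
        have e2 := h2.dist_le_mul b ⟨le_rfl, hbc⟩ y ⟨hyb, hy.2⟩
        have e3 : dist x y = dist x b + dist b y := by
          rw [Real.dist_eq, Real.dist_eq, Real.dist_eq, abs_of_nonpos (by linarith),
            abs_of_nonpos (by linarith), abs_of_nonpos (by linarith)]; ring
        rw [e3, mul_add]
        exact (dist_triangle _ _ _).trans (add_le_add e1 e2)
      · exact h2.dist_le_mul x ⟨hxb, hx.2⟩ y ⟨hxb.trans hxy, hy.2⟩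
  refine LipschitzOnWith.of_dist_le_mul fun x hx y hy => ?_
  rcases le_total x y with hxy | hxy
  · exact key x hx y hy hxy
  · rw [dist_comm, dist_comm x]; exact key y hy x hx hxy

theorem lipschitzOnWith_concat {E : Type*} [NormedAddCommGroup E] {N : ℕ} {S : ℝ} {C : NNReal}
    {z : ℕ → ℝ → E} (hS : 0 < S) (hz : ∀ l ∈ Finset.Icc 2 N, z l 0 = z (l - 1) S)
    (hL : ∀ l ∈ Finset.Icc 1 N, LipschitzOnWith C (z l) (Icc 0 S)) :
    LipschitzOnWith C (concat N S z) (Icc 0 (N * S)) := by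
  have hblock : ∀ l ∈ Finset.Icc 1 N,
      LipschitzOnWith C (concat N S z) (Icc (((l : ℝ) - 1) * S) (l * S)) := by
    intro l hl
    refine LipschitzOnWith.of_dist_le_mul fun x hx y hy => ?_
    have e : ∀ x ∈ Icc (((l : ℝ) - 1) * S) (l * S), concat N S z x = z l (x - ((l : ℝ) - 1) * S) ∧
        x - ((l : ℝ) - 1) * S ∈ Icc 0 S := by
      intro x hx
      have hm : x - ((l : ℝ) - 1) * S ∈ Icc 0 S := ⟨by linarith [hx.1], by linarith [hx.2]⟩
      refine ⟨?_, hm⟩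
      rw [← concat_apply_Icc hS hz hl hm]; congr 1; ring
    rw [(e x hx).1, (e y hy).1]
    refine ((hL l hl).dist_le_mul _ (e x hx).2 _ (e y hy).2).trans_eq ?_
    rw [dist_sub_right]
  have : ∀ k : ℕ, k ≤ N → LipschitzOnWith C (concat N S z) (Icc 0 (k * S)) := by
    intro k
    induction k with
    | zero => intro _; simp [LipschitzOnWith]
    | succ k ih =>
      intro hk
      have h2 := hblock (k + 1) (Finset.mem_Icc.2 ⟨by omega, hk⟩)
      push_cast at h2 ⊢
      rw [show ((k : ℝ) + 1 - 1) * S = k * S by ring] at h2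
      exact lipschitzOnWith_Icc_union (by positivity) (by nlinarith) (ih (by omega)) h2
  exact this N le_rfl

theorem IsClock.concat {N : ℕ} {S h : ℝ} {φ : ℝ → ℝ} {τ : ℕ → ℝ → ℝ} {C : NNReal}
    (hc : IsClock φ S h) (hN : 1 ≤ N) (hL : LipschitzOnWith C φ (Icc 0 S))
    (hτ : ∀ l ∈ Finset.Icc 1 N, ∀ s ∈ Icc 0 S, τ l s = ((l : ℝ) - 1) * h + φ s) :
    (∀ l ∈ Finset.Icc 1 N, ∀ s ∈ Icc 0 S,
      ImpulseDelay.concat N S τ (((l : ℝ) - 1) * S + s) = ((l : ℝ) - 1) * h + φ s) ∧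
    IsClock (ImpulseDelay.concat N S τ) (N * S) (N * h) := by
  have hS := hc.S_pos
  have hh := hc.h_pos
  have h0m : (0 : ℝ) ∈ Icc 0 S := ⟨le_rfl, hS.le⟩
  have hSm : S ∈ Icc 0 S := ⟨hS.le, le_rfl⟩
  have hN' : (1 : ℝ) ≤ N := by exact_mod_cast hN
  have hmatch : ∀ l ∈ Finset.Icc 2 N, τ l 0 = τ (l - 1) S := by
    intro l hl
    obtain ⟨h1, h2⟩ := Finset.mem_Icc.1 hl
    rw [hτ l (Finset.mem_Icc.2 ⟨by omega, h2⟩) 0 h0m,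
      hτ (l - 1) (Finset.mem_Icc.2 ⟨by omega, by omega⟩) S hSm, hc.zero, hc.last,
      Nat.cast_sub (by omega)]
    push_cast; ring
  have hval : ∀ l ∈ Finset.Icc 1 N, ∀ s ∈ Icc 0 S,
      ImpulseDelay.concat N S τ (((l : ℝ) - 1) * S + s) = ((l : ℝ) - 1) * h + φ s :=
    fun l hl s hs => by rw [concat_apply_Icc hS hmatch hl hs, hτ l hl s hs]
  have hmemN : N ∈ Finset.Icc 1 N := Finset.mem_Icc.2 ⟨hN, le_rfl⟩
  have hmem1 : 1 ∈ Finset.Icc 1 N := Finset.mem_Icc.2 ⟨le_rfl, hN⟩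
  refine ⟨hval, ⟨by positivity, by positivity, ?_, ?_, ?_, ?_⟩⟩
  · intro t ht t' ht' hle
    obtain ⟨l, hl, s, hs, rfl⟩ := exists_block_Icc hS hN ht
    obtain ⟨l', hl', s', hs', rfl⟩ := exists_block_Icc hS hN ht'
    rw [hval l hl s hs, hval l' hl' s' hs']
    have e1 := hc.mem_Icc hs
    have e2 := hc.mem_Icc hs'
    rcases lt_trichotomy l l' with hlt | rfl | hlt
    · have : (l : ℝ) + 1 ≤ l' := by exact_mod_cast hlt
      nlinarith [e1.2, e2.1]
    · have := hc.mono hs hs' (by linarith)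
      linarith
    -- An earlier time can lie in a later block only if both times are the common endpoint of two
    -- adjacent blocks, seen from its two sides.
    · have h1 : (l' : ℝ) + 1 ≤ l := by exact_mod_cast hlt
      have h2 : l = l' + 1 := by
        by_contra hne
        have h3 : (l' : ℝ) + 2 ≤ l := by
          have : l' + 2 ≤ l := by omega
          exact_mod_cast this
        nlinarith [hs.1, hs'.2]
      subst h2
      push_cast at hle ⊢
      have hs0 : s = 0 := le_antisymm (by nlinarith [hs'.2]) hs.1
      have hs1 : s' = S := le_antisymm hs'.2 (by nlinarith [hs.1])
      rw [hs0, hs1, hc.zero, hc.last]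
      linarith
  · refine (lipschitzOnWith_concat (C := C) hS hmatch fun l hl => ?_).continuousOn
    refine LipschitzOnWith.of_dist_le_mul fun x hx y hy => ?_
    rw [hτ l hl x hx, hτ l hl y hy, dist_add_left]
    exact hL.dist_le_mul x hx y hy
  · have := hval 1 hmem1 0 h0m
    simpa [hc.zero] using this
  · have := hval N hmemN S hSm
    rw [show ((N : ℝ) - 1) * S + S = N * S by ring, hc.last] at this
    rw [this]; ring

/-- The case `r = h` is excluded: if the clock also stops at the beginning of the next block, the
last time at level `lh` lies beyond the end of block `l`. -/
theorem IsClock.hi_concat {N : ℕ} {S h : ℝ} {φ T : ℝ → ℝ} (hc : IsClock φ S h)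
    (hval : ∀ l ∈ Finset.Icc 1 N, ∀ s ∈ Icc 0 S,
      T (((l : ℝ) - 1) * S + s) = ((l : ℝ) - 1) * h + φ s)
    (hT : IsClock T (N * S) (N * h)) {l : ℕ} (hl : l ∈ Finset.Icc 1 N) {r : ℝ}
    (hr : r ∈ Ico 0 h) :
    hi T (N * S) (((l : ℝ) - 1) * h + r) = ((l : ℝ) - 1) * S + hi φ S r := by
  have hr' : r ∈ Icc 0 h := ⟨hr.1, hr.2.le⟩
  have hR : ((l : ℝ) - 1) * h + r ∈ Icc 0 (N * h) := block_mem hc.h_pos.le hl hr'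
  obtain ⟨h1, h2⟩ := hc.hi_spec hr'
  obtain ⟨h3, h4⟩ := hT.hi_spec hR
  apply le_antisymm
  · by_contra hcon
    have hcon := not_le.1 hcon
    have hlt := hc.hi_lt hr
    set u := hi T (N * S) (((l : ℝ) - 1) * h + r)
    -- A time strictly after `hi φ S r`, still inside block `l` and not after `u`: the clock would
    -- be at most `r` there, contradicting the maximality of `hi φ S r`.
    set s := min ((hi φ S r + S) / 2) (u - ((l : ℝ) - 1) * S)
    have hs1 : hi φ S r < s := lt_min (by linarith) (by linarith)
    have hs2 : s ∈ Icc 0 S :=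
      ⟨h1.1.trans hs1.le, (min_le_left _ _).trans (by linarith)⟩
    have hsu : ((l : ℝ) - 1) * S + s ≤ u := by
      have := min_le_right ((hi φ S r + S) / 2) (u - ((l : ℝ) - 1) * S)
      linarith
    have e1 := (hT.le_hi_iff hR (block_mem hc.S_pos.le hl hs2)).1 hsu
    rw [hval l hl s hs2] at e1
    have e2 := (hc.le_hi_iff hr' hs2).2 (by linarith)
    linarith
  · rw [hT.le_hi_iff hR (block_mem hc.S_pos.le hl h1), hval l hl _ h1, h2]

/-! ### Canonical extended controls -/

/-- Almost everywhere differentiability of Lipschitz curves in finite dimension. The endpoints are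
discarded because `deriv` is two-sided and `z` is uncontrolled outside the interval. -/
theorem LipschitzOnWith.solvesOn_deriv {E : Type*} [NormedAddCommGroup E] [NormedSpace ℝ E]
    [FiniteDimensional ℝ E] {z : ℝ → E} {a b : ℝ} {C : NNReal} (hab : a ≤ b)
    (hz : LipschitzOnWith C z (Icc a b)) : SolvesOn z (deriv z) a b := by
  refine ⟨?_, ?_⟩
  · apply LipschitzOnWith.absolutelyContinuousOnInterval (K := C)
    rwa [uIcc_of_le hab]
  · rw [ae_restrict_iff' measurableSet_Icc]
    filter_upwards [hz.ae_differentiableWithinAt_of_mem, Measure.ae_ne volume a,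
      Measure.ae_ne volume b] with s hs hsa hsb hmem
    have hn : Icc a b ∈ 𝓝 s := Icc_mem_nhds (lt_of_le_of_ne hmem.1 (Ne.symm hsa))
      (lt_of_le_of_ne hmem.2 hsb)
    exact ((hs hmem).differentiableAt hn).hasDerivAt

namespace DelaySystem

variable {n m N M : ℕ} (P : DelaySystem n m N M)

/-- Extended controls satisfying the canonical normalization. -/
structure IsCanonControl (e : ExtendedData n m) : Prop extends P.IsExtendedControl e where
  canonical : ∀ᵐ s ∂(volume.restrict (Icc 0 e.S)),
    deriv e.φ₀ s + ∑ l ∈ Finset.Icc 1 N, l1 (deriv (e.φ l) s) = 1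

theorem ae_mem_Ioo (a b : ℝ) : ∀ᵐ s ∂(volume.restrict (Icc a b)), s ∈ Ioo a b := by
  rw [← restrict_Ioo_eq_restrict_Icc]
  exact ae_restrict_mem measurableSet_Ioo

namespace IsCanonControl

variable {P} {e : ExtendedData n m} (hC : P.IsCanonControl e)
include hC

theorem clock : IsClock e.φ₀ e.S P.h := by
  obtain ⟨L, hL, -⟩ := hC.lipschitz
  exact ⟨hC.S_pos, P.h_pos, hC.mono, hL.continuousOn, hC.φ₀_zero, hC.φ₀_S⟩

theorem solves_φ₀ : SolvesOn e.φ₀ (deriv e.φ₀) 0 e.S := by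
  obtain ⟨L, hL, -⟩ := hC.lipschitz
  exact LipschitzOnWith.solvesOn_deriv hC.S_pos.le hL

theorem solves_φ {l : ℕ} (hl : l ∈ Finset.Icc 1 N) : SolvesOn (e.φ l) (deriv (e.φ l)) 0 e.S := by
  obtain ⟨L, -, hL⟩ := hC.lipschitz
  exact LipschitzOnWith.solvesOn_deriv hC.S_pos.le (hL l hl)

/-- All terms of the canonical normalization are nonnegative, the first by monotonicity of `φ₀`, so
each of them is at most one. -/
theorem bounds : ∀ᵐ s ∂(volume.restrict (Icc 0 e.S)), 0 ≤ deriv e.φ₀ s ∧ deriv e.φ₀ s ≤ 1 ∧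
    ∀ l ∈ Finset.Icc 1 N, l1 (deriv (e.φ l) s) ≤ 1 := by
  filter_upwards [hC.canonical, ae_mem_Ioo 0 e.S] with s hs hmem
  have h0 : 0 ≤ deriv e.φ₀ s := by
    rw [← derivWithin_of_mem_nhds (Icc_mem_nhds hmem.1 hmem.2)]
    exact hC.mono.derivWithin_nonneg
  have h1 : 0 ≤ ∑ l ∈ Finset.Icc 1 N, l1 (deriv (e.φ l) s) :=
    Finset.sum_nonneg fun _ _ => l1_nonneg _
  refine ⟨h0, by linarith, fun l hl => ?_⟩
  have := Finset.single_le_sum (f := fun l => l1 (deriv (e.φ l) s)) (fun _ _ => l1_nonneg _) hl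
  linarith

theorem φ_bound {l : ℕ} (hl : l ∈ Finset.Icc 1 N) :
    ∀ᵐ s ∂(volume.restrict (Icc 0 e.S)), ‖deriv (e.φ l) s‖ ≤ (1 : NNReal) := by
  filter_upwards [hC.bounds] with s hs
  exact (norm_le_l1 _).trans (hs.2.2 l hl)

theorem φ₀_bound : ∀ᵐ s ∂(volume.restrict (Icc 0 e.S)), ‖deriv e.φ₀ s‖ ≤ (1 : NNReal) := by
  filter_upwards [hC.bounds] with s hs
  rw [Real.norm_of_nonneg hs.1]; exact hs.2.1

theorem integrable_φ {l : ℕ} (hl : l ∈ Finset.Icc 1 N) :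
    IntegrableOn (deriv (e.φ l)) (Icc 0 e.S) := by
  have := (hC.solves_φ hl).intervalIntegrable hC.S_pos.le (hC.φ_bound hl)
  rwa [intervalIntegrable_iff_integrableOn_Icc_of_le hC.S_pos.le] at this

theorem integrable_φ₀ : IntegrableOn (deriv e.φ₀) (Icc 0 e.S) := by
  have := hC.solves_φ₀.intervalIntegrable hC.S_pos.le hC.φ₀_bound
  rwa [intervalIntegrable_iff_integrableOn_Icc_of_le hC.S_pos.le] at this

theorem φ₀_eq_integral {s : ℝ} (hs : s ∈ Icc 0 e.S) : e.φ₀ s = ∫ t in (0)..s, deriv e.φ₀ t := by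
  rw [hC.solves_φ₀.eq_add_integral hC.S_pos.le hC.φ₀_bound s hs, hC.φ₀_zero, zero_add]

/-- The Lipschitz constant in the definition of an extended control is unspecified; the
normalization improves it to one. -/
theorem φ₀_lipschitz : LipschitzOnWith 1 e.φ₀ (Icc 0 e.S) := by
  refine (solvesOn_of_eq_integral hC.S_pos.le (F := deriv e.φ₀) ?_ hC.φ₀_bound fun s hs => ?_).2
  · rw [intervalIntegrable_iff_integrableOn_Icc_of_le hC.S_pos.le]; exact hC.integrable_φ₀
  · rw [hC.φ₀_zero, zero_add]; exact hC.φ₀_eq_integral hs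

theorem deriv_φ₀_eq_zero {r : ℝ} (hr : r ∈ Icc 0 P.h) {s : ℝ}
    (hs : s ∈ Ioo (lo e.φ₀ e.S r) (hi e.φ₀ e.S r)) : deriv e.φ₀ s = 0 := by
  have : e.φ₀ =ᶠ[𝓝 s] fun _ => r := by
    filter_upwards [Ioo_mem_nhds hs.1 hs.2] with t ht
    exact hC.clock.apply_eq hr (Ioo_subset_Icc_self ht)
  rw [this.deriv_eq]; simp

theorem ae_deriv_φ₀_uset :
    ∀ᵐ s ∂(volume.restrict (uset e.φ₀ e.S P.h)), deriv e.φ₀ s = 0 := by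
  rw [uset, ae_restrict_biUnion_iff _ hC.clock.countable_jset]
  intro r hr
  filter_upwards [ae_mem_Ioo (lo e.φ₀ e.S r) (hi e.φ₀ e.S r)] with s hs
  exact hC.deriv_φ₀_eq_zero hr.1 hs

end IsCanonControl

/-- The measures and the densities of an impulse control, described through the velocities of a
canonical extended control. -/
structure Linked (p : ImpulseData n m) (e : ExtendedData n m) : Prop extends
    P.IsCanonControl e where
  ω_eq : ∀ r ∈ Icc 0 P.h, ∀ l ∈ Finset.Icc 1 N, ∀ᵐ s ∂(volume.restrict (Icc (0 : ℝ) 1)),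
    p.ω r l s = (hi e.φ₀ e.S r - lo e.φ₀ e.S r) •
      deriv (e.φ l) ((hi e.φ₀ e.S r - lo e.φ₀ e.S r) * s + lo e.φ₀ e.S r)
  μ_eq : ∀ j A, MeasurableSet A → p.μ j A = ∑ l ∈ Finset.Icc 1 N,
    ∫ s in Icc 0 e.S ∩ {s | ((l : ℝ) - 1) * P.h + e.φ₀ s ∈ A}, deriv (e.φ l) s j
  ν_eq : ∀ A, MeasurableSet A → p.ν A = ∑ l ∈ Finset.Icc 1 N,
    ∫⁻ s in Icc 0 e.S ∩ {s | ((l : ℝ) - 1) * P.h + e.φ₀ s ∈ A},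
      ENNReal.ofReal (l1 (deriv (e.φ l) s))

/-- The extended times are translates of `φ₀`. -/
theorem tau_eq_of_solution {e : ExtendedData n m} (hC : P.IsCanonControl e)
    (hτ : ∀ l ∈ Finset.Icc 1 N, SolvesOn (e.τ l) (deriv e.φ₀) 0 e.S)
    (h1 : e.τ 1 0 = 0) (h2 : ∀ l ∈ Finset.Icc 2 N, e.τ l 0 = e.τ (l - 1) e.S) :
    ∀ l ∈ Finset.Icc 1 N, ∀ s ∈ Icc 0 e.S, e.τ l s = ((l : ℝ) - 1) * P.h + e.φ₀ s := by
  have hS := hC.S_pos.le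
  have hrep : ∀ l ∈ Finset.Icc 1 N, ∀ s ∈ Icc 0 e.S, e.τ l s = e.τ l 0 + e.φ₀ s := by
    intro l hl s hs
    rw [(hτ l hl).eq_add_integral hS hC.φ₀_bound s hs, hC.φ₀_eq_integral hs]
  have h0 : ∀ l : ℕ, 1 ≤ l → l ≤ N → e.τ l 0 = ((l : ℝ) - 1) * P.h := by
    intro l hl
    induction l, hl using Nat.le_induction with
    | base => intro _; simp [h1]
    | succ l hl ih =>
      intro hlN
      have e1 := h2 (l + 1) (Finset.mem_Icc.2 ⟨by omega, hlN⟩)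
      rw [Nat.add_sub_cancel] at e1
      rw [e1, hrep l (Finset.mem_Icc.2 ⟨hl, by omega⟩) e.S ⟨hS, le_rfl⟩, ih (by omega),
        hC.φ₀_S]
      push_cast; ring
  intro l hl s hs
  rw [hrep l hl s hs, h0 l (Finset.mem_Icc.1 hl).1 (Finset.mem_Icc.1 hl).2]

variable {P}

section Global

variable {e : ExtendedData n m} (hC : P.IsCanonControl e)
  (hτ : ∀ l ∈ Finset.Icc 1 N, ∀ s ∈ Icc 0 e.S, e.τ l s = ((l : ℝ) - 1) * P.h + e.φ₀ s)
include hC hτ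

theorem concat_tau : (∀ l ∈ Finset.Icc 1 N, ∀ s ∈ Icc 0 e.S,
      concat N e.S e.τ (((l : ℝ) - 1) * e.S + s) = ((l : ℝ) - 1) * P.h + e.φ₀ s) ∧
    IsClock (concat N e.S e.τ) (N * e.S) P.T :=
  hC.clock.concat P.one_le_N hC.φ₀_lipschitz hτ

omit hτ in
theorem measurableSet_block {A : Set ℝ} (hA : MeasurableSet A)
    (l : ℕ) : MeasurableSet (Icc 0 e.S ∩ {s | ((l : ℝ) - 1) * P.h + e.φ₀ s ∈ A}) :=
  hC.clock.measurableSet_preimage (A := (fun r => ((l : ℝ) - 1) * P.h + r) ⁻¹' A)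
    ((measurable_const_add _) hA)

theorem integral_concat_φ {A : Set ℝ} (hA : MeasurableSet A) (j : Fin m) :
    ∫ s in Icc 0 (N * e.S) ∩ concat N e.S e.τ ⁻¹' A, deriv (concat N e.S e.φ) s j
      = ∑ l ∈ Finset.Icc 1 N,
        ∫ s in Icc 0 e.S ∩ {s | ((l : ℝ) - 1) * P.h + e.φ₀ s ∈ A}, deriv (e.φ l) s j := by
  obtain ⟨hval, hT⟩ := concat_tau hC hτ
  refine setIntegral_concat hC.S_pos (fun l hl s hs => ?_) (fun l hl s hs => ?_)
    (hT.measurableSet_preimage hA) (fun l _ => measurableSet_block hC hA l)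
    (fun l hl => Integrable.eval (hC.integrable_φ hl) j)
  · rw [← hval l hl s (Ioo_subset_Icc_self hs)]
  · rw [deriv_concat _ hl hs]

theorem lintegral_concat_φ {A : Set ℝ} (hA : MeasurableSet A) :
    ∫⁻ s in Icc 0 (N * e.S) ∩ concat N e.S e.τ ⁻¹' A,
        ENNReal.ofReal (l1 (deriv (concat N e.S e.φ) s))
      = ∑ l ∈ Finset.Icc 1 N, ∫⁻ s in Icc 0 e.S ∩ {s | ((l : ℝ) - 1) * P.h + e.φ₀ s ∈ A},
        ENNReal.ofReal (l1 (deriv (e.φ l) s)) := by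
  obtain ⟨hval, hT⟩ := concat_tau hC hτ
  refine setLIntegral_concat hC.S_pos (fun l hl s hs => ?_) (fun l hl s hs => ?_)
    (hT.measurableSet_preimage hA) (fun l _ => measurableSet_block hC hA l)
  · rw [← hval l hl s (Ioo_subset_Icc_self hs)]
  · rw [deriv_concat _ hl hs]

omit hτ in
theorem ae_block {q : ℝ → Prop} {ql : ℕ → ℝ → Prop}
    (h : ∀ l ∈ Finset.Icc 1 N, ∀ s ∈ Ioo 0 e.S, ql l s → q (((l : ℝ) - 1) * e.S + s))
    (hq : ∀ l ∈ Finset.Icc 1 N, ∀ᵐ s ∂(volume.restrict (Icc 0 e.S)), ql l s) :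
    ∀ᵐ s ∂(volume.restrict (Icc 0 (N * e.S))), q s := by
  rw [← restrict_Ico_eq_restrict_Icc, volume_restrict_blocks hC.S_pos.le, ← Measure.sum_coe_finset,
    Measure.ae_sum_iff]
  rintro ⟨l, hl⟩
  rw [(measurableEmbedding_addLeft (((l : ℝ) - 1) * e.S)).ae_map_iff,
    restrict_Ico_eq_restrict_Icc]
  filter_upwards [hq l hl, ae_mem_Ioo 0 e.S] with s hs hm
  exact h l hl s hm hs

omit hτ in
theorem integrable_concat_φ :
    IntegrableOn (deriv (concat N e.S e.φ)) (Icc 0 (N * e.S)) := by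
  refine Integrable.of_bound (measurable_deriv _).aestronglyMeasurable 1 ?_
  refine ae_block hC (ql := fun l s => ‖deriv (e.φ l) s‖ ≤ 1) (fun l hl s hs h => ?_)
    fun l hl => hC.φ_bound hl
  rwa [deriv_concat _ hl hs]

/-- The times at which `τ̃ ≤ t` form the interval `[0, σ̃⁺(t)]`. Taking the right limit instead of
`σ̃(t)` matters only at `t = 0`, where `σ̃(0) = 0` by convention and an initial impulse would be
lost. -/
theorem integral_limR_eq {A : Set ℝ} {t : ℝ} (ht : t ∈ Icc 0 P.T) (j : Fin m)
    (hA : A = Icc 0 t) :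
    ∫ s in (0)..(limR P.T (P.sigmaT e) t), deriv (concat N e.S e.φ) s j
      = ∑ l ∈ Finset.Icc 1 N,
        ∫ s in Icc 0 e.S ∩ {s | ((l : ℝ) - 1) * P.h + e.φ₀ s ∈ A}, deriv (e.φ l) s j := by
  obtain ⟨hval, hT⟩ := concat_tau hC hτ
  subst hA
  rw [← integral_concat_φ hC hτ measurableSet_Icc, hT.preimage_Icc ht,
    hT.limR_eq (A := P.sigmaT e) (fun r hr => hT.rightInv_eq hr) ht,
    intervalIntegral.integral_of_le (IsClock.hi_nonneg _ _ _), integral_Icc_eq_integral_Ioc]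

theorem lintegral_limR_eq {A : Set ℝ} {t : ℝ} (ht : t ∈ Icc 0 P.T) (hA : A = Icc 0 t) :
    ENNReal.ofReal (∫ s in (0)..(limR P.T (P.sigmaT e) t), l1 (deriv (concat N e.S e.φ) s))
      = ∑ l ∈ Finset.Icc 1 N, ∫⁻ s in Icc 0 e.S ∩ {s | ((l : ℝ) - 1) * P.h + e.φ₀ s ∈ A},
        ENNReal.ofReal (l1 (deriv (e.φ l) s)) := by
  obtain ⟨hval, hT⟩ := concat_tau hC hτ
  subst hA
  rw [← lintegral_concat_φ hC hτ measurableSet_Icc, hT.preimage_Icc ht,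
    hT.limR_eq (A := P.sigmaT e) (fun r hr => hT.rightInv_eq hr) ht,
    intervalIntegral.integral_of_le (IsClock.hi_nonneg _ _ _), ← integral_Icc_eq_integral_Ioc,
    ofReal_integral_eq_lintegral_ofReal]
  · refine integrable_l1 ((integrable_concat_φ hC).mono_set ?_)
    exact Icc_subset_Icc le_rfl (hT.hi_spec ht).1.2
  · exact Eventually.of_forall fun s => l1_nonneg _

omit hτ in
theorem exists_push_μ (j : Fin m) : ∃ μ : SignedMeasure ℝ,
    (∀ A, MeasurableSet A → μ A = ∑ l ∈ Finset.Icc 1 N,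
      ∫ s in Icc 0 e.S ∩ {s | ((l : ℝ) - 1) * P.h + e.φ₀ s ∈ A}, deriv (e.φ l) s j) ∧
    μ.totalVariation (Icc 0 P.T)ᶜ = 0 := by
  have hex : ∀ l : ℕ, ∃ μ : SignedMeasure ℝ, l ∈ Finset.Icc 1 N → ∀ A, MeasurableSet A →
      μ A = ∫ s in Icc 0 e.S ∩ {s | ((l : ℝ) - 1) * P.h + e.φ₀ s ∈ A}, deriv (e.φ l) s j := by
    intro l
    by_cases hl : l ∈ Finset.Icc 1 N
    · obtain ⟨μ, hμ⟩ := exists_signedMeasure_map (lam := volume.restrict (Icc 0 e.S))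
        (φ := fun s => ((l : ℝ) - 1) * P.h + e.φ₀ s)
        (hC.clock.aemeasurable.const_add _) (Integrable.eval (hC.integrable_φ hl) j)
      refine ⟨μ, fun _ A hA => ?_⟩
      rw [hμ A hA, Measure.restrict_restrict' measurableSet_Icc, inter_comm]; rfl
    · exact ⟨0, fun h => absurd h hl⟩
  choose μl hμl using hex
  have hμ : ∀ A, MeasurableSet A → (∑ l ∈ Finset.Icc 1 N, μl l) A = ∑ l ∈ Finset.Icc 1 N,
      ∫ s in Icc 0 e.S ∩ {s | ((l : ℝ) - 1) * P.h + e.φ₀ s ∈ A}, deriv (e.φ l) s j := by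
    intro A hA
    have : ∀ s : Finset ℕ, (∑ l ∈ s, μl l) A = ∑ l ∈ s, μl l A := by
      intro s
      induction s using Finset.induction_on with
      | empty => simp
      | insert a s ha ih => rw [Finset.sum_insert ha, Finset.sum_insert ha, ← ih]; rfl
    rw [this]
    exact Finset.sum_congr rfl fun l hl => hμl l hl A hA
  refine ⟨_, hμ, ?_⟩
  set μ := ∑ l ∈ Finset.Icc 1 N, μl l
  have h0 : ∀ B, MeasurableSet B → B ⊆ (Icc 0 P.T)ᶜ → μ B = 0 := by
    intro B hB hBT
    rw [hμ B hB]
    refine Finset.sum_eq_zero fun l hl => ?_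
    have : Icc 0 e.S ∩ {s | ((l : ℝ) - 1) * P.h + e.φ₀ s ∈ B} = ∅ := by
      ext s
      simp only [mem_inter_iff, mem_ofPred_eq, mem_empty_iff_false, iff_false, not_and]
      intro hs hB'
      exact hBT hB' (block_mem P.h_pos.le hl (hC.clock.mem_Icc hs))
    simp [this]
  -- A signed measure can vanish on a set without its variation doing so. Vanishing on every
  -- measurable subset of the complement shows that `μ` is its own restriction to `[0, T]`, and
  -- variation commutes with restriction.
  have hr : μ = μ.restrict (Icc 0 P.T) := by
    ext B hB
    rw [VectorMeasure.restrict_apply _ measurableSet_Icc hB,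
      ← VectorMeasure.of_add_of_sdiff (v := μ) (hB.inter measurableSet_Icc) hB inter_subset_left,
      h0 _ (hB.diff (hB.inter measurableSet_Icc)) (fun t ht h' => ht.2 ⟨ht.1, h'⟩), add_zero]
  rw [SignedMeasure.totalVariation_eq_variation]
  rw [hr, VectorMeasure.variation_restrict measurableSet_Icc,
    Measure.restrict_apply measurableSet_Icc.compl]
  simp

end Global

end DelaySystem

/-! ### Splitting measures on `[0, h]` into interior and endpoints. -/

theorem measure_eq_Ioo_add_ends {κ : Measure ℝ} {h : ℝ} (hh : 0 < h) (hκ : κ (Icc 0 h)ᶜ = 0)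
    {A : Set ℝ} (hA : MeasurableSet A) :
    κ A = κ (A ∩ Ioo 0 h) + A.indicator (fun _ => κ {0}) 0 + A.indicator (fun _ => κ {h}) h := by
  have e1 : ∀ a, κ (A ∩ {a}) = A.indicator (fun _ => κ {a}) a := by
    intro a
    by_cases ha : a ∈ A
    · rw [indicator_of_mem ha, inter_eq_right.2 (singleton_subset_iff.2 ha)]
    · rw [indicator_of_notMem ha, inter_singleton_eq_empty.2 ha, measure_empty]
  have e2 : κ A = κ (A ∩ Icc 0 h) := by
    have h1 := measure_inter_add_sdiff (μ := κ) A (measurableSet_Icc (a := 0) (b := h))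
    rw [measure_mono_null (s := A \ Icc 0 h) (fun t ht => ht.2) hκ, add_zero] at h1
    exact h1.symm
  have e3 : A ∩ Icc 0 h = (A ∩ Ioo 0 h ∪ A ∩ {0}) ∪ A ∩ {h} := by
    rw [← inter_union_distrib_left, ← inter_union_distrib_left]
    congr 1
    ext t
    simp only [mem_Icc, mem_union, mem_Ioo, mem_singleton_iff]
    constructor
    · rintro ⟨h1, h2⟩
      rcases h1.eq_or_lt with h3 | h3
      · exact Or.inl (Or.inr h3.symm)
      · rcases h2.eq_or_lt with h4 | h4
        · exact Or.inr h4
        · exact Or.inl (Or.inl ⟨h3, h4⟩)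
    · rintro ((⟨h1, h2⟩ | rfl) | rfl)
      · exact ⟨h1.le, h2.le⟩
      · exact ⟨le_rfl, hh.le⟩
      · exact ⟨hh.le, le_rfl⟩
  rw [e2, e3, measure_union _ (hA.inter (measurableSet_singleton h)),
    measure_union _ (hA.inter (measurableSet_singleton 0)), e1, e1]
  · refine Set.disjoint_left.2 ?_
    rintro t ⟨-, h1⟩ ⟨-, rfl⟩
    exact lt_irrefl _ h1.1
  · refine Set.disjoint_left.2 ?_
    rintro t (⟨-, h1⟩ | ⟨-, rfl⟩) ⟨-, h2⟩
    · rw [mem_singleton_iff] at h2; linarith [h1.2]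
    · rw [mem_singleton_iff] at h2; linarith

theorem signedMeasure_eq_Ioo_add_ends {κ : SignedMeasure ℝ} {h : ℝ} (hh : 0 < h)
    (hκ : ∀ B, MeasurableSet B → B ⊆ (Icc 0 h)ᶜ → κ B = 0) {A : Set ℝ} (hA : MeasurableSet A) :
    κ A = κ (A ∩ Ioo 0 h) + A.indicator (fun _ => κ {0}) 0 + A.indicator (fun _ => κ {h}) h := by
  have e1 : ∀ a, κ (A ∩ {a}) = A.indicator (fun _ => κ {a}) a := by
    intro a
    by_cases ha : a ∈ A
    · rw [indicator_of_mem ha, inter_eq_right.2 (singleton_subset_iff.2 ha)]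
    · rw [indicator_of_notMem ha, inter_singleton_eq_empty.2 ha, VectorMeasure.empty]
  have hsplit : ∀ B C : Set ℝ, MeasurableSet B → MeasurableSet C →
      κ B = κ (B ∩ C) + κ (B \ C) := by
    intro B C hB hC
    rw [← VectorMeasure.of_add_of_sdiff (v := κ) (hB.inter hC) hB inter_subset_left,
      Set.sdiff_self_inter]
  have m1 : MeasurableSet (A \ Ioo 0 h) := hA.diff measurableSet_Ioo
  have m2 : MeasurableSet ((A \ Ioo 0 h) \ {0}) := m1.diff (measurableSet_singleton 0)
  rw [hsplit A _ hA (measurableSet_Ioo (a := 0) (b := h)),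
    hsplit (A \ Ioo 0 h) {0} m1 (measurableSet_singleton 0),
    hsplit ((A \ Ioo 0 h) \ {0}) {h} m2 (measurableSet_singleton h),
    hκ (((A \ Ioo 0 h) \ {0}) \ {h}) (m2.diff (measurableSet_singleton h)), add_zero, ← e1, ← e1,
    add_assoc]
  · congr 3
    · ext t
      simp only [mem_inter_iff, Set.mem_sdiff, mem_Ioo, mem_singleton_iff]
      constructor
      · rintro ⟨⟨h1, -⟩, h2⟩; exact ⟨h1, h2⟩
      · rintro ⟨h1, rfl⟩; exact ⟨⟨h1, by simp⟩, rfl⟩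
    · ext t
      simp only [mem_inter_iff, Set.mem_sdiff, mem_Ioo, mem_singleton_iff]
      constructor
      · rintro ⟨⟨⟨h1, -⟩, -⟩, h2⟩; exact ⟨h1, h2⟩
      · rintro ⟨h1, rfl⟩; exact ⟨⟨⟨h1, by simp⟩, hh.ne'⟩, rfl⟩
  · rintro t ⟨⟨⟨-, h1⟩, h2⟩, h3⟩ h4
    rw [mem_singleton_iff] at h2 h3
    exact h1 ⟨lt_of_le_of_ne h4.1 (Ne.symm h2), lt_of_le_of_ne h4.2 h3⟩

theorem tendsto_measure_Iic (κ : Measure ℝ) [IsFiniteMeasure κ] (a : ℝ) :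
    Tendsto (fun r => κ (Iic r)) (𝓝[>] a) (𝓝 (κ (Iic a))) := by
  have h := tendsto_measure_biInter_gt (μ := κ) (s := fun r : ℝ => Iic r) (a := a)
    (fun r _ => measurableSet_Iic.nullMeasurableSet) (fun i j _ hij => Iic_subset_Iic.2 hij)
    ⟨a + 1, by simp, measure_ne_top _ _⟩
  have : ⋂ r > a, Iic r = Iic a := by
    ext t
    simp only [mem_iInter, mem_Iic]
    exact ⟨fun h => le_of_forall_gt_imp_ge_of_dense h, fun h r hr => h.trans hr.le⟩
  rwa [this] at h

namespace DelaySystem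

variable {n m N M : ℕ} (P : DelaySystem n m N M)

/-! ### The measures `μ_l` and `ν_l` -/

theorem muL_apply (p : ImpulseData n m) (l : ℕ) (j : Fin m) {A : Set ℝ} (hA : MeasurableSet A) :
    P.muL p l j A
      = p.μ j ((fun t => t - ((l : ℝ) - 1) * P.h) ⁻¹' A ∩ Ioo (((l : ℝ) - 1) * P.h) (l * P.h))
        + A.indicator (fun _ => ∫ s in (0)..1, p.ω 0 l s j) 0
        + A.indicator (fun _ => ∫ s in (0)..1, p.ω P.h l s j) P.h := by
  have hm : Measurable fun t => t - ((l : ℝ) - 1) * P.h := by fun_prop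
  have hd : ∀ c a : ℝ, (c • (Measure.dirac a).toSignedMeasure) A = A.indicator (fun _ => c) a := by
    intro c a
    rw [_root_.smul_apply, Measure.toSignedMeasure_apply_measurable hA, measureReal_def,
      Measure.dirac_apply' _ hA]
    by_cases ha : a ∈ A <;> simp [ha]
  unfold muL
  rw [_root_.add_apply, _root_.add_apply, hd, hd,
    VectorMeasure.map_apply _ hm hA, VectorMeasure.restrict_apply _ measurableSet_Ioo (hm hA)]

theorem nuL_apply (p : ImpulseData n m) (l : ℕ) {A : Set ℝ} (hA : MeasurableSet A) :
    P.nuL p l A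
      = p.ν ((fun t => t - ((l : ℝ) - 1) * P.h) ⁻¹' A ∩ Ioo (((l : ℝ) - 1) * P.h) (l * P.h))
        + A.indicator (fun _ => ENNReal.ofReal (∫ s in (0)..1, l1 (p.ω 0 l s))) 0
        + A.indicator (fun _ => ENNReal.ofReal (∫ s in (0)..1, l1 (p.ω P.h l s))) P.h := by
  have hm : Measurable fun t => t - ((l : ℝ) - 1) * P.h := by fun_prop
  have hd : ∀ (c : ENNReal) (a : ℝ), c * (Measure.dirac a) A = A.indicator (fun _ => c) a := by
    intro c a
    rw [Measure.dirac_apply' _ hA]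
    by_cases ha : a ∈ A <;> simp [ha]
  unfold nuL
  simp only [Measure.add_apply, Measure.smul_apply, smul_eq_mul]
  rw [hd, hd, Measure.map_apply hm hA, Measure.restrict_apply (hm hA)]

theorem isFiniteMeasure_nuL (p : ImpulseData n m) (hp : IsFiniteMeasure p.ν) (l : ℕ) :
    IsFiniteMeasure (P.nuL p l) := by
  refine ⟨?_⟩
  rw [P.nuL_apply p l MeasurableSet.univ]
  simp only [indicator_univ]
  exact ENNReal.add_lt_top.2 ⟨ENNReal.add_lt_top.2 ⟨measure_lt_top _ _, ENNReal.ofReal_lt_top⟩,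
    ENNReal.ofReal_lt_top⟩

theorem nuL_compl (p : ImpulseData n m) (l : ℕ) : P.nuL p l (Icc 0 P.h)ᶜ = 0 := by
  have hh := P.h_pos.le
  rw [P.nuL_apply p l measurableSet_Icc.compl, indicator_of_notMem (by simp [hh]),
    indicator_of_notMem (by simp [hh]), add_zero, add_zero]
  refine measure_mono_null (t := ∅) (fun t ht => ?_) measure_empty
  exact ht.1 ⟨by linarith [ht.2.1], by linarith [ht.2.2]⟩

theorem nuL_Iic (p : ImpulseData n m) (l : ℕ) (a : ℝ) :
    P.nuL p l (Iic a) = P.nuL p l (Icc 0 a) := by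
  refine le_antisymm ?_ (measure_mono Icc_subset_Iic_self)
  refine (measure_mono (t := Icc 0 a ∪ (Icc 0 P.h)ᶜ) fun t ht => ?_).trans
    ((measure_union_le _ _).trans (by rw [P.nuL_compl, add_zero]))
  by_cases h0 : 0 ≤ t
  · exact Or.inl ⟨h0, ht⟩
  · exact Or.inr fun h' => h0 h'.1

theorem muL_compl (p : ImpulseData n m) (l : ℕ) (j : Fin m) (B : Set ℝ) (hB : MeasurableSet B)
    (hBh : B ⊆ (Icc 0 P.h)ᶜ) : P.muL p l j B = 0 := by
  have hh := P.h_pos.le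
  rw [P.muL_apply p l j hB, indicator_of_notMem (fun h => hBh h ⟨le_rfl, hh⟩),
    indicator_of_notMem (fun h => hBh h ⟨hh, le_rfl⟩), add_zero, add_zero]
  have : (fun t => t - ((l : ℝ) - 1) * P.h) ⁻¹' B ∩ Ioo (((l : ℝ) - 1) * P.h) (l * P.h) = ∅ := by
    ext t
    simp only [mem_inter_iff, mem_preimage, mem_empty_iff_false, iff_false]
    rintro ⟨h1, h2⟩
    exact hBh h1 ⟨by linarith [h2.1], by linarith [h2.2]⟩
  rw [this, VectorMeasure.empty]

/-! ### The function `ϕ` and its right inverse -/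

section Phi

variable {P} {p : ImpulseData n m} {φ : ℝ → ℝ} {S : ℝ} (hc : IsClock φ S P.h)
  (hphi : ∀ r ∈ Ioc 0 P.h, P.phi p r = hi φ S r)
include hc hphi

omit hc hphi in
theorem phi_zero (P : DelaySystem n m N M) (p : ImpulseData n m) : P.phi p 0 = 0 := by
  simp [phi]

theorem phiL_eq {r : ℝ} (hr : r ∈ Icc 0 P.h) : P.phiL p r = lo φ S r :=
  hc.limL_eq (phi_zero P p) (fun r hr => hphi r (Ioo_subset_Ioc_self hr)) hr

theorem phiR_eq {r : ℝ} (hr : r ∈ Icc 0 P.h) : P.phiR p r = hi φ S r := hc.limR_eq hphi hr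

/-- The one-sided limits of `ϕ` at `r` are `lo r` and `hi r`, with the left one absent at `0` and
the right one absent at `h`. The value is `hi r` for `r > 0` and `ϕ(0) = 0 = lo 0`, so continuity
fails exactly when `lo r < hi r`. -/
theorem jumpSet_eq : P.jumpSet p = jset φ S P.h := by
  have hh := P.h_pos
  ext r
  simp only [jumpSet, jset, mem_ofPred_eq, and_congr_right_iff]
  intro hr
  have hval : P.phi p r = hi φ S r ∨ (r = 0 ∧ P.phi p r = lo φ S r) := by
    rcases hr.1.eq_or_lt with h0 | h0
    · right; subst h0; exact ⟨rfl, by rw [phi_zero, hc.lo_zero]⟩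
    · left; exact hphi r ⟨h0, hr.2⟩
  constructor
  · intro hnc
    by_contra hcon
    have heq : lo φ S r = hi φ S r := le_antisymm (hc.lo_le_hi hr) (not_lt.1 hcon)
    have hv : P.phi p r = hi φ S r := by
      rcases hval with h | ⟨-, h⟩
      · exact h
      · rw [h, heq]
    apply hnc
    rw [← Icc_union_Icc_eq_Icc hr.1 hr.2]
    refine ContinuousWithinAt.union ?_ ?_
    · rcases hr.1.eq_or_lt with h0 | h0
      · rw [← h0]; simp [continuousWithinAt_singleton]
      · rw [← Ico_insert_right hr.1, continuousWithinAt_insert_self, ContinuousWithinAt, hv, ← heq]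
        have hle : 𝓝[Ico 0 r] r ≤ 𝓝[<] r := nhdsWithin_mono _ fun t ht => ht.2
        refine ((hc.tendsto_hi_left ⟨h0, hr.2⟩).mono_left hle).congr' ?_
        have : Ioi (0 : ℝ) ∈ 𝓝[Ico 0 r] r := mem_nhdsWithin_of_mem_nhds (Ioi_mem_nhds h0)
        filter_upwards [this, self_mem_nhdsWithin] with t ht ht'
        exact (hphi t ⟨ht, ht'.2.le.trans hr.2⟩).symm
    · rcases hr.2.eq_or_lt with h0 | h0
      · rw [h0]; simp [continuousWithinAt_singleton]
      · rw [← Ioc_insert_left hr.2, continuousWithinAt_insert_self, ContinuousWithinAt, hv]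
        have hle : 𝓝[Ioc r P.h] r ≤ 𝓝[>] r := nhdsWithin_mono _ fun t ht => ht.1
        refine ((hc.tendsto_hi_right ⟨hr.1, h0⟩).mono_left hle).congr' ?_
        filter_upwards [self_mem_nhdsWithin] with t ht
        exact (hphi t ⟨hr.1.trans_lt ht.1, ht.2⟩).symm
  · intro hlt hcont
    rcases hr.1.eq_or_lt with h0 | h0
    · subst h0
      have h1 : Tendsto (P.phi p) (𝓝[>] 0) (𝓝 (P.phi p 0)) :=
        Tendsto.mono_left hcont (by
          rw [← nhdsWithin_Ioo_eq_nhdsGT hh]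
          exact nhdsWithin_mono _ Ioo_subset_Icc_self)
      have h2 : Tendsto (P.phi p) (𝓝[>] 0) (𝓝 (hi φ S 0)) := by
        refine (hc.tendsto_hi_right ⟨le_rfl, hh⟩).congr' ?_
        filter_upwards [Ioo_mem_nhdsGT hh] with t ht
        exact (hphi t ⟨ht.1, ht.2.le⟩).symm
      have := tendsto_nhds_unique h1 h2
      rw [phi_zero] at this
      rw [hc.lo_zero] at hlt
      linarith
    · have h1 : Tendsto (P.phi p) (𝓝[<] r) (𝓝 (P.phi p r)) :=
        Tendsto.mono_left hcont (by
          rw [← nhdsWithin_Ioo_eq_nhdsLT h0]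
          exact nhdsWithin_mono _ fun t ht => ⟨ht.1.le, ht.2.le.trans hr.2⟩)
      have h2 : Tendsto (P.phi p) (𝓝[<] r) (𝓝 (lo φ S r)) := by
        refine (hc.tendsto_hi_left ⟨h0, hr.2⟩).congr' ?_
        filter_upwards [Ioo_mem_nhdsLT h0] with t ht
        exact (hphi t ⟨ht.1, ht.2.le.trans hr.2⟩).symm
      have := tendsto_nhds_unique h1 h2
      rw [hphi r ⟨h0, hr.2⟩] at this
      linarith

theorem sigmaUnion_eq : P.sigmaUnion p = uset φ S P.h := by
  unfold sigmaUnion uset sigmaSet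
  rw [jumpSet_eq hc hphi]
  refine iUnion₂_congr fun r hr => ?_
  rw [phiL_eq hc hphi hr.1, phiR_eq hc hphi hr.1]

/-- Inversion is an involution here: `s < hi b` for every `b > φ s`, while `s < hi b` forces `φ s ≤
b`, so the infimum of such `b` is `φ s`. -/
theorem rightInv_phi_eq {s : ℝ} (hs : s ∈ Icc 0 S) :
    rightInv (P.phi p) 0 P.h 0 S s = φ s := by
  have hh := P.h_pos
  unfold rightInv
  split_ifs with h0 h1
  · rw [h0, hc.zero]
  · rw [h1, hc.last]
  · have hs0 : 0 < s := lt_of_le_of_ne hs.1 (Ne.symm h0)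
    have hsS : s < S := lt_of_le_of_ne hs.2 h1
    have hφ := hc.mem_Icc hs
    apply le_antisymm
    · refine le_of_forall_gt_imp_ge_of_dense fun b hb => ?_
      have hbdd : BddBelow {t | t ∈ Icc 0 P.h ∧ s < P.phi p t} := ⟨0, fun x hx => hx.1.1⟩
      rcases le_total P.h b with hb' | hb'
      · refine (csInf_le hbdd ⟨⟨hh.le, le_rfl⟩, ?_⟩).trans hb'
        rw [hphi P.h ⟨hh, le_rfl⟩, hc.hi_last]
        exact hsS
      · have hbm : b ∈ Icc 0 P.h := ⟨hφ.1.trans hb.le, hb'⟩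
        refine csInf_le hbdd ⟨hbm, ?_⟩
        rw [hphi b ⟨hφ.1.trans_lt hb, hb'⟩]
        have h2 := (hc.le_hi_iff hφ hs).2 le_rfl
        exact h2.trans_lt ((hc.hi_lt_lo hφ hbm hb).trans_le (hc.lo_le_hi hbm))
    · refine le_csInf ⟨P.h, ⟨hh.le, le_rfl⟩, ?_⟩ fun b hb => ?_
      · rw [hphi P.h ⟨hh, le_rfl⟩, hc.hi_last]; exact hsS
      · have hb0 : 0 < b := by
          refine lt_of_le_of_ne hb.1.1 fun h' => ?_
          have := hb.2
          rw [← h', phi_zero] at this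
          linarith
        have := hb.2
        rw [hphi b ⟨hb0, hb.1.2⟩] at this
        exact (hc.le_hi_iff hb.1 hs).1 this.le

/-- For `a ∈ (0, h]` the preimage of `(-∞, a]` under the clock is `[0, hi a]`, of length `hi a =
ϕ(a) = a + ∑ ν_l([0, a])`. Agreement on half-lines suffices. -/
theorem dphi_eq (hν : IsFiniteMeasure p.ν) : P.dphi p = (volume.restrict (Icc 0 S)).map φ := by
  have hh := P.h_pos
  have hfin : ∀ l, IsFiniteMeasure (P.nuL p l) := P.isFiniteMeasure_nuL p hν
  have : IsFiniteMeasure (P.dphi p) := by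
    unfold dphi
    infer_instance
  have hpos : ∀ a ∈ Ioc 0 P.h, P.dphi p (Iic a) = (volume.restrict (Icc 0 S)).map φ (Iic a) := by
    intro a ha
    have ha' : a ∈ Icc 0 P.h := ⟨ha.1.le, ha.2⟩
    rw [Measure.map_apply_of_aemeasurable hc.aemeasurable measurableSet_Iic,
      Measure.restrict_apply₀' measurableSet_Icc.nullMeasurableSet, inter_comm]
    have e1 : Icc 0 S ∩ φ ⁻¹' (Iic a) = Icc 0 (hi φ S a) := by
      rw [← hc.preimage_Icc ha']
      ext s
      simp only [mem_inter_iff, mem_preimage, mem_Iic, mem_Icc]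
      exact ⟨fun h => ⟨h.1, (hc.mem_Icc h.1).1, h.2⟩, fun h => ⟨h.1, h.2.2⟩⟩
    rw [e1, Real.volume_Icc, sub_zero, ← hphi a ha]
    unfold dphi phi
    rw [if_neg ha.1.ne', Measure.add_apply, Measure.finsetSum_apply,
      Measure.restrict_apply measurableSet_Iic,
      ENNReal.ofReal_add ha.1.le (Finset.sum_nonneg fun _ _ => measureReal_nonneg),
      ENNReal.ofReal_sum_of_nonneg fun _ _ => measureReal_nonneg]
    have e2 : Iic a ∩ Icc 0 P.h = Icc 0 a := by
      ext s
      simp only [mem_inter_iff, mem_Iic, mem_Icc]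
      exact ⟨fun h => ⟨h.2.1, h.1⟩, fun h => ⟨h.2, h.1, h.2.trans ha.2⟩⟩
    rw [e2, Real.volume_Icc, sub_zero]
    congr 1
    refine Finset.sum_congr rfl fun l _ => ?_
    rw [P.nuL_Iic, ofReal_measureReal]
  have hcomplR : (volume.restrict (Icc 0 S)).map φ (Icc 0 P.h)ᶜ = 0 := by
    rw [Measure.map_apply_of_aemeasurable hc.aemeasurable measurableSet_Icc.compl,
      Measure.restrict_apply₀' measurableSet_Icc.nullMeasurableSet]
    refine measure_mono_null (t := ∅) (fun s hs => ?_) measure_empty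
    exact hs.1 (hc.mem_Icc hs.2)
  have hcomplL : P.dphi p (Icc 0 P.h)ᶜ = 0 := by
    unfold dphi
    rw [Measure.add_apply, Measure.finsetSum_apply,
      Finset.sum_eq_zero fun l _ => P.nuL_compl p l, Measure.restrict_apply measurableSet_Icc.compl]
    simp
  refine Measure.ext_of_Iic _ _ fun a => ?_
  rcases lt_trichotomy a 0 with h0 | rfl | h0
  · have hsub : Iic a ⊆ (Icc 0 P.h)ᶜ := fun t ht h' => by
      have : t ≤ a := ht
      linarith [h'.1]
    rw [measure_mono_null hsub hcomplR, measure_mono_null hsub hcomplL]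
  -- The convention `ϕ(0) = 0` hides a possible atom at `0`; its mass is recovered from right
  -- continuity of both distribution functions.
  · refine tendsto_nhds_unique (tendsto_measure_Iic (P.dphi p) 0) ?_
    refine (tendsto_measure_Iic ((volume.restrict (Icc 0 S)).map φ) 0).congr' ?_
    filter_upwards [Ioo_mem_nhdsGT hh] with t ht
    exact (hpos t ⟨ht.1, ht.2.le⟩).symm
  · rcases le_total a P.h with h1 | h1
    · exact hpos a ⟨h0, h1⟩
    · have hsplit : ∀ κ : Measure ℝ, κ (Icc 0 P.h)ᶜ = 0 → κ (Iic a) = κ (Iic P.h) := by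
        intro κ hκ
        refine le_antisymm ?_ (measure_mono (Iic_subset_Iic.2 h1))
        refine (measure_mono (t := Iic P.h ∪ (Icc 0 P.h)ᶜ) fun t _ => ?_).trans
          ((measure_union_le _ _).trans (by rw [hκ, add_zero]))
        by_cases ht : t ≤ P.h
        · exact Or.inl ht
        · exact Or.inr fun h' => ht h'.2
      rw [hsplit _ hcomplL, hsplit _ hcomplR]
      exact hpos P.h ⟨hh, le_rfl⟩

end Phi

end DelaySystem

/-! ### Affine rescaling between `[0, 1]` and a stopping interval. -/

theorem ae_comp_mul_add {q : ℝ → Prop} {a b : ℝ} (hab : a < b)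
    (h : ∀ᵐ s ∂(volume.restrict (Icc a b)), q s) :
    ∀ᵐ s ∂(volume.restrict (Icc (0 : ℝ) 1)), q ((b - a) * s + a) := by
  have hc : b - a ≠ 0 := (sub_pos.2 hab).ne'
  rw [ae_restrict_iff' measurableSet_Icc] at h ⊢
  have hq : Measure.QuasiMeasurePreserving (fun s : ℝ => (b - a) * s + a) volume volume := by
    refine ⟨by fun_prop, ?_⟩
    have e : (fun s : ℝ => (b - a) * s + a) = (fun s => s + a) ∘ fun s => (b - a) * s := rfl
    rw [e, ← Measure.map_map (by fun_prop) (by fun_prop), Real.map_volume_mul_left hc,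
      Measure.map_smul, (measurePreserving_add_right volume a).map_eq]
    exact Measure.smul_absolutelyContinuous
  filter_upwards [hq.ae h] with s hs hmem
  refine hs ⟨?_, ?_⟩
  · nlinarith [hmem.1, sub_pos.2 hab]
  · nlinarith [hmem.2, sub_pos.2 hab]

theorem ae_comp_sub_div {q : ℝ → Prop} {a b : ℝ} (hab : a < b)
    (h : ∀ᵐ s ∂(volume.restrict (Icc (0 : ℝ) 1)), q s) :
    ∀ᵐ s ∂(volume.restrict (Icc a b)), q ((s - a) / (b - a)) := by
  have hc : (b - a)⁻¹ ≠ 0 := inv_ne_zero (sub_pos.2 hab).ne'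
  rw [ae_restrict_iff' measurableSet_Icc] at h ⊢
  have hq : Measure.QuasiMeasurePreserving (fun s : ℝ => (s - a) / (b - a)) volume volume := by
    refine ⟨by fun_prop, ?_⟩
    have e : (fun s : ℝ => (s - a) / (b - a)) = (fun s => (b - a)⁻¹ * s) ∘ fun s => s + -a := by
      funext s; simp [div_eq_inv_mul, sub_eq_add_neg]
    rw [e, ← Measure.map_map (by fun_prop) (by fun_prop),
      (measurePreserving_add_right volume (-a)).map_eq, Real.map_volume_mul_left hc]
    exact Measure.smul_absolutelyContinuous
  filter_upwards [hq.ae h] with s hs hmem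
  exact hs ⟨div_nonneg (by linarith [hmem.1]) (by linarith),
    (div_le_one (sub_pos.2 hab)).2 (by linarith [hmem.2])⟩

/-! ### Blocks and the function `ϕ` for linked controls. -/

namespace DelaySystem

variable {n m N M : ℕ} {P : DelaySystem n m N M}

theorem block_eq {A : Set ℝ} {e : ExtendedData n m} (hC : P.IsCanonControl e) (l l' : ℕ) :
    Icc 0 e.S ∩ {s | ((l' : ℝ) - 1) * P.h + e.φ₀ s ∈ (fun t => t - ((l : ℝ) - 1) * P.h) ⁻¹' A ∩
        Ioo (((l : ℝ) - 1) * P.h) (l * P.h)}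
      = if l' = l then Icc 0 e.S ∩ e.φ₀ ⁻¹' (A ∩ Ioo 0 P.h) else ∅ := by
  have hh := P.h_pos
  ext s
  split_ifs with h
  · subst h
    simp only [mem_inter_iff, mem_ofPred_eq, mem_preimage, mem_Ioo, add_sub_cancel_left]
    constructor
    · rintro ⟨h1, h2, h3, h4⟩; exact ⟨h1, h2, by linarith, by linarith⟩
    · rintro ⟨h1, h2, h3, h4⟩; exact ⟨h1, h2, by linarith, by linarith⟩
  · simp only [mem_empty_iff_false, iff_false]
    rintro ⟨h1, h23⟩
    have h2 := h23.2.1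
    have h3 := h23.2.2
    have hm := hC.clock.mem_Icc h1
    rcases lt_or_gt_of_ne h with hl | hl
    · have : (l' : ℝ) + 1 ≤ l := by exact_mod_cast hl
      nlinarith [hm.2]
    · have : (l : ℝ) + 1 ≤ l' := by exact_mod_cast hl
      nlinarith [hm.1]

namespace Linked

variable {p : ImpulseData n m} {e : ExtendedData n m} (hL : P.Linked p e)
include hL

theorem canon : P.IsCanonControl e := hL.toIsCanonControl

/-- Rescaling produces the factor `hi r - lo r` both in `ω` and in the change of variables. Positive
homogeneity of `F` is all that is needed, so the statement covers the coordinates as well as `l1`,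
and also degenerate fibres. -/
theorem ω_eq_interval {r : ℝ} (hr : r ∈ Icc 0 P.h) {l : ℕ} (hl : l ∈ Finset.Icc 1 N)
    {E : Type*} [NormedAddCommGroup E] [NormedSpace ℝ E] {F : (Fin m → ℝ) → E}
    (hF : ∀ c : ℝ, 0 ≤ c → ∀ w, F (c • w) = c • F w) {s : ℝ} (hs : s ∈ Icc (0 : ℝ) 1) :
    ∫ t in (0)..s, F (p.ω r l t) = ∫ t in (lo e.φ₀ e.S r)..
      ((hi e.φ₀ e.S r - lo e.φ₀ e.S r) * s + lo e.φ₀ e.S r), F (deriv (e.φ l) t) := by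
  have hc : 0 ≤ hi e.φ₀ e.S r - lo e.φ₀ e.S r := sub_nonneg.2 (hL.canon.clock.lo_le_hi hr)
  have h1 : ∫ t in (0)..s, F (p.ω r l t) = ∫ t in (0)..s, (hi e.φ₀ e.S r - lo e.φ₀ e.S r) •
      F (deriv (e.φ l) ((hi e.φ₀ e.S r - lo e.φ₀ e.S r) * t + lo e.φ₀ e.S r)) := by
    refine intervalIntegral.integral_congr_ae_restrict ?_
    rw [uIoc_of_le hs.1]
    have := ae_restrict_of_ae_restrict_of_subset (s := Ioc 0 s) (t := Icc (0 : ℝ) 1)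
      (fun t ht => ⟨ht.1.le, ht.2.trans hs.2⟩) (hL.ω_eq r hr l hl)
    filter_upwards [this] with t ht
    rw [ht, hF _ hc]
  rw [h1, intervalIntegral.integral_smul, intervalIntegral.smul_integral_comp_mul_add
    (fun t => F (deriv (e.φ l) t)), mul_zero, zero_add]

theorem integral_ω {r : ℝ} (hr : r ∈ Icc 0 P.h) {l : ℕ} (hl : l ∈ Finset.Icc 1 N) (j : Fin m) :
    ∫ s in (0)..1, p.ω r l s j
      = ∫ s in (lo e.φ₀ e.S r)..(hi e.φ₀ e.S r), deriv (e.φ l) s j := by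
  rw [hL.ω_eq_interval hr hl (F := fun w => w j) (fun c _ w => rfl) ⟨zero_le_one, le_rfl⟩]
  congr 1; ring

theorem integral_l1_ω {r : ℝ} (hr : r ∈ Icc 0 P.h) {l : ℕ} (hl : l ∈ Finset.Icc 1 N) :
    ∫ s in (0)..1, l1 (p.ω r l s)
      = ∫ s in (lo e.φ₀ e.S r)..(hi e.φ₀ e.S r), l1 (deriv (e.φ l) s) := by
  rw [hL.ω_eq_interval hr hl (F := l1) (fun c hc w => by rw [l1_smul, abs_of_nonneg hc]; rfl)
    ⟨zero_le_one, le_rfl⟩]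
  congr 1; ring

theorem integral_l1_singleton {r : ℝ} (hr : r ∈ Icc 0 P.h) {l : ℕ} (hl : l ∈ Finset.Icc 1 N) :
    ∫⁻ s in Icc 0 e.S ∩ e.φ₀ ⁻¹' {r}, ENNReal.ofReal (l1 (deriv (e.φ l) s))
      = ENNReal.ofReal (∫ s in (0)..1, l1 (p.ω r l s)) := by
  have hc := hL.canon.clock
  rw [hL.integral_l1_ω hr hl, hc.preimage_singleton hr,
    intervalIntegral.integral_of_le (hc.lo_le_hi hr), ← integral_Icc_eq_integral_Ioc,
    ofReal_integral_eq_lintegral_ofReal]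
  · exact integrable_l1 ((hL.canon.integrable_φ hl).mono_set (hc.Icc_subset hr))
  · exact Eventually.of_forall fun s => l1_nonneg _

/-- In the open block only the `l`-th term of `ν` is visible. At the two endpoints the mass of `ν`
is shared with the neighbouring blocks, and it is `ω` that records the share of block `l`. -/
theorem nuL_eq {l : ℕ} (hl : l ∈ Finset.Icc 1 N) {A : Set ℝ} (hA : MeasurableSet A) :
    P.nuL p l A = ∫⁻ s in Icc 0 e.S ∩ e.φ₀ ⁻¹' A, ENNReal.ofReal (l1 (deriv (e.φ l) s)) := by
  have hc := hL.canon.clock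
  have hh := P.h_pos
  set w : ℝ → ENNReal := fun s => ENNReal.ofReal (l1 (deriv (e.φ l) s))
  set κ := ((volume.restrict (Icc 0 e.S)).withDensity w).map e.φ₀
  have hae : AEMeasurable e.φ₀ ((volume.restrict (Icc 0 e.S)).withDensity w) :=
    hc.aemeasurable.mono_ac (withDensity_absolutelyContinuous _ _)
  have hκ : ∀ B, MeasurableSet B → κ B = ∫⁻ s in Icc 0 e.S ∩ e.φ₀ ⁻¹' B, w s := by
    intro B hB
    rw [Measure.map_apply_of_aemeasurable hae hB,
      withDensity_apply₀ _ (hc.aemeasurable.nullMeasurableSet_preimage hB),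
      Measure.restrict_restrict' measurableSet_Icc, inter_comm]
  have hκ0 : κ (Icc 0 P.h)ᶜ = 0 := by
    rw [hκ _ measurableSet_Icc.compl]
    have : Icc 0 e.S ∩ e.φ₀ ⁻¹' (Icc 0 P.h)ᶜ = ∅ := by
      ext s
      simp only [mem_inter_iff, mem_preimage, mem_empty_iff_false, iff_false, not_and,
        mem_compl_iff, not_not]
      exact fun hs => hc.mem_Icc hs
    rw [this]; simp
  have hm : MeasurableSet ((fun t => t - ((l : ℝ) - 1) * P.h) ⁻¹' A ∩
      Ioo (((l : ℝ) - 1) * P.h) (l * P.h)) :=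
    ((by fun_prop : Measurable fun t => t - ((l : ℝ) - 1) * P.h) hA).inter measurableSet_Ioo
  rw [← hκ A hA, measure_eq_Ioo_add_ends hh hκ0 hA, P.nuL_apply p l hA, hL.ν_eq _ hm,
    hκ _ (hA.inter measurableSet_Ioo), hκ _ (measurableSet_singleton _),
    hκ _ (measurableSet_singleton _), hL.integral_l1_singleton ⟨le_rfl, hh.le⟩ hl,
    hL.integral_l1_singleton ⟨hh.le, le_rfl⟩ hl]
  congr 2
  rw [Finset.sum_eq_single_of_mem l hl]
  · rw [block_eq hL.canon, if_pos rfl]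
  · intro l' _ hne
    rw [block_eq hL.canon, if_neg hne]; simp

theorem muL_eq {l : ℕ} (hl : l ∈ Finset.Icc 1 N) (j : Fin m) {A : Set ℝ} (hA : MeasurableSet A) :
    P.muL p l j A = ∫ s in Icc 0 e.S ∩ e.φ₀ ⁻¹' A, deriv (e.φ l) s j := by
  have hc := hL.canon.clock
  have hh := P.h_pos
  obtain ⟨κ, hκ'⟩ := exists_signedMeasure_map (lam := volume.restrict (Icc 0 e.S))
    (φ := e.φ₀) hc.aemeasurable (Integrable.eval (hL.canon.integrable_φ hl) j)
  have hκ : ∀ B, MeasurableSet B → κ B = ∫ s in Icc 0 e.S ∩ e.φ₀ ⁻¹' B, deriv (e.φ l) s j := by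
    intro B hB
    rw [hκ' B hB, Measure.restrict_restrict' measurableSet_Icc, inter_comm]
  have hκ0 : ∀ B, MeasurableSet B → B ⊆ (Icc 0 P.h)ᶜ → κ B = 0 := by
    intro B hB hBh
    rw [hκ _ hB]
    have : Icc 0 e.S ∩ e.φ₀ ⁻¹' B = ∅ := by
      ext s
      simp only [mem_inter_iff, mem_preimage, mem_empty_iff_false, iff_false, not_and]
      exact fun hs h' => hBh h' (hc.mem_Icc hs)
    simp [this]
  have hm : MeasurableSet ((fun t => t - ((l : ℝ) - 1) * P.h) ⁻¹' A ∩
      Ioo (((l : ℝ) - 1) * P.h) (l * P.h)) :=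
    ((by fun_prop : Measurable fun t => t - ((l : ℝ) - 1) * P.h) hA).inter measurableSet_Ioo
  have hsing : ∀ r ∈ Icc 0 P.h, κ {r} = ∫ s in (0)..1, p.ω r l s j := by
    intro r hr
    rw [hκ _ (measurableSet_singleton _), hL.integral_ω hr hl, hc.preimage_singleton hr,
      intervalIntegral.integral_of_le (hc.lo_le_hi hr), ← integral_Icc_eq_integral_Ioc]
  rw [← hκ A hA, signedMeasure_eq_Ioo_add_ends hh hκ0 hA, P.muL_apply p l j hA, hL.μ_eq _ _ hm,
    hκ _ (hA.inter measurableSet_Ioo), hsing 0 ⟨le_rfl, hh.le⟩, hsing P.h ⟨hh.le, le_rfl⟩]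
  congr 2
  rw [Finset.sum_eq_single_of_mem l hl]
  · rw [block_eq hL.canon, if_pos rfl]
  · intro l' _ hne
    rw [block_eq hL.canon, if_neg hne]; simp

/-- Write `r = φ₀(hi r)` as the integral of `φ̇₀` over `[0, hi r]` and each `ν_l([0, r])` as the
integral of `‖φ̇_l‖` over the same interval. By the normalization the integrands sum to one, so
`ϕ(r)` is the length `hi r`. -/
theorem phi_eq {r : ℝ} (hr : r ∈ Ioc 0 P.h) : P.phi p r = hi e.φ₀ e.S r := by
  have hc := hL.canon.clock
  have hr' : r ∈ Icc 0 P.h := ⟨hr.1.le, hr.2⟩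
  have hsub : Icc 0 (hi e.φ₀ e.S r) ⊆ Icc 0 e.S := Icc_subset_Icc le_rfl (hc.hi_spec hr').1.2
  have h1 : ∀ l ∈ Finset.Icc 1 N, (P.nuL p l).real (Icc 0 r)
      = ∫ s in Icc 0 (hi e.φ₀ e.S r), l1 (deriv (e.φ l) s) := by
    intro l hl
    have hint : IntegrableOn (fun s => l1 (deriv (e.φ l) s)) (Icc 0 (hi e.φ₀ e.S r)) :=
      integrable_l1 ((hL.canon.integrable_φ hl).mono_set hsub)
    rw [measureReal_def, hL.nuL_eq hl measurableSet_Icc, hc.preimage_Icc hr',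
      ← ofReal_integral_eq_lintegral_ofReal hint (Eventually.of_forall fun s => l1_nonneg _),
      ENNReal.toReal_ofReal (integral_nonneg fun s => l1_nonneg _)]
  have h2 : r = ∫ s in Icc 0 (hi e.φ₀ e.S r), deriv e.φ₀ s := by
    rw [integral_Icc_eq_integral_Ioc,
      ← intervalIntegral.integral_of_le (IsClock.hi_nonneg _ _ _),
      ← hL.canon.φ₀_eq_integral (hc.hi_spec hr').1, (hc.hi_spec hr').2]
  unfold phi
  rw [if_neg hr.1.ne', Finset.sum_congr rfl h1,
    ← integral_finsetSum _ fun l hl => integrable_l1 ((hL.canon.integrable_φ hl).mono_set hsub)]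
  have h4 := integral_add (hL.canon.integrable_φ₀.mono_set hsub) (integrable_finsetSum
    (Finset.Icc 1 N) fun l hl => integrable_l1 ((hL.canon.integrable_φ hl).mono_set hsub))
  rw [← h2] at h4
  rw [← h4]
  have h3 : ∫ s in Icc 0 (hi e.φ₀ e.S r), (deriv e.φ₀ s + ∑ l ∈ Finset.Icc 1 N,
      l1 (deriv (e.φ l) s)) = ∫ s in Icc 0 (hi e.φ₀ e.S r), (1 : ℝ) :=
    integral_congr_ae (ae_restrict_of_ae_restrict_of_subset hsub hL.canonical)
  rw [h3]
  simp [IsClock.hi_nonneg]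

end Linked

end DelaySystem

/-! ### Linked data satisfy construction (i) and the axioms of an impulse control. -/

namespace DelaySystem

variable {n m N M : ℕ} {P : DelaySystem n m N M}

namespace Linked

variable {p : ImpulseData n m} {e : ExtendedData n m} (hL : P.Linked p e)
include hL

theorem isFiniteMeasure_ν : IsFiniteMeasure p.ν := by
  refine ⟨?_⟩
  rw [hL.ν_eq _ MeasurableSet.univ]
  refine ENNReal.sum_lt_top.2 fun l hl => ?_
  refine (lintegral_mono_set (inter_subset_left (s := Icc 0 e.S))).trans_lt ?_
  exact (integrable_l1 (hL.canon.integrable_φ hl)).lintegral_lt_top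

theorem contVec_muL_eq {l : ℕ} (hl : l ∈ Finset.Icc 1 N) (j : Fin m) {A : Set ℝ}
    (hA : MeasurableSet A) : contVec (P.muL p l) j A
      = ∫ s in (Icc 0 e.S \ uset e.φ₀ e.S P.h) ∩ e.φ₀ ⁻¹' A, deriv (e.φ l) s j :=
  hL.canon.clock.contVec_apply_eq (fun j _ hA => hL.muL_eq hl j hA) j hA

theorem phiL_eq {r : ℝ} (hr : r ∈ Icc 0 P.h) : P.phiL p r = lo e.φ₀ e.S r :=
  DelaySystem.phiL_eq hL.canon.clock (fun _ h => hL.phi_eq h) hr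

theorem phiR_eq {r : ℝ} (hr : r ∈ Icc 0 P.h) : P.phiR p r = hi e.φ₀ e.S r :=
  DelaySystem.phiR_eq hL.canon.clock (fun _ h => hL.phi_eq h) hr

theorem jumpSet_eq : P.jumpSet p = jset e.φ₀ e.S P.h :=
  DelaySystem.jumpSet_eq hL.canon.clock (fun _ h => hL.phi_eq h)

theorem sigmaUnion_eq : P.sigmaUnion p = uset e.φ₀ e.S P.h :=
  DelaySystem.sigmaUnion_eq hL.canon.clock (fun _ h => hL.phi_eq h)

theorem sigmaSet_eq {r : ℝ} (hr : r ∈ Icc 0 P.h) :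
    P.sigmaSet p r = Icc (lo e.φ₀ e.S r) (hi e.φ₀ e.S r) := by
  rw [sigmaSet, hL.phiL_eq hr, hL.phiR_eq hr]

theorem S_eq : e.S = P.phi p P.h := by
  rw [hL.phi_eq ⟨P.h_pos, le_rfl⟩, hL.canon.clock.hi_last]

theorem φ₀_eq {s : ℝ} (hs : s ∈ Icc 0 e.S) : e.φ₀ s = rightInv (P.phi p) 0 P.h 0 e.S s :=
  (rightInv_phi_eq hL.canon.clock (fun _ h => hL.phi_eq h) hs).symm

/-- Off the stops `φ̇_l` factors through the clock as `f ∘ φ₀`, with `f = φ̇_l ∘ hi` set to zero on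
the stopping values. As `dϕ` is the image of Lebesgue measure, `f` is a density of the continuous
part of `μ_l`, and such densities are unique. -/
theorem ae_mL {l : ℕ} (hl : l ∈ Finset.Icc 1 N) : ∀ᵐ s ∂(volume.restrict (Icc 0 e.S)),
    s ∉ uset e.φ₀ e.S P.h → P.mL p l (e.φ₀ s) = deriv (e.φ l) s := by
  have hc := hL.canon.clock
  have hd : P.dphi p = (volume.restrict (Icc 0 e.S)).map e.φ₀ :=
    dphi_eq hc (fun _ h => hL.phi_eq h) hL.isFiniteMeasure_ν
  have key : ∀ j, ∀ᵐ s ∂(volume.restrict (Icc 0 e.S)),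
      s ∉ uset e.φ₀ e.S P.h → P.mL p l (e.φ₀ s) j = deriv (e.φ l) s j := by
    intro j
    set f : ℝ → ℝ := (jset e.φ₀ e.S P.h)ᶜ.indicator fun t => deriv (e.φ l) (hi e.φ₀ e.S t) j
      with hf
    have hfm : Measurable f := by
      refine Measurable.indicator ?_ hc.measurableSet_jset.compl
      exact (measurable_pi_apply j).comp ((measurable_deriv _).comp (IsClock.measurable_hi _ _))
    have hfc : ∀ s ∈ Icc 0 e.S, f (e.φ₀ s)
        = (Icc 0 e.S \ uset e.φ₀ e.S P.h).indicator (fun s => deriv (e.φ l) s j) s := by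
      intro s hs
      by_cases hU : s ∈ uset e.φ₀ e.S P.h
      · rw [indicator_of_notMem (fun h => h.2 hU), hf,
          indicator_of_notMem (fun h : e.φ₀ s ∈ (jset e.φ₀ e.S P.h)ᶜ =>
            h ((hc.mem_uset_iff hs).1 hU))]
      · have h1 : s ∈ Icc 0 e.S \ uset e.φ₀ e.S P.h := ⟨hs, hU⟩
        have h2 : e.φ₀ s ∈ (jset e.φ₀ e.S P.h)ᶜ := fun h => hU ((hc.mem_uset_iff hs).2 h)
        rw [indicator_of_mem h1, hf, indicator_of_mem h2, (hc.lo_hi_of_notMem hs hU).2]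
    have hcongr : (fun s => f (e.φ₀ s)) =ᵐ[volume.restrict (Icc 0 e.S)]
        (Icc 0 e.S \ uset e.φ₀ e.S P.h).indicator (fun s => deriv (e.φ l) s j) :=
      (ae_restrict_mem measurableSet_Icc).mono hfc
    have hfi : Integrable f ((volume.restrict (Icc 0 e.S)).map e.φ₀) := by
      rw [integrable_map_measure hfm.aestronglyMeasurable hc.aemeasurable]
      exact ((Integrable.eval (hL.canon.integrable_φ hl) j).indicator
        hc.measurableSet_compl_uset).congr hcongr.symm
    have heq : contVec (P.muL p l) j
        = 0 + ((volume.restrict (Icc 0 e.S)).map e.φ₀).withDensityᵥ f := by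
      rw [zero_add]
      ext A hA
      rw [hL.contVec_muL_eq hl j hA, withDensityᵥ_apply hfi hA,
        setIntegral_map hA hfm.aestronglyMeasurable hc.aemeasurable,
        setIntegral_congr_ae₀ (hc.aemeasurable.nullMeasurable hA)
          (hcongr.mono fun s hs _ => hs),
        setIntegral_indicator hc.measurableSet_compl_uset,
        Measure.restrict_restrict' measurableSet_Icc]
      congr 2
      ext s
      simp only [mem_inter_iff, Set.mem_sdiff, mem_preimage]
      tauto
    have hrn := SignedMeasure.eq_rnDeriv (μ := (volume.restrict (Icc 0 e.S)).map e.φ₀)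
      0 f hfi VectorMeasure.MutuallySingular.zero_left heq
    filter_upwards [ae_of_ae_map hc.aemeasurable hrn, hcongr, ae_restrict_mem measurableSet_Icc]
      with s h1 h2 hs hU
    have h3 : s ∈ Icc 0 e.S \ uset e.φ₀ e.S P.h := ⟨hs, hU⟩
    rw [mL, hd, ← h1, h2, indicator_of_mem h3]
  filter_upwards [ae_all_iff.2 key] with s hs hU
  funext j
  exact hs j hU

theorem φ_cont {l : ℕ} (hl : l ∈ Finset.Icc 1 N) :
    ∀ᵐ s ∂(volume.restrict (Icc 0 e.S \ P.sigmaUnion p)),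
      HasDerivAt (e.φ l) (P.mL p l (e.φ₀ s)) s := by
  have hc := hL.canon.clock
  rw [hL.sigmaUnion_eq]
  have := ae_restrict_of_ae_restrict_of_subset (s := Icc 0 e.S \ uset e.φ₀ e.S P.h)
    Set.sdiff_subset ((hL.ae_mL hl).and (hL.canon.solves_φ hl).2)
  filter_upwards [this, ae_restrict_mem hc.measurableSet_compl_uset] with s hs hm
  rw [hs.1 hm.2]
  exact hs.2

theorem φ_jump {l : ℕ} (hl : l ∈ Finset.Icc 1 N) : ∀ r ∈ P.jumpSet p,
    ∀ᵐ s ∂(volume.restrict (P.sigmaSet p r)),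
      HasDerivAt (e.φ l) ((1 / (P.phiR p r - P.phiL p r)) • p.ω r l (P.gam p r s)) s := by
  have hc := hL.canon.clock
  rw [hL.jumpSet_eq]
  intro r hr
  have hne : hi e.φ₀ e.S r - lo e.φ₀ e.S r ≠ 0 := (sub_pos.2 hr.2).ne'
  simp only [gam, hL.sigmaSet_eq hr.1, hL.phiL_eq hr.1, hL.phiR_eq hr.1]
  have h1 := ae_comp_sub_div hr.2 (hL.ω_eq r hr.1 l hl)
  have h2 := ae_restrict_of_ae_restrict_of_subset (hc.Icc_subset hr.1) (hL.canon.solves_φ hl).2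
  filter_upwards [h1, h2] with s hs hs'
  rw [hs, smul_smul, one_div_mul_cancel hne, one_smul, mul_div_cancel₀ _ hne, sub_add_cancel]
  exact hs'

/-- Transports a property of the whole family of velocities on a fibre to the family `ω^r`. A fibre
reduced to a point gives `ω^r = 0` and no almost everywhere information on velocities, hence the
separate hypothesis for the zero family; indices outside `1, …, N` are filled with zero. -/
theorem ae_ω {r : ℝ} (hr : r ∈ Icc 0 P.h) {q : (ℕ → Fin m → ℝ) → Prop}
    (h0 : hi e.φ₀ e.S r - lo e.φ₀ e.S r = 0 → q fun _ => 0)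
    (hq : lo e.φ₀ e.S r < hi e.φ₀ e.S r →
      ∀ᵐ s ∂(volume.restrict (Icc (lo e.φ₀ e.S r) (hi e.φ₀ e.S r))),
        q fun l => if l ∈ Finset.Icc 1 N then
          (hi e.φ₀ e.S r - lo e.φ₀ e.S r) • deriv (e.φ l) s else 0) :
    ∀ᵐ s ∂(volume.restrict (Icc (0 : ℝ) 1)),
      q fun l => if l ∈ Finset.Icc 1 N then p.ω r l s else 0 := by
  have hc := hL.canon.clock
  have hall : ∀ᵐ s ∂(volume.restrict (Icc (0 : ℝ) 1)), ∀ l ∈ Finset.Icc 1 N,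
      p.ω r l s = (hi e.φ₀ e.S r - lo e.φ₀ e.S r) •
      deriv (e.φ l) ((hi e.φ₀ e.S r - lo e.φ₀ e.S r) * s + lo e.φ₀ e.S r) :=
    (ae_ball_iff (Finset.countable_toSet _)).2 fun l hl => hL.ω_eq r hr l hl
  rcases (hc.lo_le_hi hr).eq_or_lt with heq | hlt
  · filter_upwards [hall] with s hs
    convert! h0 (by rw [heq]; ring) using 1
    funext l
    split_ifs with hl
    · rw [hs l hl, heq]; simp
    · rfl
  · filter_upwards [hall, ae_comp_mul_add hlt (hq hlt)] with s hs hs'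
    convert! hs' using 1
    funext l
    split_ifs with hl
    · rw [hs l hl]
    · rfl

theorem ω_mem {r : ℝ} (hr : r ∈ Icc 0 P.h) {l : ℕ} (hl : l ∈ Finset.Icc 1 N) :
    ∀ᵐ s ∂(volume.restrict (Icc (0 : ℝ) 1)), p.ω r l s ∈ P.K := by
  have hc := hL.canon.clock
  have h0 : (0 : Fin m → ℝ) ∈ P.K := by
    obtain ⟨w, hw⟩ := P.K_nonempty
    simpa using P.K_cone w hw 0 le_rfl
  have := hL.ae_ω hr (q := fun w => w l ∈ P.K) (fun _ => h0) fun hlt => by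
    filter_upwards [ae_restrict_of_ae_restrict_of_subset (hc.Icc_subset hr) (hL.φ_mem l hl)]
      with s hs
    rw [if_pos hl]
    exact P.K_cone _ hs _ (sub_nonneg.2 hlt.le)
  simpa only [if_pos hl] using this

theorem ω_bdd {r : ℝ} (hr : r ∈ Icc 0 P.h) {l : ℕ} (hl : l ∈ Finset.Icc 1 N) :
    MemLp (p.ω r l) ⊤ (volume.restrict (Icc 0 1)) := by
  have hc := hL.canon.clock
  have h1 := hL.ae_ω hr (q := fun w => ‖w l‖ ≤ hi e.φ₀ e.S r - lo e.φ₀ e.S r)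
    (fun h => by rw [h, norm_zero]) fun hlt => by
    filter_upwards [ae_restrict_of_ae_restrict_of_subset (hc.Icc_subset hr) (hL.canon.φ_bound hl)]
      with s hs
    rw [if_pos hl, norm_smul, Real.norm_of_nonneg (sub_nonneg.2 hlt.le)]
    exact mul_le_of_le_one_right (sub_nonneg.2 hlt.le) hs
  simp only [if_pos hl] at h1
  refine MemLp.of_bound ?_ _ h1
  refine AEStronglyMeasurable.congr (f := fun s => (hi e.φ₀ e.S r - lo e.φ₀ e.S r) •
    deriv (e.φ l) ((hi e.φ₀ e.S r - lo e.φ₀ e.S r) * s + lo e.φ₀ e.S r)) ?_ ?_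
  · refine Measurable.aestronglyMeasurable ?_
    have hm : Measurable fun s : ℝ => (hi e.φ₀ e.S r - lo e.φ₀ e.S r) * s + lo e.φ₀ e.S r := by
      fun_prop
    exact ((measurable_deriv (e.φ l)).comp hm).const_smul (hi e.φ₀ e.S r - lo e.φ₀ e.S r)
  · filter_upwards [hL.ω_eq r hr l hl] with s hs
    exact hs.symm

/-- While the clock is stopped `φ̇₀ = 0`, so the normalization says `∑‖φ̇_l‖ = 1`; rescaling
multiplies this by the length of the fibre. This is where the constancy condition on `ω` comes from.
-/
theorem sum_l1_ω {r : ℝ} (hr : r ∈ Icc 0 P.h) : ∀ᵐ s ∂(volume.restrict (Icc (0 : ℝ) 1)),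
    ∑ l ∈ Finset.Icc 1 N, l1 (p.ω r l s) = hi e.φ₀ e.S r - lo e.φ₀ e.S r := by
  have hc := hL.canon.clock
  have := hL.ae_ω hr (q := fun w => ∑ l ∈ Finset.Icc 1 N, l1 (w l)
      = hi e.φ₀ e.S r - lo e.φ₀ e.S r) (fun h => by rw [h]; simp [l1_zero]) fun hlt => by
    filter_upwards [ae_restrict_of_ae_restrict_of_subset (hc.Icc_subset hr) hL.canonical,
      ae_mem_Ioo (lo e.φ₀ e.S r) (hi e.φ₀ e.S r)] with s hs hm
    rw [hL.canon.deriv_φ₀_eq_zero hr hm, zero_add] at hs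
    rw [Finset.sum_congr rfl fun l hl => by rw [if_pos hl, l1_smul], ← Finset.mul_sum, hs,
      mul_one, abs_of_nonneg (sub_nonneg.2 hlt.le)]
  filter_upwards [this] with s hs
  rw [← hs]
  exact Finset.sum_congr rfl fun l hl => by rw [if_pos hl]

theorem ω_const {r : ℝ} (hr : r ∈ Icc 0 P.h) : ∀ᵐ s ∂(volume.restrict (Icc (0 : ℝ) 1)),
    ∑ l ∈ Finset.Icc 1 N, l1 (p.ω r l s)
      = ∑ l ∈ Finset.Icc 1 N, ∫ s' in (0)..1, l1 (p.ω r l s') := by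
  have h2 : ∑ l ∈ Finset.Icc 1 N, ∫ s' in (0)..1, l1 (p.ω r l s')
      = hi e.φ₀ e.S r - lo e.φ₀ e.S r := by
    rw [← intervalIntegral.integral_finsetSum]
    · rw [intervalIntegral.integral_congr_ae_restrict
        (g := fun _ => hi e.φ₀ e.S r - lo e.φ₀ e.S r)]
      · simp
      · rw [uIoc_of_le zero_le_one]
        exact ae_restrict_of_ae_restrict_of_subset Ioc_subset_Icc_self (hL.sum_l1_ω hr)
    · intro l hl
      rw [intervalIntegrable_iff_integrableOn_Icc_of_le zero_le_one]
      exact integrable_l1 ((hL.ω_bdd hr hl).integrable le_top)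
  rw [h2]
  exact hL.sum_l1_ω hr

theorem atom_sum {r : ℝ} (hr : r ∈ Ioo 0 P.h) {l : ℕ}
    {A : ℕ → Set ℝ} (hA : ∀ l', A l' = Icc 0 e.S ∩
      {s | ((l' : ℝ) - 1) * P.h + e.φ₀ s ∈ ({r + ((l : ℝ) - 1) * P.h} : Set ℝ)}) (l' : ℕ) :
    A l' = if l' = l then Icc 0 e.S ∩ e.φ₀ ⁻¹' {r} else ∅ := by
  have h1 := block_eq (A := {r}) hL.canon l l'
  have h2 : (fun t => t - ((l : ℝ) - 1) * P.h) ⁻¹' {r} ∩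
      Ioo (((l : ℝ) - 1) * P.h) (l * P.h) = {r + ((l : ℝ) - 1) * P.h} := by
    ext t
    simp only [mem_inter_iff, mem_preimage, mem_singleton_iff, mem_Ioo]
    constructor
    · rintro ⟨h, -⟩; linarith
    · rintro rfl; exact ⟨by ring, by linarith [hr.1], by linarith [hr.2]⟩
  rw [h2] at h1
  rw [hA, h1, inter_eq_left.2 (singleton_subset_iff.2 hr)]

theorem ν_atom {r : ℝ} (hr : r ∈ Ioo 0 P.h) {l : ℕ} (hl : l ∈ Finset.Icc 1 N) :
    ∫ s in (0)..1, l1 (p.ω r l s) = p.ν.real {r + ((l : ℝ) - 1) * P.h} := by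
  have hr' : r ∈ Icc 0 P.h := Ioo_subset_Icc_self hr
  rw [measureReal_def, hL.ν_eq _ (measurableSet_singleton _), Finset.sum_eq_single_of_mem l hl,
    hL.atom_sum hr (fun _ => rfl), if_pos rfl, hL.integral_l1_singleton hr' hl,
    ENNReal.toReal_ofReal]
  · exact intervalIntegral.integral_nonneg zero_le_one fun _ _ => l1_nonneg _
  · intro l' _ hne
    rw [hL.atom_sum hr (fun _ => rfl), if_neg hne]; simp

theorem integral_singleton {r : ℝ} (hr : r ∈ Icc 0 P.h) {l : ℕ} (hl : l ∈ Finset.Icc 1 N)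
    (j : Fin m) : ∫ s in Icc 0 e.S ∩ e.φ₀ ⁻¹' {r}, deriv (e.φ l) s j
      = ∫ s in (0)..1, p.ω r l s j := by
  have hc := hL.canon.clock
  rw [hL.integral_ω hr hl, hc.preimage_singleton hr,
    intervalIntegral.integral_of_le (hc.lo_le_hi hr), ← integral_Icc_eq_integral_Ioc]

theorem μ_atom {r : ℝ} (hr : r ∈ Ioo 0 P.h) {l : ℕ} (hl : l ∈ Finset.Icc 1 N) (j : Fin m) :
    ∫ s in (0)..1, p.ω r l s j = p.μ j {r + ((l : ℝ) - 1) * P.h} := by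
  rw [hL.μ_eq _ _ (measurableSet_singleton _), Finset.sum_eq_single_of_mem l hl,
    hL.atom_sum hr (fun _ => rfl), if_pos rfl,
    hL.integral_singleton (Ioo_subset_Icc_self hr) hl]
  intro l' _ hne
  rw [hL.atom_sum hr (fun _ => rfl), if_neg hne]; simp

/-- The time `lh` is visited at the end of block `l` and again at the beginning of block `l + 1`,
and in no other block. -/
theorem block_endpoint (l l' : ℕ) :
    Icc 0 e.S ∩ {s | ((l' : ℝ) - 1) * P.h + e.φ₀ s ∈ ({(l : ℝ) * P.h} : Set ℝ)}
      = if l' = l then Icc 0 e.S ∩ e.φ₀ ⁻¹' {P.h} else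
        if l' = l + 1 then Icc 0 e.S ∩ e.φ₀ ⁻¹' {0} else ∅ := by
  have hh := P.h_pos
  ext s
  split_ifs with h1 h2
  · subst h1
    simp only [mem_inter_iff, mem_ofPred_eq, mem_singleton_iff, mem_preimage]
    exact and_congr_right fun _ => ⟨fun h => by linarith, fun h => by rw [h]; ring⟩
  · subst h2
    simp only [mem_inter_iff, mem_ofPred_eq, mem_singleton_iff, mem_preimage]
    push_cast
    exact and_congr_right fun _ => ⟨fun h => by linarith, fun h => by rw [h]; ring⟩
  · simp only [mem_inter_iff, mem_ofPred_eq, mem_singleton_iff, mem_empty_iff_false, iff_false,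
      not_and]
    intro hs h
    have hm := hL.canon.clock.mem_Icc hs
    rcases lt_or_gt_of_ne h1 with hl | hl
    · have : (l' : ℝ) + 1 ≤ l := by exact_mod_cast hl
      nlinarith [hm.2]
    · have : (l : ℝ) + 2 ≤ l' := by
        have : l + 2 ≤ l' := by omega
        exact_mod_cast this
      nlinarith [hm.1]

omit hL in
-- For `l = 0` the first contribution is missing and for `l = N` the second; the two conditions
-- mirror the convention in `omegaExt`.
theorem sum_endpoint {G : Type*} [AddCommMonoid G] {l : ℕ} (hl : l ∈ Finset.Icc 0 N)
    {Q : ℕ → Set ℝ → G} {A B : Set ℝ} (hQ : ∀ l, Q l ∅ = 0) :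
    ∑ l' ∈ Finset.Icc 1 N, Q l' (if l' = l then A else if l' = l + 1 then B else ∅)
      = (if 1 ≤ l ∧ l ≤ N then Q l A else 0)
        + (if 1 ≤ l + 1 ∧ l + 1 ≤ N then Q (l + 1) B else 0) := by
  have h1 : ∀ l', Q l' (if l' = l then A else if l' = l + 1 then B else ∅)
      = (if l = l' then Q l' A else 0) + (if l + 1 = l' then Q l' B else 0) := by
    intro l'
    by_cases e1 : l' = l
    · subst e1; simp
    · by_cases e2 : l' = l + 1
      · subst e2; simp
      · rw [if_neg e1, if_neg e2, if_neg (Ne.symm e1), if_neg (Ne.symm e2), hQ, add_zero]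
  simp only [h1, Finset.sum_add_distrib, Finset.sum_ite_eq, Finset.mem_Icc]

theorem μ_atom_end {l : ℕ} (hl : l ∈ Finset.Icc 0 N) (j : Fin m) :
    ∫ s in (0)..1, (P.omegaExt p P.h l s j + P.omegaExt p 0 (l + 1) s j)
      = p.μ j {(l : ℝ) * P.h} := by
  have hh := P.h_pos.le
  have hint : ∀ r ∈ Icc 0 P.h, ∀ l, IntervalIntegrable (fun s => P.omegaExt p r l s j)
      volume 0 1 := by
    intro r hr l
    unfold omegaExt
    split_ifs with h
    · rw [intervalIntegrable_iff_integrableOn_Icc_of_le zero_le_one]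
      exact Integrable.eval ((hL.ω_bdd hr (Finset.mem_Icc.2 h)).integrable le_top) j
    · exact intervalIntegrable_const
  have hval : ∀ r ∈ Icc 0 P.h, ∀ l, ∫ s in (0)..1, P.omegaExt p r l s j
      = if 1 ≤ l ∧ l ≤ N then ∫ s in Icc 0 e.S ∩ e.φ₀ ⁻¹' {r}, deriv (e.φ l) s j else 0 := by
    intro r hr l
    unfold omegaExt
    split_ifs with h
    · rw [hL.integral_singleton hr (Finset.mem_Icc.2 h)]
    · simp
  rw [intervalIntegral.integral_add (hint _ ⟨hh, le_rfl⟩ _) (hint _ ⟨le_rfl, hh⟩ _),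
    hval _ ⟨hh, le_rfl⟩, hval _ ⟨le_rfl, hh⟩, hL.μ_eq _ _ (measurableSet_singleton _)]
  simp only [hL.block_endpoint l]
  exact (sum_endpoint hl (Q := fun l A => ∫ s in A, deriv (e.φ l) s j) (by simp)).symm

theorem ν_atom_end {l : ℕ} (hl : l ∈ Finset.Icc 0 N) :
    ∫ s in (0)..1, (l1 (P.omegaExt p P.h l s) + l1 (P.omegaExt p 0 (l + 1) s))
      = p.ν.real {(l : ℝ) * P.h} := by
  have hh := P.h_pos.le
  have hint : ∀ r ∈ Icc 0 P.h, ∀ l, IntervalIntegrable (fun s => l1 (P.omegaExt p r l s))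
      volume 0 1 := by
    intro r hr l
    unfold omegaExt
    split_ifs with h
    · rw [intervalIntegrable_iff_integrableOn_Icc_of_le zero_le_one]
      exact integrable_l1 ((hL.ω_bdd hr (Finset.mem_Icc.2 h)).integrable le_top)
    · exact intervalIntegrable_const
  have hval : ∀ r ∈ Icc 0 P.h, ∀ l, ENNReal.ofReal (∫ s in (0)..1, l1 (P.omegaExt p r l s))
      = if 1 ≤ l ∧ l ≤ N then ∫⁻ s in Icc 0 e.S ∩ e.φ₀ ⁻¹' {r},
          ENNReal.ofReal (l1 (deriv (e.φ l) s)) else 0 := by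
    intro r hr l
    unfold omegaExt
    split_ifs with h
    · rw [hL.integral_l1_singleton hr (Finset.mem_Icc.2 h)]
    · simp [l1_zero]
  have hnn : ∀ r l, 0 ≤ ∫ s in (0)..1, l1 (P.omegaExt p r l s) := fun r l =>
    intervalIntegral.integral_nonneg zero_le_one fun _ _ => l1_nonneg _
  rw [intervalIntegral.integral_add (hint _ ⟨hh, le_rfl⟩ _) (hint _ ⟨le_rfl, hh⟩ _),
    ← ENNReal.toReal_ofReal (add_nonneg (hnn P.h l) (hnn 0 (l + 1))),
    ENNReal.ofReal_add (hnn P.h l) (hnn 0 (l + 1)),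
    hval _ ⟨hh, le_rfl⟩, hval _ ⟨le_rfl, hh⟩, measureReal_def,
    hL.ν_eq _ (measurableSet_singleton _)]
  congr 1
  simp only [hL.block_endpoint l]
  exact (sum_endpoint hl (Q := fun l A => ∫⁻ s in A, ENNReal.ofReal (l1 (deriv (e.φ l) s)))
    (by simp)).symm

theorem isImpulseControl (hsupp : totalVar p.μ (Icc 0 P.T)ᶜ = 0) : P.IsImpulseControl p := by
  -- `Linked` does not constrain `τ`, so it is replaced by the translates of `φ₀`. The concatenated
  -- clock and the concatenated velocities then present `μ` and `ν` as images under a single clock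
  -- on `[0, NS]`.
  set e' : ExtendedData n m := { e with τ := fun l s => ((l : ℝ) - 1) * P.h + e.φ₀ s }
  have hC' : P.IsCanonControl e' :=
    { S_pos := hL.S_pos, lipschitz := hL.lipschitz, mono := hL.mono, φ₀_zero := hL.φ₀_zero,
      φ₀_S := hL.φ₀_S, φ_init := hL.φ_init, φ_mem := hL.φ_mem, canonical := hL.canonical }
  have hτ : ∀ l ∈ Finset.Icc 1 N, ∀ s ∈ Icc 0 e'.S,
      e'.τ l s = ((l : ℝ) - 1) * P.h + e'.φ₀ s := fun _ _ _ _ => rfl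
  have hT := (concat_tau hC' hτ).2
  have hμ : ∀ j A, MeasurableSet A → p.μ j A = ∫ s in Icc 0 (N * e'.S) ∩
      concat N e'.S e'.τ ⁻¹' A, deriv (concat N e'.S e'.φ) s j := fun j A hA => by
    rw [integral_concat_φ hC' hτ hA]; exact hL.μ_eq j A hA
  have hν : ∀ A, MeasurableSet A → p.ν A = ∫⁻ s in Icc 0 (N * e'.S) ∩
      concat N e'.S e'.τ ⁻¹' A, ENNReal.ofReal (l1 (deriv (concat N e'.S e'.φ) s)) :=
    fun A hA => by rw [lintegral_concat_φ hC' hτ hA]; exact hL.ν_eq A hA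
  have hV : Measurable (deriv (concat N e'.S e'.φ)) := measurable_deriv _
  have hVi := integrable_concat_φ hC'
  have hK : ∀ᵐ s ∂(volume.restrict (Icc 0 (N * e'.S))), deriv (concat N e'.S e'.φ) s ∈ P.K := by
    refine ae_block hC' (ql := fun l s => deriv (e'.φ l) s ∈ P.K) (fun l hl s hs h => ?_)
      fun l hl => hL.φ_mem l hl
    rwa [deriv_concat _ hl hs]
  refine
    { μ_supp := hsupp
      μ_range := fun A hA => IsClock.range_mem P.K_nonempty P.K_cone hVi hμ hK hA
      μ_cont := hT.isKMeasure_off P.K_cone hV hVi (fun j A hA => hT.contVec_apply_eq hμ j hA) hK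
      ν_finite := hL.isFiniteMeasure_ν
      ν_supp := ?_
      ν_mem := hT.inVc P.K_cone hV hVi hK hμ hν
      ω_bdd := fun r hr l hl => hL.ω_bdd hr hl
      ω_mem := fun r hr l hl => hL.ω_mem hr hl
      ω_const := fun r hr => hL.ω_const hr
      ν_atom := fun r hr l hl => hL.ν_atom hr hl
      ν_atom_end := fun l hl => hL.ν_atom_end hl
      μ_atom := fun r hr l hl j => hL.μ_atom hr hl j
      μ_atom_end := fun l hl j => hL.μ_atom_end hl j }
  rw [hν _ measurableSet_Icc.compl]
  have : Icc 0 (N * e'.S) ∩ concat N e'.S e'.τ ⁻¹' (Icc 0 P.T)ᶜ = ∅ := by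
    ext s
    simp only [mem_inter_iff, mem_preimage, mem_empty_iff_false, iff_false, not_and,
      mem_compl_iff, not_not]
    exact fun hs => hT.mem_Icc hs
  rw [this]; simp

end Linked

end DelaySystem

/-! ### Construction (ii) on controls. -/

theorem measure_ext_of_Icc {T : ℝ} {κ₁ κ₂ : Measure ℝ} [IsFiniteMeasure κ₁]
    (h₁ : κ₁ (Icc 0 T)ᶜ = 0) (h₂ : κ₂ (Icc 0 T)ᶜ = 0)
    (h : ∀ t ∈ Icc 0 T, κ₁ (Icc 0 t) = κ₂ (Icc 0 t)) : κ₁ = κ₂ := by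
  have key : ∀ κ : Measure ℝ, κ (Icc 0 T)ᶜ = 0 → ∀ a, κ (Iic a) =
      if 0 ≤ min a T then κ (Icc 0 (min a T)) else 0 := by
    intro κ hκ a
    have h3 : κ (Iic a) = κ (Icc 0 (min a T)) := by
      refine le_antisymm ?_ (measure_mono fun t ht => ht.2.trans (min_le_left _ _))
      refine (measure_mono (t := Icc 0 (min a T) ∪ (Icc 0 T)ᶜ) fun t ht => ?_).trans
        ((measure_union_le _ _).trans (by rw [hκ, add_zero]))
      by_cases h0 : t ∈ Icc 0 T
      · exact Or.inl ⟨h0.1, le_min ht h0.2⟩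
      · exact Or.inr h0
    rw [h3]
    split_ifs with h4
    · rfl
    · rw [Icc_eq_empty h4, measure_empty]
  refine Measure.ext_of_Iic _ _ fun a => ?_
  rw [key _ h₁, key _ h₂]
  split_ifs with h4
  · exact h _ ⟨h4, min_le_right _ _⟩
  · rfl

namespace DelaySystem

variable {n m N M : ℕ} {P : DelaySystem n m N M}

theorem T_nonneg (P : DelaySystem n m N M) : 0 ≤ P.T := mul_nonneg N.cast_nonneg P.h_pos.le

theorem IsCanonicalProc.canon {e : ExtendedData n m} (he : P.IsCanonicalProc e) :
    P.IsCanonControl e := { he.control with canonical := he.canonical }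

theorem IsCanonicalProc.tau_eq {e : ExtendedData n m} (he : P.IsCanonicalProc e) :
    ∀ l ∈ Finset.Icc 1 N, ∀ s ∈ Icc 0 e.S, e.τ l s = ((l : ℝ) - 1) * P.h + e.φ₀ s :=
  P.tau_eq_of_solution he.canon he.solution.τ_eq he.solution.init_one.1
    fun l hl => (he.solution.init_succ l hl).1

theorem exists_push_ν {e : ExtendedData n m} (hC : P.IsCanonControl e) : ∃ ν : Measure ℝ,
    (∀ A, MeasurableSet A → ν A = ∑ l ∈ Finset.Icc 1 N,
      ∫⁻ s in Icc 0 e.S ∩ {s | ((l : ℝ) - 1) * P.h + e.φ₀ s ∈ A},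
        ENNReal.ofReal (l1 (deriv (e.φ l) s))) ∧
    ν (Icc 0 P.T)ᶜ = 0 := by
  have hc := hC.clock
  have key : ∀ A, MeasurableSet A →
      (∑ l ∈ Finset.Icc 1 N, ((volume.restrict (Icc 0 e.S)).withDensity fun s =>
        ENNReal.ofReal (l1 (deriv (e.φ l) s))).map fun s => ((l : ℝ) - 1) * P.h + e.φ₀ s) A
      = ∑ l ∈ Finset.Icc 1 N,
      ∫⁻ s in Icc 0 e.S ∩ {s | ((l : ℝ) - 1) * P.h + e.φ₀ s ∈ A},
        ENNReal.ofReal (l1 (deriv (e.φ l) s)) := by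
    intro A hA
    rw [Measure.finsetSum_apply]
    refine Finset.sum_congr rfl fun l _ => ?_
    have hae := hc.aemeasurable.const_add (((l : ℝ) - 1) * P.h)
    rw [Measure.map_apply_of_aemeasurable
        (hae.mono_ac (withDensity_absolutelyContinuous _ _)) hA,
      withDensity_apply₀ _ (hae.nullMeasurableSet_preimage hA),
      Measure.restrict_restrict' measurableSet_Icc, inter_comm]
    rfl
  refine ⟨_, key, ?_⟩
  rw [key _ measurableSet_Icc.compl]
  refine Finset.sum_eq_zero fun l hl => ?_
  have : Icc 0 e.S ∩ {s | ((l : ℝ) - 1) * P.h + e.φ₀ s ∈ (Icc 0 P.T)ᶜ} = ∅ := by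
    ext s
    simp only [mem_inter_iff, mem_ofPred_eq, mem_empty_iff_false, iff_false, not_and,
      mem_compl_iff, not_not]
    exact fun hs => block_mem P.h_pos.le hl (hc.mem_Icc hs)
  rw [this]; simp

theorem sigma_limR {e : ExtendedData n m} (hC : P.IsCanonControl e) {r : ℝ}
    (hr : r ∈ Icc 0 P.h) : limR P.h (P.sigma e) r = hi e.φ₀ e.S r :=
  hC.clock.limR_eq (A := P.sigma e) (fun _ hr => hC.clock.rightInv_eq hr) hr

theorem sigma_limL {e : ExtendedData n m} (hC : P.IsCanonControl e) {r : ℝ}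
    (hr : r ∈ Icc 0 P.h) : limL 0 (P.sigma e) r = lo e.φ₀ e.S r :=
  hC.clock.limL_eq (A := P.sigma e) (by simp [sigma, rightInv])
    (fun _ hr => hC.clock.rightInv_eq (Ioo_subset_Ioc_self hr)) hr

/-- Construction (ii) prescribes `μ` and `ν` only on the intervals `[0, t]`. The images of `φ̇_l ds`
and `‖φ̇_l‖ ds` have the same values there and are also carried by `[0, T]`, so they are the same
measures. -/
theorem linked_of_associatedImpulse {e : ExtendedData n m} {p : ImpulseData n m}
    (he : P.IsCanonicalProc e) (h : P.AssociatedImpulse e p) : P.Linked p e := by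
  have hC := he.canon
  refine { hC with ω_eq := ?_, μ_eq := ?_, ν_eq := ?_ }
  · intro r hr l hl
    have := h.ω_eq r hr l hl
    rwa [sigma_limR hC hr, sigma_limL hC hr] at this
  · intro j A hA
    obtain ⟨μ, hμ, hμ0⟩ := exists_push_μ hC j
    have : p.μ j = μ := by
      refine signedMeasure_ext_of_Icc P.T_nonneg ?_ hμ0 fun t ht => ?_
      · have := h.μ_supp
        rw [totalVar, Measure.finsetSum_apply, Finset.sum_eq_zero_iff] at this
        exact this j (Finset.mem_univ j)
      · rw [h.μ_eq t ht j, hμ _ measurableSet_Icc, integral_limR_eq hC he.tau_eq ht j rfl]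
    rw [this, hμ A hA]
  · intro A hA
    obtain ⟨ν, hν, hν0⟩ := exists_push_ν hC
    have hfin : IsFiniteMeasure p.ν := by
      refine ⟨?_⟩
      rw [← union_compl_self (Icc 0 P.T)]
      refine (measure_union_le _ _).trans_lt ?_
      rw [h.ν_supp, add_zero, h.ν_eq P.T ⟨P.T_nonneg, le_rfl⟩]
      exact ENNReal.ofReal_lt_top
    have : p.ν = ν := by
      refine measure_ext_of_Icc h.ν_supp hν0 fun t ht => ?_
      rw [h.ν_eq t ht, hν _ measurableSet_Icc, lintegral_limR_eq hC he.tau_eq ht rfl]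
    rw [this, hν A hA]

theorem exists_associatedImpulse {e : ExtendedData n m} (he : P.IsCanonicalProc e) :
    ∃ p, P.AssociatedImpulse e p := by
  have hC := he.canon
  choose μ hμ hμ0 using exists_push_μ hC
  obtain ⟨ν, hν, hν0⟩ := exists_push_ν hC
  refine ⟨⟨μ, ν, fun r l s => (limR P.h (P.sigma e) r - limL 0 (P.sigma e) r) •
      deriv (e.φ l) ((limR P.h (P.sigma e) r - limL 0 (P.sigma e) r) * s
        + limL 0 (P.sigma e) r),
    fun t => if t < 0 then P.ξ₀ t else concat N e.S e.y (P.sigmaT e t),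
    fun t => concat N e.S e.β (P.sigmaT e t)⟩, ?_⟩
  refine ⟨?_, ?_, hν0, ?_, ?_, ?_, ?_, ?_⟩
  · rw [totalVar, Measure.finsetSum_apply]
    exact Finset.sum_eq_zero fun j _ => hμ0 j
  · intro t ht j
    rw [integral_limR_eq hC he.tau_eq ht j rfl]
    exact hμ j _ measurableSet_Icc
  · intro t ht
    rw [lintegral_limR_eq hC he.tau_eq ht rfl]
    exact hν _ measurableSet_Icc
  · exact fun r hr l hl => Eventually.of_forall fun s => rfl
  · intro t ht
    exact if_pos ht.2
  · intro t ht
    exact if_neg (not_lt.2 ht.1)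
  · exact fun t ht => rfl

/-- Two impulse data associated with the same extended data are equal. -/
theorem sameImpulse_of_associatedImpulse {e : ExtendedData n m} {p q : ImpulseData n m}
    (he : P.IsCanonicalProc e) (hp : P.AssociatedImpulse e p) (hq : P.AssociatedImpulse e q) :
    P.SameImpulse p q := by
  have hLp := linked_of_associatedImpulse he hp
  have hLq := linked_of_associatedImpulse he hq
  refine ⟨?_, ?_, ?_, ?_, ?_⟩
  · funext j
    ext A hA
    rw [hLp.μ_eq j A hA, hLq.μ_eq j A hA]
  · ext A hA
    rw [hLp.ν_eq A hA, hLq.ν_eq A hA]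
  · intro r hr l hl
    filter_upwards [hp.ω_eq r hr l hl, hq.ω_eq r hr l hl] with s h1 h2
    rw [h1, h2]
  · intro t ht
    rcases lt_or_ge t 0 with h0 | h0
    · rw [hp.x_hist t ⟨ht.1, h0⟩, hq.x_hist t ⟨ht.1, h0⟩]
    · rw [hp.x_eq t ⟨h0, ht.2⟩, hq.x_eq t ⟨h0, ht.2⟩]
  · intro t ht
    rw [hp.v_eq t ht, hq.v_eq t ht]

/-- Construction (ii) does not distinguish between equal impulse data. -/
theorem AssociatedImpulse.congr_left {e : ExtendedData n m} {p q : ImpulseData n m}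
    (hp : P.AssociatedImpulse e p) (h : P.SameImpulse p q) : P.AssociatedImpulse e q := by
  have hT := P.T_nonneg
  have hM : (0 : ℝ) ≤ M * P.h := mul_nonneg M.cast_nonneg P.h_pos.le
  refine ⟨h.μ_eq ▸ hp.μ_supp, h.μ_eq ▸ hp.μ_eq, h.ν_eq ▸ hp.ν_supp, h.ν_eq ▸ hp.ν_eq, ?_, ?_, ?_, ?_⟩
  · intro r hr l hl
    filter_upwards [hp.ω_eq r hr l hl, h.ω_eq r hr l hl] with s h1 h2
    rw [← h2, h1]
  · intro t ht
    rw [← h.x_eq ⟨ht.1, ht.2.le.trans hT⟩, hp.x_hist t ht]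
  · intro t ht
    rw [← h.x_eq ⟨by linarith [ht.1], ht.2⟩, hp.x_eq t ht]
  · intro t ht
    rw [← h.v_eq ht, hp.v_eq t ht]

/-- Construction (ii) does not distinguish between equal extended data. -/
theorem AssociatedImpulse.congr_right {e d : ExtendedData n m} {p : ImpulseData n m}
    (he : P.IsCanonicalProc e) (hd : P.IsCanonicalProc d)
    (hp : P.AssociatedImpulse e p) (h : P.SameExtended e d) : P.AssociatedImpulse d p := by
  have hS := he.control.S_pos
  have e1 : concat N e.S e.φ = concat N d.S d.φ := by
    rw [← h.S_eq]; exact concat_congr hS P.one_le_N h.φ_eq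
  have e2 : concat N e.S e.τ = concat N d.S d.τ := by
    rw [← h.S_eq]; exact concat_congr hS P.one_le_N h.τ_eq
  have e3 : concat N e.S e.y = concat N d.S d.y := by
    rw [← h.S_eq]; exact concat_congr hS P.one_le_N h.y_eq
  have e4 : concat N e.S e.β = concat N d.S d.β := by
    rw [← h.S_eq]; exact concat_congr hS P.one_le_N h.β_eq
  have e5 : P.sigmaT e = P.sigmaT d := by
    unfold sigmaT
    rw [e2, h.S_eq]
  refine ⟨hp.μ_supp, ?_, hp.ν_supp, ?_, ?_, hp.x_hist, ?_, ?_⟩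
  · rw [← e1, ← e5]; exact hp.μ_eq
  · rw [← e1, ← e5]; exact hp.ν_eq
  · intro r hr l hl
    have hlo : lo d.φ₀ d.S r = lo e.φ₀ e.S r := by
      unfold lo
      congr 1
      ext s
      rw [← h.S_eq]
      exact and_congr_right fun hs => by rw [h.φ₀_eq hs]
    have hhi : hi d.φ₀ d.S r = hi e.φ₀ e.S r := by
      unfold hi
      congr 1
      ext s
      rw [← h.S_eq]
      exact and_congr_right fun hs => by rw [h.φ₀_eq hs]
    have h1 := hp.ω_eq r hr l hl
    rw [sigma_limR he.canon hr, sigma_limL he.canon hr] at h1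
    rw [sigma_limR hd.canon hr, sigma_limL hd.canon hr, hlo, hhi]
    rcases (he.canon.clock.lo_le_hi hr).eq_or_lt with heq | hlt
    -- On a degenerate fibre the derivative is evaluated at one fixed point, where those of `e.φ l`
    -- and `d.φ l` may differ; the factor `hi - lo = 0` makes this harmless.
    · filter_upwards [h1] with s hs
      rw [hs, heq]; simp
    · have h2 : ∀ᵐ s ∂(volume.restrict (Icc (lo e.φ₀ e.S r) (hi e.φ₀ e.S r))),
          deriv (e.φ l) s = deriv (d.φ l) s := by
        filter_upwards [ae_restrict_of_ae_restrict_of_subset (he.canon.clock.Icc_subset hr)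
          (ae_mem_Ioo 0 e.S)] with s hs
        refine Filter.EventuallyEq.deriv_eq ?_
        filter_upwards [Ioo_mem_nhds hs.1 hs.2] with t ht
        exact h.φ_eq l hl (Ioo_subset_Icc_self ht)
      filter_upwards [h1, ae_comp_mul_add hlt h2] with s hs hs'
      rw [hs, hs']
  · rw [← e3, ← e5]; exact hp.x_eq
  · rw [← e4, ← e5]; exact hp.v_eq

end DelaySystem

/-! ### The clock of an impulse control. -/

theorem isClock_of_le_iff {φ G : ℝ → ℝ} {S h : ℝ} (hS : 0 < S) (hh : 0 < h)
    (hmem : ∀ s ∈ Icc 0 S, φ s ∈ Icc 0 h) (h0 : φ 0 = 0) (hlast : φ S = h)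
    (hG : ∀ r ∈ Ioc 0 h, ∀ s ∈ Icc 0 S, φ s ≤ r ↔ s ≤ G r)
    (hGe : ∀ r r', 0 < r → r ≤ r' → r' ≤ h → G r + (r' - r) ≤ G r') : IsClock φ S h := by
  -- Since `G` grows at speed at least one, its inverse `φ` grows at speed at most one: advancing
  -- the level by `s' - s` advances `G` by at least as much.
  have hinc : ∀ s ∈ Icc 0 S, ∀ s' ∈ Icc 0 S, s ≤ s' → φ s' ≤ φ s + (s' - s) := by
    intro s hs s' hs' hss
    have h1 := hmem s hs
    refine le_of_forall_gt_imp_ge_of_dense fun b hb => ?_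
    set r := b - (s' - s)
    have hr : φ s < r := by simp only [r]; linarith
    rcases le_or_gt b h with hb' | hb'
    · have hr0 : 0 < r := h1.1.trans_lt hr
      have h2 := (hG r ⟨hr0, by simp only [r]; linarith⟩ s hs).1 hr.le
      refine (hG b ⟨hr0.trans_le (by simp only [r]; linarith), hb'⟩ s' hs').2 ?_
      have := hGe r b hr0 (by simp only [r]; linarith) hb'
      simp only [r] at this h2
      linarith
    · exact (hmem s' hs').2.trans hb'.le
  have hmono : MonotoneOn φ (Icc 0 S) := by
    intro s hs s' hs' hss
    refine le_of_forall_gt_imp_ge_of_dense fun b hb => ?_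
    rcases le_or_gt b h with hb' | hb'
    · have hb0 : b ∈ Ioc 0 h := ⟨(hmem s' hs').1.trans_lt hb, hb'⟩
      exact (hG b hb0 s hs).2 (hss.trans ((hG b hb0 s' hs').1 hb.le))
    · exact (hmem s hs).2.trans hb'.le
  have hlip : LipschitzOnWith 1 φ (Icc 0 S) := by
    refine LipschitzOnWith.of_le_add_mul 1 fun s hs s' hs' => ?_
    rw [NNReal.coe_one, one_mul, Real.dist_eq]
    rcases le_total s s' with hle | hle
    · linarith [hmono hs hs' hle, abs_nonneg (s - s')]
    · linarith [hinc s' hs' s hs hle, le_abs_self (s - s')]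
  exact ⟨hS, hh, hmono, hlip.continuousOn, h0, hlast⟩

theorem hi_eq_of_le_iff {φ : ℝ → ℝ} {S r a : ℝ} (ha : a ∈ Icc 0 S)
    (h : ∀ s ∈ Icc 0 S, φ s ≤ r ↔ s ≤ a) : hi φ S r = a := by
  have : {s | s ∈ Icc 0 S ∧ φ s ≤ r} = Icc 0 a := by
    ext s
    constructor
    · rintro ⟨h1, h2⟩; exact ⟨h1.1, (h s h1).1 h2⟩
    · rintro h1
      have : s ∈ Icc 0 S := ⟨h1.1, h1.2.trans ha.2⟩
      exact ⟨this, (h s this).2 h1.2⟩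
  rw [hi, this, csSup_Icc ha.1]

namespace DelaySystem

variable {n m N M : ℕ} {P : DelaySystem n m N M}

section Clock

variable {p : ImpulseData n m} (hν : IsFiniteMeasure p.ν)
include hν

/-- The summand `r` in `ϕ` gives the growth; the `ν_l` only add to it. It makes the right inverse of
`ϕ` 1-Lipschitz even if `ν = 0` on long intervals. -/
theorem phi_add_le {r r' : ℝ} (hr : 0 ≤ r) (hrr : r ≤ r') : P.phi p r + (r' - r) ≤ P.phi p r' := by
  have hfin := P.isFiniteMeasure_nuL p hν
  rcases hrr.eq_or_lt with rfl | hlt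
  · simp
  unfold phi
  rw [if_neg (hr.trans_lt hlt).ne']
  split_ifs with h0
  · have : 0 ≤ ∑ l ∈ Finset.Icc 1 N, (P.nuL p l).real (Icc 0 r') :=
      Finset.sum_nonneg fun _ _ => measureReal_nonneg
    linarith
  · have : ∑ l ∈ Finset.Icc 1 N, (P.nuL p l).real (Icc 0 r)
        ≤ ∑ l ∈ Finset.Icc 1 N, (P.nuL p l).real (Icc 0 r') :=
      Finset.sum_le_sum fun l _ => measureReal_mono (Icc_subset_Icc le_rfl hrr)
    linarith

theorem tendsto_phi_right {r : ℝ} (hr : 0 < r) :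
    Tendsto (P.phi p) (𝓝[>] r) (𝓝 (P.phi p r)) := by
  have hfin := P.isFiniteMeasure_nuL p hν
  have h1 : Tendsto (fun t => t + ∑ l ∈ Finset.Icc 1 N, (P.nuL p l).real (Icc 0 t)) (𝓝[>] r)
      (𝓝 (r + ∑ l ∈ Finset.Icc 1 N, (P.nuL p l).real (Icc 0 r))) := by
    refine (tendsto_id.mono_left nhdsWithin_le_nhds).add (tendsto_finsetSum _ fun l _ => ?_)
    simp only [measureReal_def, ← P.nuL_Iic]
    exact (ENNReal.tendsto_toReal (measure_ne_top _ _)).comp (tendsto_measure_Iic _ _)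
  have e : P.phi p r = r + ∑ l ∈ Finset.Icc 1 N, (P.nuL p l).real (Icc 0 r) := by
    unfold phi; rw [if_neg hr.ne']
  rw [e]
  refine h1.congr' ?_
  filter_upwards [self_mem_nhdsWithin] with t ht
  unfold phi
  rw [if_neg (hr.trans ht).ne']

theorem phi_nonneg {r : ℝ} (hr : 0 ≤ r) : r ≤ P.phi p r := by
  have := phi_add_le (P := P) hν le_rfl hr
  rw [phi_zero] at this
  linarith

theorem rightInv_phi_le_iff {r : ℝ} (hr : r ∈ Ioc 0 P.h) {s : ℝ} (hs : s ∈ Icc 0 (P.phi p P.h)) :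
    rightInv (P.phi p) 0 P.h 0 (P.phi p P.h) s ≤ r ↔ s ≤ P.phi p r := by
  have hh := P.h_pos
  unfold rightInv
  split_ifs with h0 h1
  · rw [h0]
    exact iff_of_true hr.1.le (hr.1.le.trans (phi_nonneg hν hr.1.le))
  · rw [h1]
    constructor
    · intro h; rw [le_antisymm h hr.2]
    · intro h
      have := phi_add_le (P := P) hν hr.1.le hr.2
      linarith
  · have hsS : s < P.phi p P.h := lt_of_le_of_ne hs.2 h1
    have hbdd : BddBelow {t | t ∈ Icc 0 P.h ∧ s < P.phi p t} := ⟨0, fun x hx => hx.1.1⟩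
    have hne : {t | t ∈ Icc 0 P.h ∧ s < P.phi p t}.Nonempty := ⟨P.h, ⟨hh.le, le_rfl⟩, hsS⟩
    constructor
    · intro h
      rcases hr.2.eq_or_lt with rfl | hrh
      · exact hs.2
      -- The infimum defining the right inverse need not be attained, so one gets `s ≤ ϕ(t)` only
      -- for `t > r` and passes to the limit by right continuity of `ϕ` at `r > 0`.
      · refine ge_of_tendsto (tendsto_phi_right hν hr.1) ?_
        filter_upwards [self_mem_nhdsWithin] with t ht
        obtain ⟨t', ht', hlt⟩ := exists_lt_of_csInf_lt hne (h.trans_lt ht)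
        have := phi_add_le (P := P) hν ht'.1.1 hlt.le
        linarith [ht'.2]
    · intro h
      refine le_of_forall_gt_imp_ge_of_dense fun b hb => ?_
      rcases le_total P.h b with hb' | hb'
      · exact (csInf_le hbdd ⟨⟨hh.le, le_rfl⟩, hsS⟩).trans hb'
      · refine csInf_le hbdd ⟨⟨(hr.1.trans hb).le, hb'⟩, ?_⟩
        have := phi_add_le (P := P) hν hr.1.le hb.le
        linarith

theorem isClock_rightInv_phi {φ : ℝ → ℝ} {S : ℝ} (hS : S = P.phi p P.h)
    (hφ : ∀ s ∈ Icc 0 S, φ s = rightInv (P.phi p) 0 P.h 0 S s) :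
    IsClock φ S P.h ∧ ∀ r ∈ Ioc 0 P.h, P.phi p r = hi φ S r := by
  have hh := P.h_pos
  have hS0 : 0 < S := by rw [hS]; exact hh.trans_le (phi_nonneg hν hh.le)
  have hle : ∀ r ∈ Ioc 0 P.h, ∀ s ∈ Icc 0 S, φ s ≤ r ↔ s ≤ P.phi p r := by
    intro r hr s hs
    rw [hφ s hs]
    subst hS
    exact rightInv_phi_le_iff hν hr hs
  have hmem : ∀ s ∈ Icc 0 S, φ s ∈ Icc 0 P.h := by
    intro s hs
    refine ⟨?_, (hle P.h ⟨hh, le_rfl⟩ s hs).2 (by rw [← hS]; exact hs.2)⟩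
    rw [hφ s hs]
    unfold rightInv
    split_ifs
    · exact le_rfl
    · exact hh.le
    · exact Real.sInf_nonneg fun t ht => ht.1.1
  refine ⟨isClock_of_le_iff hS0 hh hmem ?_ ?_ hle fun r r' hr hrr _ => phi_add_le hν hr.le hrr, ?_⟩
  · rw [hφ 0 ⟨le_rfl, hS0.le⟩, rightInv, if_pos rfl]
  · rw [hφ S ⟨hS0.le, le_rfl⟩, rightInv, if_neg hS0.ne', if_pos rfl]
  · intro r hr
    refine (hi_eq_of_le_iff ⟨hr.1.le.trans (phi_nonneg hν hr.1.le), ?_⟩ (hle r hr)).symm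
    rw [hS]
    have := phi_add_le (P := P) hν hr.1.le hr.2
    linarith [hr.2]

end Clock

end DelaySystem

/-! ### Atoms and continuous parts of `μ_l` and `ν_l` for an impulse control. -/

namespace DelaySystem

variable {n m N M : ℕ} {P : DelaySystem n m N M}

section Atoms

variable {p : ImpulseData n m} (hp : P.IsImpulseControl p)

theorem shift_preimage_singleton {r : ℝ} (hr : r ∈ Ioo 0 P.h) (l : ℕ) :
    (fun t => t - ((l : ℝ) - 1) * P.h) ⁻¹' {r} ∩ Ioo (((l : ℝ) - 1) * P.h) (l * P.h)
      = {r + ((l : ℝ) - 1) * P.h} := by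
  ext t
  simp only [mem_inter_iff, mem_preimage, mem_singleton_iff, mem_Ioo]
  constructor
  · rintro ⟨h, -⟩; linarith
  · rintro rfl; exact ⟨by ring, by linarith [hr.1], by linarith [hr.2]⟩

theorem shift_preimage_endpoint {r : ℝ} (hr : r = 0 ∨ r = P.h) (l : ℕ) :
    (fun t => t - ((l : ℝ) - 1) * P.h) ⁻¹' {r} ∩ Ioo (((l : ℝ) - 1) * P.h) (l * P.h) = ∅ := by
  ext t
  simp only [mem_inter_iff, mem_preimage, mem_singleton_iff, mem_Ioo, mem_empty_iff_false,
    iff_false]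
  rintro ⟨h, h1, h2⟩
  rcases hr with rfl | rfl <;> linarith

include hp

theorem nuL_singleton {r : ℝ} (hr : r ∈ Icc 0 P.h) {l : ℕ} (hl : l ∈ Finset.Icc 1 N) :
    P.nuL p l {r} = ENNReal.ofReal (∫ s in (0)..1, l1 (p.ω r l s)) := by
  have hh := P.h_pos
  have := hp.ν_finite
  rw [P.nuL_apply p l (measurableSet_singleton r)]
  rcases hr.1.eq_or_lt with h0 | h0
  · subst h0
    rw [shift_preimage_endpoint (Or.inl rfl), indicator_of_mem (mem_singleton (0 : ℝ)),
      indicator_of_notMem (s := {0}) hh.ne']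
    simp
  · rcases hr.2.eq_or_lt with h1 | h1
    · subst h1
      rw [shift_preimage_endpoint (Or.inr rfl), indicator_of_mem (mem_singleton P.h),
        indicator_of_notMem (s := {P.h}) hh.ne]
      simp
    · rw [shift_preimage_singleton ⟨h0, h1⟩, hp.ν_atom r ⟨h0, h1⟩ l hl,
        indicator_of_notMem (s := {r}) h0.ne, indicator_of_notMem (s := {r}) h1.ne', add_zero,
        add_zero, ofReal_measureReal]

theorem muL_singleton {r : ℝ} (hr : r ∈ Icc 0 P.h) {l : ℕ} (hl : l ∈ Finset.Icc 1 N) (j : Fin m) :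
    P.muL p l j {r} = ∫ s in (0)..1, p.ω r l s j := by
  have hh := P.h_pos
  rw [P.muL_apply p l j (measurableSet_singleton r)]
  rcases hr.1.eq_or_lt with h0 | h0
  · subst h0
    rw [shift_preimage_endpoint (Or.inl rfl), indicator_of_mem (mem_singleton (0 : ℝ)),
      indicator_of_notMem (s := {0}) hh.ne']
    simp
  · rcases hr.2.eq_or_lt with h1 | h1
    · subst h1
      rw [shift_preimage_endpoint (Or.inr rfl), indicator_of_mem (mem_singleton P.h),
        indicator_of_notMem (s := {P.h}) hh.ne]
      simp
    · rw [shift_preimage_singleton ⟨h0, h1⟩, hp.μ_atom r ⟨h0, h1⟩ l hl j,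
        indicator_of_notMem (s := {r}) h0.ne, indicator_of_notMem (s := {r}) h1.ne', add_zero,
        add_zero]

theorem integrable_l1_ω {r : ℝ} (hr : r ∈ Icc 0 P.h) {l : ℕ} (hl : l ∈ Finset.Icc 1 N) :
    IntervalIntegrable (fun s => l1 (p.ω r l s)) volume 0 1 := by
  rw [intervalIntegrable_iff_integrableOn_Icc_of_le zero_le_one]
  exact integrable_l1 ((hp.ω_bdd r hr l hl).integrable le_top)

theorem integral_ω_eq_zero {r : ℝ} (hr : r ∈ Icc 0 P.h) {l : ℕ} (hl : l ∈ Finset.Icc 1 N)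
    (h0 : ∫ s in (0)..1, l1 (p.ω r l s) = 0) (j : Fin m) : ∫ s in (0)..1, p.ω r l s j = 0 := by
  have h1 : ‖∫ s in (0)..1, p.ω r l s j‖ ≤ ∫ s in (0)..1, l1 (p.ω r l s) :=
    intervalIntegral.norm_integral_le_of_norm_le zero_le_one
      (Eventually.of_forall fun s _ => abs_le_l1 _ j) (integrable_l1_ω hp hr hl)
  rw [h0] at h1
  exact norm_le_zero_iff.1 h1

end Atoms

theorem dphi_isFinite {p : ImpulseData n m} (hν : IsFiniteMeasure p.ν) :
    IsFiniteMeasure (P.dphi p) := by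
  have hfin : ∀ l, IsFiniteMeasure (P.nuL p l) := P.isFiniteMeasure_nuL p hν
  unfold dphi
  infer_instance

theorem nuL_le_dphi (p : ImpulseData n m) {l : ℕ} (hl : l ∈ Finset.Icc 1 N) :
    P.nuL p l ≤ P.dphi p := by
  refine Measure.le_iff.2 fun A _ => ?_
  unfold dphi
  rw [Measure.add_apply, Measure.finsetSum_apply]
  exact (Finset.single_le_sum (f := fun l => P.nuL p l A) (fun _ _ => zero_le) hl).trans
    le_add_self

section Density

variable {p : ImpulseData n m} (hp : P.IsImpulseControl p) {φ : ℝ → ℝ} {S : ℝ}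
  (hc : IsClock φ S P.h) (hphi : ∀ r ∈ Ioc 0 P.h, P.phi p r = hi φ S r)
include hp hc hphi

theorem dphi_apply {A : Set ℝ} (hA : MeasurableSet A) :
    P.dphi p A = volume (Icc 0 S ∩ φ ⁻¹' A) := by
  rw [dphi_eq hc hphi hp.ν_finite, Measure.map_apply_of_aemeasurable hc.aemeasurable hA,
    Measure.restrict_apply₀' measurableSet_Icc.nullMeasurableSet, inter_comm]

theorem dphi_singleton {r : ℝ} (hr : r ∈ Icc 0 P.h) :
    P.dphi p {r} = ENNReal.ofReal (hi φ S r - lo φ S r) := by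
  rw [dphi_apply hp hc hphi (measurableSet_singleton _), hc.preimage_singleton hr,
    Real.volume_Icc]

theorem dphi_singleton_eq_zero {t : ℝ} (ht : t ∉ jset φ S P.h) : P.dphi p {t} = 0 := by
  by_cases hr : t ∈ Icc 0 P.h
  · rw [dphi_singleton hp hc hphi hr, ENNReal.ofReal_eq_zero]
    have : ¬ lo φ S t < hi φ S t := fun h => ht ⟨hr, h⟩
    linarith [not_lt.1 this]
  · rw [dphi_apply hp hc hphi (measurableSet_singleton _)]
    refine measure_mono_null (t := ∅) (fun s hs => ?_) measure_empty
    have h2 : φ s = t := hs.2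
    exact hr (h2 ▸ hc.mem_Icc hs.1)

theorem nuL_singleton_eq_zero {l : ℕ} (hl : l ∈ Finset.Icc 1 N) {t : ℝ}
    (ht : t ∉ jset φ S P.h) : P.nuL p l {t} = 0 :=
  le_antisymm ((nuL_le_dphi p hl _).trans (dphi_singleton_eq_zero hp hc hphi ht).le) zero_le

theorem integral_l1_ω_eq_zero {l : ℕ} (hl : l ∈ Finset.Icc 1 N) {t : ℝ} (hr : t ∈ Icc 0 P.h)
    (ht : t ∉ jset φ S P.h) : ∫ s in (0)..1, l1 (p.ω t l s) = 0 := by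
  have h1 := nuL_singleton_eq_zero hp hc hphi hl ht
  rw [nuL_singleton hp hr hl, ENNReal.ofReal_eq_zero] at h1
  exact le_antisymm h1 (intervalIntegral.integral_nonneg zero_le_one fun _ _ => l1_nonneg _)

theorem muL_singleton_eq_zero {l : ℕ} (hl : l ∈ Finset.Icc 1 N) {t : ℝ}
    (ht : t ∉ jset φ S P.h) (j : Fin m) : P.muL p l j {t} = 0 := by
  by_cases hr : t ∈ Icc 0 P.h
  · rw [muL_singleton hp hr hl]
    exact integral_ω_eq_zero hp hr hl (integral_l1_ω_eq_zero hp hc hphi hl hr ht) j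
  · exact P.muL_compl p l j _ (measurableSet_singleton _) (singleton_subset_iff.2 hr)

/-- Both sides are the mass of `{r}` under `dϕ`: the Lebesgue part has no atom, and the atoms of the
`ν_l` are the integrals of `‖ω^r_l‖`. -/
theorem sum_integral_l1_ω {r : ℝ} (hr : r ∈ Icc 0 P.h) :
    ∑ l ∈ Finset.Icc 1 N, ∫ s in (0)..1, l1 (p.ω r l s) = hi φ S r - lo φ S r := by
  have h1 := dphi_singleton hp hc hphi hr
  have hnn : ∀ l, 0 ≤ ∫ s in (0)..1, l1 (p.ω r l s) := fun l =>
    intervalIntegral.integral_nonneg zero_le_one fun _ _ => l1_nonneg _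
  unfold dphi at h1
  rw [Measure.add_apply, Measure.finsetSum_apply,
    measure_mono_null (Subset.rfl) (by
      rw [Measure.restrict_apply (measurableSet_singleton _)]
      exact measure_mono_null inter_subset_left Real.volume_singleton), zero_add,
    Finset.sum_congr rfl fun l hl => nuL_singleton hp hr hl,
    ← ENNReal.ofReal_sum_of_nonneg fun l _ => hnn l] at h1
  rwa [ENNReal.ofReal_eq_ofReal_iff (Finset.sum_nonneg fun l _ => hnn l)
    (sub_nonneg.2 (hc.lo_le_hi hr))] at h1

omit hp hphi in
theorem shift_preimage_diff (l : ℕ) (A : Set ℝ) :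
    (fun t => t - ((l : ℝ) - 1) * P.h) ⁻¹' (A \ jset φ S P.h) ∩
        Ioo (((l : ℝ) - 1) * P.h) (l * P.h)
      = ((fun t => t - ((l : ℝ) - 1) * P.h) ⁻¹' A ∩ Ioo (((l : ℝ) - 1) * P.h) (l * P.h)) \
        (fun t => t - ((l : ℝ) - 1) * P.h) ⁻¹' (jset φ S P.h) ∧
    ((fun t => t - ((l : ℝ) - 1) * P.h) ⁻¹' (jset φ S P.h)).Countable := by
  constructor
  · ext t
    simp only [mem_inter_iff, Set.mem_sdiff, mem_preimage]
    tauto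
  · exact hc.countable_jset.preimage_of_injOn fun a _ b _ h => sub_left_injective h

/-- Every atom of `ν` inside the block comes from a stopping value, and conversely discarding the
countably many stopping values costs `νᶜ` nothing. The endpoint atoms vanish when `0` or `h` is not
a stopping value and are removed otherwise. -/
theorem nuL_diff {l : ℕ} (hl : l ∈ Finset.Icc 1 N) {A : Set ℝ} (hA : MeasurableSet A) :
    P.nuL p l (A \ jset φ S P.h) = contMeas p.ν
      ((fun t => t - ((l : ℝ) - 1) * P.h) ⁻¹' A ∩ Ioo (((l : ℝ) - 1) * P.h) (l * P.h)) := by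
  have := hp.ν_finite
  have hh := P.h_pos.le
  have hm : Measurable fun t => t - ((l : ℝ) - 1) * P.h := by fun_prop
  obtain ⟨e1, hD⟩ := shift_preimage_diff (P := P) hc l A
  have hz : ∀ r ∈ Icc 0 P.h, (A \ jset φ S P.h).indicator
      (fun _ => ENNReal.ofReal (∫ s in (0)..1, l1 (p.ω r l s))) r = 0 := by
    intro r hr
    rw [indicator_apply_eq_zero]
    intro h
    rw [integral_l1_ω_eq_zero hp hc hphi hl hr h.2, ENNReal.ofReal_zero]
  rw [P.nuL_apply p l (hA.diff hc.measurableSet_jset), hz 0 ⟨le_rfl, hh⟩, hz P.h ⟨hh, le_rfl⟩,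
    add_zero, add_zero, e1, contMeas_apply _ ((hm hA).inter measurableSet_Ioo)]
  rw [measure_apply_sub_countable hD (A := ((fun t => t - ((l : ℝ) - 1) * P.h) ⁻¹' A ∩
    Ioo (((l : ℝ) - 1) * P.h) (l * P.h)) ∩ {t | p.ν {t} = 0}) fun t ht _ => ht.2]
  congr 1
  ext t
  simp only [Set.mem_sdiff, mem_inter_iff, mem_preimage, mem_ofPred_eq]
  constructor
  · rintro ⟨⟨h1, h2⟩, h3⟩
    refine ⟨⟨⟨h1, h2⟩, ?_⟩, h3⟩
    have h4 := nuL_singleton_eq_zero hp hc hphi hl h3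
    have h5 : t - ((l : ℝ) - 1) * P.h ∈ Ioo 0 P.h := ⟨by linarith [h2.1], by linarith [h2.2]⟩
    rw [nuL_singleton hp (Ioo_subset_Icc_self h5) hl, hp.ν_atom _ h5 l hl, ofReal_measureReal,
      sub_add_cancel] at h4
    exact h4
  · rintro ⟨⟨⟨h1, h2⟩, -⟩, h3⟩
    exact ⟨⟨h1, h2⟩, h3⟩

theorem muL_diff {l : ℕ} (hl : l ∈ Finset.Icc 1 N) (j : Fin m) {A : Set ℝ}
    (hA : MeasurableSet A) : P.muL p l j (A \ jset φ S P.h) = contVec p.μ j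
      ((fun t => t - ((l : ℝ) - 1) * P.h) ⁻¹' A ∩ Ioo (((l : ℝ) - 1) * P.h) (l * P.h)) := by
  have hh := P.h_pos.le
  have hm : Measurable fun t => t - ((l : ℝ) - 1) * P.h := by fun_prop
  obtain ⟨e1, hD⟩ := shift_preimage_diff (P := P) hc l A
  have hz : ∀ r ∈ Icc 0 P.h, (A \ jset φ S P.h).indicator
      (fun _ => ∫ s in (0)..1, p.ω r l s j) r = 0 := by
    intro r hr
    rw [indicator_apply_eq_zero]
    intro h
    exact integral_ω_eq_zero hp hr hl (integral_l1_ω_eq_zero hp hc hphi hl hr h.2) j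
  rw [P.muL_apply p l j (hA.diff hc.measurableSet_jset), hz 0 ⟨le_rfl, hh⟩, hz P.h ⟨hh, le_rfl⟩,
    add_zero, add_zero, e1, contVec_apply _ _ ((hm hA).inter measurableSet_Ioo)]
  rw [signedMeasure_apply_sub_countable (A := ((fun t => t - ((l : ℝ) - 1) * P.h) ⁻¹' A ∩
    Ioo (((l : ℝ) - 1) * P.h) (l * P.h)) ∩ {t | ∀ i, p.μ i {t} = 0})
    (((hm hA).inter measurableSet_Ioo).inter (measurableSet_atoms _)) hD fun t ht _ => ht.2 j]
  congr 1
  ext t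
  simp only [Set.mem_sdiff, mem_inter_iff, mem_preimage, mem_ofPred_eq]
  constructor
  · rintro ⟨⟨h1, h2⟩, h3⟩
    refine ⟨⟨⟨h1, h2⟩, fun i => ?_⟩, h3⟩
    have h4 := muL_singleton_eq_zero hp hc hphi hl h3 i
    have h5 : t - ((l : ℝ) - 1) * P.h ∈ Ioo 0 P.h := ⟨by linarith [h2.1], by linarith [h2.2]⟩
    rw [muL_singleton hp (Ioo_subset_Icc_self h5) hl, hp.μ_atom _ h5 l hl,
      sub_add_cancel] at h4
    exact h4
  · rintro ⟨⟨⟨h1, h2⟩, -⟩, h3⟩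
    exact ⟨⟨h1, h2⟩, h3⟩

theorem contVec_muL {l : ℕ} (hl : l ∈ Finset.Icc 1 N) (j : Fin m) {A : Set ℝ}
    (hA : MeasurableSet A) : contVec (P.muL p l) j A = P.muL p l j (A \ jset φ S P.h) :=
  contVec_apply_eq_diff hc.countable_jset
    (fun _ ht i => muL_singleton_eq_zero hp hc hphi hl ht i) j hA

/-- The continuous part of `μ_l` has a density with respect to `dϕ` which is a nonnegative
multiple of an element of `K`, and whose norm is the density of the continuous part of `ν_l`. -/
theorem mL_spec {l : ℕ} (hl : l ∈ Finset.Icc 1 N) :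
    Integrable (P.mL p l) (P.dphi p) ∧
    (∀ j A, MeasurableSet A →
      P.muL p l j (A \ jset φ S P.h) = ∫ t in A, P.mL p l t j ∂(P.dphi p)) ∧
    (∀ A, MeasurableSet A →
      P.nuL p l (A \ jset φ S P.h) = ∫⁻ t in A, ENNReal.ofReal (l1 (P.mL p l t)) ∂(P.dphi p)) ∧
    ∀ᵐ t ∂(P.dphi p), P.mL p l t ∈ P.K := by
  have := hp.ν_finite
  have hfin := P.isFiniteMeasure_nuL p hp.ν_finite
  have hfin' := dphi_isFinite (P := P) hp.ν_finite
  have h0K : (0 : Fin m → ℝ) ∈ P.K := by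
    obtain ⟨w, hw⟩ := P.K_nonempty
    simpa using P.K_cone w hw 0 le_rfl
  set J := jset φ S P.h with hJ
  set sh : ℝ → ℝ := fun t => t - ((l : ℝ) - 1) * P.h with hsh
  have hshm : Measurable sh := by fun_prop
  set ν' := (P.nuL p l).restrict Jᶜ with hν'
  have hν'a : ∀ A, MeasurableSet A → ν' A = P.nuL p l (A \ J) := fun A hA => by
    rw [hν', Measure.restrict_apply hA]; rfl
  set Λ := totalVar (contVec p.μ) with hΛ
  have hΛν : contMeas p.ν = Λ := hp.ν_mem.1
  set k := polarDensity (contVec p.μ) with hk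
  have hkm : Measurable k := measurable_polarDensity _
  set I := Ioo (((l : ℝ) - 1) * P.h) (l * P.h) with hI
  -- This is where `νᶜ = |μᶜ|` enters: off the stopping values `ν_l` is the translate of `|μᶜ|`, so
  -- the polar density of `μᶜ`, which lies in `K` and has norm one, is also the density of `μ_l`
  -- with respect to `ν_l` there.
  have hmap : ν' = (Λ.restrict I).map sh := by
    ext A hA
    rw [hν'a A hA, Measure.map_apply hshm hA, Measure.restrict_apply (hshm hA),
      nuL_diff hp hc hphi hl hA, hΛν]
  set k' : ℝ → Fin m → ℝ := fun t => k (t + ((l : ℝ) - 1) * P.h) with hk'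
  have hk'm : Measurable k' := hkm.comp (by fun_prop)
  have hk'sh : ∀ t, k' (sh t) = k t := fun t => by simp [hk', hsh]
  have hk'i : Integrable k' ν' := by
    rw [hmap, integrable_map_measure hk'm.aestronglyMeasurable hshm.aemeasurable]
    have : k' ∘ sh = k := funext hk'sh
    rw [this]
    exact (integrable_polarDensity _).integrableOn
  have hk'K : ∀ᵐ t ∂ν', k' t ∈ P.K ∧ l1 (k' t) = 1 := by
    rw [hmap, ae_map_iff hshm.aemeasurable]
    · simp only [hk'sh]
      exact ae_restrict_of_ae (hp.μ_cont.2.and (ae_l1_polarDensity _))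
    · exact (hk'm P.K_closed.measurableSet).inter
        ((measurable_l1.comp hk'm) (measurableSet_singleton 1))
  have hμ' : ∀ j A, MeasurableSet A → P.muL p l j (A \ J) = ∫ t in A, k' t j ∂ν' := by
    intro j A hA
    rw [muL_diff hp hc hphi hl j hA, apply_eq_integral_polarDensity_eval _
      ((hshm hA).inter measurableSet_Ioo), hmap, setIntegral_map (f := fun t => k' t j) hA
        ((measurable_pi_apply j).comp hk'm).aestronglyMeasurable hshm.aemeasurable,
      Measure.restrict_restrict (hshm hA)]
    simp only [hk'sh]
    rfl
  have hac : ν' ≪ P.dphi p :=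
    (Measure.absolutelyContinuous_of_le (Measure.restrict_le_self)).trans
      (Measure.absolutelyContinuous_of_le (nuL_le_dphi p hl))
  set rn := ν'.rnDeriv (P.dphi p) with hrn
  have hκi : Integrable (fun t => (rn t).toReal • k' t) (P.dphi p) :=
    (integrable_rnDeriv_smul_iff hac).2 hk'i
  have hκ : ∀ j A, MeasurableSet A →
      P.muL p l j (A \ J) = ∫ t in A, (rn t).toReal • k' t j ∂(P.dphi p) := fun j A hA => by
    rw [hμ' j A hA, setIntegral_rnDeriv_smul hac hA]
  have hm : ∀ᵐ t ∂(P.dphi p), P.mL p l t = (rn t).toReal • k' t := by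
    have key : ∀ j, ∀ᵐ t ∂(P.dphi p), P.mL p l t j = (rn t).toReal • k' t j := by
      intro j
      have hκj : Integrable (fun t => (rn t).toReal • k' t j) (P.dphi p) := hκi.eval j
      refine EventuallyEq.symm (SignedMeasure.eq_rnDeriv 0 _ hκj
        VectorMeasure.MutuallySingular.zero_left ?_)
      rw [zero_add]
      ext A hA
      rw [withDensityᵥ_apply hκj hA, contVec_muL hp hc hphi hl j hA, hκ j A hA]
    filter_upwards [ae_all_iff.2 key] with t ht
    funext j
    exact ht j
  -- The properties of `k'` hold almost everywhere for `ν_l` only. For `dϕ` they survive where the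
  -- density `rn` is nonzero; elsewhere `m_l = 0`, which belongs to `K`.
  have hpt : ∀ᵐ t ∂(P.dphi p), rn t ≠ 0 → k' t ∈ P.K ∧ l1 (k' t) = 1 := by
    rw [← ae_withDensity_iff (Measure.measurable_rnDeriv _ _),
      Measure.withDensity_rnDeriv_eq _ _ hac]
    exact hk'K
  refine ⟨hκi.congr (hm.mono fun t ht => ht.symm), ?_, ?_, ?_⟩
  · intro j A hA
    rw [hκ j A hA]
    refine integral_congr_ae (ae_restrict_of_ae (hm.mono fun t ht => ?_))
    simp only [ht, Pi.smul_apply]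
  · intro A hA
    rw [← hν'a A hA, ← Measure.setLIntegral_rnDeriv hac]
    refine lintegral_congr_ae (ae_restrict_of_ae ?_)
    filter_upwards [hm, hpt, Measure.rnDeriv_lt_top ν' (P.dphi p)] with t h1 h2 h3
    rw [h1, l1_smul, abs_of_nonneg ENNReal.toReal_nonneg]
    by_cases h0 : rn t = 0
    · rw [← hrn, h0]; simp
    · rw [(h2 h0).2, mul_one, ENNReal.ofReal_toReal h3.ne]
  · filter_upwards [hm, hpt] with t h1 h2
    rw [h1]
    by_cases h0 : rn t = 0
    · rw [h0]; simpa using h0K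
    · exact P.K_cone _ (h2 h0).1 _ ENNReal.toReal_nonneg

end Density

end DelaySystem

/-! ### The derivative of the clock and the normalization off the stops. -/

namespace DelaySystem

variable {n m N M : ℕ} {P : DelaySystem n m N M}

/-- The density of the Lebesgue measure on `[0, h]` with respect to `dϕ`. -/
def rho (P : DelaySystem n m N M) (p : ImpulseData n m) (t : ℝ) : ℝ :=
  ((volume.restrict (Icc 0 P.h)).rnDeriv (P.dphi p) t).toReal

section Density

variable {p : ImpulseData n m} (hp : P.IsImpulseControl p) {φ : ℝ → ℝ} {S : ℝ}
  (hc : IsClock φ S P.h) (hphi : ∀ r ∈ Ioc 0 P.h, P.phi p r = hi φ S r)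
include hp

theorem setIntegral_rho (A : Set ℝ) :
    ∫ t in A, P.rho p t ∂(P.dphi p) = (volume.restrict (Icc 0 P.h)).real A := by
  have hfin' := dphi_isFinite (P := P) hp.ν_finite
  have hac : volume.restrict (Icc 0 P.h) ≪ P.dphi p :=
    Measure.absolutelyContinuous_of_le (Measure.le_add_right le_rfl)
  exact Measure.setIntegral_toReal_rnDeriv hac A

theorem integrable_rho : Integrable (P.rho p) (P.dphi p) := by
  have hfin' := dphi_isFinite (P := P) hp.ν_finite
  exact Measure.integrable_toReal_rnDeriv

include hc hphi

/-- A pointwise statement about a density is legitimate here because `{r}` has positive `dϕ`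
measure, while Lebesgue measure has no atom. -/
theorem rho_eq_zero {r : ℝ} (hr : r ∈ jset φ S P.h) : P.rho p r = 0 := by
  have h1 := setIntegral_rho hp {r}
  rw [integral_singleton, measureReal_def, measureReal_def, dphi_singleton hp hc hphi hr.1,
    ENNReal.toReal_ofReal (sub_pos.2 hr.2).le,
    measure_mono_null (Subset.rfl) (by
      rw [Measure.restrict_apply (measurableSet_singleton _)]
      exact measure_mono_null inter_subset_left Real.volume_singleton), ENNReal.toReal_zero,
    smul_eq_mul, mul_eq_zero] at h1
  exact h1.resolve_left (sub_pos.2 hr.2).ne'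

/-- Off the stopping values `dϕ` is the sum of Lebesgue measure and of the continuous parts of the
`ν_l`, whose densities with respect to `dϕ` are `ρ` and `‖m_l‖`. The densities of the summands add
up to one, as one checks by integrating over arbitrary sets. -/
theorem rho_add_sum : ∀ᵐ t ∂(P.dphi p), t ∉ jset φ S P.h →
    P.rho p t + ∑ l ∈ Finset.Icc 1 N, l1 (P.mL p l t) = 1 := by
  have hfin := P.isFiniteMeasure_nuL p hp.ν_finite
  have hfin' := dphi_isFinite (P := P) hp.ν_finite
  have hint : ∀ l ∈ Finset.Icc 1 N, Integrable (fun t => l1 (P.mL p l t)) (P.dphi p) :=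
    fun l hl => integrable_l1 (mL_spec hp hc hphi hl).1
  have hJ := hc.measurableSet_jset
  have hone : Integrable ((jset φ S P.h)ᶜ.indicator fun _ => (1 : ℝ)) (P.dphi p) :=
    (integrable_const 1).indicator hJ.compl
  have key : (fun t => P.rho p t + ∑ l ∈ Finset.Icc 1 N, l1 (P.mL p l t))
      =ᵐ[P.dphi p] (jset φ S P.h)ᶜ.indicator fun _ => (1 : ℝ) := by
    refine Integrable.ae_eq_of_forall_setIntegral_eq _ _
      ((integrable_rho hp).add (integrable_finsetSum _ hint)) hone fun A hA _ => ?_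
    rw [integral_add (integrable_rho hp).integrableOn
      (integrable_finsetSum _ fun l hl => (hint l hl).integrableOn),
      integral_finsetSum _ fun l hl => (hint l hl).integrableOn, setIntegral_rho hp,
      setIntegral_indicator hJ.compl, setIntegral_const, smul_eq_mul, mul_one]
    have e1 : ∀ l ∈ Finset.Icc 1 N, ∫ t in A, l1 (P.mL p l t) ∂(P.dphi p)
        = (P.nuL p l).real (A \ jset φ S P.h) := by
      intro l hl
      rw [measureReal_def, (mL_spec hp hc hphi hl).2.2.1 A hA,
        ← ofReal_integral_eq_lintegral_ofReal (hint l hl).integrableOn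
          (Eventually.of_forall fun t => l1_nonneg _),
        ENNReal.toReal_ofReal (integral_nonneg fun t => l1_nonneg _)]
    have e2 : volume.restrict (Icc 0 P.h) A = volume.restrict (Icc 0 P.h) (A \ jset φ S P.h) :=
      (measure_sdiff_null (hc.countable_jset.measure_zero _)).symm
    have e3 : (P.dphi p) (A ∩ (jset φ S P.h)ᶜ) = volume.restrict (Icc 0 P.h) (A \ jset φ S P.h)
        + ∑ l ∈ Finset.Icc 1 N, P.nuL p l (A \ jset φ S P.h) := by
      unfold dphi
      rw [Measure.add_apply, Measure.finsetSum_apply]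
      rfl
    rw [Finset.sum_congr rfl e1, measureReal_def, measureReal_def, e2, e3,
      ENNReal.toReal_add (measure_ne_top _ _) (ENNReal.sum_ne_top.2 fun l _ => measure_ne_top _ _),
      ENNReal.toReal_sum fun l _ => measure_ne_top _ _]
    rfl
  filter_upwards [key] with t ht htJ
  rw [ht, indicator_of_mem htJ]

theorem ae_rho_comp : ∀ᵐ s ∂(volume.restrict (Icc 0 S)),
    ‖P.rho p (φ s)‖ ≤ (1 : NNReal) ∧
    (s ∉ uset φ S P.h → P.rho p (φ s) + ∑ l ∈ Finset.Icc 1 N, l1 (P.mL p l (φ s)) = 1) := by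
  have h1 := rho_add_sum hp hc hphi
  rw [dphi_eq hc hphi hp.ν_finite] at h1
  filter_upwards [ae_of_ae_map hc.aemeasurable h1, ae_restrict_mem measurableSet_Icc] with s hs hm
  rw [← hc.mem_uset_iff hm] at hs
  refine ⟨?_, hs⟩
  have h0 : 0 ≤ P.rho p (φ s) := ENNReal.toReal_nonneg
  rw [Real.norm_of_nonneg h0, NNReal.coe_one]
  by_cases hU : s ∈ uset φ S P.h
  · rw [rho_eq_zero hp hc hphi ((hc.mem_uset_iff hm).1 hU)]
    exact zero_le_one
  · have h2 : 0 ≤ ∑ l ∈ Finset.Icc 1 N, l1 (P.mL p l (φ s)) :=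
      Finset.sum_nonneg fun _ _ => l1_nonneg _
    linarith [hs hU]

theorem integrable_rho_comp : IntegrableOn (fun s => P.rho p (φ s)) (Icc 0 S) := by
  have h1 := integrable_rho hp
  rw [dphi_eq hc hphi hp.ν_finite] at h1
  exact h1.comp_aemeasurable hc.aemeasurable

/-- With `r = φ s`, the integral up to `hi r` is the Lebesgue measure of `[0, r]`, that is `r`.
Between `s` and `hi r` the clock is stopped and the integrand is the constant `ρ(r)`, which is zero
unless that interval is trivial. -/
theorem clock_eq_integral_rho {s : ℝ} (hs : s ∈ Icc 0 S) :
    φ s = ∫ t in (0)..s, P.rho p (φ t) := by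
  have hr := hc.mem_Icc hs
  set r := φ s with hrdef
  have hsr : s ≤ hi φ S r := (hc.le_hi_iff hr hs).2 le_rfl
  have hlr : lo φ S r ≤ s := (hc.lo_le_iff hr hs).2 le_rfl
  have hint := integrable_rho_comp hp hc hphi
  have hint' : ∀ a b, a ∈ Icc 0 S → b ∈ Icc 0 S →
      IntervalIntegrable (fun s => P.rho p (φ s)) volume a b := by
    intro a b ha hb
    refine (hint.mono_set ?_).intervalIntegrable
    exact uIcc_subset_Icc ha hb
  have h0S : (0 : ℝ) ∈ Icc 0 S := ⟨le_rfl, hc.S_pos.le⟩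
  have h1 := intervalIntegral.integral_add_adjacent_intervals (hint' 0 s h0S hs)
    (hint' s (hi φ S r) hs (hc.hi_spec hr).1)
  have h2 : ∫ t in s..(hi φ S r), P.rho p (φ t) = 0 := by
    have : ∀ t ∈ uIcc s (hi φ S r), P.rho p (φ t) = P.rho p r := by
      intro t ht
      rw [uIcc_of_le hsr] at ht
      rw [hc.apply_eq hr ⟨hlr.trans ht.1, ht.2⟩]
    rw [intervalIntegral.integral_congr this, intervalIntegral.integral_const, smul_eq_mul,
      mul_eq_zero]
    rcases hsr.eq_or_lt with h | h
    · left; rw [← h, sub_self]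
    · right; exact rho_eq_zero hp hc hphi ⟨hr, hlr.trans_lt h⟩
  have h3 : ∫ t in (0)..(hi φ S r), P.rho p (φ t) = r := by
    have h4 := setIntegral_rho hp (Icc 0 r)
    have hm := (integrable_rho hp).aestronglyMeasurable
    rw [dphi_eq hc hphi hp.ν_finite] at h4 hm
    rw [setIntegral_map measurableSet_Icc hm hc.aemeasurable,
      Measure.restrict_restrict' measurableSet_Icc, inter_comm, hc.preimage_Icc hr,
      measureReal_def, Measure.restrict_apply measurableSet_Icc,
      inter_eq_left.2 (Icc_subset_Icc le_rfl hr.2), Real.volume_Icc, sub_zero,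
      ENNReal.toReal_ofReal hr.1, integral_Icc_eq_integral_Ioc,
      ← intervalIntegral.integral_of_le (IsClock.hi_nonneg _ _ _)] at h4
    exact h4
  rw [h2, h3, add_zero] at h1
  exact h1.symm

theorem solvesOn_rho : SolvesOn φ (fun s => P.rho p (φ s)) 0 S ∧
    LipschitzOnWith 1 φ (Icc 0 S) := by
  have hS := hc.S_pos.le
  refine solvesOn_of_eq_integral hS ?_ ((ae_rho_comp hp hc hphi).mono fun s hs => hs.1)
    fun s hs => ?_
  · rw [intervalIntegrable_iff_integrableOn_Icc_of_le hS]
    exact integrable_rho_comp hp hc hphi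
  · rw [hc.zero, zero_add]
    exact clock_eq_integral_rho hp hc hphi hs

theorem ae_mL_comp {l : ℕ} (hl : l ∈ Finset.Icc 1 N) :
    ∀ᵐ s ∂(volume.restrict (Icc 0 S)), P.mL p l (φ s) ∈ P.K := by
  have h1 := (mL_spec hp hc hphi hl).2.2.2
  rw [dphi_eq hc hphi hp.ν_finite] at h1
  exact ae_of_ae_map hc.aemeasurable h1

theorem muL_diff_eq {l : ℕ} (hl : l ∈ Finset.Icc 1 N) (j : Fin m) {A : Set ℝ}
    (hA : MeasurableSet A) : P.muL p l j (A \ jset φ S P.h)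
      = ∫ s in Icc 0 S ∩ φ ⁻¹' (A \ jset φ S P.h), P.mL p l (φ s) j := by
  have hm := (mL_spec hp hc hphi hl).1.eval j
  have hA' : MeasurableSet (A \ jset φ S P.h) := hA.diff hc.measurableSet_jset
  have h2 := (mL_spec hp hc hphi hl).2.1 j _ hA'
  rw [Set.sdiff_sdiff, union_self] at h2
  rw [dphi_eq hc hphi hp.ν_finite] at hm h2
  rw [h2, setIntegral_map hA' hm.aestronglyMeasurable hc.aemeasurable,
    Measure.restrict_restrict' measurableSet_Icc, inter_comm]

theorem nuL_diff_eq {l : ℕ} (hl : l ∈ Finset.Icc 1 N) {A : Set ℝ}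
    (hA : MeasurableSet A) : P.nuL p l (A \ jset φ S P.h)
      = ∫⁻ s in Icc 0 S ∩ φ ⁻¹' (A \ jset φ S P.h), ENNReal.ofReal (l1 (P.mL p l (φ s))) := by
  have hm := (integrable_l1 (mL_spec hp hc hphi hl).1).aestronglyMeasurable.aemeasurable
  have hA' : MeasurableSet (A \ jset φ S P.h) := hA.diff hc.measurableSet_jset
  have h2 := (mL_spec hp hc hphi hl).2.2.1 _ hA'
  rw [Set.sdiff_sdiff, union_self] at h2
  rw [dphi_eq hc hphi hp.ν_finite] at hm h2
  rw [h2, ← lintegral_indicator hA', lintegral_map' (hm.ennreal_ofReal.indicator hA')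
    hc.aemeasurable]
  have : ∀ s, (A \ jset φ S P.h).indicator (fun a => ENNReal.ofReal (l1 (P.mL p l a))) (φ s)
      = (φ ⁻¹' (A \ jset φ S P.h)).indicator (fun s => ENNReal.ofReal (l1 (P.mL p l (φ s)))) s :=
    fun s => rfl
  simp only [this]
  rw [lintegral_indicator₀ (hc.aemeasurable.nullMeasurableSet_preimage hA'),
    Measure.restrict_restrict' measurableSet_Icc, inter_comm]

end Density

end DelaySystem

/-- The interval `[0, N h]` as a disjoint union of open intervals and endpoints, seen by an
additive function of sets. -/
theorem apply_Icc_eq_sum {G : Type*} [AddCommMonoid G] {h : ℝ} (hh : 0 < h) {Q : Set ℝ → G}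
    (hQ : ∀ B C, MeasurableSet B → MeasurableSet C → Disjoint B C → Q (B ∪ C) = Q B + Q C)
    {A : Set ℝ} (hA : MeasurableSet A) (N : ℕ) :
    Q (A ∩ Icc 0 (N * h)) = ∑ l ∈ Finset.Icc 1 N, Q (A ∩ Ioo (((l : ℝ) - 1) * h) (l * h))
      + ∑ l ∈ Finset.Icc 0 N, Q (A ∩ {(l : ℝ) * h}) := by
  induction N with
  | zero => simp
  | succ N ih =>
    have hN : (0 : ℝ) ≤ N * h := by positivity
    have e : A ∩ Icc 0 (((N + 1 : ℕ) : ℝ) * h) = (A ∩ Icc 0 (N * h) ∪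
        A ∩ Ioo ((((N + 1 : ℕ) : ℝ) - 1) * h) (((N + 1 : ℕ) : ℝ) * h)) ∪
        A ∩ {((N + 1 : ℕ) : ℝ) * h} := by
      rw [← inter_union_distrib_left, ← inter_union_distrib_left]
      congr 1
      push_cast
      rw [add_sub_cancel_right]
      ext t
      simp only [mem_Icc, mem_union, mem_Ioo, mem_singleton_iff]
      constructor
      · rintro ⟨h1, h2⟩
        rcases h2.eq_or_lt with h3 | h3
        · exact Or.inr h3
        · rcases le_or_gt t (N * h) with h4 | h4
          · exact Or.inl (Or.inl ⟨h1, h4⟩)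
          · exact Or.inl (Or.inr ⟨h4, h3⟩)
      · rintro ((⟨h1, h2⟩ | ⟨h1, h2⟩) | rfl)
        · exact ⟨h1, by nlinarith⟩
        · exact ⟨by linarith, h2.le⟩
        · exact ⟨by positivity, le_rfl⟩
    have m1 : MeasurableSet (A ∩ Icc 0 ((N : ℝ) * h)) := hA.inter measurableSet_Icc
    have m2 : MeasurableSet (A ∩ Ioo ((((N + 1 : ℕ) : ℝ) - 1) * h) (((N + 1 : ℕ) : ℝ) * h)) :=
      hA.inter measurableSet_Ioo
    rw [e, hQ _ _ (m1.union m2) (hA.inter (measurableSet_singleton _)), hQ _ _ m1 m2, ih,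
      Finset.sum_Icc_succ_top (by omega : 1 ≤ N + 1),
      Finset.sum_Icc_succ_top (by omega : 0 ≤ N + 1)]
    · abel
    · refine Set.disjoint_left.2 ?_
      rintro t ⟨-, h1⟩ ⟨-, h2⟩
      have h3 := h2.1
      push_cast at h3
      rw [add_sub_cancel_right] at h3
      exact absurd h1.2 (not_le.2 h3)
    · refine Set.disjoint_left.2 ?_
      rintro t (⟨-, h1⟩ | ⟨-, h1⟩) ⟨-, rfl⟩
      · have := h1.2
        push_cast at this
        nlinarith
      · exact lt_irrefl _ h1.2

/-- Distributing the weights of the endpoints over the adjacent intervals. -/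
theorem sum_endpoints {G : Type*} [AddCommMonoid G] (N : ℕ) (c a b : ℕ → G)
    (hc : ∀ l ∈ Finset.Icc 0 N, c l = (if 1 ≤ l ∧ l ≤ N then a l else 0)
      + (if 1 ≤ l + 1 ∧ l + 1 ≤ N then b (l + 1) else 0)) :
    ∑ l ∈ Finset.Icc 0 N, c l = ∑ l ∈ Finset.Icc 1 N, (b l + a l) := by
  rw [Finset.sum_congr rfl hc, Finset.sum_add_distrib, Finset.sum_add_distrib, add_comm]
  congr 1
  · have e : Finset.Icc 1 N = (Finset.Ico 0 N).map (addRightEmbedding 1) := by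
      rw [Finset.map_add_right_Ico]; rfl
    rw [e, Finset.sum_map, ← Finset.sum_filter]
    refine Finset.sum_congr ?_ fun l _ => rfl
    ext l
    simp only [Finset.mem_filter, Finset.mem_Icc, Finset.mem_Ico]
    omega
  · rw [← Finset.sum_filter]
    refine Finset.sum_congr ?_ fun l _ => rfl
    ext l
    simp only [Finset.mem_filter, Finset.mem_Icc]
    omega

/-! ### Reassembling `μ` and `ν` from the blocks. -/

namespace DelaySystem

variable {n m N M : ℕ} {P : DelaySystem n m N M}

/-- Inside the open blocks there is nothing to do. The atom of `μ` at `lh` is divided between the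
right end of block `l` and the left end of block `l + 1` according to `ω^h_l` and `ω^0_{l+1}`. -/
theorem μ_eq_sum_muL {p : ImpulseData n m} (hp : P.IsImpulseControl p) (j : Fin m) {A : Set ℝ}
    (hA : MeasurableSet A) : p.μ j A = ∑ l ∈ Finset.Icc 1 N,
      P.muL p l j ((fun r => ((l : ℝ) - 1) * P.h + r) ⁻¹' A) := by
  have hh := P.h_pos
  have hsplit : ∀ B C, MeasurableSet B → MeasurableSet C → Disjoint B C →
      p.μ j (B ∪ C) = p.μ j B + p.μ j C := fun B C hB hC hd => VectorMeasure.of_union hd hB hC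
  have h0 : p.μ j A = p.μ j (A ∩ Icc 0 P.T) := by
    conv_lhs => rw [← inter_union_sdiff A (Icc 0 P.T)]
    rw [hsplit _ _ (hA.inter measurableSet_Icc) (hA.diff measurableSet_Icc)
      (disjoint_sdiff_right.mono_left inter_subset_right)]
    have : p.μ j (A \ Icc 0 P.T) = 0 := by
      refine SignedMeasure.null_of_totalVariation_zero _ (measure_mono_null (fun t ht => ht.2) ?_)
      have := hp.μ_supp
      rw [totalVar, Measure.finsetSum_apply, Finset.sum_eq_zero_iff] at this
      exact this j (Finset.mem_univ j)
    rw [this, add_zero]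
  have hend : ∀ l ∈ Finset.Icc 0 N, p.μ j (A ∩ {(l : ℝ) * P.h})
      = (if 1 ≤ l ∧ l ≤ N then A.indicator (fun _ => ∫ s in (0)..1, p.ω P.h l s j) (l * P.h) else 0)
        + (if 1 ≤ l + 1 ∧ l + 1 ≤ N then
          A.indicator (fun _ => ∫ s in (0)..1, p.ω 0 (l + 1) s j)
            ((((l + 1 : ℕ) : ℝ) - 1) * P.h) else 0) := by
    intro l hl
    have e1 : (((l + 1 : ℕ) : ℝ) - 1) * P.h = l * P.h := by push_cast; ring
    rw [e1]
    by_cases hm : (l : ℝ) * P.h ∈ A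
    · rw [inter_eq_right.2 (singleton_subset_iff.2 hm), indicator_of_mem hm, indicator_of_mem hm,
        ← hp.μ_atom_end l hl j]
      have hint : ∀ r ∈ Icc 0 P.h, ∀ l, IntervalIntegrable (fun s => P.omegaExt p r l s j)
          volume 0 1 := by
        intro r hr l
        unfold omegaExt
        split_ifs with h
        · rw [intervalIntegrable_iff_integrableOn_Icc_of_le zero_le_one]
          exact Integrable.eval ((hp.ω_bdd r hr l (Finset.mem_Icc.2 h)).integrable le_top) j
        · exact intervalIntegrable_const
      rw [intervalIntegral.integral_add (hint _ ⟨hh.le, le_rfl⟩ _) (hint _ ⟨le_rfl, hh.le⟩ _)]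
      unfold omegaExt
      congr 1 <;> split_ifs <;> simp
    · rw [inter_singleton_eq_empty.2 hm, VectorMeasure.empty, indicator_of_notMem hm,
        indicator_of_notMem hm]
      simp
  have hT : P.T = N * P.h := rfl
  rw [h0, hT, apply_Icc_eq_sum hh hsplit hA N, sum_endpoints N _
    (fun l => A.indicator (fun _ => ∫ s in (0)..1, p.ω P.h l s j) (l * P.h))
    (fun l => A.indicator (fun _ => ∫ s in (0)..1, p.ω 0 l s j) (((l : ℝ) - 1) * P.h)) hend,
    ← Finset.sum_add_distrib]
  refine Finset.sum_congr rfl fun l _ => ?_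
  rw [P.muL_apply p l j ((by fun_prop : Measurable fun r => ((l : ℝ) - 1) * P.h + r) hA), add_assoc]
  have e1 : (fun t => t - ((l : ℝ) - 1) * P.h) ⁻¹' ((fun r => ((l : ℝ) - 1) * P.h + r) ⁻¹' A) = A := by
    ext t; simp
  have e2 : ((l : ℝ) - 1) * P.h + 0 ∈ A ↔ ((l : ℝ) - 1) * P.h ∈ A := by rw [add_zero]
  have e3 : ((l : ℝ) - 1) * P.h + P.h ∈ A ↔ (l : ℝ) * P.h ∈ A := by ring_nf
  rw [e1]
  classical simp only [indicator_apply, mem_preimage, e2, e3]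

theorem ν_eq_sum_nuL {p : ImpulseData n m} (hp : P.IsImpulseControl p) {A : Set ℝ}
    (hA : MeasurableSet A) : p.ν A = ∑ l ∈ Finset.Icc 1 N,
      P.nuL p l ((fun r => ((l : ℝ) - 1) * P.h + r) ⁻¹' A) := by
  have hh := P.h_pos
  have := hp.ν_finite
  have h0 : p.ν A = p.ν (A ∩ Icc 0 P.T) := by
    have h1 := measure_inter_add_sdiff (μ := p.ν) A (measurableSet_Icc (a := 0) (b := P.T))
    rw [measure_mono_null (s := A \ Icc 0 P.T) (fun t ht => ht.2) hp.ν_supp, add_zero] at h1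
    exact h1.symm
  have hnn : ∀ r l, 0 ≤ ∫ s in (0)..1, l1 (P.omegaExt p r l s) := fun r l =>
    intervalIntegral.integral_nonneg zero_le_one fun _ _ => l1_nonneg _
  have hend : ∀ l ∈ Finset.Icc 0 N, p.ν (A ∩ {(l : ℝ) * P.h})
      = (if 1 ≤ l ∧ l ≤ N then
          A.indicator (fun _ => ENNReal.ofReal (∫ s in (0)..1, l1 (p.ω P.h l s))) (l * P.h) else 0)
        + (if 1 ≤ l + 1 ∧ l + 1 ≤ N then
          A.indicator (fun _ => ENNReal.ofReal (∫ s in (0)..1, l1 (p.ω 0 (l + 1) s)))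
            ((((l + 1 : ℕ) : ℝ) - 1) * P.h) else 0) := by
    intro l hl
    have e1 : (((l + 1 : ℕ) : ℝ) - 1) * P.h = l * P.h := by push_cast; ring
    rw [e1]
    by_cases hm : (l : ℝ) * P.h ∈ A
    · rw [inter_eq_right.2 (singleton_subset_iff.2 hm), indicator_of_mem hm, indicator_of_mem hm,
        ← ofReal_measureReal, ← hp.ν_atom_end l hl]
      have hint : ∀ r ∈ Icc 0 P.h, ∀ l, IntervalIntegrable (fun s => l1 (P.omegaExt p r l s))
          volume 0 1 := by
        intro r hr l
        unfold omegaExt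
        split_ifs with h
        · exact integrable_l1_ω hp hr (Finset.mem_Icc.2 h)
        · exact intervalIntegrable_const
      rw [intervalIntegral.integral_add (hint _ ⟨hh.le, le_rfl⟩ _) (hint _ ⟨le_rfl, hh.le⟩ _),
        ENNReal.ofReal_add (hnn _ _) (hnn _ _)]
      unfold omegaExt
      congr 1 <;> split_ifs <;> simp [l1_zero]
    · rw [inter_singleton_eq_empty.2 hm, measure_empty, indicator_of_notMem hm,
        indicator_of_notMem hm]
      simp
  have hT : P.T = N * P.h := rfl
  rw [h0, hT, apply_Icc_eq_sum hh (fun B C _ hC hd => measure_union hd hC) hA N,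
    sum_endpoints N _
      (fun l => A.indicator (fun _ => ENNReal.ofReal (∫ s in (0)..1, l1 (p.ω P.h l s))) (l * P.h))
      (fun l => A.indicator (fun _ => ENNReal.ofReal (∫ s in (0)..1, l1 (p.ω 0 l s)))
        (((l : ℝ) - 1) * P.h)) hend, ← Finset.sum_add_distrib]
  refine Finset.sum_congr rfl fun l _ => ?_
  rw [P.nuL_apply p l ((by fun_prop : Measurable fun r => ((l : ℝ) - 1) * P.h + r) hA), add_assoc]
  have e1 : (fun t => t - ((l : ℝ) - 1) * P.h) ⁻¹' ((fun r => ((l : ℝ) - 1) * P.h + r) ⁻¹' A) = A := by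
    ext t; simp
  have e2 : ((l : ℝ) - 1) * P.h + 0 ∈ A ↔ ((l : ℝ) - 1) * P.h ∈ A := by rw [add_zero]
  have e3 : ((l : ℝ) - 1) * P.h + P.h ∈ A ↔ (l : ℝ) * P.h ∈ A := by ring_nf
  rw [e1]
  classical simp only [indicator_apply, mem_preimage, e2, e3]

end DelaySystem

/-! ### Construction (i) on controls. -/

namespace DelaySystem

variable {n m N M : ℕ} {P : DelaySystem n m N M}

/-- `(S, φ₀, φ)` is constructed from `(μ, ν, {ω^r})`, in terms of the clock `φ₀`. -/
structure IsAssocControl (P : DelaySystem n m N M) (p : ImpulseData n m) (e : ExtendedData n m) :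
    Prop where
  clock : IsClock e.φ₀ e.S P.h
  phi_eq : ∀ r ∈ Ioc 0 P.h, P.phi p r = hi e.φ₀ e.S r
  ac : ∀ l ∈ Finset.Icc 1 N, AbsolutelyContinuousOnInterval (e.φ l) 0 e.S
  init : ∀ l ∈ Finset.Icc 1 N, e.φ l 0 = if l = 1 then 0 else e.φ (l - 1) e.S
  cont : ∀ l ∈ Finset.Icc 1 N, ∀ᵐ s ∂(volume.restrict (Icc 0 e.S \ uset e.φ₀ e.S P.h)),
    HasDerivAt (e.φ l) (P.mL p l (e.φ₀ s)) s
  jump : ∀ l ∈ Finset.Icc 1 N, ∀ r ∈ jset e.φ₀ e.S P.h,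
    ∀ᵐ s ∂(volume.restrict (Icc (lo e.φ₀ e.S r) (hi e.φ₀ e.S r))),
      HasDerivAt (e.φ l) ((1 / (hi e.φ₀ e.S r - lo e.φ₀ e.S r)) •
        p.ω r l ((s - lo e.φ₀ e.S r) / (hi e.φ₀ e.S r - lo e.φ₀ e.S r))) s

theorem AssociatedExtended.isAssocControl {p : ImpulseData n m} {e : ExtendedData n m}
    (hp : P.IsImpulseControl p) (h : P.AssociatedExtended p e) : P.IsAssocControl p e := by
  obtain ⟨hc, hphi⟩ := isClock_rightInv_phi hp.ν_finite h.S_eq h.φ₀_eq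
  refine ⟨hc, hphi, h.φ_ac, h.φ_init, ?_, ?_⟩
  · rw [← sigmaUnion_eq hc hphi]
    exact h.φ_cont
  · intro l hl r hr
    have h1 := h.φ_jump l hl r (by rw [jumpSet_eq hc hphi]; exact hr)
    simpa only [sigmaSet, gam, phiL_eq hc hphi hr.1, phiR_eq hc hphi hr.1] using h1

namespace IsAssocControl

variable {p : ImpulseData n m} {e : ExtendedData n m} (h : P.IsAssocControl p e)
  (hp : P.IsImpulseControl p)
include h hp

omit hp in
/-- To check a property almost everywhere, check it off the jumps and on each of them. -/
theorem ae_split {q : ℝ → Prop}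
    (h1 : ∀ᵐ s ∂(volume.restrict (Icc 0 e.S \ uset e.φ₀ e.S P.h)), q s)
    (h2 : ∀ r ∈ jset e.φ₀ e.S P.h,
      ∀ᵐ s ∂(volume.restrict (Icc (lo e.φ₀ e.S r) (hi e.φ₀ e.S r))), q s) :
    ∀ᵐ s ∂(volume.restrict (Icc 0 e.S)), q s := by
  have h3 : ∀ᵐ s ∂(volume.restrict (uset e.φ₀ e.S P.h)), q s := by
    rw [uset, ae_restrict_biUnion_iff _ h.clock.countable_jset]
    exact h2
  rw [← Set.sdiff_union_of_subset h.clock.uset_subset]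
  exact (ae_restrict_union_iff _ _ _).2 ⟨h1, h3⟩

/-- Off the stops the normalization is the identity for the densities of `dϕ`. On a stop `φ̇₀ = 0`,
and the constancy of `∑‖ω^r_l‖`, whose value is the length of the fibre, gives the sum one after
rescaling. -/
theorem ae_bound : ∀ᵐ s ∂(volume.restrict (Icc 0 e.S)),
    deriv e.φ₀ s + ∑ l ∈ Finset.Icc 1 N, l1 (deriv (e.φ l) s) = 1 ∧ 0 ≤ deriv e.φ₀ s ∧
    ∀ l ∈ Finset.Icc 1 N, DifferentiableAt ℝ (e.φ l) s ∧ deriv (e.φ l) s ∈ P.K := by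
  have hc := h.clock
  have hρ := (solvesOn_rho hp hc h.phi_eq).1.2
  refine h.ae_split ?_ fun r hr => ?_
  · have hsub : Icc 0 e.S \ uset e.φ₀ e.S P.h ⊆ Icc 0 e.S := Set.sdiff_subset
    have h1 := (ae_ball_iff (Finset.countable_toSet (Finset.Icc 1 N))).2 h.cont
    have h2 := (ae_ball_iff (Finset.countable_toSet (Finset.Icc 1 N))).2
      fun l hl => ae_mL_comp hp hc h.phi_eq hl
    filter_upwards [h1, ae_restrict_of_ae_restrict_of_subset hsub h2,
      ae_restrict_of_ae_restrict_of_subset hsub hρ,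
      ae_restrict_of_ae_restrict_of_subset hsub (ae_rho_comp hp hc h.phi_eq),
      ae_restrict_mem hc.measurableSet_compl_uset] with s a1 a2 a3 a4 a5
    refine ⟨?_, ?_, fun l hl => ⟨(a1 l hl).differentiableAt, ?_⟩⟩
    · rw [a3.deriv, Finset.sum_congr rfl fun l hl => by rw [(a1 l hl).deriv]]
      exact a4.2 a5.2
    · rw [a3.deriv]; exact ENNReal.toReal_nonneg
    · rw [(a1 l hl).deriv]; exact a2 l hl
  · have hd : 0 < hi e.φ₀ e.S r - lo e.φ₀ e.S r := sub_pos.2 hr.2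
    have h1 := (ae_ball_iff (Finset.countable_toSet (Finset.Icc 1 N))).2
      fun l hl => h.jump l hl r hr
    have h2 := (ae_ball_iff (Finset.countable_toSet (Finset.Icc 1 N))).2
      fun l hl => ae_comp_sub_div hr.2 (hp.ω_mem r hr.1 l hl)
    filter_upwards [h1, h2, ae_comp_sub_div hr.2 (hp.ω_const r hr.1),
      ae_restrict_of_ae_restrict_of_subset (hc.Icc_subset hr.1) hρ,
      ae_restrict_mem measurableSet_Icc] with s a1 a2 a3 a4 a5
    have h0 : deriv e.φ₀ s = 0 := by
      rw [a4.deriv, hc.apply_eq hr.1 a5, rho_eq_zero hp hc h.phi_eq hr]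
    refine ⟨?_, h0.ge, fun l hl => ⟨(a1 l hl).differentiableAt, ?_⟩⟩
    · rw [h0, zero_add, Finset.sum_congr rfl fun l hl => by rw [(a1 l hl).deriv, l1_smul],
        ← Finset.mul_sum, a3, sum_integral_l1_ω hp hc h.phi_eq hr.1, abs_of_pos (by positivity),
        one_div_mul_cancel hd.ne']
    · rw [(a1 l hl).deriv]
      exact P.K_cone _ (a2 l hl) _ (by positivity)

/-- Construction (i) only provides absolutely continuous `φ_l`; the Lipschitz property follows from
the normalization, which bounds the derivatives by one. -/
theorem canon : P.IsCanonControl e := by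
  have hS := h.clock.S_pos.le
  have hb := h.ae_bound hp
  refine
    { S_pos := h.clock.S_pos
      lipschitz := ⟨1, (solvesOn_rho hp h.clock h.phi_eq).2, ?_⟩
      mono := h.clock.mono
      φ₀_zero := h.clock.zero
      φ₀_S := h.clock.last
      φ_init := h.init
      φ_mem := fun l hl => hb.mono fun s hs => (hs.2.2 l hl).2
      canonical := hb.mono fun s hs => hs.1 }
  intro l hl
  have hs1 : SolvesOn (e.φ l) (deriv (e.φ l)) 0 e.S :=
    ⟨h.ac l hl, hb.mono fun s hs => (hs.2.2 l hl).1.hasDerivAt⟩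
  have hb1 : ∀ᵐ s ∂(volume.restrict (Icc 0 e.S)), ‖deriv (e.φ l) s‖ ≤ (1 : NNReal) := by
    filter_upwards [hb] with s hs
    have := Finset.single_le_sum (f := fun l => l1 (deriv (e.φ l) s)) (fun _ _ => l1_nonneg _) hl
    rw [NNReal.coe_one]
    exact (norm_le_l1 _).trans (by linarith [hs.1, hs.2.1])
  exact (solvesOn_of_eq_integral hS (hs1.intervalIntegrable hS hb1) hb1
    (hs1.eq_add_integral hS hb1)).2

/-- On a nondegenerate fibre this is the prescription for `φ̇_l` read backwards. On a degenerate one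
`ν_l` has no atom at `r`, so `ω^r_l` has zero `ℓ¹` integral and vanishes almost everywhere. -/
theorem ω_eq {r : ℝ} (hr : r ∈ Icc 0 P.h) {l : ℕ} (hl : l ∈ Finset.Icc 1 N) :
    ∀ᵐ s ∂(volume.restrict (Icc (0 : ℝ) 1)),
    p.ω r l s = (hi e.φ₀ e.S r - lo e.φ₀ e.S r) •
      deriv (e.φ l) ((hi e.φ₀ e.S r - lo e.φ₀ e.S r) * s + lo e.φ₀ e.S r) := by
  have hc := h.clock
  rcases (hc.lo_le_hi hr).eq_or_lt with heq | hlt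
  · have h0 := integral_l1_ω_eq_zero hp hc h.phi_eq hl hr fun hj => heq.not_lt hj.2
    have hi1 := integrable_l1_ω hp hr hl
    rw [intervalIntegral.integral_eq_zero_iff_of_le_of_nonneg_ae zero_le_one
      (Eventually.of_forall fun s => l1_nonneg _) hi1, restrict_Ioc_eq_restrict_Icc] at h0
    filter_upwards [h0] with s hs
    rw [l1_eq_zero hs, ← heq]; simp
  · have hd := (sub_pos.2 hlt).ne'
    filter_upwards [ae_comp_mul_add hlt (h.jump l hl r ⟨hr, hlt⟩)] with s hs
    rw [hs.deriv, smul_smul, mul_one_div_cancel hd, one_smul, add_sub_cancel_right,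
      mul_div_cancel_left₀ _ hd]

theorem integral_jump {r : ℝ} (hr : r ∈ Icc 0 P.h) {l : ℕ} (hl : l ∈ Finset.Icc 1 N)
    {E : Type*} [NormedAddCommGroup E] [NormedSpace ℝ E] {F : (Fin m → ℝ) → E}
    (hF : ∀ c : ℝ, 0 ≤ c → ∀ w, F (c • w) = c • F w) :
    ∫ t in (0)..1, F (p.ω r l t)
      = ∫ s in Icc 0 e.S ∩ e.φ₀ ⁻¹' {r}, F (deriv (e.φ l) s) := by
  have hc := h.clock
  have hd : 0 ≤ hi e.φ₀ e.S r - lo e.φ₀ e.S r := sub_nonneg.2 (hc.lo_le_hi hr)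
  have h1 : ∫ t in (0)..1, F (p.ω r l t) = ∫ t in (0)..1, (hi e.φ₀ e.S r - lo e.φ₀ e.S r) •
      F (deriv (e.φ l) ((hi e.φ₀ e.S r - lo e.φ₀ e.S r) * t + lo e.φ₀ e.S r)) := by
    refine intervalIntegral.integral_congr_ae_restrict ?_
    rw [uIoc_of_le zero_le_one, restrict_Ioc_eq_restrict_Icc]
    filter_upwards [h.ω_eq hp hr hl] with t ht
    rw [ht, hF _ hd]
  rw [h1, intervalIntegral.integral_smul, intervalIntegral.smul_integral_comp_mul_add
    (fun t => F (deriv (e.φ l) t)), mul_zero, zero_add, mul_one, sub_add_cancel,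
    hc.preimage_singleton hr, intervalIntegral.integral_of_le (hc.lo_le_hi hr),
    integral_Icc_eq_integral_Ioc]

omit hp in
theorem off_eq (A : Set ℝ) : (Icc 0 e.S ∩ e.φ₀ ⁻¹' (A \ jset e.φ₀ e.S P.h))
    ⊆ Icc 0 e.S \ uset e.φ₀ e.S P.h := fun _ hs =>
  ⟨hs.1, fun hU => hs.2.2 ((h.clock.mem_uset_iff hs.1).1 hU)⟩

/-- The difference of the two signed measures vanishes at every stopping value, by the formula for
`ω`, and on sets avoiding them, by the formula for `m_l`; since the stopping values are countable it
vanishes. -/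
theorem muL_eq {l : ℕ} (hl : l ∈ Finset.Icc 1 N) (j : Fin m) {A : Set ℝ} (hA : MeasurableSet A) :
    P.muL p l j A = ∫ s in Icc 0 e.S ∩ e.φ₀ ⁻¹' A, deriv (e.φ l) s j := by
  have hc := h.clock
  have hJ := hc.countable_jset
  obtain ⟨κ, hκ'⟩ := exists_signedMeasure_map (lam := volume.restrict (Icc 0 e.S))
    (φ := e.φ₀) hc.aemeasurable (Integrable.eval ((h.canon hp).integrable_φ hl) j)
  have hκ : ∀ B, MeasurableSet B → κ B = ∫ s in Icc 0 e.S ∩ e.φ₀ ⁻¹' B, deriv (e.φ l) s j := by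
    intro B hB
    rw [hκ' B hB, Measure.restrict_restrict' measurableSet_Icc, inter_comm]
  have hsub : ∀ B, MeasurableSet B → (P.muL p l j - κ) B = P.muL p l j B - κ B := fun B hB => rfl
  have h1 : (P.muL p l j - κ) A = (P.muL p l j - κ) (A \ jset e.φ₀ e.S P.h) := by
    refine signedMeasure_apply_sub_countable hA hJ fun t _ ht => ?_
    rw [hsub _ (measurableSet_singleton _), hκ _ (measurableSet_singleton _),
      muL_singleton hp ht.1 hl, h.integral_jump hp ht.1 hl (F := fun w => w j) (fun c _ w => rfl),
      sub_self]
  have h2 : (P.muL p l j - κ) (A \ jset e.φ₀ e.S P.h) = 0 := by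
    have hm : MeasurableSet (A \ jset e.φ₀ e.S P.h) := hA.diff hc.measurableSet_jset
    rw [hsub _ hm, hκ _ hm, muL_diff_eq hp hc h.phi_eq hl j hA, sub_eq_zero]
    refine integral_congr_ae (ae_restrict_of_ae_restrict_of_subset (h.off_eq A) ?_)
    filter_upwards [h.cont l hl] with s hs
    rw [hs.deriv]
  rw [h2, hsub _ hA, sub_eq_zero, hκ _ hA] at h1
  exact h1

/-- Same splitting as for `μ_l`. Extended nonnegative measures cannot be subtracted, so the
countable part is compared atom by atom through a sum. -/
theorem nuL_eq {l : ℕ} (hl : l ∈ Finset.Icc 1 N) {A : Set ℝ} (hA : MeasurableSet A) :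
    P.nuL p l A = ∫⁻ s in Icc 0 e.S ∩ e.φ₀ ⁻¹' A, ENNReal.ofReal (l1 (deriv (e.φ l) s)) := by
  have hc := h.clock
  have hJ := hc.countable_jset
  set w : ℝ → ENNReal := fun s => ENNReal.ofReal (l1 (deriv (e.φ l) s))
  set κ := ((volume.restrict (Icc 0 e.S)).withDensity w).map e.φ₀
  have hae : AEMeasurable e.φ₀ ((volume.restrict (Icc 0 e.S)).withDensity w) :=
    hc.aemeasurable.mono_ac (withDensity_absolutelyContinuous _ _)
  have hκ : ∀ B, MeasurableSet B → κ B = ∫⁻ s in Icc 0 e.S ∩ e.φ₀ ⁻¹' B, w s := by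
    intro B hB
    rw [Measure.map_apply_of_aemeasurable hae hB,
      withDensity_apply₀ _ (hc.aemeasurable.nullMeasurableSet_preimage hB),
      Measure.restrict_restrict' measurableSet_Icc, inter_comm]
  rw [← hκ A hA]
  have hm : MeasurableSet (A \ jset e.φ₀ e.S P.h) := hA.diff hc.measurableSet_jset
  have h1 : P.nuL p l (A \ jset e.φ₀ e.S P.h) = κ (A \ jset e.φ₀ e.S P.h) := by
    rw [hκ _ hm, nuL_diff_eq hp hc h.phi_eq hl hA]
    refine lintegral_congr_ae (ae_restrict_of_ae_restrict_of_subset (h.off_eq A) ?_)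
    filter_upwards [h.cont l hl] with s hs
    simp only [w, hs.deriv]
  have hsing : ∀ t ∈ A ∩ jset e.φ₀ e.S P.h, P.nuL p l {t} = κ {t} := by
    intro t ht
    rw [nuL_singleton hp ht.2.1 hl, hκ _ (measurableSet_singleton _),
      h.integral_jump hp ht.2.1 hl (F := l1) (fun c hc w => by rw [l1_smul, abs_of_nonneg hc]; rfl),
      ofReal_integral_eq_lintegral_ofReal]
    · exact integrable_l1 (((h.canon hp).integrable_φ hl).mono_set inter_subset_left)
    · exact Eventually.of_forall fun s => l1_nonneg _
  have h2 : ∀ κ' : Measure ℝ, κ' (A ∩ jset e.φ₀ e.S P.h)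
      = ∑' t : ↥(A ∩ jset e.φ₀ e.S P.h), κ' {(t : ℝ)} := by
    intro κ'
    have := measure_biUnion (μ := κ') (s := A ∩ jset e.φ₀ e.S P.h) (f := fun t => {t})
      (hJ.mono inter_subset_right) (fun a _ b _ hab => disjoint_singleton.2 hab)
      fun t _ => measurableSet_singleton t
    rwa [biUnion_of_singleton] at this
  rw [← measure_inter_add_sdiff A hc.measurableSet_jset, h1, h2,
    ← measure_inter_add_sdiff (μ := κ) A hc.measurableSet_jset, h2 κ]
  congr 1
  exact tsum_congr fun t => hsing t t.2

theorem linked : P.Linked p e := by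
  refine { h.canon hp with ω_eq := fun r hr l hl => h.ω_eq hp hr hl, μ_eq := ?_, ν_eq := ?_ }
  · intro j A hA
    rw [μ_eq_sum_muL hp j hA]
    refine Finset.sum_congr rfl fun l hl => ?_
    rw [h.muL_eq hp hl j ((by fun_prop : Measurable fun r => ((l : ℝ) - 1) * P.h + r) hA)]
    rfl
  · intro A hA
    rw [ν_eq_sum_nuL hp hA]
    refine Finset.sum_congr rfl fun l hl => ?_
    rw [h.nuL_eq hp hl ((by fun_prop : Measurable fun r => ((l : ℝ) - 1) * P.h + r) hA)]
    rfl

end IsAssocControl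

end DelaySystem

/-! ### Measurability and bounds for trajectories and velocities. -/

theorem MonotoneOn.exists_measurable_eqOn {f : ℝ → ℝ} {a b : ℝ} (hab : a ≤ b)
    (hf : MonotoneOn f (Icc a b)) : ∃ g : ℝ → ℝ, Measurable g ∧ EqOn f g (Icc a b) := by
  obtain ⟨g, hg, hgf⟩ := hf.exists_monotone_extension
    ⟨f a, by rintro _ ⟨x, hx, rfl⟩; exact hf ⟨le_rfl, hab⟩ hx hx.1⟩
    ⟨f b, by rintro _ ⟨x, hx, rfl⟩; exact hf hx ⟨hab, le_rfl⟩ hx.2⟩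
  exact ⟨g, hg.measurable, hgf⟩

theorem BoundedVariationOn.exists_measurable_eqOn {n : ℕ} {f : ℝ → Fin n → ℝ} {a b : ℝ}
    (hab : a ≤ b) (hf : BoundedVariationOn f (Icc a b)) :
    ∃ g : ℝ → Fin n → ℝ, Measurable g ∧ EqOn f g (Icc a b) := by
  have h : ∀ i, ∃ g : ℝ → ℝ, Measurable g ∧ EqOn (fun t => f t i) g (Icc a b) := by
    intro i
    have h1 : BoundedVariationOn (fun t => f t i) (Icc a b) :=
      (LipschitzWith.eval i).comp_boundedVariationOn hf
    obtain ⟨p, q, hp, hq, hpq⟩ :=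
      h1.locallyBoundedVariationOn.exists_monotoneOn_sub_monotoneOn
    obtain ⟨p', hp', hpp⟩ := MonotoneOn.exists_measurable_eqOn hab hp
    obtain ⟨q', hq', hqq⟩ := MonotoneOn.exists_measurable_eqOn hab hq
    refine ⟨p' - q', hp'.sub hq', fun t ht => ?_⟩
    have := congrFun hpq t
    simp only [Pi.sub_apply] at this ⊢
    rw [this, hpp ht, hqq ht]
  choose g hg hfg using h
  exact ⟨fun t i => g i t, measurable_pi_lambda _ hg, fun t ht => funext fun i => hfg i ht⟩

theorem IsClock.off_preimage_Icc_ae {φ : ℝ → ℝ} {S h : ℝ} (hc : IsClock φ S h) (r : ℝ) :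
    ((Icc 0 S \ uset φ S h) ∩ φ ⁻¹' (Icc 0 r) : Set ℝ)
      =ᵐ[volume] ((Icc 0 S \ uset φ S h) ∩ φ ⁻¹' (Ioc 0 r) : Set ℝ) := by
  refine (ae_eq_set.2 ⟨?_, ?_⟩)
  · refine measure_mono_null (t := {0}) ?_ Real.volume_singleton
    rintro s ⟨⟨h1, h2⟩, h3⟩
    have h4 : φ s = 0 := by
      by_contra h5
      exact h3 ⟨h1, lt_of_le_of_ne h2.1 (Ne.symm h5), h2.2⟩
    have h5 := (hc.lo_hi_of_notMem h1.1 h1.2).1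
    rw [h4, hc.lo_zero] at h5
    exact h5.symm
  · refine measure_mono_null (t := ∅) ?_ measure_empty
    rintro s ⟨⟨h1, h2⟩, h3⟩
    exact h3 ⟨h1, Ioc_subset_Icc_self h2⟩

namespace DelaySystem

variable {n m N M : ℕ} {P : DelaySystem n m N M}

theorem f_cont (P : DelaySystem n m N M) :
    Continuous fun q : ℝ × (Fin (M + 1) → Fin n → ℝ) => P.f q.1 q.2 := P.f_C1.continuous

theorem g_cont (P : DelaySystem n m N M) (j : Fin m) :
    Continuous fun q : ℝ × (Fin (M + 1) → Fin n → ℝ) => P.g j q.1 q.2 := (P.g_C1 j).continuous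

theorem exists_bound (P : DelaySystem n m N M) :
    ∃ C : NNReal, (∀ t X, ‖P.f t X‖ ≤ C) ∧ ∀ j t X, ‖P.g j t X‖ ≤ C := by
  obtain ⟨a, ha⟩ := P.f_bdd
  choose b hb using P.g_bdd
  refine ⟨Real.toNNReal a + ∑ j, Real.toNNReal (b j), fun t X => ?_, fun j t X => ?_⟩
  · refine (ha t X).trans ((Real.le_coe_toNNReal a).trans ?_)
    push_cast
    exact le_add_of_nonneg_right (Finset.sum_nonneg fun _ _ => NNReal.coe_nonneg _)
  · refine (hb j t X).trans ((Real.le_coe_toNNReal (b j)).trans ?_)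
    push_cast
    refine le_add_of_nonneg_of_le (NNReal.coe_nonneg _) ?_
    exact Finset.single_le_sum (f := fun j => ((Real.toNNReal (b j) : NNReal) : ℝ))
      (fun _ _ => NNReal.coe_nonneg _) (Finset.mem_univ j)

/-- The velocity of `y_l` in the auxiliary control system. -/
def velocity (P : DelaySystem n m N M) (e : ExtendedData n m) (l : ℕ) (s : ℝ) : Fin n → ℝ :=
  deriv e.φ₀ s • P.f (e.τ l s) (fun k => P.yExt e ((l : ℤ) - (k : ℕ)) s)
      + ∑ j, deriv (e.φ l) s j •
          P.g j (e.τ l s) (fun k => P.yExt e ((l : ℤ) - (k : ℕ)) s)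

theorem exists_velocity_bound {e : ExtendedData n m} (hC : P.IsCanonControl e) :
    ∃ C : NNReal, ∀ l ∈ Finset.Icc 1 N, ∀ᵐ s ∂(volume.restrict (Icc 0 e.S)),
      ‖P.velocity e l s‖ ≤ C := by
  obtain ⟨C, hf, hg⟩ := P.exists_bound
  refine ⟨C + m * C, fun l hl => ?_⟩
  filter_upwards [hC.φ₀_bound, hC.φ_bound hl] with s h1 h2
  refine (norm_add_le _ _).trans ?_
  push_cast
  refine add_le_add ?_ ?_
  · rw [norm_smul]
    exact (mul_le_of_le_one_left (norm_nonneg _) h1).trans (hf _ _)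
  · refine (norm_sum_le _ _).trans ((Finset.sum_le_card_nsmul _ _ (C : ℝ) fun j _ => ?_).trans ?_)
    · rw [norm_smul]
      refine (mul_le_of_le_one_left (norm_nonneg _) ?_).trans (hg _ _ _)
      exact (norm_le_pi_norm _ j).trans h2
    · simp

/-- Off the stops and away from the endpoints the clock value lies in the open interval `(0, h)`, so
no delayed time is a multiple of `h`. The junctions, where `x` has a convention of its own, and the
point `0`, where `x` may differ from `ξ₀`, are never met. -/
theorem delayed_eq {p : ImpulseData n m} {e : ExtendedData n m} (hc : IsClock e.φ₀ e.S P.h)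
    (hτ : ∀ l ∈ Finset.Icc 1 N, ∀ s ∈ Icc 0 e.S, e.τ l s = ((l : ℝ) - 1) * P.h + e.φ₀ s)
    (hhist : ∀ t ∈ Ico (-(M * P.h)) 0, p.x t = P.ξ₀ t)
    (hxy : ∀ l ∈ Finset.Icc 1 N, ∀ s ∈ Ioo 0 e.S, s ∉ uset e.φ₀ e.S P.h →
      p.x (((l : ℝ) - 1) * P.h + e.φ₀ s) = e.y l s)
    {l : ℕ} (hl : l ∈ Finset.Icc 1 N) {s : ℝ} (hs : s ∈ Ioo 0 e.S)
    (hU : s ∉ uset e.φ₀ e.S P.h) :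
    P.delayed p.x (((l : ℝ) - 1) * P.h + e.φ₀ s) =
      fun k : Fin (M + 1) => P.yExt e ((l : ℤ) - (k : ℕ)) s := by
  have hh := P.h_pos
  obtain ⟨hl1, hlN⟩ := Finset.mem_Icc.1 hl
  have hφ := hc.notMem_uset_apply hs hU
  funext k
  have hk : (k : ℕ) ≤ M := Nat.lt_succ_iff.1 k.2
  unfold delayed yExt
  split_ifs with h1
  · have h2 : (k : ℕ) < l := by omega
    have h3 : ((l : ℤ) - (k : ℕ)).toNat = l - k := by omega
    rw [h3, ← hxy (l - k) (Finset.mem_Icc.2 ⟨by omega, by omega⟩) s hs hU,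
      Nat.cast_sub h2.le]
    congr 1; ring
  · have h2 : l ≤ (k : ℕ) := by omega
    have h3 : (l : ℝ) ≤ (k : ℕ) := by exact_mod_cast h2
    have h4 : ((k : ℕ) : ℝ) ≤ M := by exact_mod_cast hk
    have h5 : (1 : ℝ) ≤ l := by exact_mod_cast hl1
    rw [hτ 1 (Finset.mem_Icc.2 ⟨le_rfl, P.one_le_N⟩) s (Ioo_subset_Icc_self hs), hhist]
    · congr 1; push_cast; ring
    · constructor
      · nlinarith [hφ.1]
      · nlinarith [hφ.2]

/-- Changes of variables require Borel integrands on the line, while `x` is controlled only on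
`[-Mh, T]`. Bounded variation on `[0, T]` and continuity of `ξ₀` provide a Borel function with the
same relevant values. -/
theorem exists_measurable_history {p : ImpulseData n m}
    (hhist : ∀ t ∈ Ico (-(M * P.h)) 0, p.x t = P.ξ₀ t)
    (hbv : BoundedVariationOn p.x (Icc 0 P.T)) :
    ∃ X : ℝ → Fin n → ℝ, Measurable X ∧ EqOn p.x X (Icc (-(M * P.h)) P.T) := by
  have hM : -((M : ℝ) * P.h) ≤ 0 := by
    have := mul_nonneg M.cast_nonneg P.h_pos.le (α := ℝ); linarith
  obtain ⟨g, hg, hxg⟩ := BoundedVariationOn.exists_measurable_eqOn P.T_nonneg hbv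
  have hξ : Continuous (IccExtend hM (domRestrict (Icc (-((M : ℝ) * P.h)) 0) P.ξ₀)) :=
    (continuousOn_iff_continuous_domRestrict.1 P.ξ₀_cont).Icc_extend'
  refine ⟨fun t => if t < 0 then IccExtend hM (domRestrict _ P.ξ₀) t else g t,
    Measurable.ite measurableSet_Iio hξ.measurable hg, fun t ht => ?_⟩
  dsimp only
  split_ifs with h0
  · rw [hhist t ⟨ht.1, h0⟩, IccExtend_of_mem hM _ ⟨ht.1, h0.le⟩]; rfl
  · exact hxg ⟨not_lt.1 h0, ht.2⟩

theorem delayed_congr {x X : ℝ → Fin n → ℝ} (h : EqOn x X (Icc (-(M * P.h)) P.T)) {t : ℝ}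
    (ht : t ∈ Icc 0 P.T) : P.delayed x t = P.delayed X t := by
  have hh := P.h_pos
  funext k
  have hk : ((k : ℕ) : ℝ) ≤ M := by exact_mod_cast Nat.lt_succ_iff.1 k.2
  have h0 : (0 : ℝ) ≤ (k : ℕ) := Nat.cast_nonneg _
  refine h ⟨?_, ?_⟩
  · nlinarith [ht.1]
  · nlinarith [ht.2]

theorem measurable_delayed {X : ℝ → Fin n → ℝ} (hX : Measurable X) : Measurable (P.delayed X) :=
  measurable_pi_lambda _ fun k => hX.comp (by fun_prop)

end DelaySystem

/-! ### Trajectories with jumps on `[0, h]` and primitives on `[0, S]`. -/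

theorem leftLim_add_const {E : Type*} [TopologicalSpace E] [T2Space E] {x : ℝ → E} {r c : ℝ} {a : E}
    (h : Tendsto (fun t => x (t + c)) (𝓝[<] r) (𝓝 a)) : Function.leftLim x (r + c) = a := by
  have h1 : Tendsto (fun t => t - c) (𝓝[<] (r + c)) (𝓝[<] r) := by
    refine tendsto_nhdsWithin_iff.2 ⟨?_, ?_⟩
    · have : Tendsto (fun t : ℝ => t - c) (𝓝 (r + c)) (𝓝 (r + c - c)) :=
        (continuous_id.sub continuous_const).tendsto _
      rw [add_sub_cancel_right] at this
      exact this.mono_left nhdsWithin_le_nhds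
    · filter_upwards [self_mem_nhdsWithin] with t ht
      have : t < r + c := ht
      exact (by linarith : t - c < r)
  have h2 : Tendsto x (𝓝[<] (r + c)) (𝓝 a) := by simpa [Function.comp_def] using h.comp h1
  exact leftLim_eq_of_tendsto h2

namespace IsClock

variable {φ : ℝ → ℝ} {S h : ℝ} (hc : IsClock φ S h)
include hc

theorem sub_lo_add_mem {r : ℝ} (hr : r ∈ Icc 0 h) {u : ℝ} (hu : u ∈ Icc (0 : ℝ) 1) :
    lo φ S r + u * (hi φ S r - lo φ S r) ∈ Icc (lo φ S r) (hi φ S r) := by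
  have := hc.lo_le_hi hr
  constructor <;> nlinarith [hu.1, hu.2]

variable {E : Type*} [NormedAddCommGroup E] [NormedSpace ℝ E]

theorem continuousOn_primitive {F : ℝ → E} (hF : IntegrableOn F (Icc 0 S)) (c : E) :
    ContinuousOn (fun s => c + ∫ t in (0)..s, F t) (Icc 0 S) := by
  refine continuousOn_const.add ?_
  have := intervalIntegral.continuousOn_primitive_interval (f := F) (μ := volume) (a := 0) (b := S)
    (by rwa [uIcc_of_le hc.S_pos.le])
  rwa [uIcc_of_le hc.S_pos.le] at this

omit hc [NormedSpace ℝ E] in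
theorem intervalIntegrable {F : ℝ → E} (hF : IntegrableOn F (Icc 0 S)) {a b : ℝ}
    (ha : a ∈ Icc 0 S) (hb : b ∈ Icc 0 S) : IntervalIntegrable F volume a b :=
  (hF.mono_set (uIcc_subset_Icc ha hb)).intervalIntegrable

omit [NormedSpace ℝ E] in
/-- The left limit of a function which is a continuous function of `hi`. -/
theorem tendsto_left_of_eq_hi {X z : ℝ → E} (hz : ContinuousOn z (Icc 0 S))
    (hX : ∀ r ∈ Ioo 0 h, X r = z (hi φ S r)) {r : ℝ} (hr : r ∈ Ioc 0 h) :
    Tendsto X (𝓝[<] r) (𝓝 (z (lo φ S r))) := by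
  have h1 := hz _ (hc.lo_spec ⟨hr.1.le, hr.2⟩).1
  have hnear : ∀ᶠ t in 𝓝[<] r, t ∈ Ioo 0 h := by
    filter_upwards [Ioo_mem_nhdsLT hr.1] with t ht
    exact ⟨ht.1, ht.2.trans_le hr.2⟩
  have h2 : Tendsto (hi φ S) (𝓝[<] r) (𝓝[Icc 0 S] (lo φ S r)) := by
    refine tendsto_nhdsWithin_iff.2 ⟨hc.tendsto_hi_left hr, ?_⟩
    filter_upwards [hnear] with t ht
    exact (hc.hi_spec (Ioo_subset_Icc_self ht)).1
  refine (Tendsto.comp h1 h2).congr' ?_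
  filter_upwards [hnear] with t ht
  rw [hX t ht]; rfl

theorem hasSum_jumps_Ioc {F : ℝ → E} (hF : IntegrableOn F (Icc 0 S)) {r : ℝ} (hr : r ∈ Icc 0 h) :
    HasSum (fun r' : Ioc 0 r => ∫ s in (lo φ S r')..(hi φ S r'), F s)
      ((∫ s in (hi φ S 0)..(hi φ S r), F s)
        - ∫ s in (Icc 0 S \ uset φ S h) ∩ φ ⁻¹' (Ioc 0 r), F s) := by
  rw [hc.integral_eq_add_preimage_Ioc hr]
  exact hc.hasSum_jumps hF measurableSet_Ioc fun t ht => ⟨ht.1.le, ht.2.trans hr.2⟩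

/-- A function with jumps on `[0, h]` unfolds to a primitive on `[0, S]`. -/
theorem eq_primitive_of_jumps {F : ℝ → E} (hF : IntegrableOn F (Icc 0 S)) {ζ : ℝ → ℝ → E}
    {X L : ℝ → E}
    (hζ : ∀ r ∈ Icc 0 h, ∀ u ∈ Icc (0 : ℝ) 1,
      ζ r u = ζ r 0 + ∫ s in (lo φ S r)..(lo φ S r + u * (hi φ S r - lo φ S r)), F s)
    (hζL : ∀ r ∈ Ioc 0 h, ζ r 0 = L r)
    (hL : ∀ r ∈ Ioc 0 h, ∀ a, Tendsto X (𝓝[<] r) (𝓝 a) → L r = a)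
    (hX : ∀ r ∈ Ioo 0 h, X r = ζ 0 1
      + (∫ s in (Icc 0 S \ uset φ S h) ∩ φ ⁻¹' (Ioc 0 r), F s)
      + ∑' r' : Ioc 0 r, (ζ r' 1 - L r')) :
    (∀ r ∈ Icc 0 h, ∀ u ∈ Icc (0 : ℝ) 1,
      ζ r u = ζ 0 0 + ∫ s in (0)..(lo φ S r + u * (hi φ S r - lo φ S r)), F s) ∧
    ∀ r ∈ Ioo 0 h, X r = ζ 0 0 + ∫ s in (0)..(hi φ S r), F s := by
  have h0 : (0 : ℝ) ∈ Icc 0 h := ⟨le_rfl, hc.h_pos.le⟩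
  have h0S : (0 : ℝ) ∈ Icc 0 S := ⟨le_rfl, hc.S_pos.le⟩
  have hζ1 : ∀ r ∈ Icc 0 h, ζ r 1 - ζ r 0 = ∫ s in (lo φ S r)..(hi φ S r), F s := by
    intro r hr
    rw [hζ r hr 1 ⟨zero_le_one, le_rfl⟩, one_mul, add_sub_cancel, add_sub_cancel_left]
  -- The sum of the jumps in `(0, r]` is the integral of `F` over the stops at these values;
  -- together with the integral off the stops and the arc at `0` it exhausts `[0, hi r]`. This comes
  -- first, because the arcs start at left limits of `X`.
  have hX' : ∀ r ∈ Ioo 0 h, X r = ζ 0 0 + ∫ s in (0)..(hi φ S r), F s := by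
    intro r hr
    have hr' := Ioo_subset_Icc_self hr
    have hsum := hc.hasSum_jumps_Ioc hF hr'
    have hcongr : (fun r' : Ioc 0 r => ζ r' 1 - L r')
        = fun r' : Ioc 0 r => ∫ s in (lo φ S r')..(hi φ S r'), F s := by
      funext r'
      have hm : (r' : ℝ) ∈ Ioc 0 h := ⟨r'.2.1, r'.2.2.trans hr.2.le⟩
      rw [← hζL _ hm, hζ1 _ (Ioc_subset_Icc_self hm)]
    have h1 := hζ1 0 h0
    rw [hc.lo_zero, sub_eq_iff_eq_add'] at h1
    rw [hX r hr, hcongr, hsum.tsum_eq, h1,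
      ← intervalIntegral.integral_add_adjacent_intervals
        (intervalIntegrable hF h0S (hc.hi_spec h0).1)
        (intervalIntegrable hF (hc.hi_spec h0).1 (hc.hi_spec hr').1)]
    abel
  refine ⟨fun r hr u hu => ?_, hX'⟩
  have hm := hc.Icc_subset hr (hc.sub_lo_add_mem hr hu)
  -- For `r > 0` the starting point is the left limit of `X`, now known to be a continuous function
  -- of `hi`, whose left limit is `lo`.
  have hlo : ζ r 0 = ζ 0 0 + ∫ s in (0)..(lo φ S r), F s := by
    rcases hr.1.eq_or_lt with h1 | h1
    · rw [← h1, hc.lo_zero, intervalIntegral.integral_same, add_zero]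
    · rw [hζL r ⟨h1, hr.2⟩]
      exact hL r ⟨h1, hr.2⟩ _
        (hc.tendsto_left_of_eq_hi (hc.continuousOn_primitive hF _) hX' ⟨h1, hr.2⟩)
  rw [hζ r hr u hu, hlo, ← intervalIntegral.integral_add_adjacent_intervals
    (intervalIntegrable hF h0S (hc.lo_spec hr).1)
    (intervalIntegrable hF (hc.lo_spec hr).1 hm)]
  abel

/-- A primitive on `[0, S]` folds to a function with jumps on `[0, h]`. -/
theorem jumps_of_eq_primitive {F z : ℝ → E} (hF : IntegrableOn F (Icc 0 S)) {X L : ℝ → E}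
    (hz : ∀ s ∈ Icc 0 S, z s = z 0 + ∫ t in (0)..s, F t)
    (hL : ∀ r ∈ Ioc 0 h, ∀ a, Tendsto X (𝓝[<] r) (𝓝 a) → L r = a)
    (hX : ∀ r ∈ Ioo 0 h, X r = z (hi φ S r)) :
    (∀ r ∈ Ioc 0 h, L r = z (lo φ S r)) ∧
    ∀ r ∈ Ioo 0 h, Summable (fun r' : Ioc 0 r => z (hi φ S r') - L r') ∧
      X r = z (hi φ S 0) + (∫ s in (Icc 0 S \ uset φ S h) ∩ φ ⁻¹' (Ioc 0 r), F s)
        + ∑' r' : Ioc 0 r, (z (hi φ S r') - L r') := by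
  have h0 : (0 : ℝ) ∈ Icc 0 h := ⟨le_rfl, hc.h_pos.le⟩
  have h0S : (0 : ℝ) ∈ Icc 0 S := ⟨le_rfl, hc.S_pos.le⟩
  have hdiff : ∀ a ∈ Icc 0 S, ∀ b ∈ Icc 0 S, z b - z a = ∫ s in a..b, F s := by
    intro a ha b hb
    rw [hz a ha, hz b hb, add_sub_add_left_eq_sub,
      intervalIntegral.integral_interval_sub_left (intervalIntegrable hF h0S hb)
        (intervalIntegrable hF h0S ha)]
  have hzc : ContinuousOn z (Icc 0 S) := (hc.continuousOn_primitive hF (z 0)).congr hz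
  have hL' : ∀ r ∈ Ioc 0 h, L r = z (lo φ S r) := fun r hr =>
    hL r hr _ (hc.tendsto_left_of_eq_hi hzc hX hr)
  refine ⟨hL', fun r hr => ?_⟩
  have hr' := Ioo_subset_Icc_self hr
  have hsum := hc.hasSum_jumps_Ioc hF hr'
  have hcongr : (fun r' : Ioc 0 r => z (hi φ S r') - L r')
      = fun r' : Ioc 0 r => ∫ s in (lo φ S r')..(hi φ S r'), F s := by
    funext r'
    have hm : (r' : ℝ) ∈ Ioc 0 h := ⟨r'.2.1, r'.2.2.trans hr.2.le⟩
    have hm' := Ioc_subset_Icc_self hm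
    rw [hL' _ hm, hdiff _ (hc.lo_spec hm').1 _ (hc.hi_spec hm').1]
  rw [hcongr]
  refine ⟨hsum.summable, ?_⟩
  rw [hsum.tsum_eq, hX r hr, ← hdiff _ (hc.hi_spec h0).1 _ (hc.hi_spec hr').1]
  abel

end IsClock

/-! ### Integrals in `t` as integrals over the times off the stops. -/

namespace DelaySystem

variable {n m N M : ℕ} {P : DelaySystem n m N M}

/-- The image of `φ̇₀ ds` gives `[0, t]` the mass `φ₀(hi t) = t`. It converts the drift integral in
`t` into one in `s`. -/
theorem IsCanonControl.map_clock {e : ExtendedData n m} (hC : P.IsCanonControl e) :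
    ((volume.restrict (Icc 0 e.S)).withDensity
      (fun s => ENNReal.ofReal (deriv e.φ₀ s))).map e.φ₀ = volume.restrict (Icc 0 P.h) := by
  have hc := hC.clock
  set w : ℝ → ENNReal := fun s => ENNReal.ofReal (deriv e.φ₀ s)
  have hae : AEMeasurable e.φ₀ ((volume.restrict (Icc 0 e.S)).withDensity w) :=
    hc.aemeasurable.mono_ac (withDensity_absolutelyContinuous _ _)
  have hκ : ∀ B, MeasurableSet B → ((volume.restrict (Icc 0 e.S)).withDensity w).map e.φ₀ B
      = ∫⁻ s in Icc 0 e.S ∩ e.φ₀ ⁻¹' B, w s := by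
    intro B hB
    rw [Measure.map_apply_of_aemeasurable hae hB,
      withDensity_apply₀ _ (hc.aemeasurable.nullMeasurableSet_preimage hB),
      Measure.restrict_restrict' measurableSet_Icc, inter_comm]
  symm
  refine measure_ext_of_Icc (T := P.h) ?_ ?_ fun t ht => ?_
  · rw [Measure.restrict_apply measurableSet_Icc.compl, compl_inter_self, measure_empty]
  · rw [hκ _ measurableSet_Icc.compl]
    refine setLIntegral_measure_zero _ _ ?_
    convert measure_empty (μ := volume)
    rw [eq_empty_iff_forall_notMem]
    rintro s ⟨h1, h2⟩
    exact h2 (hc.mem_Icc h1)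
  · obtain ⟨h1, h2⟩ := hc.hi_spec ht
    rw [hκ _ measurableSet_Icc, hc.preimage_Icc ht, ← ofReal_integral_eq_lintegral_ofReal
      (hC.integrable_φ₀.mono_set (Icc_subset_Icc le_rfl h1.2)), integral_Icc_eq_integral_Ioc,
      ← intervalIntegral.integral_of_le h1.1, ← hC.φ₀_eq_integral h1, h2,
      Measure.restrict_apply measurableSet_Icc,
      inter_eq_left.2 (Icc_subset_Icc le_rfl ht.2), Real.volume_Icc, sub_zero]
    exact ae_restrict_of_ae_restrict_of_subset (Icc_subset_Icc le_rfl h1.2)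
      (hC.bounds.mono fun s hs => hs.1)

/-- The part of an integral over the jumps of `φ₀` vanishes when `dφ₀` is a factor. -/
theorem IsCanonControl.integral_Ioc_eq {e : ExtendedData n m} (hC : P.IsCanonControl e)
    {E : Type*} [NormedAddCommGroup E] [NormedSpace ℝ E] [MeasurableSpace E] [BorelSpace E]
    [SecondCountableTopology E] {k : ℝ → E} (hk : Measurable k) {r : ℝ} (hr : r ∈ Icc 0 P.h) :
    ∫ t in (0)..r, k t = ∫ s in (Icc 0 e.S \ uset e.φ₀ e.S P.h) ∩ e.φ₀ ⁻¹' (Ioc 0 r),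
      deriv e.φ₀ s • k (e.φ₀ s) := by
  have hc := hC.clock
  have hae : AEMeasurable e.φ₀ ((volume.restrict (Icc 0 e.S)).withDensity
      fun s => ENNReal.ofReal (deriv e.φ₀ s)) :=
    hc.aemeasurable.mono_ac (withDensity_absolutelyContinuous _ _)
  have hpre : MeasurableSet (Icc 0 e.S ∩ e.φ₀ ⁻¹' Ioc 0 r) :=
    hc.measurableSet_preimage measurableSet_Ioc
  have h1 : ∫ t in (0)..r, k t = ∫ t in Ioc 0 r, k t ∂(volume.restrict (Icc 0 P.h)) := by
    rw [intervalIntegral.integral_of_le hr.1, Measure.restrict_restrict measurableSet_Ioc,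
      inter_eq_left.2 (Ioc_subset_Icc_self.trans (Icc_subset_Icc le_rfl hr.2))]
  have hsub : Icc 0 e.S ∩ e.φ₀ ⁻¹' Ioc 0 r ⊆ Icc 0 e.S := inter_subset_left
  have hwm : Measurable fun s => ENNReal.ofReal (deriv e.φ₀ s) :=
    (measurable_deriv _).ennreal_ofReal
  rw [h1, ← hC.map_clock, setIntegral_map measurableSet_Ioc hk.aestronglyMeasurable hae,
    restrict_withDensity' (e.φ₀ ⁻¹' Ioc 0 r), Measure.restrict_restrict' measurableSet_Icc,
    inter_comm, integral_withDensity_eq_integral_toReal_smul hwm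
      (Eventually.of_forall fun s => ENNReal.ofReal_lt_top)]
  have h2 : ∫ s in Icc 0 e.S ∩ e.φ₀ ⁻¹' Ioc 0 r, (ENNReal.ofReal (deriv e.φ₀ s)).toReal •
      k (e.φ₀ s) = ∫ s in Icc 0 e.S ∩ e.φ₀ ⁻¹' Ioc 0 r, deriv e.φ₀ s • k (e.φ₀ s) := by
    refine integral_congr_ae ?_
    filter_upwards [ae_restrict_of_ae_restrict_of_subset hsub hC.bounds] with s hs
    rw [ENNReal.toReal_ofReal hs.1]
  rw [h2]
  have h3 : (Icc 0 e.S \ uset e.φ₀ e.S P.h) ∩ e.φ₀ ⁻¹' (Ioc 0 r)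
      = (Icc 0 e.S ∩ e.φ₀ ⁻¹' Ioc 0 r) \ uset e.φ₀ e.S P.h := by
    ext s; simp only [mem_inter_iff, Set.mem_sdiff]; tauto
  rw [h3]
  refine setIntegral_eq_of_subset_of_ae_sdiff_eq_zero hpre.nullMeasurableSet Set.sdiff_subset ?_
  have h4 := (ae_restrict_iff' hc.measurableSet_uset).1 hC.ae_deriv_φ₀_uset
  filter_upwards [h4] with s hs hm
  have : s ∈ uset e.φ₀ e.S P.h := by
    by_contra h5
    exact hm.2 ⟨hm.1, h5⟩
  rw [hs this, zero_smul]

namespace Linked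

variable {p : ImpulseData n m} {e : ExtendedData n m} (hL : P.Linked p e)
  (hp : P.IsImpulseControl p)
include hL hp

/-- The identity for `μ_l` sees only the open block. The left endpoint `(l-1)h` may belong to `B`,
but the continuous component does not charge it. -/
theorem contVec_eq {l : ℕ} (hl : l ∈ Finset.Icc 1 N) (j : Fin m) {B : Set ℝ} (hB : MeasurableSet B)
    (hsub : B ⊆ Ico (((l : ℝ) - 1) * P.h) (l * P.h)) :
    contVec p.μ j B = ∫ s in (Icc 0 e.S \ uset e.φ₀ e.S P.h) ∩
      {s | ((l : ℝ) - 1) * P.h + e.φ₀ s ∈ B}, deriv (e.φ l) s j := by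
  have hc := hL.canon.clock
  have hm : Measurable fun t => ((l : ℝ) - 1) * P.h + t := by fun_prop
  have h1 := muL_diff hp hc (fun r hr => hL.phi_eq hr) hl j (hm hB)
  rw [← contVec_muL hp hc (fun r hr => hL.phi_eq hr) hl j (hm hB),
    hL.contVec_muL_eq hl j (hm hB)] at h1
  refine Eq.trans ?_ h1.symm
  have h2 : (fun t => t - ((l : ℝ) - 1) * P.h) ⁻¹' ((fun t => ((l : ℝ) - 1) * P.h + t) ⁻¹' B) ∩
      Ioo (((l : ℝ) - 1) * P.h) (l * P.h) = B \ {((l : ℝ) - 1) * P.h} := by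
    ext t
    simp only [mem_inter_iff, mem_preimage, Set.mem_sdiff, mem_singleton_iff, add_sub_cancel]
    constructor
    · rintro ⟨h3, h4⟩; exact ⟨h3, h4.1.ne'⟩
    · rintro ⟨h3, h4⟩
      exact ⟨h3, lt_of_le_of_ne (hsub h3).1 (Ne.symm h4), (hsub h3).2⟩
  rw [h2]
  refine signedMeasure_apply_sub_countable hB (countable_singleton _) fun t _ _ => ?_
  rw [contVec_apply _ _ (measurableSet_singleton t)]
  by_cases ht : t ∈ {t | ∀ i, p.μ i {t} = 0}
  · rw [inter_eq_left.2 (singleton_subset_iff.2 ht)]; exact ht j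
  · rw [singleton_inter_eq_empty.2 ht]; exact VectorMeasure.empty _

theorem contMeas_real_Icc {l : ℕ} (hl : l ∈ Finset.Icc 1 N) {r : ℝ} (hr : r ∈ Ico 0 P.h) :
    (contMeas p.ν).real (Icc (((l : ℝ) - 1) * P.h) (((l : ℝ) - 1) * P.h + r))
      = ∫ s in (Icc 0 e.S \ uset e.φ₀ e.S P.h) ∩ e.φ₀ ⁻¹' (Ioc 0 r), l1 (deriv (e.φ l) s) := by
  have hc := hL.canon.clock
  have := hp.ν_finite
  set a := ((l : ℝ) - 1) * P.h with ha
  have hsing : contMeas p.ν {a} = 0 := by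
    rw [contMeas_apply _ (measurableSet_singleton _)]
    by_cases ht : a ∈ {t | p.ν {t} = 0}
    · exact measure_mono_null inter_subset_left ht
    · rw [singleton_inter_eq_empty.2 ht, measure_empty]
  have h1 : contMeas p.ν (Icc a (a + r)) = contMeas p.ν (Ioc a (a + r)) := by
    refine le_antisymm ?_ (measure_mono Ioc_subset_Icc_self)
    rw [← Icc_sdiff_left, measure_sdiff_null hsing]
  have h2 := nuL_diff hp hc (fun r hr => hL.phi_eq hr) hl (measurableSet_Ioc (a := 0) (b := r))
  have h3 : (fun t => t - ((l : ℝ) - 1) * P.h) ⁻¹' (Ioc 0 r) ∩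
      Ioo (((l : ℝ) - 1) * P.h) (l * P.h) = Ioc a (a + r) := by
    ext t
    simp only [mem_inter_iff, mem_preimage, mem_Ioc, mem_Ioo, ← ha]
    constructor
    · rintro ⟨⟨h3, h4⟩, -⟩; exact ⟨by linarith, by linarith⟩
    · rintro ⟨h3, h4⟩
      refine ⟨⟨by linarith, by linarith⟩, h3, ?_⟩
      have : (l : ℝ) * P.h = a + P.h := by rw [ha]; ring
      linarith [hr.2]
  rw [h3, hL.nuL_eq hl (measurableSet_Ioc.diff hc.measurableSet_jset),
    setLIntegral_congr (hc.preimage_diff_ae hc.countable_jset subset_rfl)] at h2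
  have hsub : (Icc 0 e.S \ uset e.φ₀ e.S P.h) ∩ e.φ₀ ⁻¹' (Ioc 0 r) ⊆ Icc 0 e.S :=
    inter_subset_left.trans Set.sdiff_subset
  rw [measureReal_def, h1, ← h2, ← ofReal_integral_eq_lintegral_ofReal
    (integrable_l1 ((hL.canon.integrable_φ hl).mono_set hsub))
    (Eventually.of_forall fun s => l1_nonneg _),
    ENNReal.toReal_ofReal (integral_nonneg fun s => l1_nonneg _)]

theorem sInt_eq {l : ℕ} (hl : l ∈ Finset.Icc 1 N) (j : Fin m) {r : ℝ} (hr : r ∈ Ico 0 P.h)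
    {G : ℝ → Fin n → ℝ} (hG : Measurable G) {C : ℝ} (hC : ∀ t, ‖G t‖ ≤ C) :
    sInt (contVec p.μ j) (Icc (((l : ℝ) - 1) * P.h) (((l : ℝ) - 1) * P.h + r)) G
      = ∫ s in (Icc 0 e.S \ uset e.φ₀ e.S P.h) ∩ e.φ₀ ⁻¹' (Ioc 0 r),
          deriv (e.φ l) s j • G (((l : ℝ) - 1) * P.h + e.φ₀ s) := by
  have hc := hL.canon.clock
  set a := ((l : ℝ) - 1) * P.h with ha
  have hla : (l : ℝ) * P.h = a + P.h := by rw [ha]; ring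
  have hψ : AEMeasurable (fun s => a + e.φ₀ s)
      (volume.restrict (Icc 0 e.S \ uset e.φ₀ e.S P.h)) :=
    (hc.aemeasurable.mono_set Set.sdiff_subset).const_add a
  have hk : Integrable (fun s => deriv (e.φ l) s j)
      (volume.restrict (Icc 0 e.S \ uset e.φ₀ e.S P.h)) :=
    ((hL.canon.integrable_φ hl).mono_set Set.sdiff_subset).eval j
  have hInd : ∀ {E : Type} [NormedAddCommGroup E] [NormedSpace ℝ E] (F : ℝ → E) (B : Set ℝ),
      MeasurableSet B → ∫ s in Icc 0 e.S \ uset e.φ₀ e.S P.h,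
        ((fun s => a + e.φ₀ s) ⁻¹' B).indicator F s
      = ∫ s in (Icc 0 e.S \ uset e.φ₀ e.S P.h) ∩ (fun s => a + e.φ₀ s) ⁻¹' B, F s := by
    intro E _ _ F B hB
    rw [integral_indicator₀ (hψ.nullMeasurableSet_preimage hB),
      Measure.restrict_restrict' hc.measurableSet_compl_uset, inter_comm]
  rw [sInt_eq_integral_of_map measurableSet_Icc hψ hk (fun B hB hsub => ?_) hG hC,
    hInd _ _ measurableSet_Icc]
  · have h1 : (fun s => a + e.φ₀ s) ⁻¹' (Icc a (a + r)) = e.φ₀ ⁻¹' (Icc 0 r) := by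
      ext s; simp
    rw [h1, setIntegral_congr_set (hc.off_preimage_Icc_ae r)]
  · rw [hInd _ _ hB]
    refine hL.contVec_eq hp hl j hB fun t ht => ?_
    exact ⟨(hsub ht).1, by linarith [(hsub ht).2, hr.2]⟩

end Linked

end DelaySystem

/-! ### The velocity off the stops. -/

namespace DelaySystem

variable {n m N M : ℕ} {P : DelaySystem n m N M}

namespace Linked

variable {p : ImpulseData n m} {e : ExtendedData n m} (hL : P.Linked p e)
include hL

theorem integrable_smul {l : ℕ} (hl : l ∈ Finset.Icc 1 N) (j : Fin m) {G : ℝ → Fin n → ℝ}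
    (hG : Measurable G) {C : ℝ} (hC : ∀ t, ‖G t‖ ≤ C) (c : ℝ) :
    IntegrableOn (fun s => deriv (e.φ l) s j • G (c + e.φ₀ s)) (Icc 0 e.S) := by
  refine Integrable.smul_bdd ((hL.canon.integrable_φ hl).eval j) C
    (hG.comp_aemeasurable (hL.canon.clock.aemeasurable.const_add c)).aestronglyMeasurable
    (Eventually.of_forall fun s => hC _)

theorem integrable_smul_clock {G : ℝ → Fin n → ℝ}
    (hG : Measurable G) {C : ℝ} (hC : ∀ t, ‖G t‖ ≤ C) (c : ℝ) :
    IntegrableOn (fun s => deriv e.φ₀ s • G (c + e.φ₀ s)) (Icc 0 e.S) := by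
  refine Integrable.smul_bdd hL.canon.integrable_φ₀ C
    (hG.comp_aemeasurable (hL.canon.clock.aemeasurable.const_add c)).aestronglyMeasurable
    (Eventually.of_forall fun s => hC _)

variable (hp : P.IsImpulseControl p)
  (hτ : ∀ l ∈ Finset.Icc 1 N, ∀ s ∈ Icc 0 e.S, e.τ l s = ((l : ℝ) - 1) * P.h + e.φ₀ s)
  (hhist : ∀ t ∈ Ico (-(M * P.h)) 0, p.x t = P.ξ₀ t)
  (hxy : ∀ l ∈ Finset.Icc 1 N, ∀ s ∈ Ioo 0 e.S, s ∉ uset e.φ₀ e.S P.h →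
      p.x (((l : ℝ) - 1) * P.h + e.φ₀ s) = e.y l s)
  {X : ℝ → Fin n → ℝ} (hX : Measurable X) (hxX : EqOn p.x X (Icc (-(M * P.h)) P.T))
include hτ hhist hxy hxX

/-- Off the jumps, the velocity of `y_l` is a function of the clock. -/
theorem ae_velocity_off {l : ℕ} (hl : l ∈ Finset.Icc 1 N) :
    ∀ᵐ s ∂(volume.restrict (Icc 0 e.S \ uset e.φ₀ e.S P.h)), P.velocity e l s
      = deriv e.φ₀ s • P.f (((l : ℝ) - 1) * P.h + e.φ₀ s)
          (P.delayed X (((l : ℝ) - 1) * P.h + e.φ₀ s))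
        + ∑ j, deriv (e.φ l) s j • P.g j (((l : ℝ) - 1) * P.h + e.φ₀ s)
          (P.delayed X (((l : ℝ) - 1) * P.h + e.φ₀ s)) := by
  have hc := hL.canon.clock
  have hh := P.h_pos
  filter_upwards [ae_restrict_of_ae_restrict_of_subset Set.sdiff_subset (ae_mem_Ioo 0 e.S),
    ae_restrict_mem hc.measurableSet_compl_uset] with s hs hm
  have h1 := hc.notMem_uset_apply hs hm.2
  have h2 : ((l : ℝ) - 1) * P.h + e.φ₀ s ∈ Icc 0 P.T := by
    have hl1 : (1 : ℝ) ≤ l := by exact_mod_cast (Finset.mem_Icc.1 hl).1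
    have hl2 : (l : ℝ) ≤ N := by exact_mod_cast (Finset.mem_Icc.1 hl).2
    unfold T
    constructor
    · nlinarith [h1.1]
    · nlinarith [h1.2]
  rw [← delayed_congr hxX h2, delayed_eq hc hτ hhist hxy hl hs hm.2, ← hτ l hl s hm.1]
  rfl

include hX

theorem aestronglyMeasurable_velocity_off {l : ℕ} (hl : l ∈ Finset.Icc 1 N) :
    AEStronglyMeasurable (P.velocity e l)
      (volume.restrict (Icc 0 e.S \ uset e.φ₀ e.S P.h)) := by
  have hD := measurable_delayed (P := P) hX
  obtain ⟨C, hf, hg⟩ := P.exists_bound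
  have h1 := hL.integrable_smul_clock
    (P.f_cont.measurable.comp (measurable_id.prodMk hD)) (fun t => hf _ _) (((l : ℝ) - 1) * P.h)
  have h2 := fun j => hL.integrable_smul hl j
    ((P.g_cont j).measurable.comp (measurable_id.prodMk hD)) (fun t => hg j _ _)
    (((l : ℝ) - 1) * P.h)
  have h3 := (h1.add (integrable_finsetSum Finset.univ fun j _ => h2 j)).mono_set
    (Set.sdiff_subset (t := uset e.φ₀ e.S P.h))
  refine h3.aestronglyMeasurable.congr ?_
  filter_upwards [hL.ae_velocity_off hτ hhist hxy hxX hl] with s hs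
  rw [hs]
  simp [id]

include hp

/-- The drift is transported by `φ̇₀ ds ↦ dt` and each control term by `φ̇_l ds ↦ dμᶜ`; both
integrands become functions of the clock value once `x` is replaced by its Borel version `X`. Their
sum is the velocity of `y_l` off the stops. -/
theorem integral_velocity_off {l : ℕ} (hl : l ∈ Finset.Icc 1 N) {r : ℝ} (hr : r ∈ Ico 0 P.h) :
    (∫ t in (((l : ℝ) - 1) * P.h)..(((l : ℝ) - 1) * P.h + r), P.f t (P.delayed p.x t))
      + ∑ j, sInt (contVec p.μ j) (Icc (((l : ℝ) - 1) * P.h) (((l : ℝ) - 1) * P.h + r))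
          (fun t => P.g j t (P.delayed p.x t))
      = ∫ s in (Icc 0 e.S \ uset e.φ₀ e.S P.h) ∩ e.φ₀ ⁻¹' (Ioc 0 r), P.velocity e l s := by
  have hc := hL.canon.clock
  have hh := P.h_pos
  have hD := measurable_delayed (P := P) hX
  obtain ⟨C, hf, hg⟩ := P.exists_bound
  set a := ((l : ℝ) - 1) * P.h with ha
  have hmem : ∀ t ∈ Icc a (a + r), t ∈ Icc 0 P.T := by
    have hl1 : (1 : ℝ) ≤ l := by exact_mod_cast (Finset.mem_Icc.1 hl).1
    have hl2 : (l : ℝ) ≤ N := by exact_mod_cast (Finset.mem_Icc.1 hl).2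
    intro t ht
    unfold T
    constructor
    · nlinarith [ht.1]
    · nlinarith [ht.2, hr.2]
  have hfm : Measurable fun t => P.f t (P.delayed X t) :=
    P.f_cont.measurable.comp (measurable_id.prodMk hD)
  have hgm : ∀ j, Measurable fun t => P.g j t (P.delayed X t) := fun j =>
    (P.g_cont j).measurable.comp (measurable_id.prodMk hD)
  have e1 : ∫ t in a..(a + r), P.f t (P.delayed p.x t)
      = ∫ s in (Icc 0 e.S \ uset e.φ₀ e.S P.h) ∩ e.φ₀ ⁻¹' (Ioc 0 r),
        deriv e.φ₀ s • P.f (a + e.φ₀ s) (P.delayed X (a + e.φ₀ s)) := by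
    rw [← hL.canon.integral_Ioc_eq (k := fun t => P.f (a + t) (P.delayed X (a + t)))
      (hfm.comp (by fun_prop : Measurable fun t => a + t)) ⟨hr.1, hr.2.le⟩,
      intervalIntegral.integral_comp_add_left (fun t => P.f t (P.delayed X t)), add_zero]
    refine intervalIntegral.integral_congr fun t ht => ?_
    rw [uIcc_of_le (by linarith [hr.1])] at ht
    simp only [delayed_congr hxX (hmem t ht)]
  have e2 : ∀ j, sInt (contVec p.μ j) (Icc a (a + r)) (fun t => P.g j t (P.delayed p.x t))
      = ∫ s in (Icc 0 e.S \ uset e.φ₀ e.S P.h) ∩ e.φ₀ ⁻¹' (Ioc 0 r),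
        deriv (e.φ l) s j • P.g j (a + e.φ₀ s) (P.delayed X (a + e.φ₀ s)) := by
    intro j
    rw [← hL.sInt_eq hp hl j hr (hgm j) fun t => hg j _ _]
    have : EqOn (fun t => P.g j t (P.delayed p.x t)) (fun t => P.g j t (P.delayed X t))
        (Icc a (a + r)) := fun t ht => by simp only [delayed_congr hxX (hmem t ht)]
    unfold sInt
    rw [setIntegral_congr_fun measurableSet_Icc this, setIntegral_congr_fun measurableSet_Icc this]
  have hsub : (Icc 0 e.S \ uset e.φ₀ e.S P.h) ∩ e.φ₀ ⁻¹' (Ioc 0 r) ⊆ Icc 0 e.S :=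
    inter_subset_left.trans Set.sdiff_subset
  have i1 := (hL.integrable_smul_clock hfm (fun t => hf _ _) a).mono_set hsub
  have i2 := fun j => (hL.integrable_smul hl j (hgm j) (fun t => hg j _ _) a).mono_set hsub
  rw [e1, Finset.sum_congr rfl fun j _ => e2 j, ← integral_finsetSum _ fun j _ => i2 j,
    ← integral_add i1 (integrable_finsetSum _ fun j _ => i2 j)]
  refine integral_congr_ae ?_
  filter_upwards [ae_restrict_of_ae_restrict_of_subset inter_subset_left
    (hL.ae_velocity_off hτ hhist hxy hxX hl)] with s hs
  rw [hs]

end Linked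

/-! ### The jump equations -/

/-- The velocity of `ζ^r_l` in the jump equations. -/
def jumpVelocity (P : DelaySystem n m N M) (p : ImpulseData n m) (ζ : ℝ → ℕ → ℝ → Fin n → ℝ)
    (r : ℝ) (l : ℕ) (s : ℝ) : Fin n → ℝ :=
  ∑ j, p.ω r l s j • P.g j (r + ((l : ℝ) - 1) * P.h)
    (fun k => P.zetaExt ζ r ((l : ℤ) - (k : ℕ)) s)

theorem exists_jumpVelocity_bound {p : ImpulseData n m} {r c : ℝ}
    (hω : ∀ᵐ s ∂(volume.restrict (Icc (0 : ℝ) 1)), ∑ l ∈ Finset.Icc 1 N, l1 (p.ω r l s) = c)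
    {l : ℕ} (hl : l ∈ Finset.Icc 1 N) : ∃ C : NNReal, ∀ ζ,
    ∀ᵐ s ∂(volume.restrict (Icc (0 : ℝ) 1)), ‖P.jumpVelocity p ζ r l s‖ ≤ C := by
  obtain ⟨C, -, hg⟩ := P.exists_bound
  refine ⟨Real.toNNReal c * C, fun ζ => ?_⟩
  filter_upwards [hω] with s hs
  have h1 : l1 (p.ω r l s) ≤ c := by
    rw [← hs]
    exact Finset.single_le_sum (f := fun l => l1 (p.ω r l s)) (fun _ _ => l1_nonneg _) hl
  unfold jumpVelocity
  calc _ ≤ ∑ j, |p.ω r l s j| * C := by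
        refine (norm_sum_le _ _).trans (Finset.sum_le_sum fun j _ => ?_)
        rw [norm_smul]
        exact mul_le_mul_of_nonneg_left (hg _ _ _) (norm_nonneg _)
    _ = l1 (p.ω r l s) * C := by rw [← Finset.sum_mul]; rfl
    _ ≤ _ := by
        push_cast
        exact mul_le_mul_of_nonneg_right (h1.trans (Real.le_coe_toNNReal c)) C.2

/-- Stated for `u` in the open interval `(0, 1)`: the exceptional value `ζ^h_0(1) = x₀` does not
follow the history formula, but it is irrelevant to integrals. -/
theorem zetaExt_eq_yExt {e : ExtendedData n m} (hc : IsClock e.φ₀ e.S P.h)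
    (hτ : ∀ l ∈ Finset.Icc 1 N, ∀ s ∈ Icc 0 e.S, e.τ l s = ((l : ℝ) - 1) * P.h + e.φ₀ s)
    {ζ : ℝ → ℕ → ℝ → Fin n → ℝ} {r : ℝ} (hr : r ∈ Icc 0 P.h) {u : ℝ} (hu : u ∈ Ioo (0 : ℝ) 1)
    (hζ : ∀ l ∈ Finset.Icc 1 N,
      ζ r l u = e.y l (lo e.φ₀ e.S r + u * (hi e.φ₀ e.S r - lo e.φ₀ e.S r)))
    {i : ℤ} (hi' : i ≤ N) :
    P.zetaExt ζ r i u = P.yExt e i (lo e.φ₀ e.S r + u * (hi e.φ₀ e.S r - lo e.φ₀ e.S r)) := by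
  have hm := hc.sub_lo_add_mem hr (Ioo_subset_Icc_self hu)
  unfold zetaExt yExt
  split_ifs with h1 h2
  · exact hζ _ (Finset.mem_Icc.2 ⟨by omega, by omega⟩)
  · exact absurd h2.2.2 hu.2.ne
  · rw [hτ 1 (Finset.mem_Icc.2 ⟨le_rfl, P.one_le_N⟩) _ (hc.Icc_subset hr hm),
      hc.apply_eq hr hm]
    congr 1; push_cast; ring

/-- Inside a fibre `φ̇₀ = 0` kills the drift and freezes the time argument of `g`, so the auxiliary
system becomes the jump equation up to the affine change of parameter. On a degenerate fibre both
sides vanish and no relation between `ζ` and `y` is needed. -/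
theorem Linked.ae_jumpVelocity {p : ImpulseData n m} {e : ExtendedData n m} (hL : P.Linked p e)
    (hτ : ∀ l ∈ Finset.Icc 1 N, ∀ s ∈ Icc 0 e.S, e.τ l s = ((l : ℝ) - 1) * P.h + e.φ₀ s)
    {ζ : ℝ → ℕ → ℝ → Fin n → ℝ} {r : ℝ} (hr : r ∈ Icc 0 P.h)
    (hζ : lo e.φ₀ e.S r < hi e.φ₀ e.S r → ∀ u ∈ Ioo (0 : ℝ) 1, ∀ l ∈ Finset.Icc 1 N,
      ζ r l u = e.y l (lo e.φ₀ e.S r + u * (hi e.φ₀ e.S r - lo e.φ₀ e.S r)))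
    {l : ℕ} (hl : l ∈ Finset.Icc 1 N) :
    ∀ᵐ u ∂(volume.restrict (Icc (0 : ℝ) 1)), P.jumpVelocity p ζ r l u
      = (hi e.φ₀ e.S r - lo e.φ₀ e.S r) •
        P.velocity e l ((hi e.φ₀ e.S r - lo e.φ₀ e.S r) * u + lo e.φ₀ e.S r) := by
  have hc := hL.canon.clock
  filter_upwards [hL.ω_eq r hr l hl, ae_mem_Ioo 0 1] with u h1 hu
  unfold jumpVelocity
  rw [h1]
  rcases (hc.lo_le_hi hr).eq_or_lt with h | h
  · rw [h]; simp
  · have hd := sub_pos.2 h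
    have hm : (hi e.φ₀ e.S r - lo e.φ₀ e.S r) * u + lo e.φ₀ e.S r
        ∈ Ioo (lo e.φ₀ e.S r) (hi e.φ₀ e.S r) := by
      constructor <;> nlinarith [hu.1, hu.2]
    have h2 : (fun k : Fin (M + 1) => P.zetaExt ζ r ((l : ℤ) - (k : ℕ)) u)
        = fun k : Fin (M + 1) => P.yExt e ((l : ℤ) - (k : ℕ))
          ((hi e.φ₀ e.S r - lo e.φ₀ e.S r) * u + lo e.φ₀ e.S r) := by
      funext k
      have := (Finset.mem_Icc.1 hl).2
      rw [zetaExt_eq_yExt hc hτ hr hu (hζ h u hu) (by omega)]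
      congr 1; ring
    unfold velocity
    rw [h2, hL.canon.deriv_φ₀_eq_zero hr hm, zero_smul, zero_add, Finset.smul_sum,
      hτ l hl _ (hc.Icc_subset hr (Ioo_subset_Icc_self hm)),
      hc.apply_eq hr (Ioo_subset_Icc_self hm), add_comm (((l : ℝ) - 1) * P.h)]
    refine Finset.sum_congr rfl fun j _ => ?_
    rw [smul_smul]; rfl

theorem Linked.integral_jumpVelocity {p : ImpulseData n m} {e : ExtendedData n m}
    (hL : P.Linked p e)
    (hτ : ∀ l ∈ Finset.Icc 1 N, ∀ s ∈ Icc 0 e.S, e.τ l s = ((l : ℝ) - 1) * P.h + e.φ₀ s)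
    {ζ : ℝ → ℕ → ℝ → Fin n → ℝ} {r : ℝ} (hr : r ∈ Icc 0 P.h)
    (hζ : lo e.φ₀ e.S r < hi e.φ₀ e.S r → ∀ u ∈ Ioo (0 : ℝ) 1, ∀ l ∈ Finset.Icc 1 N,
      ζ r l u = e.y l (lo e.φ₀ e.S r + u * (hi e.φ₀ e.S r - lo e.φ₀ e.S r)))
    {l : ℕ} (hl : l ∈ Finset.Icc 1 N) {u : ℝ} (hu : u ∈ Icc (0 : ℝ) 1) :
    ∫ t in (0)..u, P.jumpVelocity p ζ r l t
      = ∫ s in (lo e.φ₀ e.S r)..(lo e.φ₀ e.S r + u * (hi e.φ₀ e.S r - lo e.φ₀ e.S r)),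
          P.velocity e l s := by
  have h1 := hL.ae_jumpVelocity hτ hr hζ hl
  rw [intervalIntegral.integral_congr_ae_restrict (g := fun u => (hi e.φ₀ e.S r - lo e.φ₀ e.S r) •
    P.velocity e l ((hi e.φ₀ e.S r - lo e.φ₀ e.S r) * u + lo e.φ₀ e.S r)),
    intervalIntegral.integral_smul, intervalIntegral.smul_integral_comp_mul_add, mul_zero,
    zero_add]
  · congr 1; ring
  · rw [uIoc_of_le hu.1]
    exact ae_restrict_of_ae_restrict_of_subset
      (Ioc_subset_Icc_self.trans (Icc_subset_Icc le_rfl hu.2)) h1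

end DelaySystem

/-! ### Uniqueness for the jump equations. -/

namespace DelaySystem

variable {n m N M : ℕ} {P : DelaySystem n m N M}

theorem exists_lipschitz_g (P : DelaySystem n m N M) (t R : ℝ) :
    ∃ C : NNReal, ∀ j, ∀ X Y : Fin (M + 1) → Fin n → ℝ, ‖X‖ ≤ R → ‖Y‖ ≤ R →
      ‖P.g j t X - P.g j t Y‖ ≤ C * ‖X - Y‖ := by
  have h : ∀ j, ∃ C : NNReal, LipschitzOnWith C
      (fun q : ℝ × (Fin (M + 1) → Fin n → ℝ) => P.g j q.1 q.2)
      ({t} ×ˢ Metric.closedBall 0 R) := fun j =>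
    LocallyLipschitzOn.exists_lipschitzOnWith_of_compact
      (isCompact_singleton.prod (isCompact_closedBall _ _))
      (P.g_C1 j).locallyLipschitz.locallyLipschitzOn
  choose C hC using h
  refine ⟨∑ j, C j, fun j X Y hX hY => ?_⟩
  have h1 := (hC j).dist_le_mul (t, X) ⟨rfl, by simpa using hX⟩ (t, Y) ⟨rfl, by simpa using hY⟩
  have h2 : dist (t, X) (t, Y) = ‖X - Y‖ := by
    rw [Prod.dist_eq, dist_self, max_eq_right dist_nonneg, dist_eq_norm]
  rw [dist_eq_norm, h2] at h1
  refine h1.trans (mul_le_mul_of_nonneg_right ?_ (norm_nonneg _))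
  exact_mod_cast Finset.single_le_sum (f := C) (fun _ _ => zero_le) (Finset.mem_univ j)

theorem exists_zetaExt_bound {ζ : ℝ → ℕ → ℝ → Fin n → ℝ} {r : ℝ}
    (hζ : ∀ l ∈ Finset.Icc 1 N, ContinuousOn (ζ r l) (Icc 0 1)) {l : ℕ}
    (hl : l ∈ Finset.Icc 1 N) : ∃ R : ℝ, ∀ s ∈ Icc (0 : ℝ) 1,
      ‖fun k : Fin (M + 1) => P.zetaExt ζ r ((l : ℤ) - (k : ℕ)) s‖ ≤ R := by
  have h : ∀ k : Fin (M + 1), ∃ R : ℝ, ∀ s ∈ Icc (0 : ℝ) 1,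
      ‖P.zetaExt ζ r ((l : ℤ) - (k : ℕ)) s‖ ≤ R := by
    intro k
    by_cases h1 : 1 ≤ (l : ℤ) - (k : ℕ)
    · have h2 := (Finset.mem_Icc.1 hl).2
      obtain ⟨R, hR⟩ := isCompact_Icc.exists_bound_of_continuousOn
        (hζ ((l : ℤ) - (k : ℕ)).toNat (Finset.mem_Icc.2 ⟨by omega, by omega⟩))
      exact ⟨R, fun s hs => by rw [zetaExt, if_pos h1]; exact hR s hs⟩
    · refine ⟨max ‖P.x₀‖ ‖P.ξ₀ (r - (1 - (((l : ℤ) - (k : ℕ) : ℤ) : ℝ)) * P.h)‖, fun s _ => ?_⟩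
      rw [zetaExt, if_neg h1]
      split_ifs
      exacts [le_max_left _ _, le_max_right _ _]
  choose R hR using h
  refine ⟨∑ k, |R k|, fun s hs => (pi_norm_le_iff_of_nonneg
    (Finset.sum_nonneg fun _ _ => abs_nonneg _)).2 fun k => (hR k s hs).trans ?_⟩
  exact (le_abs_self _).trans
    (Finset.single_le_sum (f := fun k => |R k|) (fun _ _ => abs_nonneg _) (Finset.mem_univ k))

namespace IsJumpSolution

variable {p : ImpulseData n m} {ζ ζ' : ℝ → ℕ → ℝ → Fin n → ℝ} {θ θ' : ℝ → ℕ → ℝ → ℝ}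

theorem eq_add_integral (hp : P.IsImpulseControl p) (J : P.IsJumpSolution p ζ θ) {r : ℝ}
    (hr : r ∈ Icc 0 P.h) {l : ℕ} (hl : l ∈ Finset.Icc 1 N) :
    IntervalIntegrable (P.jumpVelocity p ζ r l) volume 0 1 ∧
    ContinuousOn (ζ r l) (Icc 0 1) ∧ ∀ u ∈ Icc (0 : ℝ) 1,
      ζ r l u = ζ r l 0 + ∫ s in (0)..u, P.jumpVelocity p ζ r l s := by
  obtain ⟨C, hC⟩ := exists_jumpVelocity_bound (P := P) (hp.ω_const r hr) hl
  have h1 : SolvesOn (ζ r l) (P.jumpVelocity p ζ r l) 0 1 := J.ζ_eq r hr l hl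
  refine ⟨h1.intervalIntegrable zero_le_one (hC ζ), ?_, h1.eq_add_integral zero_le_one (hC ζ)⟩
  have := h1.1.continuousOn
  rwa [uIcc_of_le zero_le_one] at this

/-- For fixed `r` the equation of `ζ^r_l` involves only arcs of index at most `l` and the history,
so strong induction on `l` leaves the difference in the undelayed argument. That difference is
handled by Grönwall, with the Lipschitz constant of `g` on a ball containing both solutions and the
almost everywhere constant value of `∑‖ω^r_l‖`. -/
theorem ζ_unique_of_init (hp : P.IsImpulseControl p) (J : P.IsJumpSolution p ζ θ)
    (J' : P.IsJumpSolution p ζ' θ') {r : ℝ} (hr : r ∈ Icc 0 P.h)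
    (h0 : ∀ l ∈ Finset.Icc 1 N, ζ r l 0 = ζ' r l 0) :
    ∀ l ∈ Finset.Icc 1 N, ∀ u ∈ Icc (0 : ℝ) 1, ζ r l u = ζ' r l u := by
  intro l
  induction l using Nat.strong_induction_on with
  | _ l ih =>
  intro hl
  obtain ⟨i1, c1, e1⟩ := J.eq_add_integral hp hr hl
  obtain ⟨i2, c2, e2⟩ := J'.eq_add_integral hp hr hl
  obtain ⟨R1, hR1⟩ := exists_zetaExt_bound (P := P)
    (fun l hl => (J.eq_add_integral hp hr hl).2.1) hl
  obtain ⟨R2, hR2⟩ := exists_zetaExt_bound (P := P)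
    (fun l hl => (J'.eq_add_integral hp hr hl).2.1) hl
  obtain ⟨C, hC⟩ := P.exists_lipschitz_g (r + ((l : ℝ) - 1) * P.h) (max R1 R2)
  set c := ∑ l ∈ Finset.Icc 1 N, ∫ s' in (0)..1, l1 (p.ω r l s') with hc
  set D : ℝ → ℝ := fun u => ‖ζ r l u - ζ' r l u‖ with hD
  have hDc : ContinuousOn D (Icc 0 1) := (c1.sub c2).norm
  have hstate : ∀ s ∈ Icc (0 : ℝ) 1,
      ‖(fun k : Fin (M + 1) => P.zetaExt ζ r ((l : ℤ) - (k : ℕ)) s)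
        - fun k : Fin (M + 1) => P.zetaExt ζ' r ((l : ℤ) - (k : ℕ)) s‖ ≤ D s := by
    intro s hs
    refine (pi_norm_le_iff_of_nonneg (norm_nonneg _)).2 fun k => ?_
    have h2 := (Finset.mem_Icc.1 hl).2
    simp only [Pi.sub_apply]
    by_cases h1 : 1 ≤ (l : ℤ) - (k : ℕ)
    · rw [zetaExt, zetaExt, if_pos h1, if_pos h1]
      by_cases hk : (k : ℕ) = 0
      · rw [hk]; simp
      · rw [ih _ (by omega) (Finset.mem_Icc.2 ⟨by omega, by omega⟩) s hs, sub_self, norm_zero]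
        exact norm_nonneg _
    · rw [zetaExt, zetaExt, if_neg h1, if_neg h1, sub_self, norm_zero]
      exact norm_nonneg _
  have hvel : ∀ᵐ s ∂(volume.restrict (Icc (0 : ℝ) 1)),
      ‖P.jumpVelocity p ζ r l s - P.jumpVelocity p ζ' r l s‖ ≤ c * C * D s := by
    filter_upwards [hp.ω_const r hr, ae_restrict_mem measurableSet_Icc] with s hs hm
    have h1 : l1 (p.ω r l s) ≤ c := by
      rw [hc, ← hs]
      exact Finset.single_le_sum (f := fun l => l1 (p.ω r l s)) (fun _ _ => l1_nonneg _) hl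
    unfold jumpVelocity
    rw [← Finset.sum_sub_distrib]
    calc _ ≤ ∑ j, |p.ω r l s j| * (C * D s) := by
          refine (norm_sum_le _ _).trans (Finset.sum_le_sum fun j _ => ?_)
          rw [← smul_sub, norm_smul]
          refine mul_le_mul_of_nonneg_left ((hC j _ _ ((hR1 s hm).trans (le_max_left _ _))
            ((hR2 s hm).trans (le_max_right _ _))).trans ?_) (norm_nonneg _)
          exact mul_le_mul_of_nonneg_left (hstate s hm) C.2
      _ = l1 (p.ω r l s) * (C * D s) := by rw [← Finset.sum_mul]; rfl
      _ ≤ c * (C * D s) := mul_le_mul_of_nonneg_right h1 (mul_nonneg C.2 (norm_nonneg _))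
      _ = _ := by ring
  have hzero := eq_zero_of_le_mul_integral hDc (fun s _ => norm_nonneg _) (C := c * C) ?_
  · intro u hu
    exact sub_eq_zero.1 (norm_eq_zero.1 (hzero u hu))
  intro u hu
  have hmono : ∀ {f : ℝ → Fin n → ℝ}, IntervalIntegrable f volume 0 1 →
      IntervalIntegrable f volume 0 u := fun h => h.mono_set (by
    rw [uIcc_of_le hu.1, uIcc_of_le zero_le_one]; exact Icc_subset_Icc le_rfl hu.2)
  have hDi : IntervalIntegrable (fun s => c * C * D s) volume 0 u := by
    refine ContinuousOn.intervalIntegrable ?_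
    rw [uIcc_of_le hu.1]
    exact continuousOn_const.mul (hDc.mono (Icc_subset_Icc le_rfl hu.2))
  have h1 : D u = ‖∫ s in (0)..u, (P.jumpVelocity p ζ r l s - P.jumpVelocity p ζ' r l s)‖ := by
    rw [intervalIntegral.integral_sub (hmono i1) (hmono i2), hD]
    simp only
    rw [e1 u hu, e2 u hu, h0 l hl, add_sub_add_left_eq_sub]
  rw [h1, ← intervalIntegral.integral_const_mul]
  refine intervalIntegral.norm_integral_le_of_norm_le hu.1 ?_ hDi
  have := (ae_restrict_iff' measurableSet_Icc).1 hvel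
  filter_upwards [this] with s hs hm
  exact hs ⟨hm.1.le, hm.2.trans hu.2⟩

theorem zetaExt_init (h : ∀ l ∈ Finset.Icc 1 N, ζ P.h l 1 = ζ' P.h l 1) {l : ℕ}
    (hl : l ∈ Finset.Icc 1 N) :
    P.zetaExt ζ P.h ((l : ℤ) - 1) 1 = P.zetaExt ζ' P.h ((l : ℤ) - 1) 1 := by
  unfold zetaExt
  have := Finset.mem_Icc.1 hl
  split_ifs with h1
  · exact h _ (Finset.mem_Icc.2 ⟨by omega, by omega⟩)
  · rfl
  · rfl

/-- The jump equations have at most one solution. -/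
theorem unique (hp : P.IsImpulseControl p) (J : P.IsJumpSolution p ζ θ)
    (J' : P.IsJumpSolution p ζ' θ') {r : ℝ} (hr : r ∈ Icc 0 P.h) {l : ℕ} (hl : l ∈ Finset.Icc 1 N)
    {u : ℝ} (hu : u ∈ Icc (0 : ℝ) 1) : ζ r l u = ζ' r l u ∧ θ r l u = θ' r l u := by
  have hh := P.h_pos
  -- For `r > 0` the initial values are left limits of the common `(x, v)`. For `r = 0` they are
  -- terminal values of arcs at `r = h`, which must therefore be known first.
  have hpos : ∀ r ∈ Ioc 0 P.h, ∀ l ∈ Finset.Icc 1 N, ∀ u ∈ Icc (0 : ℝ) 1,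
      ζ r l u = ζ' r l u ∧ θ r l u = θ' r l u := by
    intro r hr l hl u hu
    have hr' := Ioc_subset_Icc_self hr
    refine ⟨J.ζ_unique_of_init hp J' hr' (fun l hl => ?_) l hl u hu, ?_⟩
    · rw [J.ζ_init r hr' l hl, J'.ζ_init r hr' l hl, if_neg hr.1.ne', if_neg hr.1.ne']
    · rw [J.θ_eq r hr' l hl u hu, J'.θ_eq r hr' l hl u hu, J.θ_init r hr' l hl,
        J'.θ_init r hr' l hl, if_neg hr.1.ne', if_neg hr.1.ne']
  rcases hr.1.eq_or_lt with h0 | h0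
  swap
  · exact hpos r ⟨h0, hr.2⟩ l hl u hu
  subst h0
  have h1 : (1 : ℝ) ∈ Icc (0 : ℝ) 1 := ⟨zero_le_one, le_rfl⟩
  refine ⟨J.ζ_unique_of_init hp J' hr (fun l hl => ?_) l hl u hu, ?_⟩
  · rw [J.ζ_init 0 hr l hl, J'.ζ_init 0 hr l hl, if_pos rfl, if_pos rfl,
      zetaExt_init (fun l hl => (hpos P.h ⟨hh, le_rfl⟩ l hl 1 h1).1) hl]
  · rw [J.θ_eq 0 hr l hl u hu, J'.θ_eq 0 hr l hl u hu, J.θ_init 0 hr l hl,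
      J'.θ_init 0 hr l hl, if_pos rfl, if_pos rfl]
    split_ifs with h2
    · rfl
    · have := Finset.mem_Icc.1 hl
      rw [(hpos P.h ⟨hh, le_rfl⟩ (l - 1) (Finset.mem_Icc.2 ⟨by omega, by omega⟩) 1 h1).2]

end IsJumpSolution

end DelaySystem

/-! ### Unfolding the state of an impulse process. -/

theorem IsClock.eq_primitive {φ : ℝ → ℝ} {S h : ℝ} (hc : IsClock φ S h)
    {E : Type*} [NormedAddCommGroup E] [NormedSpace ℝ E]
    {F : ℝ → E} (hF : IntegrableOn F (Icc 0 S)) {ζ : ℝ → ℝ → E} {X L z : ℝ → E}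
    (hζ : ∀ r ∈ Icc 0 h, ∀ u ∈ Icc (0 : ℝ) 1,
      ζ r u = ζ r 0 + ∫ s in (lo φ S r)..(lo φ S r + u * (hi φ S r - lo φ S r)), F s)
    (hζL : ∀ r ∈ Ioc 0 h, ζ r 0 = L r)
    (hL : ∀ r ∈ Ioc 0 h, ∀ a, Tendsto X (𝓝[<] r) (𝓝 a) → L r = a)
    (hX : ∀ r ∈ Ioo 0 h, X r = ζ 0 1
      + (∫ s in (Icc 0 S \ uset φ S h) ∩ φ ⁻¹' (Ioc 0 r), F s)
      + ∑' r' : Ioc 0 r, (ζ r' 1 - L r'))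
    (hz0 : z 0 = ζ 0 0) (hzS : z S = ζ h 1)
    (hoff : ∀ s ∈ Ioo 0 S, s ∉ uset φ S h → z s = X (φ s))
    (hjump : ∀ r ∈ jset φ S h, ∀ s ∈ Ioo 0 S ∩ Icc (lo φ S r) (hi φ S r),
      z s = ζ r ((s - lo φ S r) / (hi φ S r - lo φ S r))) :
    (∀ s ∈ Icc 0 S, z s = z 0 + ∫ t in (0)..s, F t) ∧ (∀ r ∈ Ioo 0 h, X r = z (hi φ S r)) ∧
      z (hi φ S 0) = ζ 0 1 := by
  have h0 : (0 : ℝ) ∈ Icc 0 h := ⟨le_rfl, hc.h_pos.le⟩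
  have h1 : (1 : ℝ) ∈ Icc (0 : ℝ) 1 := ⟨zero_le_one, le_rfl⟩
  obtain ⟨hζZ, hXZ⟩ := hc.eq_primitive_of_jumps hF hζ hζL hL hX
  rw [← hz0] at hζZ hXZ
  -- The two endpoints are separate cases: there `z` is given by its own prescription, not by the
  -- formulas on and off the stops, which hold only for interior times.
  have hz : ∀ s ∈ Icc 0 S, z s = z 0 + ∫ t in (0)..s, F t := by
    intro s hs
    rcases hs.1.eq_or_lt with hs0 | hs0
    · rw [← hs0, intervalIntegral.integral_same, add_zero]
    rcases hs.2.eq_or_lt with hsS | hsS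
    · have := hζZ h ⟨hc.h_pos.le, le_rfl⟩ 1 h1
      rw [one_mul, add_sub_cancel, hc.hi_last] at this
      rw [hsS, hzS, this]
    by_cases hU : s ∈ uset φ S h
    · have hr := (hc.mem_uset_iff hs).1 hU
      have hm := (hc.mem_Icc_iff hr.1 hs).2 rfl
      have hd := sub_pos.2 hr.2
      rw [hjump _ hr s ⟨⟨hs0, hsS⟩, hm⟩, hζZ _ hr.1 _ ⟨div_nonneg (by linarith [hm.1]) hd.le,
        (div_le_one hd).2 (by linarith [hm.2])⟩, div_mul_cancel₀ _ hd.ne', add_sub_cancel]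
    · rw [hoff s ⟨hs0, hsS⟩ hU, hXZ _ (hc.notMem_uset_apply ⟨hs0, hsS⟩ hU),
        (hc.lo_hi_of_notMem hs hU).2]
  refine ⟨hz, fun r hr => ?_, ?_⟩
  · rw [hXZ r hr, hz _ (hc.hi_spec (Ioo_subset_Icc_self hr)).1]
  · have := hζZ 0 h0 1 h1
    rw [one_mul, add_sub_cancel] at this
    rw [this, hz _ (hc.hi_spec h0).1]

namespace DelaySystem

variable {n m N M : ℕ} {P : DelaySystem n m N M}

/-- The relations between `(x, v)`, `(ζ, θ)` and `(y, β)`, in terms of the clock. -/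
structure IsStateLink (P : DelaySystem n m N M) (p : ImpulseData n m) (e : ExtendedData n m)
    (ζ : ℝ → ℕ → ℝ → Fin n → ℝ) (θ : ℝ → ℕ → ℝ → ℝ) : Prop where
  init : ∀ l ∈ Finset.Icc 1 N, (e.y l 0 = if l = 1 then P.x₀ else ζ P.h (l - 1) 1) ∧
    (e.β l 0 = if l = 1 then 0 else θ P.h (l - 1) 1)
  last : ∀ l ∈ Finset.Icc 1 N, e.y l e.S = ζ P.h l 1 ∧ e.β l e.S = θ P.h l 1
  off : ∀ l ∈ Finset.Icc 1 N, ∀ s ∈ Ioo 0 e.S, s ∉ uset e.φ₀ e.S P.h →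
    e.y l s = p.x (((l : ℝ) - 1) * P.h + e.φ₀ s) ∧ e.β l s = p.v (((l : ℝ) - 1) * P.h + e.φ₀ s)
  jump : ∀ l ∈ Finset.Icc 1 N, ∀ r ∈ jset e.φ₀ e.S P.h,
    ∀ s ∈ Ioo 0 e.S ∩ Icc (lo e.φ₀ e.S r) (hi e.φ₀ e.S r),
    e.y l s = ζ r l ((s - lo e.φ₀ e.S r) / (hi e.φ₀ e.S r - lo e.φ₀ e.S r)) ∧
    e.β l s = θ r l ((s - lo e.φ₀ e.S r) / (hi e.φ₀ e.S r - lo e.φ₀ e.S r))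

/-- The integral equations of an impulse solution. -/
def IsJumpRepresentation (P : DelaySystem n m N M) (p : ImpulseData n m)
    (ζ : ℝ → ℕ → ℝ → Fin n → ℝ) (θ : ℝ → ℕ → ℝ → ℝ) : Prop :=
  ∀ l ∈ Finset.Icc 1 N, ∀ t ∈ Ioo (((l : ℝ) - 1) * P.h) (l * P.h),
      (Summable (fun r : Ioc 0 (t - ((l : ℝ) - 1) * P.h) =>
          ζ r l 1 - Function.leftLim p.x (r + ((l : ℝ) - 1) * P.h)) ∧
        p.x t = ζ 0 l 1 + (∫ t' in (((l : ℝ) - 1) * P.h)..t, P.f t' (P.delayed p.x t'))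
          + (∑ j, sInt (contVec p.μ j) (Icc (((l : ℝ) - 1) * P.h) t)
              (fun t' => P.g j t' (P.delayed p.x t')))
          + ∑' r : Ioc 0 (t - ((l : ℝ) - 1) * P.h),
              (ζ r l 1 - Function.leftLim p.x (r + ((l : ℝ) - 1) * P.h))) ∧
      (Summable (fun r : Ioc 0 (t - ((l : ℝ) - 1) * P.h) =>
          θ r l 1 - Function.leftLim p.v (r + ((l : ℝ) - 1) * P.h)) ∧
        p.v t = θ 0 l 1 + (contMeas p.ν).real (Icc (((l : ℝ) - 1) * P.h) t)
          + ∑' r : Ioc 0 (t - ((l : ℝ) - 1) * P.h),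
              (θ r l 1 - Function.leftLim p.v (r + ((l : ℝ) - 1) * P.h)))

namespace IsStateLink

variable {p : ImpulseData n m} {e : ExtendedData n m}
  {ζ : ℝ → ℕ → ℝ → Fin n → ℝ} {θ : ℝ → ℕ → ℝ → ℝ} (hS : P.IsStateLink p e ζ θ)
  (hL : P.Linked p e) (hp : P.IsImpulseControl p) (J : P.IsJumpSolution p ζ θ)
  (hτ : ∀ l ∈ Finset.Icc 1 N, ∀ s ∈ Icc 0 e.S, e.τ l s = ((l : ℝ) - 1) * P.h + e.φ₀ s)
  (hhist : ∀ t ∈ Ico (-(M * P.h)) 0, p.x t = P.ξ₀ t)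
  (hbv : BoundedVariationOn p.x (Icc 0 P.T))
  (hR : P.IsJumpRepresentation p ζ θ)
include hS hL

theorem ζ_eq {r : ℝ} (hr : r ∈ Icc 0 P.h) (hlt : lo e.φ₀ e.S r < hi e.φ₀ e.S r) {u : ℝ}
    (hu : u ∈ Ioo (0 : ℝ) 1) {l : ℕ} (hl : l ∈ Finset.Icc 1 N) :
    ζ r l u = e.y l (lo e.φ₀ e.S r + u * (hi e.φ₀ e.S r - lo e.φ₀ e.S r)) := by
  have hc := hL.canon.clock
  have hd := sub_pos.2 hlt
  have hm := hc.sub_lo_add_mem hr (Ioo_subset_Icc_self hu)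
  have h1 := (hc.lo_spec hr).1.1
  have h2 := (hc.hi_spec hr).1.2
  rw [(hS.jump l hl r ⟨hr, hlt⟩ _ ⟨⟨?_, ?_⟩, hm⟩).1, add_sub_cancel_left,
    mul_div_cancel_right₀ _ hd.ne']
  · nlinarith [hu.1]
  · nlinarith [hu.2]

include hp J hτ hhist hbv

/-- The differential equation for `y_l` is not yet available, so measurability of its velocity is
assembled: off the stops from a Borel function of the clock, and on each of the countably many
fibres from the rescaled velocity of the arc. -/
theorem integrable_velocity {l : ℕ} (hl : l ∈ Finset.Icc 1 N) :
    IntegrableOn (P.velocity e l) (Icc 0 e.S) := by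
  have hc := hL.canon.clock
  obtain ⟨C, hC⟩ := exists_velocity_bound hL.canon
  obtain ⟨X, hX, hxX⟩ := exists_measurable_history hhist hbv
  have hxy := fun l hl s hs hU => (hS.off l hl s hs hU).1.symm
  refine Integrable.of_bound ?_ C (hC l hl)
  have h1 := hL.aestronglyMeasurable_velocity_off hτ hhist hxy hX hxX hl
  have h2 : AEStronglyMeasurable (P.velocity e l) (volume.restrict (uset e.φ₀ e.S P.h)) := by
    unfold uset
    have := hc.countable_jset.to_subtype
    rw [biUnion_eq_iUnion]
    refine AEStronglyMeasurable.iUnion fun r => ?_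
    obtain ⟨r, hr⟩ := r
    have hd := sub_pos.2 hr.2
    have hJV := (J.eq_add_integral hp hr.1 hl).1
    rw [intervalIntegrable_iff_integrableOn_Icc_of_le zero_le_one] at hJV
    have hm := hJV.aestronglyMeasurable
    have hae := hL.ae_jumpVelocity hτ hr.1
      (fun hlt u hu l hl => hS.ζ_eq hL hr.1 hlt hu hl) hl
    have hsm : StronglyMeasurable fun s => (hi e.φ₀ e.S r - lo e.φ₀ e.S r)⁻¹ •
        hm.mk _ ((s - lo e.φ₀ e.S r) / (hi e.φ₀ e.S r - lo e.φ₀ e.S r)) := by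
      have hg : Measurable fun s => (s - lo e.φ₀ e.S r) / (hi e.φ₀ e.S r - lo e.φ₀ e.S r) :=
        (measurable_id.sub_const _).div_const _
      exact (hm.stronglyMeasurable_mk.comp_measurable hg).const_smul
        (hi e.φ₀ e.S r - lo e.φ₀ e.S r)⁻¹
    refine hsm.aestronglyMeasurable.congr ?_
    filter_upwards [ae_comp_sub_div hr.2 hae, ae_comp_sub_div hr.2 hm.ae_eq_mk] with s a1 a2
    rw [← a2, a1, smul_smul, inv_mul_cancel₀ hd.ne', one_smul, mul_div_cancel₀ _ hd.ne',
      sub_add_cancel]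
  rw [← Set.sdiff_union_of_subset hc.uset_subset]
  exact aestronglyMeasurable_union_iff.2 ⟨h1, h2⟩

omit hL hp hτ hhist hbv in
-- The arcs at `r = 0` start where those at `r = h` of the previous block end. For `l = 1` the
-- exceptional value `ζ^h_0(1) = x₀` supplies the initial state.
theorem init_eq {l : ℕ} (hl : l ∈ Finset.Icc 1 N) : e.y l 0 = ζ 0 l 0 ∧ e.β l 0 = θ 0 l 0 := by
  have h0 : (0 : ℝ) ∈ Icc 0 P.h := ⟨le_rfl, P.h_pos.le⟩
  have h1 := (Finset.mem_Icc.1 hl).1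
  rw [J.ζ_init 0 h0 l hl, J.θ_init 0 h0 l hl, if_pos rfl, if_pos rfl, (hS.init l hl).1,
    (hS.init l hl).2]
  refine ⟨?_, rfl⟩
  unfold zetaExt
  split_ifs with h2 h3 h4 h5
  · omega
  · rfl
  · exact absurd ⟨by omega, rfl, rfl⟩ h4
  · congr 1
    omega
  · omega
  · omega

include hR

theorem y_eq {l : ℕ} (hl : l ∈ Finset.Icc 1 N) :
    (∀ s ∈ Icc 0 e.S, e.y l s = e.y l 0 + ∫ t in (0)..s, P.velocity e l t) ∧
    (∀ r ∈ Ioo 0 P.h, p.x (r + ((l : ℝ) - 1) * P.h) = e.y l (hi e.φ₀ e.S r)) ∧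
    e.y l (hi e.φ₀ e.S 0) = ζ 0 l 1 := by
  have hc := hL.canon.clock
  obtain ⟨X, hX, hxX⟩ := exists_measurable_history hhist hbv
  have hxy := fun l hl s hs hU => (hS.off l hl s hs hU).1.symm
  refine hc.eq_primitive (hS.integrable_velocity hL hp J hτ hhist hbv hl)
    (ζ := fun r u => ζ r l u) (X := fun r => p.x (r + ((l : ℝ) - 1) * P.h))
    (L := fun r => Function.leftLim p.x (r + ((l : ℝ) - 1) * P.h))
    (fun r hr u hu => ?_) (fun r hr => ?_) (fun r hr a ha => leftLim_add_const ha)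
    (fun r hr => ?_) (hS.init_eq J hl).1 (hS.last l hl).1 (fun s hs hU => ?_)
    fun r hr s hs => (hS.jump l hl r hr s hs).1
  · rw [(J.eq_add_integral hp hr hl).2.2 u hu, hL.integral_jumpVelocity hτ hr
      (fun hlt u hu l hl => hS.ζ_eq hL hr hlt hu hl) hl hu]
  · rw [J.ζ_init r (Ioc_subset_Icc_self hr) l hl, if_neg hr.1.ne']
  · have h1 := (hR l hl (((l : ℝ) - 1) * P.h + r) ⟨by linarith [hr.1], by linarith [hr.2]⟩).1.2
    rw [add_sub_cancel_left] at h1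
    rw [← hL.integral_velocity_off hp hτ hhist hxy hX hxX hl ⟨hr.1.le, hr.2⟩,
      add_comm r, h1, ← add_assoc]
  · rw [(hS.off l hl s hs hU).1, add_comm]

omit hτ hhist hbv in
theorem β_eq {l : ℕ} (hl : l ∈ Finset.Icc 1 N) :
    (∀ s ∈ Icc 0 e.S, e.β l s = e.β l 0 + ∫ t in (0)..s, l1 (deriv (e.φ l) t)) ∧
    (∀ r ∈ Ioo 0 P.h, p.v (r + ((l : ℝ) - 1) * P.h) = e.β l (hi e.φ₀ e.S r)) ∧
    e.β l (hi e.φ₀ e.S 0) = θ 0 l 1 := by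
  have hc := hL.canon.clock
  refine hc.eq_primitive (integrable_l1 (hL.canon.integrable_φ hl))
    (ζ := fun r u => θ r l u) (X := fun r => p.v (r + ((l : ℝ) - 1) * P.h))
    (L := fun r => Function.leftLim p.v (r + ((l : ℝ) - 1) * P.h))
    (fun r hr u hu => ?_) (fun r hr => ?_) (fun r hr a ha => leftLim_add_const ha)
    (fun r hr => ?_) (hS.init_eq J hl).2 (hS.last l hl).2 (fun s hs hU => ?_)
    fun r hr s hs => (hS.jump l hl r hr s hs).2
  · have := hL.ω_eq_interval hr hl (F := l1)
      (hF := fun c hc w => by rw [l1_smul, abs_of_nonneg hc]; rfl) hu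
    rw [J.θ_eq r hr l hl u hu, this]
    congr 2
    ring
  · rw [J.θ_init r (Ioc_subset_Icc_self hr) l hl, if_neg hr.1.ne']
  · have h1 := (hR l hl (((l : ℝ) - 1) * P.h + r) ⟨by linarith [hr.1], by linarith [hr.2]⟩).2.2
    rw [add_sub_cancel_left, hL.contMeas_real_Icc hp hl ⟨hr.1.le, hr.2⟩] at h1
    rw [add_comm r, h1]
  · rw [(hS.off l hl s hs hU).2, add_comm]

end IsStateLink

end DelaySystem

/-! ### Construction (i) on processes. -/

namespace DelaySystem

variable {n m N M : ℕ} {P : DelaySystem n m N M}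

theorem IsCanonControl.l1_bound {e : ExtendedData n m} (hC : P.IsCanonControl e) {l : ℕ}
    (hl : l ∈ Finset.Icc 1 N) :
    ∀ᵐ s ∂(volume.restrict (Icc 0 e.S)), ‖l1 (deriv (e.φ l) s)‖ ≤ (1 : NNReal) := by
  filter_upwards [hC.canonical, hC.bounds] with s a1 a2
  rw [Real.norm_of_nonneg (l1_nonneg _)]
  have := Finset.single_le_sum (f := fun l => l1 (deriv (e.φ l) s))
    (fun _ _ => l1_nonneg _) hl
  rw [NNReal.coe_one]
  linarith [a2.1]

section SigmaT

variable {e : ExtendedData n m} (hC : P.IsCanonControl e)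
  (hτ : ∀ l ∈ Finset.Icc 1 N, ∀ s ∈ Icc 0 e.S, e.τ l s = ((l : ℝ) - 1) * P.h + e.φ₀ s)
  {E : Type*} [AddCommMonoid E] (z : ℕ → ℝ → E)
include hC

theorem concat_sigmaT_zero : concat N e.S z (P.sigmaT e 0) = z 1 0 := by
  have h1 : P.sigmaT e 0 = 0 := by unfold sigmaT rightInv; rw [if_pos rfl]
  have h2 := concat_apply z (Finset.mem_Icc.2 ⟨le_rfl, P.one_le_N⟩) (s := 0)
    (S := e.S) ⟨le_rfl, hC.S_pos⟩
  rw [h1, ← h2]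
  congr 1
  push_cast
  ring

include hτ

theorem sigmaT_eq {t : ℝ} (ht : t ∈ Ioc 0 P.T) :
    P.sigmaT e t = hi (concat N e.S e.τ) (N * e.S) t :=
  (concat_tau hC hτ).2.rightInv_eq ht

theorem concat_sigmaT_last : concat N e.S z (P.sigmaT e P.T) = z N e.S := by
  have hT := (concat_tau hC hτ).2
  have hN : (1 : ℝ) ≤ N := by exact_mod_cast P.one_le_N
  have hT0 : 0 < P.T := mul_pos (by linarith) P.h_pos
  rw [sigmaT_eq hC hτ ⟨hT0, le_rfl⟩, hT.hi_last, concat_last]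

/-- The time `0` is excluded: `σ̃(0) = 0` selects the state before a possible initial impulse,
whereas `hi` would select the state after it. -/
theorem concat_sigmaT_block {l : ℕ} (hl : l ∈ Finset.Icc 1 N) {r : ℝ} (hr : r ∈ Ico 0 P.h)
    (h0 : 0 < ((l : ℝ) - 1) * P.h + r) :
    concat N e.S z (P.sigmaT e (((l : ℝ) - 1) * P.h + r)) = z l (hi e.φ₀ e.S r) := by
  obtain ⟨hval, hT⟩ := concat_tau hC hτ
  rw [sigmaT_eq hC hτ ⟨h0, (block_mem P.h_pos.le hl (Ico_subset_Icc_self hr)).2⟩,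
    hC.clock.hi_concat hval hT hl hr, concat_apply z hl ⟨IsClock.hi_nonneg _ _ _,
      hC.clock.hi_lt hr⟩]

/-- To check an identity on `[0, T]`, check it at `0`, at `T` and on the blocks. -/
theorem eq_concat_sigmaT {x : ℝ → E} (h0 : x 0 = z 1 0) (hT : x P.T = z N e.S)
    (hend : ∀ l ∈ Finset.Icc 2 N, x (((l : ℝ) - 1) * P.h) = z l (hi e.φ₀ e.S 0))
    (hblock : ∀ l ∈ Finset.Icc 1 N, ∀ r ∈ Ioo 0 P.h,
      x (r + ((l : ℝ) - 1) * P.h) = z l (hi e.φ₀ e.S r)) {t : ℝ} (ht : t ∈ Icc 0 P.T) :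
    x t = concat N e.S z (P.sigmaT e t) := by
  have hh := P.h_pos
  rcases ht.2.eq_or_lt with h1 | h1
  · rw [h1, hT, concat_sigmaT_last hC hτ]
  obtain ⟨l, hl, r, hr, rfl⟩ := exists_block hh ⟨ht.1, h1⟩
  have hl1 := (Finset.mem_Icc.1 hl).1
  have hl1' : (1 : ℝ) ≤ l := by exact_mod_cast hl1
  rcases hr.1.eq_or_lt with h2 | h2
  · subst h2
    rcases hl1.eq_or_lt with h3 | h3
    · subst h3
      simp only [Nat.cast_one, sub_self, zero_mul, add_zero]
      rw [h0, concat_sigmaT_zero hC]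
    · have h3' : (2 : ℝ) ≤ l := by exact_mod_cast h3
      rw [concat_sigmaT_block hC hτ z hl hr (by nlinarith), add_zero,
        hend l (Finset.mem_Icc.2 ⟨h3, (Finset.mem_Icc.1 hl).2⟩)]
  · rw [concat_sigmaT_block hC hτ z hl hr (by nlinarith), add_comm, hblock l hl r ⟨h2, hr.2⟩]

end SigmaT

theorem Linked.isStateLink_iff {p : ImpulseData n m} {e : ExtendedData n m} (hL : P.Linked p e)
    (hτ : ∀ l ∈ Finset.Icc 1 N, ∀ s ∈ Icc 0 e.S, e.τ l s = ((l : ℝ) - 1) * P.h + e.φ₀ s)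
    {ζ : ℝ → ℕ → ℝ → Fin n → ℝ} {θ : ℝ → ℕ → ℝ → ℝ} :
    P.IsStateLink p e ζ θ ↔ ∀ l ∈ Finset.Icc 1 N,
      (e.y l 0 = if l = 1 then P.x₀ else ζ P.h (l - 1) 1) ∧
      (e.β l 0 = if l = 1 then 0 else θ P.h (l - 1) 1) ∧
      (e.y l e.S = ζ P.h l 1 ∧ e.β l e.S = θ P.h l 1) ∧
      (∀ s ∈ Ioo 0 e.S \ P.sigmaUnion p,
        e.y l s = p.x (e.τ l s) ∧ e.β l s = p.v (e.τ l s)) ∧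
      (∀ r ∈ P.jumpSet p, ∀ s ∈ Ioo 0 e.S ∩ P.sigmaSet p r,
        e.y l s = ζ r l (P.gam p r s) ∧ e.β l s = θ r l (P.gam p r s)) := by
  have hg : ∀ r ∈ jset e.φ₀ e.S P.h, ∀ s, P.gam p r s
      = (s - lo e.φ₀ e.S r) / (hi e.φ₀ e.S r - lo e.φ₀ e.S r) := fun r hr s => by
    rw [gam, hL.phiL_eq hr.1, hL.phiR_eq hr.1]
  rw [hL.jumpSet_eq, hL.sigmaUnion_eq]
  constructor
  · intro h l hl
    refine ⟨(h.init l hl).1, (h.init l hl).2, h.last l hl, fun s hs => ?_, fun r hr s hs => ?_⟩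
    · rw [hτ l hl s (Ioo_subset_Icc_self hs.1)]
      exact h.off l hl s hs.1 hs.2
    · rw [hL.sigmaSet_eq hr.1] at hs
      rw [hg r hr]
      exact h.jump l hl r hr s hs
  · intro h
    refine ⟨fun l hl => ⟨(h l hl).1, (h l hl).2.1⟩, fun l hl => (h l hl).2.2.1,
      fun l hl s hs hU => ?_, fun l hl r hr s hs => ?_⟩
    · rw [← hτ l hl s (Ioo_subset_Icc_self hs)]
      exact (h l hl).2.2.2.1 s ⟨hs, hU⟩
    · rw [← hg r hr]
      refine (h l hl).2.2.2.2 r hr s ?_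
      rwa [hL.sigmaSet_eq hr.1]

namespace AssociatedExtended

variable {p : ImpulseData n m} {e : ExtendedData n m}

theorem linked (hp : P.IsImpulseControl p) (h : P.AssociatedExtended p e) : P.Linked p e :=
  (h.isAssocControl hp).linked hp

/-- The functions `(ζ, θ)` in the definition of `(y, β)` are those of the impulse process. -/
theorem isStateLink (hp : P.IsImpulseControl p) (h : P.AssociatedExtended p e)
    {ζ : ℝ → ℕ → ℝ → Fin n → ℝ} {θ : ℝ → ℕ → ℝ → ℝ} (J : P.IsJumpSolution p ζ θ) :
    P.IsStateLink p e ζ θ := by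
  have hL := h.linked hp
  have hc := hL.canon.clock
  obtain ⟨ζ', θ', J', h'⟩ := h.yβ
  have hS := (hL.isStateLink_iff h.τ_eq).2 h'
  have h1 : (1 : ℝ) ∈ Icc (0 : ℝ) 1 := ⟨zero_le_one, le_rfl⟩
  have hh : P.h ∈ Icc 0 P.h := ⟨P.h_pos.le, le_rfl⟩
  refine ⟨fun l hl => ?_, fun l hl => ?_, hS.off, fun l hl r hr s hs => ?_⟩
  · rw [(hS.init l hl).1, (hS.init l hl).2]
    split_ifs with hl1
    · exact ⟨rfl, rfl⟩
    · have := Finset.mem_Icc.1 hl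
      exact J'.unique hp J hh (Finset.mem_Icc.2 ⟨by omega, by omega⟩) h1
  · rw [(hS.last l hl).1, (hS.last l hl).2]
    exact J'.unique hp J hh hl h1
  · have hd := sub_pos.2 hr.2
    rw [(hS.jump l hl r hr s hs).1, (hS.jump l hl r hr s hs).2]
    exact J'.unique hp J hr.1 hl ⟨div_nonneg (by linarith [hs.2.1]) hd.le,
      (div_le_one hd).2 (by linarith [hs.2.2])⟩

theorem solvesOn_tau {e : ExtendedData n m} (hC : P.IsCanonControl e)
    (hτ : ∀ l ∈ Finset.Icc 1 N, ∀ s ∈ Icc 0 e.S, e.τ l s = ((l : ℝ) - 1) * P.h + e.φ₀ s) {l : ℕ}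
    (hl : l ∈ Finset.Icc 1 N) : SolvesOn (e.τ l) (deriv e.φ₀) 0 e.S := by
  have hS := hC.S_pos.le
  refine (solvesOn_of_eq_integral hS ?_ hC.φ₀_bound fun s hs => ?_).1
  · rw [intervalIntegrable_iff_integrableOn_Icc_of_le hS]; exact hC.integrable_φ₀
  · rw [hτ l hl s hs, hτ l hl 0 ⟨le_rfl, hS⟩, hC.φ₀_zero, add_zero, hC.φ₀_eq_integral hs]

/-- Construction (i) sends impulse processes to canonical extended processes. -/
theorem isCanonicalProc (hp : P.IsImpulseProc p) (h : P.AssociatedExtended p e) :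
    P.IsCanonicalProc e := by
  have hL := h.linked hp.1
  have hC := hL.canon
  have hS0 := hC.S_pos.le
  have h00 : (0 : ℝ) ∈ Icc 0 e.S := ⟨le_rfl, hS0⟩
  have h0S : e.S ∈ Icc 0 e.S := ⟨hS0, le_rfl⟩
  obtain ⟨ζ, θ, J, -, -, hR⟩ := hp.2.jump
  have hS := h.isStateLink hp.1 J
  obtain ⟨C, hCv⟩ := exists_velocity_bound hC
  have hone : (1 : ℕ) ∈ Finset.Icc 1 N := Finset.mem_Icc.2 ⟨le_rfl, P.one_le_N⟩
  refine ⟨hC.toIsExtendedControl, ⟨fun l hl => solvesOn_tau hC h.τ_eq hl, fun l hl => ?_,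
    fun l hl => ?_, ⟨?_, ?_, ?_⟩, fun l hl => ?_⟩, hC.canonical⟩
  · refine (solvesOn_of_eq_integral hS0 (F := P.velocity e l) ?_ (hCv l hl)
      (hS.y_eq hL hp.1 J h.τ_eq hp.2.x_hist hp.2.x_bv hR hl).1).1
    rw [intervalIntegrable_iff_integrableOn_Icc_of_le hS0]
    exact hS.integrable_velocity hL hp.1 J h.τ_eq hp.2.x_hist hp.2.x_bv hl
  · refine (solvesOn_of_eq_integral (C := 1) hS0 ?_ ?_ (hS.β_eq hL hp.1 J hR hl).1).1
    · rw [intervalIntegrable_iff_integrableOn_Icc_of_le hS0]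
      exact integrable_l1 (hC.integrable_φ hl)
    · exact hC.l1_bound hl
  · rw [h.τ_eq 1 hone 0 h00, hC.φ₀_zero]; simp
  · rw [(hS.init 1 hone).1, if_pos rfl]
  · rw [(hS.init 1 hone).2, if_pos rfl]
  · obtain ⟨h1, h2⟩ := Finset.mem_Icc.1 hl
    have hl' : l ∈ Finset.Icc 1 N := Finset.mem_Icc.2 ⟨by omega, h2⟩
    have hl'' : l - 1 ∈ Finset.Icc 1 N := Finset.mem_Icc.2 ⟨by omega, by omega⟩
    have hne : l ≠ 1 := by omega
    refine ⟨?_, ?_, ?_⟩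
    · rw [h.τ_eq l hl' 0 h00, h.τ_eq _ hl'' e.S h0S, hC.φ₀_zero, hC.φ₀_S,
        Nat.cast_sub (by omega : 1 ≤ l)]
      push_cast
      ring
    · rw [(hS.init l hl').1, if_neg hne, (hS.last _ hl'').1]
    · rw [(hS.init l hl').2, if_neg hne, (hS.last _ hl'').2]

/-- Construction (ii) inverts construction (i). -/
theorem associatedImpulse (hp : P.IsImpulseProc p) (h : P.AssociatedExtended p e) :
    P.AssociatedImpulse e p := by
  have hL := h.linked hp.1
  have hC := hL.canon
  have := hp.1.ν_finite
  obtain ⟨ζ, θ, J, hend, hT, hR⟩ := hp.2.jump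
  have hS := h.isStateLink hp.1 J
  have hone : (1 : ℕ) ∈ Finset.Icc 1 N := Finset.mem_Icc.2 ⟨le_rfl, P.one_le_N⟩
  have hN : N ∈ Finset.Icc 1 N := Finset.mem_Icc.2 ⟨P.one_le_N, le_rfl⟩
  have hy := fun l hl => hS.y_eq hL hp.1 J h.τ_eq hp.2.x_hist hp.2.x_bv hR (l := l) hl
  have hβ := fun l hl => hS.β_eq hL hp.1 J hR (l := l) hl
  have h2 : ∀ l ∈ Finset.Icc 2 N, l ∈ Finset.Icc 1 N := fun l hl => by
    rw [Finset.mem_Icc] at hl ⊢; omega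
  refine ⟨hp.1.μ_supp, fun t ht j => ?_, hp.1.ν_supp, fun t ht => ?_, fun r hr l hl => ?_,
    hp.2.x_hist, fun t ht => ?_, fun t ht => ?_⟩
  · rw [integral_limR_eq hC h.τ_eq ht j rfl, hL.μ_eq j _ measurableSet_Icc]
  · rw [lintegral_limR_eq hC h.τ_eq ht rfl, hL.ν_eq _ measurableSet_Icc]
  · rw [sigma_limR hC hr, sigma_limL hC hr]
    exact hL.ω_eq r hr l hl
  · refine eq_concat_sigmaT hC h.τ_eq e.y ?_ ?_ (fun l hl => ?_)
      (fun l hl => (hy l hl).2.1) ht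
    · rw [hp.2.x_zero, (hS.init 1 hone).1, if_pos rfl]
    · rw [hT.1, (hS.last N hN).1]
    · rw [(hend l hl).1, (hy l (h2 l hl)).2.2]
  · refine eq_concat_sigmaT hC h.τ_eq e.β ?_ ?_ (fun l hl => ?_)
      (fun l hl => (hβ l hl).2.1) ht
    · rw [hp.2.v_zero, (hS.init 1 hone).2, if_pos rfl]
    · rw [hT.2, (hS.last N hN).2]
    · rw [(hend l hl).2, (hβ l (h2 l hl)).2.2]

end AssociatedExtended

end DelaySystem

/-! ### Construction (ii) on processes. -/

theorem intervalIntegrable_comp_mul_add {E : Type*} [NormedAddCommGroup E] {F : ℝ → E} {a b : ℝ}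
    (hab : a < b) (hF : IntervalIntegrable F volume a b) :
    IntervalIntegrable (fun u => F ((b - a) * u + a)) volume 0 1 := by
  have hd := (sub_pos.2 hab).ne'
  have h1 := (hF.comp_add_right a).comp_mul_left (c := b - a)
  rwa [sub_self, zero_div, div_self hd] at h1

namespace DelaySystem

variable {n m N M : ℕ} {P : DelaySystem n m N M}

/-- The arcs `ζ^r_l` (or `θ^r_l`) read off the extended trajectory. -/
def arcs {E : Type*} (e : ExtendedData n m) (z : ℕ → ℝ → E) (r : ℝ) (l : ℕ) (u : ℝ) : E :=
  z l (lo e.φ₀ e.S r + u * (hi e.φ₀ e.S r - lo e.φ₀ e.S r))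

theorem arcs_zero {E : Type*} (e : ExtendedData n m) (z : ℕ → ℝ → E) (r : ℝ) (l : ℕ) :
    arcs e z r l 0 = z l (lo e.φ₀ e.S r) := by
  unfold arcs; rw [zero_mul, add_zero]

theorem arcs_one {E : Type*} (e : ExtendedData n m) (z : ℕ → ℝ → E) (r : ℝ) (l : ℕ) :
    arcs e z r l 1 = z l (hi e.φ₀ e.S r) := by
  unfold arcs; rw [one_mul, add_sub_cancel]

namespace AssociatedImpulse

variable {e : ExtendedData n m} {p : ImpulseData n m} (he : P.IsCanonicalProc e)
  (h : P.AssociatedImpulse e p)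
include he

theorem integrable_velocity {l : ℕ} (hl : l ∈ Finset.Icc 1 N) :
    IntegrableOn (P.velocity e l) (Icc 0 e.S) ∧
    ∀ s ∈ Icc 0 e.S, e.y l s = e.y l 0 + ∫ t in (0)..s, P.velocity e l t := by
  have hS0 := he.control.S_pos.le
  obtain ⟨C, hC⟩ := exists_velocity_bound he.canon
  have h1 : SolvesOn (e.y l) (P.velocity e l) 0 e.S := he.solution.y_eq l hl
  have h2 := h1.intervalIntegrable hS0 (hC l hl)
  rw [intervalIntegrable_iff_integrableOn_Icc_of_le hS0] at h2
  exact ⟨h2, h1.eq_add_integral hS0 (hC l hl)⟩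

theorem β_eq_integral {l : ℕ} (hl : l ∈ Finset.Icc 1 N) :
    ∀ s ∈ Icc 0 e.S, e.β l s = e.β l 0 + ∫ t in (0)..s, l1 (deriv (e.φ l) t) :=
  (he.solution.β_eq l hl).eq_add_integral he.control.S_pos.le (he.canon.l1_bound hl)

include h

theorem link {l : ℕ} (hl : l ∈ Finset.Icc 1 N) {r : ℝ} (hr : r ∈ Ico 0 P.h)
    (h0 : 0 < ((l : ℝ) - 1) * P.h + r) :
    p.x (((l : ℝ) - 1) * P.h + r) = e.y l (hi e.φ₀ e.S r) ∧
    p.v (((l : ℝ) - 1) * P.h + r) = e.β l (hi e.φ₀ e.S r) := by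
  have hm := block_mem P.h_pos.le hl (Ico_subset_Icc_self hr)
  rw [h.x_eq _ hm, h.v_eq _ hm, concat_sigmaT_block he.canon he.tau_eq _ hl hr h0,
    concat_sigmaT_block he.canon he.tau_eq _ hl hr h0]
  exact ⟨rfl, rfl⟩

theorem link_Ioo {l : ℕ} (hl : l ∈ Finset.Icc 1 N) {r : ℝ} (hr : r ∈ Ioo 0 P.h) :
    p.x (r + ((l : ℝ) - 1) * P.h) = e.y l (hi e.φ₀ e.S r) ∧
    p.v (r + ((l : ℝ) - 1) * P.h) = e.β l (hi e.φ₀ e.S r) := by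
  have hl1 : (1 : ℝ) ≤ l := by exact_mod_cast (Finset.mem_Icc.1 hl).1
  rw [add_comm r]
  exact link he h hl ⟨hr.1.le, hr.2⟩ (by nlinarith [hr.1, P.h_pos])

theorem isStateLink : P.IsStateLink p e (arcs e e.y) (arcs e e.β) := by
  have hc := he.canon.clock
  refine ⟨fun l hl => ?_, fun l hl => ?_, fun l hl s hs hU => ?_, fun l hl r hr s hs => ?_⟩
  · rw [arcs_one, arcs_one, hc.hi_last]
    split_ifs with h1
    · subst h1
      exact ⟨he.solution.init_one.2.1, he.solution.init_one.2.2⟩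
    · have h2 := Finset.mem_Icc.1 hl
      exact (he.solution.init_succ l (Finset.mem_Icc.2 ⟨by omega, h2.2⟩)).2
  · rw [arcs_one, arcs_one, hc.hi_last]
    exact ⟨rfl, rfl⟩
  · have h1 := hc.notMem_uset_apply hs hU
    rw [add_comm, (link_Ioo he h hl h1).1, (link_Ioo he h hl h1).2,
      (hc.lo_hi_of_notMem (Ioo_subset_Icc_self hs) hU).2]
    exact ⟨rfl, rfl⟩
  · unfold arcs
    rw [div_mul_cancel₀ _ (sub_pos.2 hr.2).ne', add_sub_cancel]
    exact ⟨rfl, rfl⟩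

theorem folded {l : ℕ} (hl : l ∈ Finset.Icc 1 N) :
    (∀ r ∈ Ioc 0 P.h, Function.leftLim p.x (r + ((l : ℝ) - 1) * P.h)
      = e.y l (lo e.φ₀ e.S r)) ∧
    ∀ r ∈ Ioo 0 P.h, Summable (fun r' : Ioc 0 r => e.y l (hi e.φ₀ e.S r')
        - Function.leftLim p.x (r' + ((l : ℝ) - 1) * P.h)) ∧
      p.x (r + ((l : ℝ) - 1) * P.h) = e.y l (hi e.φ₀ e.S 0)
        + (∫ s in (Icc 0 e.S \ uset e.φ₀ e.S P.h) ∩ e.φ₀ ⁻¹' (Ioc 0 r), P.velocity e l s)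
        + ∑' r' : Ioc 0 r, (e.y l (hi e.φ₀ e.S r')
          - Function.leftLim p.x (r' + ((l : ℝ) - 1) * P.h)) := by
  obtain ⟨h1, h2⟩ := integrable_velocity he hl
  exact he.canon.clock.jumps_of_eq_primitive h1 (X := fun r => p.x (r + ((l : ℝ) - 1) * P.h))
    (L := fun r => Function.leftLim p.x (r + ((l : ℝ) - 1) * P.h)) h2
    (fun r hr a ha => leftLim_add_const ha) fun r hr => (link_Ioo he h hl hr).1

theorem folded_β {l : ℕ} (hl : l ∈ Finset.Icc 1 N) :
    (∀ r ∈ Ioc 0 P.h, Function.leftLim p.v (r + ((l : ℝ) - 1) * P.h)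
      = e.β l (lo e.φ₀ e.S r)) ∧
    ∀ r ∈ Ioo 0 P.h, Summable (fun r' : Ioc 0 r => e.β l (hi e.φ₀ e.S r')
        - Function.leftLim p.v (r' + ((l : ℝ) - 1) * P.h)) ∧
      p.v (r + ((l : ℝ) - 1) * P.h) = e.β l (hi e.φ₀ e.S 0)
        + (∫ s in (Icc 0 e.S \ uset e.φ₀ e.S P.h) ∩ e.φ₀ ⁻¹' (Ioc 0 r), l1 (deriv (e.φ l) s))
        + ∑' r' : Ioc 0 r, (e.β l (hi e.φ₀ e.S r')
          - Function.leftLim p.v (r' + ((l : ℝ) - 1) * P.h)) := by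
  exact he.canon.clock.jumps_of_eq_primitive (integrable_l1 (he.canon.integrable_φ hl))
    (X := fun r => p.v (r + ((l : ℝ) - 1) * P.h))
    (L := fun r => Function.leftLim p.v (r + ((l : ℝ) - 1) * P.h)) (β_eq_integral he hl)
    (fun r hr a ha => leftLim_add_const ha) fun r hr => (link_Ioo he h hl hr).2

/-- The arcs are restrictions of `(y, β)` to the fibres, so their equations are those of `(y, β)`
rescaled. For `r > 0` the initial values are left limits because `x` and `v` are continuous
functions of `hi`; for `r = 0` they express the matching of consecutive blocks. -/
theorem isJumpSolution : P.IsJumpSolution p (arcs e e.y) (arcs e e.β) := by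
  have hL := linked_of_associatedImpulse he h
  have hc := he.canon.clock
  have hS := isStateLink he h
  have h0S : (0 : ℝ) ∈ Icc 0 e.S := ⟨le_rfl, he.control.S_pos.le⟩
  refine ⟨fun r hr l hl => ?_, fun r hr l hl => ?_, fun r hr l hl u hu => ?_,
    fun r hr l hl => ?_⟩
  · obtain ⟨h1, h2⟩ := integrable_velocity he hl
    have hae := hL.ae_jumpVelocity he.tau_eq hr
      (fun hlt u hu l hl => hS.ζ_eq hL hr hlt hu hl) hl
    obtain ⟨C, hC⟩ := exists_jumpVelocity_bound (P := P) (hL.sum_l1_ω hr) hl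
    have hlo := (hc.lo_spec hr).1
    refine (solvesOn_of_eq_integral (F := P.jumpVelocity p (arcs e e.y) r l) zero_le_one ?_
      (hC _) fun u hu => ?_).1
    · have hi1 : IntervalIntegrable (fun u => (hi e.φ₀ e.S r - lo e.φ₀ e.S r) •
          P.velocity e l ((hi e.φ₀ e.S r - lo e.φ₀ e.S r) * u + lo e.φ₀ e.S r)) volume 0 1 := by
        rcases (hc.lo_le_hi hr).eq_or_lt with heq | hlt
        · rw [heq]; simp
        · exact (intervalIntegrable_comp_mul_add hlt
            (IsClock.intervalIntegrable h1 hlo (hc.hi_spec hr).1)).smul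
            (hi e.φ₀ e.S r - lo e.φ₀ e.S r)
      rw [intervalIntegrable_iff_integrableOn_Icc_of_le zero_le_one] at hi1 ⊢
      exact hi1.congr (hae.mono fun u hu => hu.symm)
    · have hm := hc.Icc_subset hr (hc.sub_lo_add_mem hr hu)
      rw [hL.integral_jumpVelocity he.tau_eq hr
        (fun hlt u hu l hl => hS.ζ_eq hL hr hlt hu hl) hl hu, arcs_zero]
      unfold arcs
      rw [h2 _ hm, h2 _ hlo, add_assoc, intervalIntegral.integral_add_adjacent_intervals
        (IsClock.intervalIntegrable h1 h0S hlo) (IsClock.intervalIntegrable h1 hlo hm)]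
  · rw [arcs_zero]
    split_ifs with hr0
    · rw [hr0, hc.lo_zero, (hS.init l hl).1]
      have h1 := (Finset.mem_Icc.1 hl).1
      unfold zetaExt
      split_ifs with h2 h3 h4 h5
      · omega
      · rfl
      · exact absurd ⟨by omega, rfl, rfl⟩ h4
      · congr 1
        omega
      · omega
      · omega
    · exact ((folded he h hl).1 r ⟨lt_of_le_of_ne hr.1 (Ne.symm hr0), hr.2⟩).symm
  · have hlo := (hc.lo_spec hr).1
    have hm := hc.Icc_subset hr (hc.sub_lo_add_mem hr hu)
    have hint := integrable_l1 (he.canon.integrable_φ hl)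
    have hβ := β_eq_integral he hl
    rw [hL.ω_eq_interval hr hl (F := l1)
      (hF := fun c hc w => by rw [l1_smul, abs_of_nonneg hc]; rfl) hu, arcs_zero]
    unfold arcs
    rw [hβ _ hm, hβ _ hlo, add_assoc, mul_comm (hi e.φ₀ e.S r - lo e.φ₀ e.S r), add_comm (u * _),
      intervalIntegral.integral_add_adjacent_intervals
        (IsClock.intervalIntegrable hint h0S hlo) (IsClock.intervalIntegrable hint hlo hm)]
  · rw [arcs_zero]
    split_ifs with hr0 hl1
    · rw [hr0, hc.lo_zero, (hS.init l hl).2, if_pos hl1]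
    · rw [hr0, hc.lo_zero, (hS.init l hl).2, if_neg hl1]
    · exact ((folded_β he h hl).1 r ⟨lt_of_le_of_ne hr.1 (Ne.symm hr0), hr.2⟩).symm

omit h in
-- The function is a Lipschitz concatenation composed with the monotone `σ̃`; monotonicity persists
-- at `t = 0`, where the conventional value is the smallest one.
theorem boundedVariationOn {E : Type*} [NormedAddCommGroup E] {z : ℕ → ℝ → E} {x : ℝ → E}
    {C : NNReal} (hz : ∀ l ∈ Finset.Icc 2 N, z l 0 = z (l - 1) e.S)
    (hLip : ∀ l ∈ Finset.Icc 1 N, LipschitzOnWith C (z l) (Icc 0 e.S))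
    (hx : ∀ t ∈ Icc 0 P.T, x t = concat N e.S z (P.sigmaT e t)) :
    BoundedVariationOn x (Icc 0 P.T) := by
  have hT := (concat_tau he.canon he.tau_eq).2
  have hmem : MapsTo (P.sigmaT e) (Icc 0 P.T) (Icc 0 (N * e.S)) ∧
      MonotoneOn (P.sigmaT e) (Icc 0 P.T) := by
    have h0 : P.sigmaT e 0 = 0 := by unfold sigmaT rightInv; rw [if_pos rfl]
    have hpos := fun t ht => sigmaT_eq he.canon he.tau_eq (t := t) ht
    refine ⟨fun t ht => ?_, fun t ht t' ht' htt => ?_⟩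
    · rcases ht.1.eq_or_lt with h1 | h1
      · rw [← h1, h0]; exact ⟨le_rfl, hT.S_pos.le⟩
      · rw [hpos t ⟨h1, ht.2⟩]; exact (hT.hi_spec ht).1
    · rcases ht.1.eq_or_lt with h1 | h1
      · rw [← h1, h0]
        rcases ht'.1.eq_or_lt with h2 | h2
        · rw [← h2, h0]
        · rw [hpos t' ⟨h2, ht'.2⟩]; exact IsClock.hi_nonneg _ _ _
      · rw [hpos t ⟨h1, ht.2⟩, hpos t' ⟨h1.trans_le htt, ht'.2⟩]
        exact IsClock.monotone_hi _ _ htt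
  have h1 : BoundedVariationOn (P.sigmaT e) (Icc 0 P.T) := by
    have := hmem.2.locallyBoundedVariationOn 0 P.T ⟨le_rfl, P.T_nonneg⟩ ⟨P.T_nonneg, le_rfl⟩
    rwa [inter_self] at this
  have h2 := (lipschitzOnWith_concat he.control.S_pos hz hLip).comp_boundedVariationOn
    hmem.1 h1
  have h3 : eVariationOn x (Icc 0 P.T)
      = eVariationOn (concat N e.S z ∘ P.sigmaT e) (Icc 0 P.T) := eVariationOn.eq_of_eqOn hx
  unfold BoundedVariationOn at h2 ⊢
  rwa [h3]

theorem x_bv : BoundedVariationOn p.x (Icc 0 P.T) := by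
  obtain ⟨C, hC⟩ := exists_velocity_bound he.canon
  refine boundedVariationOn he (C := C) (fun l hl => (he.solution.init_succ l hl).2.1)
    (fun l hl => ?_) h.x_eq
  obtain ⟨h1, h2⟩ := integrable_velocity he hl
  refine (solvesOn_of_eq_integral he.control.S_pos.le ?_ (hC l hl) h2).2
  rwa [intervalIntegrable_iff_integrableOn_Icc_of_le he.control.S_pos.le]

theorem v_bv : BoundedVariationOn p.v (Icc 0 P.T) := by
  refine boundedVariationOn he (C := 1) (fun l hl => (he.solution.init_succ l hl).2.2)
    (fun l hl => ?_) h.v_eq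
  refine (solvesOn_of_eq_integral he.control.S_pos.le ?_ (he.canon.l1_bound hl)
    (β_eq_integral he hl)).2
  rw [intervalIntegrable_iff_integrableOn_Icc_of_le he.control.S_pos.le]
  exact integrable_l1 (he.canon.integrable_φ hl)

theorem isJumpRepresentation : P.IsJumpRepresentation p (arcs e e.y) (arcs e e.β) := by
  have hL := linked_of_associatedImpulse he h
  have hp := hL.isImpulseControl h.μ_supp
  obtain ⟨X, hX, hxX⟩ := exists_measurable_history h.x_hist (x_bv he h)
  have hS := isStateLink he h
  have hxy := fun l hl s hs hU => (hS.off l hl s hs hU).1.symm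
  intro l hl t ht
  obtain ⟨r, rfl⟩ : ∃ r, t = ((l : ℝ) - 1) * P.h + r := ⟨t - ((l : ℝ) - 1) * P.h, by ring⟩
  have hr : r ∈ Ioo 0 P.h := ⟨by linarith [ht.1], by linarith [ht.2]⟩
  have h1 := (folded he h hl).2 r hr
  have h2 := (folded_β he h hl).2 r hr
  rw [add_sub_cancel_left]
  simp only [arcs_one]
  refine ⟨⟨h1.1, ?_⟩, h2.1, ?_⟩
  · rw [add_assoc (e.y l _), hL.integral_velocity_off hp he.tau_eq h.x_hist hxy hX hxX hl
      ⟨hr.1.le, hr.2⟩, add_comm _ r, h1.2]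
  · rw [hL.contMeas_real_Icc hp hl ⟨hr.1.le, hr.2⟩, add_comm _ r, h2.2]

/-- Construction (ii) sends canonical extended processes to impulse processes. -/
theorem isImpulseProc : P.IsImpulseProc p := by
  have hL := linked_of_associatedImpulse he h
  have hc := he.canon.clock
  have h0T : (0 : ℝ) ∈ Icc 0 P.T := ⟨le_rfl, P.T_nonneg⟩
  have hTT : P.T ∈ Icc 0 P.T := ⟨P.T_nonneg, le_rfl⟩
  refine ⟨hL.isImpulseControl h.μ_supp, h.x_hist, ?_, ?_, x_bv he h, v_bv he h, arcs e e.y,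
    arcs e e.β, isJumpSolution he h, fun l hl => ?_, ?_, isJumpRepresentation he h⟩
  · rw [h.x_eq 0 h0T, concat_sigmaT_zero he.canon, he.solution.init_one.2.1]
  · rw [h.v_eq 0 h0T, concat_sigmaT_zero he.canon, he.solution.init_one.2.2]
  · rw [arcs_one, arcs_one]
    have h2 := Finset.mem_Icc.1 hl
    have h3 : (2 : ℝ) ≤ l := by exact_mod_cast h2.1
    have := link he h (l := l) (Finset.mem_Icc.2 ⟨by omega, h2.2⟩) (r := 0) ⟨le_rfl, P.h_pos⟩
      (by nlinarith [P.h_pos])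
    rwa [add_zero] at this
  · rw [arcs_one, arcs_one, hc.hi_last, h.x_eq _ hTT, h.v_eq _ hTT,
      concat_sigmaT_last he.canon he.tau_eq, concat_sigmaT_last he.canon he.tau_eq]
    exact ⟨rfl, rfl⟩

/-- Construction (i) inverts construction (ii). -/
theorem associatedExtended : P.AssociatedExtended p e := by
  have hL := linked_of_associatedImpulse he h
  exact
    { S_eq := hL.S_eq
      φ₀_eq := fun s hs => hL.φ₀_eq hs
      φ_ac := fun l hl => (he.canon.solves_φ hl).1
      φ_init := he.control.φ_init
      φ_cont := fun l hl => hL.φ_cont hl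
      φ_jump := fun l hl => hL.φ_jump hl
      τ_eq := he.tau_eq
      yβ := ⟨arcs e e.y, arcs e e.β, isJumpSolution he h,
        (hL.isStateLink_iff he.tau_eq).1 (isStateLink he h)⟩ }

end AssociatedImpulse

end DelaySystem

namespace DelaySystem

variable {n m N M : ℕ} {P : DelaySystem n m N M}

/-! ### The canonical extended process constructed from an impulse process -/

/-- The control `φ̇_l` constructed from an impulse control, in terms of the clock. -/
def controlDensity (P : DelaySystem n m N M) (p : ImpulseData n m) (φ : ℝ → ℝ) (S : ℝ) (l : ℕ)
    (s : ℝ) : Fin m → ℝ := by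
  classical
  exact if s ∈ uset φ S P.h then (1 / (hi φ S (φ s) - lo φ S (φ s))) •
      p.ω (φ s) l ((s - lo φ S (φ s)) / (hi φ S (φ s) - lo φ S (φ s)))
    else P.mL p l (φ s)

section Density

variable {p : ImpulseData n m} (hp : P.IsImpulseControl p) {φ : ℝ → ℝ} {S : ℝ}
  (hc : IsClock φ S P.h) (hphi : ∀ r ∈ Ioc 0 P.h, P.phi p r = hi φ S r)
include hc

theorem controlDensity_jump (p : ImpulseData n m) (l : ℕ) {r : ℝ} (hr : r ∈ jset φ S P.h) {s : ℝ}
    (hs : s ∈ Icc (lo φ S r) (hi φ S r)) : P.controlDensity p φ S l s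
      = (1 / (hi φ S r - lo φ S r)) • p.ω r l ((s - lo φ S r) / (hi φ S r - lo φ S r)) := by
  have h1 : s ∈ uset φ S P.h := mem_biUnion hr hs
  rw [controlDensity, if_pos h1, hc.apply_eq hr.1 hs]

omit hc in
theorem controlDensity_off (p : ImpulseData n m) (l : ℕ) {s : ℝ} (hs : s ∉ uset φ S P.h) :
    P.controlDensity p φ S l s = P.mL p l (φ s) := by
  rw [controlDensity, if_neg hs]

include hp hphi

/-- The bound one comes from `ρ + ∑‖m_l‖ = 1` off the stops, and from `∑‖ω^r_l‖ = hi r - lo r` on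
them. Measurability is checked on each of the countably many fibres, since nothing is assumed on the
dependence of `ω^r` on `r`. -/
theorem controlDensity_integrable {l : ℕ} (hl : l ∈ Finset.Icc 1 N) :
    IntegrableOn (P.controlDensity p φ S l) (Icc 0 S) ∧
    ∀ᵐ s ∂(volume.restrict (Icc 0 S)), ‖P.controlDensity p φ S l s‖ ≤ (1 : NNReal) := by
  have hsub : Icc 0 S \ uset φ S P.h ⊆ Icc 0 S := Set.sdiff_subset
  have hm1 : AEStronglyMeasurable (P.controlDensity p φ S l)
      (volume.restrict (Icc 0 S \ uset φ S P.h)) := by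
    have hmL : Measurable (P.mL p l) :=
      measurable_pi_lambda _ fun j => SignedMeasure.measurable_rnDeriv _ _
    refine (hmL.comp_aemeasurable (hc.aemeasurable.mono_set hsub)).aestronglyMeasurable.congr ?_
    filter_upwards [ae_restrict_mem hc.measurableSet_compl_uset] with s hs
    exact (controlDensity_off p l hs.2).symm
  have hm2 : AEStronglyMeasurable (P.controlDensity p φ S l)
      (volume.restrict (uset φ S P.h)) := by
    unfold uset
    have := hc.countable_jset.to_subtype
    rw [biUnion_eq_iUnion]
    refine AEStronglyMeasurable.iUnion fun r => ?_
    obtain ⟨r, hr⟩ := r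
    have hm := (hp.ω_bdd r hr.1 l hl).aestronglyMeasurable
    have hsm : StronglyMeasurable fun s => (1 / (hi φ S r - lo φ S r)) •
        hm.mk _ ((s - lo φ S r) / (hi φ S r - lo φ S r)) := by
      have hg : Measurable fun s => (s - lo φ S r) / (hi φ S r - lo φ S r) :=
        (measurable_id.sub_const _).div_const _
      exact (hm.stronglyMeasurable_mk.comp_measurable hg).const_smul
        (1 / (hi φ S r - lo φ S r))
    refine hsm.aestronglyMeasurable.congr ?_
    filter_upwards [ae_comp_sub_div hr.2 hm.ae_eq_mk, ae_restrict_mem measurableSet_Icc]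
      with s a1 a2
    rw [← a1, controlDensity_jump hc p l hr a2]
  have hb1 : ∀ᵐ s ∂(volume.restrict (Icc 0 S \ uset φ S P.h)),
      ‖P.controlDensity p φ S l s‖ ≤ (1 : NNReal) := by
    filter_upwards [ae_restrict_mem hc.measurableSet_compl_uset,
      ae_restrict_of_ae_restrict_of_subset hsub (ae_rho_comp hp hc hphi)] with s a1 a2
    rw [controlDensity_off p l a1.2, NNReal.coe_one]
    have h1 := Finset.single_le_sum (f := fun l => l1 (P.mL p l (φ s)))
      (fun _ _ => l1_nonneg _) hl
    have h2 : 0 ≤ P.rho p (φ s) := ENNReal.toReal_nonneg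
    exact (norm_le_l1 _).trans (by linarith [a2.2 a1.2])
  have hb2 : ∀ᵐ s ∂(volume.restrict (uset φ S P.h)),
      ‖P.controlDensity p φ S l s‖ ≤ (1 : NNReal) := by
    rw [uset, ae_restrict_biUnion_iff _ hc.countable_jset]
    intro r hr
    have hd := sub_pos.2 hr.2
    filter_upwards [ae_comp_sub_div hr.2 (hp.ω_const r hr.1), ae_restrict_mem measurableSet_Icc]
      with s a1 a2
    rw [sum_integral_l1_ω hp hc hphi hr.1] at a1
    have h1 := Finset.single_le_sum
      (f := fun l => l1 (p.ω r l ((s - lo φ S r) / (hi φ S r - lo φ S r))))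
      (fun _ _ => l1_nonneg _) hl
    rw [controlDensity_jump hc p l hr a2, norm_smul, NNReal.coe_one, one_div,
      Real.norm_of_nonneg (inv_nonneg.2 hd.le), inv_mul_le_iff₀ hd, mul_one]
    exact (norm_le_l1 _).trans (h1.trans a1.le)
  have hb : ∀ᵐ s ∂(volume.restrict (Icc 0 S)),
      ‖P.controlDensity p φ S l s‖ ≤ (1 : NNReal) := by
    rw [← Set.sdiff_union_of_subset hc.uset_subset]
    exact (ae_restrict_union_iff _ _ _).2 ⟨hb1, hb2⟩
  refine ⟨Integrable.of_bound ?_ _ hb, hb⟩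
  rw [← Set.sdiff_union_of_subset hc.uset_subset]
  exact aestronglyMeasurable_union_iff.2 ⟨hm1, hm2⟩

end Density

/-- Construction (i) applies to every impulse process. -/
theorem exists_associatedExtended {p : ImpulseData n m} (hp : P.IsImpulseControl p)
    {ζ : ℝ → ℕ → ℝ → Fin n → ℝ} {θ : ℝ → ℕ → ℝ → ℝ} (J : P.IsJumpSolution p ζ θ) :
    ∃ e, P.AssociatedExtended p e := by
  classical
  set S := P.phi p P.h with hS
  set φ₀ := rightInv (P.phi p) 0 P.h 0 S with hφ₀
  obtain ⟨hc, hphi⟩ := isClock_rightInv_phi (φ := φ₀) hp.ν_finite hS fun s _ => rfl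
  set Φ := P.controlDensity p φ₀ S
  have hS0 := hc.S_pos
  have hΦ := fun l hl => controlDensity_integrable hp hc hphi (l := l) hl
  have hII : ∀ l ∈ Finset.Icc 1 N, IntervalIntegrable (Φ l) volume 0 S := fun l hl => by
    rw [intervalIntegrable_iff_integrableOn_Icc_of_le hS0.le]
    exact (hΦ l hl).1
  -- The constant added to the `l`-th primitive is the total increment of the preceding blocks, so
  -- that `φ_l(0) = φ_{l-1}(S)`.
  set φ : ℕ → ℝ → Fin m → ℝ := fun l s =>
    (∑ l' ∈ Finset.Ico 1 l, ∫ t in (0)..S, Φ l' t) + ∫ t in (0)..s, Φ l t with hφ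
  have hsol : ∀ l ∈ Finset.Icc 1 N, SolvesOn (φ l) (Φ l) 0 S := fun l hl =>
    (solvesOn_of_eq_integral hS0.le (hII l hl) (hΦ l hl).2 fun s _ => by
      simp only [hφ, intervalIntegral.integral_same, add_zero]).1
  refine ⟨⟨S, φ₀, φ, fun l s => ((l : ℝ) - 1) * P.h + φ₀ s,
    fun l s => if s = 0 then (if l = 1 then P.x₀ else ζ P.h (l - 1) 1)
      else if s = S then ζ P.h l 1
      else if s ∈ P.sigmaUnion p then ζ (φ₀ s) l (P.gam p (φ₀ s) s)
      else p.x (((l : ℝ) - 1) * P.h + φ₀ s),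
    fun l s => if s = 0 then (if l = 1 then 0 else θ P.h (l - 1) 1)
      else if s = S then θ P.h l 1
      else if s ∈ P.sigmaUnion p then θ (φ₀ s) l (P.gam p (φ₀ s) s)
      else p.v (((l : ℝ) - 1) * P.h + φ₀ s)⟩, rfl, fun s _ => rfl, fun l hl => (hsol l hl).1,
    fun l hl => ?_, fun l hl => ?_, fun l hl r hr => ?_, fun l hl s hs => rfl, ζ, θ, J,
    fun l hl => ⟨if_pos rfl, if_pos rfl, ?_, fun s hs => ?_, fun r hr s hs => ?_⟩⟩
  · have h1 := (Finset.mem_Icc.1 hl).1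
    simp only [hφ, intervalIntegral.integral_same, add_zero]
    split_ifs with h2
    · rw [h2]; simp
    · obtain ⟨k, rfl⟩ : ∃ k, l = k + 1 := ⟨l - 1, by omega⟩
      rw [Finset.sum_Ico_succ_top (by omega), Nat.add_sub_cancel]
  · rw [sigmaUnion_eq hc hphi]
    filter_upwards [ae_restrict_of_ae_restrict_of_subset Set.sdiff_subset (hsol l hl).2,
      ae_restrict_mem hc.measurableSet_compl_uset] with s a1 a2
    rwa [← controlDensity_off p l a2.2]
  · rw [jumpSet_eq hc hphi] at hr
    simp only [sigmaSet, gam, phiL_eq hc hphi hr.1, phiR_eq hc hphi hr.1]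
    filter_upwards [ae_restrict_of_ae_restrict_of_subset (hc.Icc_subset hr.1) (hsol l hl).2,
      ae_restrict_mem measurableSet_Icc] with s a1 a2
    rwa [← controlDensity_jump hc p l hr a2]
  · dsimp only
    rw [if_neg hS0.ne', if_pos rfl, if_neg hS0.ne', if_pos rfl]
    exact ⟨rfl, rfl⟩
  · dsimp only
    rw [if_neg hs.1.1.ne', if_neg hs.1.2.ne, if_neg hs.2, if_neg hs.1.1.ne', if_neg hs.1.2.ne,
      if_neg hs.2]
    exact ⟨rfl, rfl⟩
  · have hU : s ∈ P.sigmaUnion p := mem_biUnion hr hs.2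
    rw [jumpSet_eq hc hphi] at hr
    have hs2 := hs.2
    rw [sigmaSet, phiL_eq hc hphi hr.1, phiR_eq hc hphi hr.1] at hs2
    dsimp only
    rw [if_neg hs.1.1.ne', if_neg hs.1.2.ne, if_pos hU, if_neg hs.1.1.ne', if_neg hs.1.2.ne,
      if_pos hU, hc.apply_eq hr.1 hs2]
    exact ⟨rfl, rfl⟩

/-- Construction (i) determines the extended process. -/
theorem AssociatedExtended.sameExtended {p : ImpulseData n m} {e d : ExtendedData n m}
    (hp : P.IsImpulseProc p) (he : P.AssociatedExtended p e) (hd : P.AssociatedExtended p d) :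
    P.SameExtended e d := by
  have hLe := he.linked hp.1
  have hLd := hd.linked hp.1
  have hS : e.S = d.S := he.S_eq.trans hd.S_eq.symm
  have hφ₀ : EqOn e.φ₀ d.φ₀ (Icc 0 e.S) := fun s hs => by
    rw [he.φ₀_eq s hs, hd.φ₀_eq s (hS ▸ hs), hS]
  have hS0 := hLe.S_pos.le
  have h0 : (0 : ℝ) ∈ Icc 0 e.S := ⟨le_rfl, hS0⟩
  have hτ : ∀ l ∈ Finset.Icc 1 N, EqOn (e.τ l) (d.τ l) (Icc 0 e.S) := fun l hl s hs => by
    rw [he.τ_eq l hl s hs, hd.τ_eq l hl s (hS ▸ hs), hφ₀ hs]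
  have hderiv : ∀ l ∈ Finset.Icc 1 N, ∀ᵐ s ∂(volume.restrict (Icc 0 e.S)),
      deriv (e.φ l) s = deriv (d.φ l) s := by
    intro l hl
    refine (he.isAssocControl hp.1).ae_split ?_ fun r hr => ?_
    · rw [← hLe.sigmaUnion_eq]
      have h2 := hd.φ_cont l hl
      rw [← hS] at h2
      have hm : MeasurableSet (Icc 0 e.S \ P.sigmaUnion p) := by
        rw [hLe.sigmaUnion_eq]; exact hLe.canon.clock.measurableSet_compl_uset
      filter_upwards [he.φ_cont l hl, h2, ae_restrict_mem hm] with s a1 a2 a3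
      rw [a1.deriv, a2.deriv, hφ₀ a3.1]
    · rw [← hLe.jumpSet_eq] at hr
      have hr' := hr
      rw [hLe.jumpSet_eq] at hr'
      rw [← hLe.sigmaSet_eq hr'.1]
      filter_upwards [he.φ_jump l hl r hr, hd.φ_jump l hl r hr] with s a1 a2
      rw [a1.deriv, a2.deriv]
  have hrep : ∀ {c : ExtendedData n m}, P.IsCanonControl c → ∀ l ∈ Finset.Icc 1 N,
      ∀ s ∈ Icc 0 c.S, c.φ l s = c.φ l 0 + ∫ t in (0)..s, deriv (c.φ l) t := fun hC l hl =>
    (hC.solves_φ hl).eq_add_integral hC.S_pos.le (hC.φ_bound hl)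
  have hφ : ∀ l, l ∈ Finset.Icc 1 N → EqOn (e.φ l) (d.φ l) (Icc 0 e.S) := by
    intro l
    induction l with
    | zero => intro hl; simp at hl
    | succ k ih =>
      intro hl s hs
      have hinit : e.φ (k + 1) 0 = d.φ (k + 1) 0 := by
        rw [he.φ_init _ hl, hd.φ_init _ hl]
        split_ifs with h1
        · rfl
        · have := Finset.mem_Icc.1 hl
          rw [Nat.add_sub_cancel, ← hS]
          exact ih (Finset.mem_Icc.2 ⟨by omega, by omega⟩) ⟨hS0, le_rfl⟩
      rw [hrep hLe.canon _ hl s hs, hrep hLd.canon _ hl s (hS ▸ hs), hinit]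
      congr 1
      refine intervalIntegral.integral_congr_ae_restrict ?_
      rw [uIoc_of_le hs.1]
      exact ae_restrict_of_ae_restrict_of_subset
        (Ioc_subset_Icc_self.trans (Icc_subset_Icc le_rfl hs.2)) (hderiv _ hl)
  -- The arcs used to build `e` and `d` are a priori different; by uniqueness both may be replaced
  -- by those of the impulse process.
  obtain ⟨ζ, θ, J, -⟩ := hp.2.jump
  have h1 := (hLe.isStateLink_iff he.τ_eq).1 (he.isStateLink hp.1 J)
  have h2 := (hLd.isStateLink_iff hd.τ_eq).1 (hd.isStateLink hp.1 J)
  have hyβ : ∀ l ∈ Finset.Icc 1 N, ∀ s ∈ Icc 0 e.S, e.y l s = d.y l s ∧ e.β l s = d.β l s := by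
    intro l hl s hs
    obtain ⟨a1, a2, a3, a4, a5⟩ := h1 l hl
    obtain ⟨b1, b2, b3, b4, b5⟩ := h2 l hl
    rw [← hS] at b3 b4 b5
    rcases hs.1.eq_or_lt with hs0 | hs0
    · rw [← hs0, a1, a2, b1, b2]; exact ⟨rfl, rfl⟩
    rcases hs.2.eq_or_lt with hsS | hsS
    · rw [hsS, a3.1, a3.2, b3.1, b3.2]; exact ⟨rfl, rfl⟩
    by_cases hU : s ∈ P.sigmaUnion p
    · obtain ⟨r, hr, hsr⟩ := mem_iUnion₂.1 hU
      have a := a5 r hr s ⟨⟨hs0, hsS⟩, hsr⟩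
      have b := b5 r hr s ⟨⟨hs0, hsS⟩, hsr⟩
      rw [a.1, a.2, b.1, b.2]; exact ⟨rfl, rfl⟩
    · have a := a4 s ⟨⟨hs0, hsS⟩, hU⟩
      have b := b4 s ⟨⟨hs0, hsS⟩, hU⟩
      rw [a.1, a.2, b.1, b.2, hτ l hl hs]; exact ⟨rfl, rfl⟩
  exact ⟨hS, hφ₀, hφ, hτ, fun l hl s hs => (hyβ l hl s hs).1, fun l hl s hs => (hyβ l hl s hs).2⟩

/-! ### The bijection -/

/-- Construction (ii), as a map from canonical extended processes to impulse processes. -/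
theorem exists_toImpulse (P : DelaySystem n m N M) : ∃ J : P.CanonicalProcs → P.ImpulseProcs,
    ∀ e p, J (CanonicalProcs.mk P e) = ImpulseProcs.mk P p ↔ P.AssociatedImpulse e.1 p.1 := by
  have hex := fun e : {e : ExtendedData n m // P.IsCanonicalProc e} =>
    exists_associatedImpulse e.2
  choose q hq using hex
  refine ⟨Quotient.lift (fun e => ImpulseProcs.mk P ⟨q e, (hq e).isImpulseProc e.2⟩)
    fun e d hed => ?_, fun e p => ?_⟩
  · exact Quotient.sound (sameImpulse_of_associatedImpulse d.2
      ((hq e).congr_right e.2 d.2 hed) (hq d))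
  · constructor
    · intro h
      have h1 : P.SameImpulse (q e) p.1 := Quotient.exact h
      exact (hq e).congr_left h1
    · intro h
      exact Quotient.sound (sameImpulse_of_associatedImpulse e.2 (hq e) h)

/-- The map of construction (ii) is shown to be bijective and inverted. If two canonical processes
share an image `p`, both are outcomes of construction (i) for `p` and hence equal. For surjectivity,
an outcome of (i) for `p` is a preimage of `p`. That the inverse has the graph of (i) is the
equivalence of the two relations on processes. -/
theorem exists_equiv (P : DelaySystem n m N M) : ∃ I : P.ImpulseProcs ≃ P.CanonicalProcs,
    (∀ p e, I (ImpulseProcs.mk P p) = CanonicalProcs.mk P e ↔ P.AssociatedExtended p.1 e.1) ∧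
    ∀ e p, I.symm (CanonicalProcs.mk P e) = ImpulseProcs.mk P p
      ↔ P.AssociatedImpulse e.1 p.1 := by
  obtain ⟨J, hJ⟩ := P.exists_toImpulse
  have hinj : Function.Injective J := by
    intro a b hab
    induction a using Quotient.inductionOn with
    | h e =>
    induction b using Quotient.inductionOn with
    | h d =>
    obtain ⟨p, hp⟩ := exists_associatedImpulse e.2
    have hpi := hp.isImpulseProc e.2
    have h1 := (hJ e ⟨p, hpi⟩).2 hp
    have h2 := (hJ d ⟨p, hpi⟩).1 (hab.symm.trans h1)
    exact Quotient.sound ((hp.associatedExtended e.2).sameExtended hpi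
      (h2.associatedExtended d.2))
  have hsurj : Function.Surjective J := by
    intro a
    induction a using Quotient.inductionOn with
    | h p =>
    obtain ⟨ζ, θ, hζ, -⟩ := p.2.2.jump
    obtain ⟨e, he⟩ := exists_associatedExtended p.2.1 hζ
    exact ⟨CanonicalProcs.mk P ⟨e, he.isCanonicalProc p.2⟩,
      (hJ _ p).2 (he.associatedImpulse p.2)⟩
  have hbij : Function.Bijective J := ⟨hinj, hsurj⟩
  refine ⟨(Equiv.ofBijective J hbij).symm, fun p e => ?_, fun e p => ?_⟩
  · rw [Equiv.symm_apply_eq, Equiv.ofBijective_apply, eq_comm, hJ]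
    exact ⟨fun h => h.associatedExtended e.2, fun h => h.associatedImpulse p.2⟩
  · rw [Equiv.symm_symm, Equiv.ofBijective_apply]
    exact hJ e p

end DelaySystem

end ImpulseDelay

end

theorem mainTheorem8 {n m N M : ℕ} (P : ImpulseDelay.DelaySystem n m N M) :
    (∀ (p : ImpulseDelay.ImpulseData n m) (e : ImpulseDelay.ExtendedData n m),
      P.IsImpulseProc p → P.AssociatedExtended p e → P.IsCanonicalProc e) ∧
    (∀ (e : ImpulseDelay.ExtendedData n m) (p : ImpulseDelay.ImpulseData n m),
      P.IsCanonicalProc e → P.AssociatedImpulse e p → P.IsImpulseProc p) ∧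
    ∃ I : P.ImpulseProcs ≃ P.CanonicalProcs,
      (∀ (p : {p : ImpulseDelay.ImpulseData n m // P.IsImpulseProc p})
        (e : {e : ImpulseDelay.ExtendedData n m // P.IsCanonicalProc e}),
        I (ImpulseDelay.DelaySystem.ImpulseProcs.mk P p)
            = ImpulseDelay.DelaySystem.CanonicalProcs.mk P e
          ↔ P.AssociatedExtended p.1 e.1) ∧
      (∀ (e : {e : ImpulseDelay.ExtendedData n m // P.IsCanonicalProc e})
        (p : {p : ImpulseDelay.ImpulseData n m // P.IsImpulseProc p}),
        I.symm (ImpulseDelay.DelaySystem.CanonicalProcs.mk P e)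
            = ImpulseDelay.DelaySystem.ImpulseProcs.mk P p
          ↔ P.AssociatedImpulse e.1 p.1) := by
  exact ⟨fun _ _ hp h => h.isCanonicalProc hp, fun _ _ he h => h.isImpulseProc he,
    P.exists_equiv⟩
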